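/- **Setting.** Let $\hat a_1,\dots,\hat a_n$ be the annihilation operators on the Fock space $\ell^2(\mathbb N^n)$ of $n$ bosonic modes, $[\hat a_i,\hat a_j^\dagger]=\delta_{ij}$, with zero-particle state $|0\rangle$. Let $\hat w_{j+}=(\hat a_j+\hat a_j^\dagger)/\sqrt2$, $\hat w_{j-}=i(\hat a_j-\hat a_j^\dagger)/\sqrt2$, with indices ordered as $(1+,\dots,n+,1-,\dots,n-)$. Consider the Liouvillian $$\mathcal L(R)=-i[\hat H,R]+\sum_r\Big(\hat L_rR\hat L_r^\dagger-\tfrac12\{\hat L_r^\dagger\hat L_r,R\}\Big),\qquad \hat H=\sum_{p,q}H_{pq}\hat w_p\hat w_q,\quad \hat L_r=\sum_pL_{r,p}\hat w_p$$ (finitely many $r$), with $H$ real symmetric and $L_{r,p}\in\mathbb C$. Put $B_{pq}=\sum_rL_{r,p}\overline{L_{r,q}}$ with entrywise real and imaginary parts $B_{\rm r},B_{\rm i}$, $\tau=\begin{pmatrix}0&-i\mathbb 1_n\\ i\mathbb 1_n&0\end{pmatrix}$, $X_0=-2i\tau H+i\tau B_{\rm i}$ and $Y=\tau B_{\rm r}\tau$.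 Let $S^{-1}X_0S=\xi$ be in (upper) Jordan normal form with blocks $k=1,\dots,N_J$ of eigenvalue $\xi_k$ and dimension $D_k\ge1$, and write $(k,\ell)$, $1\le\ell\le D_k$, for its row indices. A real symmetric $2n\times2n$ matrix $\Gamma$ is *physical* if it is positive definite and all its symplectic eigenvalues (the positive eigenvalues of $\tau\Gamma$) are $\ge\frac12$. Assume that $\Gamma_{\rm ss}$ is physical and solves the Lyapunov equation $X_0\Gamma_{\rm ss}+\Gamma_{\rm ss}X_0^T=-Y$. Define super-operators $$b_{j\pm}(R)=\tfrac1{\sqrt2}(\hat w_{j\pm}R+R\hat w_{j\pm}),\qquad b'_{j\pm}(R)=\tfrac{\pm i}{\sqrt2}(\hat w_{j\mp}R-R\hat w_{j\mp}),$$ $$a_{j+}(R)=\hat a_jR,\quad a_{j-}(R)=R\hat a_j^\dagger,\quad a'_{j+}(R)=\hat a_j^\dagger R-R\hat a_j^\dagger,\quad a'_{j-}(R)=R\hat a_j-\hat a_jR,$$ and $d=S^{-1}(b-2\Gamma_{\rm ss}b')$, $d'=S^Tb'$. With $U=\begin{pmatrix}\mathbb 1_n&\mathbb 1_n\\ i\mathbb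 1_n&-i\mathbb 1_n\end{pmatrix}$ and its entrywise conjugate $U^*$, let $$W=\begin{pmatrix}r&s\\t&u\end{pmatrix}=\begin{pmatrix}S^{-1}&0\\0&S^T\end{pmatrix}\begin{pmatrix}\mathbb 1&-2\Gamma_{\rm ss}\\0&\mathbb 1\end{pmatrix}\begin{pmatrix}U&U^*/2\\0&U^*/2\end{pmatrix}.$$ **Conventions.** $R_1=e^{\mathcal Q}R_0$ for an unbounded super-operator $\mathcal Q$ means: the evolution equation $\partial_tu=\mathcal Qu$, $0\le t\le1$, $u(0)=R_0$, has a solution in the Hilbert–Schmidt operators, differentiable in Hilbert–Schmidt norm, and every such solution has $u(1)=R_1$. An operator $R$ is *regular* if $\hat w_{p_1}\cdots\hat w_{p_k}R\,\hat w_{q_1}\cdots\hat w_{q_l}$ is trace class for all indices. A *steady state* is a positive trace-class operator $\rho$ of trace one that is regular and satisfies $\mathcal L(\rho)=0$. A state $\rho$ is *Gaussian* with mean $\mu$ and covariance matrix $\Gamma$ if $\operatorname{Tr}(\rho\,e^{i x\cdot\hat w})=e^{i x\cdot\mu-\frac12x\cdot\Gamma x}$ for all $x\in\mathbb R^{2n}$.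 **Claim.** 1. $a_{j\pm}|0\rangle\langle0|=0$ for all $j$, $\binom{d}{d'}=W\binom{a}{a'}$, and $r$ is invertible. The operator $\rho=e^{-\frac12a'\cdot r^{-1}s\,a'}\,|0\rangle\langle0|$ exists. It is a (trace-class, positive, normalized) steady state, it is Gaussian with mean $0$ and covariance matrix $\Gamma_{\rm ss}$, and $\frac12\operatorname{Tr}[(\hat w_p\hat w_q+\hat w_q\hat w_p)\rho]=(\Gamma_{\rm ss})_{pq}$ for all $p,q$. 2. $d_{k,\ell}\,\rho=0$ for all $k,\ell$. 3. $\langle\!\langle\mathbb 1|d'_{k,\ell}=0$ for all $k,\ell$: $\operatorname{Tr}(d'_{k,\ell}R)=0$ for every trace-class $R$ for which $d'_{k,\ell}R$ is trace class. 4. (Zero modes.) Let $Z=\{k:\xi_k=0\}$, and for $k\in Z$ let $s_k$ be the column $(k,1)$ of $S$. The operators $\prod_{k\in Z}(d'_{k,1})^{\alpha_k}\rho$, $\alpha\in\mathbb N^Z$, are linearly independent, and every finite linear combination $R$ of them is regular with $\mathcal L(R)=0$. Moreover, for coefficients $c_k,C_{kl}\in\mathbb C$ ($k,l\in Z$) such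 that $v=\sum_kc_ks_k$ is real and $\Gamma'=\Gamma_{\rm ss}+\sum_{k,l}C_{kl}s_ks_l^T$ is real and physical, $\rho'=\exp\big(\sum_kc_kd'_{k,1}+\sum_{k,l}C_{kl}d'_{k,1}d'_{l,1}\big)\rho$ exists and is a steady state that is Gaussian with mean $v/\sqrt2$ and covariance matrix $\Gamma'$; $\rho'\neq\rho$ if $v\ne0$ or $\Gamma'\neq\Gamma_{\rm ss}$. If $Z\ne\emptyset$, there are such coefficients with $v\neq0$ and $\Gamma'\ne\Gamma_{\rm ss}$. -/

import Mathlib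

open Matrix

noncomputable section

namespace QuasiFree

/-! ## Fock space of `n` bosonic modes and operators in the occupation-number basis -/

/-- Occupation numbers of `n` modes. -/
abbrev Occ (n : ℕ) : Type := Fin n → ℕ

/-- The bosonic Fock space of `n` modes, `ℓ²(ℕⁿ)`. -/
abbrev Fock (n : ℕ) : Type := lp (fun _ : Occ n => ℂ) 2

/-- The occupation-number state `|m⟩`. -/
def ket {n : ℕ} (m : Occ n) : Fock n := lp.single 2 m (1 : ℂ)

/-- Operators, possibly unbounded, are given by their matrix elements `R m m' = ⟨m|R|m'⟩`. -/
abbrev Op (n : ℕ) : Type := Matrix (Occ n) (Occ n) ℂ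

/-- Operator product in matrix elements. Whenever one factor is a polynomial in the ladder operators,
every sum below has only finitely many nonzero terms. -/
def opMul {n : ℕ} (A R : Op n) : Op n := fun m m' => ∑' k, A m k * R k m'

infixl:70 " ⋆ₒ " => opMul

/-- Powers of an operator. -/
def opPow {n : ℕ} (A : Op n) : ℕ → Op n
  | 0 => 1
  | k + 1 => A ⋆ₒ opPow A k

/-- `R` is the matrix of the bounded operator `T`. -/
def Represents {n : ℕ} (T : Fock n →L[ℂ] Fock n) (R : Op n) : Prop :=
  ∀ m m', (T (ket m') : Occ n → ℂ) m = R m m'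

/-- The absolute value `|T| = (T† T)^{1/2}` of a bounded operator. -/
def absOp {E : Type*} [NormedAddCommGroup E] [InnerProductSpace ℂ E] [CompleteSpace E]
    (T : E →L[ℂ] E) : E →L[ℂ] E := CFC.abs T

/-- `R` is the matrix of a trace-class operator `T`: `∑ₘ ⟨m| |T| |m⟩ < ∞`. -/
def IsTraceClass {n : ℕ} (R : Op n) : Prop :=
  ∃ T : Fock n →L[ℂ] Fock n, Represents T R ∧
    Summable fun m : Occ n => (inner ℂ (ket m) (absOp T (ket m))).re

/-- `R` is trace class and `Tr R = c`. -/
def HasTrace {n : ℕ} (R : Op n) (c : ℂ) : Prop :=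
  IsTraceClass R ∧ HasSum (fun m => R m m) c

/-- Density operators: positive, trace class, of trace one. -/
def IsDensity {n : ℕ} (R : Op n) : Prop :=
  HasTrace R 1 ∧ ∃ T : Fock n →L[ℂ] Fock n, Represents T R ∧ T.IsPositive

/-- The projector `|0⟩⟨0|` onto the zero-particle state. -/
def vac (n : ℕ) : Op n := fun m m' => if m = 0 ∧ m' = 0 then 1 else 0

/-- The annihilation operator of mode `j`: `â_j |m'⟩ = √(m'_j) |m' - e_j⟩`. -/
def ann {n : ℕ} (j : Fin n) : Op n :=
  fun m m' => if m' = m + Pi.single j 1 then ((Real.sqrt (m' j) : ℝ) : ℂ) else 0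

/-- The creation operator of mode `j`. -/
def cre {n : ℕ} (j : Fin n) : Op n := (ann j)ᴴ

/-- The index set `(1+, …, n+, 1-, …, n-)`; `inl j` is `j+` and `inr j` is `j-`. -/
abbrev Ix (n : ℕ) : Type := Fin n ⊕ Fin n

/-- The self-adjoint operators `w_{j+} = (a_j + a_j†)/√2` and `w_{j-} = i (a_j - a_j†)/√2`. -/
def maj {n : ℕ} : Ix n → Op n
  | Sum.inl j => ((Real.sqrt 2 : ℝ) : ℂ)⁻¹ • (ann j + cre j)
  | Sum.inr j => (Complex.I * ((Real.sqrt 2 : ℝ) : ℂ)⁻¹) • (ann j - cre j)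

/-- `w_{p₁} ⋯ w_{p_k} R w_{q₁} ⋯ w_{q_l}` for the words `l = [p₁, …]` and `l' = [q₁, …]`. -/
def sandwich {n : ℕ} (l : List (Ix n)) (R : Op n) (l' : List (Ix n)) : Op n :=
  l'.foldl (fun A q => A ⋆ₒ maj q) (l.foldr (fun p A => maj p ⋆ₒ A) R)

/-- `R` remains trace class under multiplication from both sides with arbitrary polynomials in the
ladder operators: the domain on which all polynomial super-operators act. -/
def IsRegularOp {n : ℕ} (R : Op n) : Prop :=
  ∀ l l' : List (Ix n), IsTraceClass (sandwich l R l')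

/-! ## The quasi-free system -/

/-- `H` are the coefficients of the quadratic Hamiltonian, `L r` those of the `r`-th linear Lindblad
operator. -/
structure System (n : ℕ) where
  H : Matrix (Ix n) (Ix n) ℝ
  H_symm : H.IsSymm
  numL : ℕ
  L : Fin numL → Ix n → ℂ

namespace System

variable {n : ℕ} (𝒮 : System n)

/-- `Ĥ = ∑ w_p H_{pq} w_q`. -/
def ham : Op n := ∑ p, ∑ q, (𝒮.H p q : ℂ) • (maj p ⋆ₒ maj q)

/-- `L̂_r = ∑ L_{r,p} w_p`. -/
def lind (r : Fin 𝒮.numL) : Op n := ∑ p, 𝒮.L r p • maj p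

/-- The Liouvillian
`ℒ(R) = -i[Ĥ, R] + ∑ᵣ (L̂ᵣ R L̂ᵣ† - ½ (L̂ᵣ† L̂ᵣ R + R L̂ᵣ† L̂ᵣ))`. -/
def liouvillian (R : Op n) : Op n :=
  (-Complex.I) • (𝒮.ham ⋆ₒ R - R ⋆ₒ 𝒮.ham)
    + ∑ r, (𝒮.lind r ⋆ₒ R ⋆ₒ (𝒮.lind r)ᴴ
        - (1 / 2 : ℂ) • ((𝒮.lind r)ᴴ ⋆ₒ 𝒮.lind r ⋆ₒ R + R ⋆ₒ ((𝒮.lind r)ᴴ ⋆ₒ 𝒮.lind r)))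

/-- `B = ∑ᵣ Lᵣ Lᵣ†`. -/
def B : Matrix (Ix n) (Ix n) ℂ := fun p q => ∑ r, 𝒮.L r p * star (𝒮.L r q)

/-- The entrywise real part of `B`. -/
def Bre : Matrix (Ix n) (Ix n) ℂ := 𝒮.B.map fun z => (z.re : ℂ)

/-- The entrywise imaginary part of `B`. -/
def Bim : Matrix (Ix n) (Ix n) ℂ := 𝒮.B.map fun z => (z.im : ℂ)

end System

/-- `τ = σ_y ⊗ 1`. -/
def tau (n : ℕ) : Matrix (Ix n) (Ix n) ℂ :=
  Matrix.fromBlocks 0 (-(Complex.I • 1)) (Complex.I • 1) 0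

namespace System

variable {n : ℕ} (𝒮 : System n)

/-- `X₀ = -2iτH + iτB_i`. -/
def X₀ : Matrix (Ix n) (Ix n) ℂ :=
  (-(2 * Complex.I)) • (tau n * 𝒮.H.map Complex.ofReal) + Complex.I • (tau n * 𝒮.Bim)

/-- `Y = τ B_r τ`. -/
def Y : Matrix (Ix n) (Ix n) ℂ := tau n * 𝒮.Bre * tau n

/-- The continuous Lyapunov equation `X₀ Γ + Γ X₀ᵀ = -Y`. -/
def Lyapunov (Γ : Matrix (Ix n) (Ix n) ℝ) : Prop :=
  𝒮.X₀ * Γ.map Complex.ofReal + Γ.map Complex.ofReal * 𝒮.X₀ᵀ = -𝒮.Y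

end System

/-- The symplectic eigenvalues of a positive definite `Γ` are the positive eigenvalues of `τΓ`. -/
def IsSymplecticEigenvalue {n : ℕ} (Γ : Matrix (Ix n) (Ix n) ℝ) (ν : ℝ) : Prop :=
  0 < ν ∧ Module.End.HasEigenvalue (Matrix.toLin' (tau n * Γ.map Complex.ofReal)) (ν : ℂ)

/-- Physical covariance matrices: real symmetric positive definite matrices all of whose symplectic
eigenvalues are at least `1/2`. -/
def IsPhysical {n : ℕ} (Γ : Matrix (Ix n) (Ix n) ℝ) : Prop :=
  Γ.PosDef ∧ ∀ ν, IsSymplecticEigenvalue Γ ν → 1 / 2 ≤ ν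

/-- A steady state: a density operator in the domain of all polynomial super-operators that is
annihilated by the Liouvillian. -/
def System.IsSteadyState {n : ℕ} (𝒮 : System n) (R : Op n) : Prop :=
  IsDensity R ∧ IsRegularOp R ∧ 𝒮.liouvillian R = 0

/-! ## Gaussian states -/

/-- The Weyl operator `exp(i ∑ x_p w_p)`; the exponential series converges absolutely in every
matrix element between occupation-number states. -/
def weyl {n : ℕ} (x : Ix n → ℝ) : Op n := fun m m' =>
  ∑' k : ℕ, (Complex.I ^ k / (k.factorial : ℂ)) * opPow (∑ p, (x p : ℂ) • maj p) k m m'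

/-- `R` is Gaussian with mean `μ` and covariance matrix `Γ`: its characteristic function is
`Tr(R exp(i x·w)) = exp(i x·μ - ½ x·Γx)`. -/
def IsGaussian {n : ℕ} (μ : Ix n → ℝ) (Γ : Matrix (Ix n) (Ix n) ℝ) (R : Op n) : Prop :=
  ∀ x : Ix n → ℝ, HasTrace (R ⋆ₒ weyl x)
    (Complex.exp (Complex.I * ((x ⬝ᵥ μ : ℝ) : ℂ) - (1 / 2 : ℂ) * ((x ⬝ᵥ Γ *ᵥ x : ℝ) : ℂ)))

/-- `R` has covariance matrix `½ Tr[(w_p w_q + w_q w_p) R] = Γ_{pq}`. -/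
def HasCovariance {n : ℕ} (R : Op n) (Γ : Matrix (Ix n) (Ix n) ℝ) : Prop :=
  ∀ p q, HasTrace ((1 / 2 : ℂ) • ((maj p ⋆ₒ maj q + maj q ⋆ₒ maj p) ⋆ₒ R)) (Γ p q : ℂ)

/-! ## Ladder super-operators -/

/-- `b_p(R) = (w_p R + R w_p)/√2`. -/
def bSup {n : ℕ} (p : Ix n) (R : Op n) : Op n :=
  ((Real.sqrt 2 : ℝ) : ℂ)⁻¹ • (maj p ⋆ₒ R + R ⋆ₒ maj p)

/-- `b'_{j±}(R) = ± i (w_{j∓} R - R w_{j∓})/√2`. -/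
def bSup' {n : ℕ} : Ix n → Op n → Op n
  | Sum.inl j, R => (Complex.I * ((Real.sqrt 2 : ℝ) : ℂ)⁻¹) •
      (maj (Sum.inr j) ⋆ₒ R - R ⋆ₒ maj (Sum.inr j))
  | Sum.inr j, R => (-Complex.I * ((Real.sqrt 2 : ℝ) : ℂ)⁻¹) •
      (maj (Sum.inl j) ⋆ₒ R - R ⋆ₒ maj (Sum.inl j))

/-- `a_{j+}(R) = a_j R` and `a_{j-}(R) = R a_j†`. -/
def aSup {n : ℕ} : Ix n → Op n → Op n
  | Sum.inl j, R => ann j ⋆ₒ R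
  | Sum.inr j, R => R ⋆ₒ cre j

/-- `a'_{j+}(R) = a_j† R - R a_j†` and `a'_{j-}(R) = R a_j - a_j R`; the signs are such that
`[a_p, a'_q] = δ_{pq}`. -/
def aSup' {n : ℕ} : Ix n → Op n → Op n
  | Sum.inl j, R => cre j ⋆ₒ R - R ⋆ₒ cre j
  | Sum.inr j, R => R ⋆ₒ ann j - ann j ⋆ₒ R

/-- `R = (1 1; i -i) ⊗ 1`, so that `b = R a + (R*/2) a'` and `b' = (R*/2) a'`. -/
def rotR (n : ℕ) : Matrix (Ix n) (Ix n) ℂ :=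
  Matrix.fromBlocks 1 1 (Complex.I • 1) (-(Complex.I • 1))

/-- The entrywise complex conjugate of `rotR`. -/
def rotRconj (n : ℕ) : Matrix (Ix n) (Ix n) ℂ := (rotR n).map star

/-! ## Jordan normal form and the adapted ladder super-operators -/

/-- The Jordan matrix with blocks of dimension `D k` and eigenvalue `ξ k`, indexed by `(k, ℓ)`. -/
def jordanMatrix {N : ℕ} (D : Fin N → ℕ) (ξ : Fin N → ℂ) :
    Matrix (Σ k, Fin (D k)) (Σ k, Fin (D k)) ℂ := fun i j =>
  if i = j then ξ i.1
  else if i.1 = j.1 ∧ (i.2 : ℕ) + 1 = (j.2 : ℕ) then 1 else 0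

/-- A transformation `S⁻¹ X S = ξ` of `X` to Jordan normal form; `idx` enumerates the rows of the
Jordan matrix. -/
structure JordanForm {n : ℕ} (X : Matrix (Ix n) (Ix n) ℂ) where
  N : ℕ
  D : Fin N → ℕ
  D_pos : ∀ k, 0 < D k
  ξ : Fin N → ℂ
  idx : (Σ k, Fin (D k)) ≃ Ix n
  S : Matrix (Ix n) (Ix n) ℂ
  S_unit : IsUnit S.det
  eq : S⁻¹ * X * S = Matrix.reindex idx idx (jordanMatrix D ξ)

namespace JordanForm

variable {n : ℕ} {X : Matrix (Ix n) (Ix n) ℂ} (J : JordanForm X)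
  (Γ : Matrix (Ix n) (Ix n) ℝ)

/-- The vector `d = S⁻¹ (b - 2Γ b')`. -/
def dVec (p : Ix n) (R : Op n) : Op n :=
  ∑ q, J.S⁻¹ p q • (bSup q R - (2 : ℂ) • ∑ s, (Γ q s : ℂ) • bSup' s R)

/-- The vector `d' = Sᵀ b'`. -/
def dVec' (p : Ix n) (R : Op n) : Op n := ∑ q, J.Sᵀ p q • bSup' q R

/-- `d_{k,ℓ}`. -/
def d (k : Fin J.N) (l : Fin (J.D k)) (R : Op n) : Op n := J.dVec Γ (J.idx ⟨k, l⟩) R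

/-- `d'_{k,ℓ}`. -/
def d' (k : Fin J.N) (l : Fin (J.D k)) (R : Op n) : Op n := J.dVec' (J.idx ⟨k, l⟩) R

/-- The transformation
`W = (S⁻¹ 0; 0 Sᵀ) (1 -2Γ; 0 1) (R R*/2; 0 R*/2)` from `(a, a')` to `(d, d')`. -/
def W : Matrix (Ix n ⊕ Ix n) (Ix n ⊕ Ix n) ℂ :=
  Matrix.fromBlocks J.S⁻¹ 0 0 J.Sᵀ
    * Matrix.fromBlocks 1 (-((2 : ℂ) • Γ.map Complex.ofReal)) 0 1
    * Matrix.fromBlocks (rotR n) ((1 / 2 : ℂ) • rotRconj n) 0 ((1 / 2 : ℂ) • rotRconj n)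

/-- The upper left block of `W`. -/
def r : Matrix (Ix n) (Ix n) ℂ := (J.W Γ).toBlocks₁₁

/-- The upper right block of `W`. -/
def s : Matrix (Ix n) (Ix n) ℂ := (J.W Γ).toBlocks₁₂

/-- The quadratic super-operator `-½ a'·r⁻¹s a'`. -/
def Q (R : Op n) : Op n :=
  (-(1 / 2) : ℂ) • ∑ p, ∑ q, ((J.r Γ)⁻¹ * J.s Γ) p q • aSup' p (aSup' q R)

/-- The indices of the Jordan blocks with eigenvalue zero. -/
abbrev ZeroIx : Type := {k : Fin J.N // J.ξ k = 0}

/-- The creation super-operator `d'_{k,1}` of a zero mode. -/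
def d0' (k : J.ZeroIx) : Op n → Op n := J.d' k.1 ⟨0, J.D_pos k.1⟩

/-- The first column of the Jordan block of a zero mode, an eigenvector of `X` with eigenvalue zero. -/
def col0 (k : J.ZeroIx) : Ix n → ℂ := fun p => J.S p (J.idx ⟨k.1, ⟨0, J.D_pos k.1⟩⟩)

/-- The monomial `∏ₖ (d'_{k,1})^{α k}` in the (mutually commuting) zero-mode creation
super-operators. -/
def zeroMonomial (α : J.ZeroIx → ℕ) (R : Op n) : Op n :=
  (List.finRange J.N).foldr
    (fun k A => if h : J.ξ k = 0 then (J.d0' ⟨k, h⟩)^[α ⟨k, h⟩] A else A) R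

/-- The super-operator `∑ₖ cₖ d'_{k,1} + ∑ₖₗ Cₖₗ d'_{k,1} d'_{l,1}` built from the zero modes. -/
def zeroGen (c : J.ZeroIx → ℂ) (C : J.ZeroIx → J.ZeroIx → ℂ) (R : Op n) : Op n :=
  ∑ k, c k • J.d0' k R + ∑ k, ∑ l, C k l • J.d0' k (J.d0' l R)

/-- Coefficients for which `zeroGen` shifts the mean by `v/√2` and the covariance matrix from `Γ` to
`Γ'`: with the zero-mode columns `sₖ`, `v = ∑ₖ cₖ sₖ` is real and `Γ' = Γ + ∑ₖₗ Cₖₗ sₖ sₗᵀ` is real and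
physical. -/
def IsShift (c : J.ZeroIx → ℂ) (C : J.ZeroIx → J.ZeroIx → ℂ)
    (v : Ix n → ℝ) (Γ' : Matrix (Ix n) (Ix n) ℝ) : Prop :=
  (∀ p, (v p : ℂ) = ∑ k, c k * J.col0 k p) ∧
  (∀ p q, (Γ' p q : ℂ) = Γ p q + ∑ k, ∑ l, C k l * J.col0 k p * J.col0 l q) ∧
  IsPhysical Γ'

end JordanForm

/-! ## Exponentials of unbounded super-operators -/

/-- Hilbert-Schmidt operators, with the Hilbert-Schmidt norm. -/
abbrev HS (n : ℕ) : Type := lp (fun _ : Occ n × Occ n => ℂ) 2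

/-- The matrix of a Hilbert-Schmidt operator. -/
def HS.toOp {n : ℕ} (u : HS n) : Op n := fun m m' => (u : Occ n × Occ n → ℂ) (m, m')

/-- The evolution equation `∂ₜ u = 𝒬 u`, `0 ≤ t ≤ 1`, has a solution in the Hilbert-Schmidt operators
(differentiable in Hilbert-Schmidt norm) with `u(0) = R₀` and `u(1) = R₁`. -/
def Evolves {n : ℕ} (𝒬 : Op n → Op n) (R₀ R₁ : Op n) : Prop :=
  ∃ u : ℝ → HS n, (u 0).toOp = R₀ ∧ (u 1).toOp = R₁ ∧
    ∀ t ∈ Set.Icc (0 : ℝ) 1, ∃ v : HS n, v.toOp = 𝒬 (u t).toOp ∧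
      HasDerivWithinAt u v (Set.Icc 0 1) t

/-- `R₁ = e^𝒬 R₀`: `R₁` is the value at `t = 1` of the solution of `∂ₜ u = 𝒬 u`, `u(0) = R₀`, and
every solution has this value. -/
def IsExp {n : ℕ} (𝒬 : Op n → Op n) (R₀ R₁ : Op n) : Prop :=
  Evolves 𝒬 R₀ R₁ ∧ ∀ R, Evolves 𝒬 R₀ R → R = R₁

end QuasiFree

end

open QuasiFree

noncomputable section

namespace QuasiFree

set_option linter.unusedSectionVars false

/-! An operator given by matrix elements is a function on the occupation numbers of 2n modes
(`toFn`), n for rows and n for columns. Left and right multiplications by ladder operators become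
ladder operators of these modes. The unitary U/√2 (`rotV`) rotates them into lowering operators e
and raising operators r, and then b = (e + r)/√2, b' = (r - e)/√2. Hence [b_p, b'_q] = δ_pq, while
the b commute among themselves, as do the b'. In these variables the Liouvillian is b'·X₀b + b'·Yb'
(`System.toFn_liouvillian`).

Algebra. With M = (Γ + 1/2)⁻¹, the Gaussian vector g = exp(½ r·(1 - M)r + κ·Mr)|0⟩ (`gaussCov`)
satisfies (b - 2Γb')g = √2 κ g (`bOp_gaussCov`). For κ = 0 this says that every d annihilates g.
Inserted into the Liouvillian it leaves b'·(2X₀Γ + Y)b' + √2 b'·X₀κ, which vanishes by the Lyapunov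
equation and X₀κ = 0 (`System.liouvOp_gaussState`). Together with Tr ∘ b' = 0 it gives a two-step
recurrence for the moments of x·w, hence the characteristic function (`isGaussian_gaussState`). A
zero-mode column satisfies X₀s_k = 0, so d'_{k,1} commutes with the Liouvillian; d_{k,1}, d'_{k,1}
form bosonic pairs whose number operators separate the monomials
(`JordanForm.linearIndependent_zeroMonomial`).

Exponentials. Both exponents in the theorem have the form v·b' + b'·Δb' with real v, Δ (`genOp`).
Along Γ_t = Γ₀ + tΔ with mean tv/√2, the vectors g solve the evolution equation up to a scalar
factor (`genOp_gaussFn`). Since the generator produces trace zero, dividing by the trace removes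
this factor (`hasDerivWithinAt_gaussState_path`). The vacuum is the Gaussian with Γ = 1/2.
Uniqueness holds because the generator shifts degrees by at most two with coefficients linear in the
degree, so that iterating the integrated equation forces a bounded solution with zero initial value
to vanish (`eq_zero_of_growth`).

Analysis. For Γ > 0 the matrix 1 - M is a strict contraction. Comparing norms degree by degree, this
yields exponential decay of g, uniformly along the path (`expDecay_gaussFn`). Exponential decay
survives every polynomial in the ladder operators and implies trace class, which gives regularity
and justifies all interchanges of limits.

Positivity. Physicality is equivalent to Γ ≥ τ/2. This makes the part of the exponent that couples
rows to columns positive semidefinite (`IsBona.couplingMatrix`), so it is a sum of maps R ↦ LRL†;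
the rest acts as R ↦ ARA† (`isPosForm_gaussCov`).

Trace. For general trace-class R, the partial traces of a'R up to degree N telescope to a boundary
term. It is at most N + 1 times a summable sequence, so its limit can only be zero
(`hasTrace_zero_of_eq_sum_apOp`). -/

/-! ## Ladder operators on functions of occupation numbers -/

/-- Functions of the occupation numbers of the modes `ι`. -/
abbrev Fn (ι : Type*) : Type _ := (ι → ℕ) → ℂ

section Ladder

variable {ι : Type*} [DecidableEq ι]

/-- Lowering operator of mode `p`. -/
def low (p : ι) : Module.End ℂ (Fn ι) where
  toFun X i := ((Real.sqrt (i p + 1) : ℝ) : ℂ) * X (i + Pi.single p 1)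
  map_add' X Y := by ext i; simp [mul_add]
  map_smul' a X := by ext i; simp [mul_left_comm]

/-- Raising operator of mode `p`. -/
def rai (p : ι) : Module.End ℂ (Fn ι) where
  toFun X i := ((Real.sqrt (i p) : ℝ) : ℂ) * X (i - Pi.single p 1)
  map_add' X Y := by ext i; simp [mul_add]
  map_smul' a X := by ext i; simp [mul_left_comm]

theorem low_apply (p : ι) (X : Fn ι) (i : ι → ℕ) :
    low p X i = ((Real.sqrt (i p + 1) : ℝ) : ℂ) * X (i + Pi.single p 1) := rfl

theorem rai_apply (p : ι) (X : Fn ι) (i : ι → ℕ) :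
    rai p X i = ((Real.sqrt (i p) : ℝ) : ℂ) * X (i - Pi.single p 1) := rfl

theorem ofReal_sqrt_mul_self {x : ℝ} (hx : 0 ≤ x) :
    ((Real.sqrt x : ℝ) : ℂ) * ((Real.sqrt x : ℝ) : ℂ) = x := by
  rw [← Complex.ofReal_mul, Real.mul_self_sqrt hx]

theorem low_mul_low (p q : ι) : low p * low q = low q * low p := by
  rcases eq_or_ne p q with rfl | h
  · rfl
  ext X i
  simp only [Module.End.mul_apply, low_apply, Pi.add_apply, Pi.single_eq_of_ne h,
    Pi.single_eq_of_ne h.symm, add_zero, add_right_comm i]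
  ring

theorem rai_mul_rai (p q : ι) : rai p * rai q = rai q * rai p := by
  rcases eq_or_ne p q with rfl | h
  · rfl
  ext X i
  simp only [Module.End.mul_apply, rai_apply, Pi.sub_apply, Pi.single_eq_of_ne h,
    Pi.single_eq_of_ne h.symm, tsub_zero, tsub_right_comm (a := i)]
  ring

theorem low_mul_rai (p q : ι) :
    low p * rai q = rai q * low p + (if p = q then (1 : ℂ) else 0) • 1 := by
  rcases eq_or_ne p q with rfl | h
  · ext X i
    simp only [Module.End.mul_apply, low_apply, rai_apply, Pi.add_apply, Pi.sub_apply,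
      Pi.single_eq_same, add_tsub_cancel_right, LinearMap.add_apply, if_true, one_smul,
      Module.End.one_apply, Nat.cast_add, Nat.cast_one]
    rw [← mul_assoc, ofReal_sqrt_mul_self (by positivity), ← mul_assoc]
    -- At occupation zero, truncated subtraction does not undo the shift; the factor √0 removes that
    -- entry.
    rcases Nat.eq_zero_or_pos (i p) with h0 | h0
    · simp [h0]
    · have h1 : i - Pi.single p 1 + Pi.single p 1 = i := by
        refine tsub_add_cancel_of_le fun q => ?_
        rcases eq_or_ne q p with rfl | hq
        · simpa using Nat.succ_le_of_lt h0
        · simp [hq]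
      have h2 : ((i p - 1 : ℕ) : ℝ) + 1 = i p := by
        exact_mod_cast Nat.sub_add_cancel h0
      rw [h1, h2, ofReal_sqrt_mul_self (by positivity)]
      push_cast
      ring
  · ext X i
    simp only [Module.End.mul_apply, low_apply, rai_apply, Pi.add_apply, Pi.sub_apply,
      Pi.single_eq_of_ne h, Pi.single_eq_of_ne h.symm, add_zero, tsub_zero,
      if_neg h, zero_smul]
    have h1 : i + Pi.single p 1 - Pi.single q 1 = i - Pi.single q 1 + Pi.single p 1 := by
      ext r
      rcases eq_or_ne r p with rfl | hr
      · simp [Pi.single_eq_of_ne h]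
      · simp [Pi.single_eq_of_ne hr]
    rw [h1]
    ring

/-- Operators that are polynomials in the ladder operators. -/
def ladderAlg (ι : Type*) [DecidableEq ι] : Subalgebra ℂ (Module.End ℂ (Fn ι)) :=
  Algebra.adjoin ℂ (Set.range low ∪ Set.range rai)

theorem low_mem (p : ι) : low p ∈ ladderAlg ι := Algebra.subset_adjoin (Or.inl ⟨p, rfl⟩)

theorem rai_mem (p : ι) : rai p ∈ ladderAlg ι := Algebra.subset_adjoin (Or.inr ⟨p, rfl⟩)

theorem ladder_induction {P : Module.End ℂ (Fn ι) → Prop} (hlow : ∀ p, P (low p))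
    (hrai : ∀ p, P (rai p)) (hone : P 1) (hsmul : ∀ (a : ℂ) T, P T → P (a • T))
    (hadd : ∀ T T', P T → P T' → P (T + T')) (hmul : ∀ T T', P T → P T' → P (T * T'))
    {T : Module.End ℂ (Fn ι)} (hT : T ∈ ladderAlg ι) : P T := by
  refine Algebra.adjoin_induction (p := fun T _ => P T) ?_ ?_ ?_ ?_ hT
  · rintro T (⟨p, rfl⟩ | ⟨p, rfl⟩)
    exacts [hlow p, hrai p]
  · intro a
    rw [Algebra.algebraMap_eq_smul_one]
    exact hsmul a _ hone
  · exact fun T T' _ _ h h' => hadd T T' h h'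
  · exact fun T T' _ _ h h' => hmul T T' h h'

variable [Fintype ι]

/-- Total occupation number. -/
def deg (i : ι → ℕ) : ℕ := ∑ p, i p

theorem deg_add_single (i : ι → ℕ) (p : ι) : deg (i + Pi.single p 1) = deg i + 1 := by
  simp [deg, Finset.sum_add_distrib]

theorem le_deg (i : ι → ℕ) (p : ι) : i p ≤ deg i :=
  Finset.single_le_sum (f := i) (fun _ _ => Nat.zero_le _) (Finset.mem_univ p)

theorem sub_single_add_single {i : ι → ℕ} {p : ι} (h : 0 < i p) :
    i - Pi.single p 1 + Pi.single p 1 = i := by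
  refine tsub_add_cancel_of_le fun q => ?_
  rcases eq_or_ne q p with rfl | hq
  · simpa using Nat.succ_le_of_lt h
  · simp [hq]

theorem deg_sub_single {i : ι → ℕ} {p : ι} (h : 0 < i p) :
    deg (i - Pi.single p 1) + 1 = deg i := by
  rw [← deg_add_single, sub_single_add_single h]

theorem deg_sub_single_le (i : ι → ℕ) (p : ι) : deg (i - Pi.single p 1) ≤ deg i :=
  Finset.sum_le_sum fun q _ => by simp

/-- `T` changes degrees by at most `k` and has coefficients of order `√deg ^ k`. -/
def GrowthLE (k : ℕ) (T : Module.End ℂ (Fn ι)) : Prop :=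
  ∃ C : ℝ, 0 ≤ C ∧ ∀ (X : Fn ι) (N : ℕ) (b : ℝ), 0 ≤ b → (∀ i, deg i ≤ N + k → ‖X i‖ ≤ b) →
    ∀ i, deg i ≤ N → ‖T X i‖ ≤ C * Real.sqrt (N + k) ^ k * b

theorem GrowthLE.low (p : ι) : GrowthLE 1 (low p) := by
  refine ⟨1, zero_le_one, fun X N b hb h i hi => ?_⟩
  rw [low_apply, norm_mul, Complex.norm_real, Real.norm_of_nonneg (Real.sqrt_nonneg _), one_mul,
    pow_one]
  have h1 : (i p : ℝ) ≤ N := by exact_mod_cast (le_deg i p).trans hi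
  gcongr
  · simp
  · exact h _ (by rw [deg_add_single]; omega)

theorem GrowthLE.rai (p : ι) : GrowthLE 1 (rai p) := by
  refine ⟨1, zero_le_one, fun X N b hb h i hi => ?_⟩
  rw [rai_apply, norm_mul, Complex.norm_real, Real.norm_of_nonneg (Real.sqrt_nonneg _), one_mul,
    pow_one]
  have h1 : (i p : ℝ) ≤ N := by exact_mod_cast (le_deg i p).trans hi
  gcongr
  · push_cast; linarith
  · exact h _ ((deg_sub_single_le i p).trans (by omega))

theorem GrowthLE.zero (k : ℕ) : GrowthLE k (0 : Module.End ℂ (Fn ι)) :=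
  ⟨0, le_rfl, fun X N b hb h i hi => by simp⟩

theorem GrowthLE.add {k : ℕ} {T T' : Module.End ℂ (Fn ι)} (h : GrowthLE k T)
    (h' : GrowthLE k T') : GrowthLE k (T + T') := by
  obtain ⟨C, hC, hT⟩ := h
  obtain ⟨C', hC', hT'⟩ := h'
  refine ⟨C + C', by positivity, fun X N b hb h i hi => ?_⟩
  rw [add_mul, add_mul]
  exact (norm_add_le _ _).trans (add_le_add (hT X N b hb h i hi) (hT' X N b hb h i hi))

theorem GrowthLE.smul {k : ℕ} {T : Module.End ℂ (Fn ι)} (a : ℂ) (h : GrowthLE k T) :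
    GrowthLE k (a • T) := by
  obtain ⟨C, hC, hT⟩ := h
  refine ⟨‖a‖ * C, by positivity, fun X N b hb h i hi => ?_⟩
  rw [LinearMap.smul_apply, Pi.smul_apply, norm_smul, mul_assoc, mul_assoc]
  gcongr
  rw [← mul_assoc]
  exact hT X N b hb h i hi

theorem GrowthLE.sum {α : Type*} {k : ℕ} {s : Finset α} {T : α → Module.End ℂ (Fn ι)}
    (h : ∀ a ∈ s, GrowthLE k (T a)) : GrowthLE k (∑ a ∈ s, T a) :=
  Finset.sum_induction _ (GrowthLE k) (fun _ _ => GrowthLE.add) (GrowthLE.zero k) h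

theorem GrowthLE.mul {k l : ℕ} {T T' : Module.End ℂ (Fn ι)} (h : GrowthLE k T)
    (h' : GrowthLE l T') : GrowthLE (k + l) (T * T') := by
  obtain ⟨C, hC, hT⟩ := h
  obtain ⟨C', hC', hT'⟩ := h'
  refine ⟨C * C', by positivity, fun X N b hb h i hi => ?_⟩
  have h1 := hT (T' X) N (C' * Real.sqrt (N + k + l) ^ l * b) (by positivity) (fun j hj => by
    simpa using hT' X (N + k) b hb (fun i' hi' => h i' (by omega)) j hj) i hi
  refine h1.trans ?_
  have h2 : Real.sqrt (N + k) ≤ Real.sqrt (N + k + l) := by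
    exact Real.sqrt_le_sqrt (by simp)
  calc C * Real.sqrt (N + k) ^ k * (C' * Real.sqrt (N + k + l) ^ l * b)
      ≤ C * Real.sqrt (N + k + l) ^ k * (C' * Real.sqrt (N + k + l) ^ l * b) := by gcongr
    _ = C * C' * Real.sqrt (N + ((k + l : ℕ) : ℝ)) ^ (k + l) * b := by
        rw [pow_add]; push_cast; rw [add_assoc]; ring

theorem GrowthLE.succ {k : ℕ} {T : Module.End ℂ (Fn ι)} (h : GrowthLE k T) :
    GrowthLE (k + 1) T := by
  obtain ⟨C, hC, hT⟩ := h
  refine ⟨C, hC, fun X N b hb h i hi => (hT X N b hb (fun i hi => h i (by omega)) i hi).trans ?_⟩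
  have h1 : Real.sqrt (N + k) ≤ Real.sqrt (N + (k + 1 : ℕ)) := by
    gcongr
    simp
  have h2 : 1 ≤ Real.sqrt (N + (k + 1 : ℕ)) := by
    rw [Real.one_le_sqrt]
    push_cast
    have : (0 : ℝ) ≤ N + k := by positivity
    linarith
  have h3 : Real.sqrt (N + k) ^ k ≤ Real.sqrt (N + (k + 1 : ℕ)) ^ (k + 1) := by
    rw [pow_succ]
    calc Real.sqrt (N + k) ^ k ≤ Real.sqrt (N + (k + 1 : ℕ)) ^ k * 1 := by
          rw [mul_one]; gcongr
      _ ≤ _ := by gcongr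
  gcongr

/-- The growth bound with `b = 0`, applied to `X - Y`, expresses locality: an entry of the image
sees only bounded degrees. Infinite series can therefore be replaced by truncations. -/
theorem GrowthLE.eq_of_eq {k : ℕ} {T : Module.End ℂ (Fn ι)} (h : GrowthLE k T) {X Y : Fn ι}
    {N : ℕ} (hXY : ∀ i, deg i ≤ N + k → X i = Y i) {i : ι → ℕ} (hi : deg i ≤ N) :
    T X i = T Y i := by
  obtain ⟨C, hC, hT⟩ := h
  have := hT (X - Y) N 0 le_rfl (fun i hi => by simp [hXY i hi]) i hi
  rw [mul_zero, norm_le_zero_iff, map_sub, Pi.sub_apply, sub_eq_zero] at this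
  exact this

theorem exists_growthLE {T : Module.End ℂ (Fn ι)} (hT : T ∈ ladderAlg ι) : ∃ k, GrowthLE k T := by
  have mono : ∀ {T : Module.End ℂ (Fn ι)} {k l : ℕ}, k ≤ l → GrowthLE k T → GrowthLE l T :=
    fun hkl h => Nat.le_induction h (fun _ _ h => h.succ) _ hkl
  refine ladder_induction (P := fun T => ∃ k, GrowthLE k T) (fun p => ⟨1, .low p⟩)
    (fun p => ⟨1, .rai p⟩) ⟨0, 1, zero_le_one, fun X N b hb h i hi => by simpa using h i hi⟩
    ?_ ?_ ?_ hT
  · rintro a T ⟨k, h⟩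
    exact ⟨k, h.smul a⟩
  · rintro T T' ⟨k, h⟩ ⟨l, h'⟩
    exact ⟨max k l, (mono (le_max_left _ _) h).add (mono (le_max_right _ _) h')⟩
  · rintro T T' ⟨k, h⟩ ⟨l, h'⟩
    exact ⟨k + l, h.mul h'⟩

/-! ## Families with uniform exponential decay -/

/-- A family of functions decays exponentially, uniformly in the parameter. -/
def ExpDecay {α : Type*} (F : α → Fn ι) : Prop :=
  ∃ C r : ℝ, 0 ≤ C ∧ 0 < r ∧ r < 1 ∧ ∀ a i, ‖F a i‖ ≤ C * r ^ deg i

theorem ExpDecay.comp {α β : Type*} {F : α → Fn ι} (h : ExpDecay F) (f : β → α) :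
    ExpDecay fun b => F (f b) := by
  obtain ⟨C, r, hC, h0, h1, hF⟩ := h
  exact ⟨C, r, hC, h0, h1, fun a i => hF _ i⟩

theorem ExpDecay.add {α : Type*} {F F' : α → Fn ι} (h : ExpDecay F) (h' : ExpDecay F') :
    ExpDecay fun a => F a + F' a := by
  obtain ⟨C, r, hC, h0, h1, hF⟩ := h
  obtain ⟨C', r', hC', h0', h1', hF'⟩ := h'
  refine ⟨C + C', max r r', by positivity, lt_max_of_lt_left h0, max_lt h1 h1', fun a i => ?_⟩
  rw [add_mul]
  refine (norm_add_le _ _).trans (add_le_add ((hF a i).trans ?_) ((hF' a i).trans ?_)) <;> gcongr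
  · exact le_max_left _ _
  · exact le_max_right _ _

theorem ExpDecay.smul {α : Type*} {F : α → Fn ι} (h : ExpDecay F) {c : α → ℂ} {K : ℝ}
    (hc : ∀ a, ‖c a‖ ≤ K) : ExpDecay fun a => c a • F a := by
  obtain ⟨C, r, hC, h0, h1, hF⟩ := h
  refine ⟨|K| * C, r, by positivity, h0, h1, fun a i => ?_⟩
  change ‖c a • F a i‖ ≤ _
  rw [norm_smul, mul_assoc]
  exact mul_le_mul ((hc a).trans (le_abs_self K)) (hF a i) (norm_nonneg _) (abs_nonneg _)

/-- Any ratio `s` strictly between `r` and 1 absorbs the square root, since N(r/s)^N is bounded. -/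
theorem exists_sqrt_mul_pow_le {r : ℝ} (h0 : 0 < r) (h1 : r < 1) :
    ∃ C s : ℝ, 0 ≤ C ∧ 0 < s ∧ s < 1 ∧ ∀ N : ℕ, Real.sqrt (N + 1) * r ^ N ≤ C * s ^ N := by
  obtain ⟨s, hrs, hs1⟩ := exists_between h1
  have hs0 : 0 < s := h0.trans hrs
  have hq : r / s < 1 := (div_lt_one hs0).2 hrs
  have ht := tendsto_self_mul_const_pow_of_lt_one (by positivity : 0 ≤ r / s) hq
  obtain ⟨K, hK⟩ := ht.bddAbove_range
  refine ⟨|K| + 1, s, by positivity, hs0, hs1, fun N => ?_⟩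
  have h2 : Real.sqrt (N + 1) ≤ N + 1 := by
    rw [Real.sqrt_le_left (by positivity)]
    have : (0 : ℝ) ≤ N := N.cast_nonneg
    nlinarith
  have h3 : (N : ℝ) * (r / s) ^ N ≤ K := hK ⟨N, rfl⟩
  have h4 : (r / s) ^ N ≤ 1 := pow_le_one₀ (by positivity) hq.le
  calc Real.sqrt (N + 1) * r ^ N ≤ (N + 1) * r ^ N := by gcongr
    _ = (N * (r / s) ^ N + (r / s) ^ N) * s ^ N := by
        rw [div_pow]; field_simp
    _ ≤ (|K| + 1) * s ^ N := by
        gcongr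
        exact h3.trans (le_abs_self K)

theorem ExpDecay.low {α : Type*} {F : α → Fn ι} (h : ExpDecay F) (p : ι) :
    ExpDecay fun a => low p (F a) := by
  obtain ⟨C, r, hC, h0, h1, hF⟩ := h
  obtain ⟨K, s, hK, hs0, hs1, hKs⟩ := exists_sqrt_mul_pow_le h0 h1
  refine ⟨C * K, s, by positivity, hs0, hs1, fun a i => ?_⟩
  beta_reduce
  rw [low_apply, norm_mul, Complex.norm_real, Real.norm_of_nonneg (Real.sqrt_nonneg _)]
  have h2 : (i p : ℝ) ≤ deg i := by exact_mod_cast le_deg i p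
  calc Real.sqrt (i p + 1) * ‖F a (i + Pi.single p 1)‖
      ≤ Real.sqrt (deg i + 1) * (C * r ^ (deg i)) := by
        gcongr
        refine (hF _ _).trans ?_
        rw [deg_add_single]
        exact mul_le_mul_of_nonneg_left (pow_le_pow_of_le_one h0.le h1.le (by omega)) hC
    _ = C * (Real.sqrt (deg i + 1) * r ^ (deg i)) := by ring
    _ ≤ C * (K * s ^ deg i) := mul_le_mul_of_nonneg_left (hKs _) hC
    _ = _ := by ring

theorem ExpDecay.rai {α : Type*} {F : α → Fn ι} (h : ExpDecay F) (p : ι) :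
    ExpDecay fun a => rai p (F a) := by
  obtain ⟨C, r, hC, h0, h1, hF⟩ := h
  obtain ⟨K, s, hK, hs0, hs1, hKs⟩ := exists_sqrt_mul_pow_le h0 h1
  refine ⟨C * r⁻¹ * K, s, by positivity, hs0, hs1, fun a i => ?_⟩
  beta_reduce
  rw [rai_apply, norm_mul, Complex.norm_real, Real.norm_of_nonneg (Real.sqrt_nonneg _)]
  rcases Nat.eq_zero_or_pos (i p) with h3 | h3
  · rw [h3, Nat.cast_zero, Real.sqrt_zero, zero_mul]
    positivity
  have h2 : (i p : ℝ) ≤ deg i + 1 := by exact_mod_cast (le_deg i p).trans (Nat.le_succ _)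
  calc Real.sqrt (i p) * ‖F a (i - Pi.single p 1)‖
      ≤ Real.sqrt (deg i + 1) * (C * r ^ (deg (i - Pi.single p 1))) := by
        gcongr
        exact hF _ _
    _ = C * r⁻¹ * (Real.sqrt (deg i + 1) * r ^ (deg i)) := by
        rw [← deg_sub_single h3, pow_succ]
        field_simp
    _ ≤ C * r⁻¹ * (K * s ^ deg i) := mul_le_mul_of_nonneg_left (hKs _) (by positivity)
    _ = _ := by ring

theorem ExpDecay.apply {α : Type*} {F : α → Fn ι} (h : ExpDecay F) {T : Module.End ℂ (Fn ι)}
    (hT : T ∈ ladderAlg ι) : ExpDecay fun a => T (F a) := by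
  refine ladder_induction (P := fun T => ∀ F : α → Fn ι, ExpDecay F → ExpDecay fun a => T (F a))
    (fun p F h => h.low p) (fun p F h => h.rai p) (fun F h => h) ?_ ?_ ?_ hT F h
  · exact fun a T hT F h => (hT F h).smul (c := fun _ => a) (fun _ => le_rfl)
  · exact fun T T' hT hT' F h => (hT F h).add (hT' F h)
  · exact fun T T' hT hT' F h => hT _ (hT' F h)

theorem summable_geometric_deg {r : ℝ} (h0 : 0 ≤ r) (h1 : r < 1) :
    Summable fun i : ι → ℕ => r ^ deg i := by
  classical
  refine summable_of_sum_le (c := ∏ _p : ι, (1 - r)⁻¹) (fun i => by positivity) fun s => ?_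
  obtain ⟨K, hK⟩ : ∃ K, ∀ i ∈ s, ∀ p, i p < K := by
    refine ⟨s.sup deg + 1, fun i hi p => ?_⟩
    have h2 : deg i ≤ s.sup deg := Finset.le_sup (f := deg) hi
    have := le_deg i p
    omega
  -- A finite set of occupation numbers lies in a box, over which the sum factors into one partial
  -- geometric series per mode.
  calc ∑ i ∈ s, r ^ deg i ≤ ∑ i ∈ Fintype.piFinset fun _ : ι => Finset.range K, r ^ deg i := by
        refine Finset.sum_le_sum_of_subset_of_nonneg (fun i hi => ?_) fun i _ _ => by positivity
        rw [Fintype.mem_piFinset]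
        exact fun p => Finset.mem_range.2 (hK i hi p)
    _ = ∏ _p : ι, ∑ k ∈ Finset.range K, r ^ k := by
        rw [Finset.prod_univ_sum]
        exact Finset.sum_congr rfl fun i _ => (Finset.prod_pow_eq_pow_sum _ _ _).symm
    _ ≤ ∏ _p : ι, (1 - r)⁻¹ := by
        refine Finset.prod_le_prod (fun p _ => by positivity) fun p _ => ?_
        rw [← tsum_geometric_of_lt_one h0 h1]
        exact (summable_geometric_of_lt_one h0 h1).sum_le_tsum _ (fun k _ => by positivity)

/-! ## Entrywise derivatives -/

/-- Each entry of the image is a finite combination of entries of `X`, so no convergence question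
arises. -/
theorem hasDerivWithinAt_ladder {T : Module.End ℂ (Fn ι)} (hT : T ∈ ladderAlg ι) {s : Set ℝ}
    {t : ℝ} {X : ℝ → Fn ι} {X' : Fn ι} (h : ∀ i, HasDerivWithinAt (fun t => X t i) (X' i) s t) :
    ∀ i, HasDerivWithinAt (fun t => T (X t) i) (T X' i) s t := by
  refine ladder_induction (P := fun T => ∀ (X : ℝ → Fn ι) (X' : Fn ι),
    (∀ i, HasDerivWithinAt (fun t => X t i) (X' i) s t) →
    ∀ i, HasDerivWithinAt (fun t => T (X t) i) (T X' i) s t)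
    (fun p X X' h i => (h _).const_mul _) (fun p X X' h i => (h _).const_mul _)
    (fun X X' h i => h i) ?_ ?_ ?_ hT X X' h
  · exact fun a T hT X X' h i => (hT X X' h i).const_smul a
  · exact fun T T' hT hT' X X' h i => (hT X X' h i).add (hT' X X' h i)
  · exact fun T T' hT hT' X X' h => hT _ _ (hT' X X' h)

end Ladder

/-! ## Exponential decay from a three-term inequality -/

/-- For large N the inequality behaves like F(N+2) ≤ a F(N) with a < 1, so F decays at any rate r
with r² > a. The constants depend only on `a`, `b`, `D`; this uniformity is what later gives decay
along a whole path of Gaussians. -/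
theorem exists_geometric_bound {a b D : ℝ} (ha : 0 ≤ a) (ha1 : a < 1) (hb : 0 ≤ b) (hD : 0 ≤ D) :
    ∃ C r : ℝ, 0 ≤ C ∧ 0 < r ∧ r < 1 ∧ ∀ F : ℕ → ℝ, (∀ N, 0 ≤ F N) → F 0 ≤ 1 → F 1 ≤ b →
      (∀ N : ℕ, (N + 2) * F (N + 2) ≤ a * (N + D) * F N + b * F (N + 1)) →
      ∀ N, F N ≤ C * r ^ N := by
  obtain ⟨q, haq, hq1⟩ := exists_between ha1
  have hq0 : 0 < q := ha.trans_lt haq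
  set r := Real.sqrt q with hr
  have hr0 : 0 < r := Real.sqrt_pos.2 hq0
  have hrr : r ^ 2 = q := Real.sq_sqrt hq0.le
  have hr1 : r < 1 := by nlinarith
  -- Beyond `M₀`, the bound C r^N reproduces itself: this requires a(N + D) + br ≤ q(N + 2) with r²
  -- = q, and the slope q exceeds a.
  obtain ⟨M₀, hM₀⟩ := exists_nat_ge ((a * D + b * r) / (q - a))
  have hM₀' : ∀ N : ℕ, M₀ ≤ N → a * (N + D) + b * r ≤ q * (N + 2) := by
    intro N hN
    have h1 : (M₀ : ℝ) ≤ N := by exact_mod_cast hN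
    have h2 : a * D + b * r ≤ N * (q - a) := (div_le_iff₀ (by linarith)).1 (hM₀.trans h1)
    nlinarith
  -- A crude growth rate, used only up to `M₀ + 1`; dividing by `r` and taking the power `M₀ + 1`
  -- turns it into the final constant.
  set L : ℝ := a * (1 + D) + b + 1 with hL
  have hL1 : 1 ≤ L := by
    have : 0 ≤ a * (1 + D) := by positivity
    linarith
  have hLr : 1 ≤ L / r := by rw [le_div_iff₀ hr0]; linarith
  refine ⟨(L / r) ^ (M₀ + 1), r, by positivity, hr0, hr1, fun F hF h0 h1 hrec => ?_⟩
  have hFL : ∀ N, F N ≤ L ^ N ∧ F (N + 1) ≤ L ^ (N + 1) := by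
    intro N
    induction N with
    | zero =>
      refine ⟨by simpa using h0, ?_⟩
      have : 0 ≤ a * (1 + D) := by positivity
      simp only [zero_add, pow_one]
      linarith
    | succ N ih =>
      refine ⟨ih.2, ?_⟩
      have h2 := hrec N
      have hN : (0 : ℝ) ≤ N := N.cast_nonneg
      have h3 : a * (N + D) * F N ≤ (N + 2) * (a * (1 + D) * L ^ (N + 1)) := by
        have h4 : F N ≤ L ^ (N + 1) := ih.1.trans (pow_le_pow_right₀ hL1 (by omega))
        calc a * (N + D) * F N ≤ a * ((N + 2) * (1 + D)) * L ^ (N + 1) := by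
              gcongr
              · exact hF N
              · nlinarith
          _ = _ := by ring
      have h5 : b * F (N + 1) ≤ (N + 2) * (b * L ^ (N + 1)) := by
        have h6 : b * F (N + 1) ≤ b * L ^ (N + 1) := mul_le_mul_of_nonneg_left ih.2 hb
        have h7 : 0 ≤ b * L ^ (N + 1) := by positivity
        nlinarith
      have h8 : F (N + 2) ≤ (a * (1 + D) + b) * L ^ (N + 1) := by
        refine le_of_mul_le_mul_left ?_ (by positivity : (0 : ℝ) < N + 2)
        linarith
      calc F (N + 2) ≤ (a * (1 + D) + b) * L ^ (N + 1) := h8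
        _ ≤ L * L ^ (N + 1) := by gcongr; linarith
        _ = L ^ (N + 1 + 1) := by ring
  have hsmall : ∀ N ≤ M₀ + 1, F N ≤ (L / r) ^ (M₀ + 1) * r ^ N := fun N hN =>
    calc F N ≤ L ^ N := (hFL N).1
      _ = (L / r) ^ N * r ^ N := by rw [div_pow]; field_simp
      _ ≤ (L / r) ^ (M₀ + 1) * r ^ N := by gcongr
  have hpair : ∀ N, F (M₀ + N) ≤ (L / r) ^ (M₀ + 1) * r ^ (M₀ + N) ∧
      F (M₀ + N + 1) ≤ (L / r) ^ (M₀ + 1) * r ^ (M₀ + N + 1) := by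
    intro N
    induction N with
    | zero => exact ⟨hsmall _ (by omega), hsmall _ (by omega)⟩
    | succ N ih =>
      refine ⟨ih.2, ?_⟩
      have h2 := hrec (M₀ + N)
      have h3 := hM₀' (M₀ + N) (by omega)
      set C := (L / r) ^ (M₀ + 1)
      have hC : 0 ≤ C := by positivity
      have hN : (0 : ℝ) ≤ (M₀ + N : ℕ) := Nat.cast_nonneg _
      refine le_of_mul_le_mul_left (h2.trans ?_) (by positivity : (0 : ℝ) < (M₀ + N : ℕ) + 2)
      calc a * ((M₀ + N : ℕ) + D) * F (M₀ + N) + b * F (M₀ + N + 1)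
          ≤ a * ((M₀ + N : ℕ) + D) * (C * r ^ (M₀ + N)) + b * (C * r ^ (M₀ + N + 1)) := by
            gcongr
            exacts [ih.1, ih.2]
        _ = (a * ((M₀ + N : ℕ) + D) + b * r) * (C * r ^ (M₀ + N)) := by ring
        _ ≤ (q * ((M₀ + N : ℕ) + 2)) * (C * r ^ (M₀ + N)) := by gcongr
        _ = _ := by rw [← hrr]; ring
  intro N
  rcases le_or_gt N M₀ with hN | hN
  · exact hsmall N (by omega)
  · have := (hpair (N - M₀)).1
    rwa [show M₀ + (N - M₀) = N by omega] at this

/-! ### Sums over occupation numbers of fixed degree. -/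

section Level

variable {ι : Type*} [DecidableEq ι] [Fintype ι]

/-- The occupation numbers of degree `N`. -/
def level (ι : Type*) [DecidableEq ι] [Fintype ι] (N : ℕ) : Finset (ι → ℕ) :=
  Finset.piAntidiag Finset.univ N

theorem mem_level {N : ℕ} {i : ι → ℕ} : i ∈ level ι N ↔ deg i = N := by
  simp [level, deg]

theorem sum_level_succ {M : Type*} [AddCommMonoid M] (N : ℕ) (p : ι) (f : (ι → ℕ) → M)
    (hf : ∀ i, i p = 0 → f i = 0) :
    ∑ i ∈ level ι (N + 1), f i = ∑ i ∈ level ι N, f (i + Pi.single p 1) := by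
  rw [← Finset.sum_filter_of_ne (p := fun i => 0 < i p)
    (fun i _ h => Nat.pos_of_ne_zero fun h0 => h (hf i h0))]
  refine Finset.sum_nbij' (fun i => i - Pi.single p 1) (fun i => i + Pi.single p 1) ?_ ?_ ?_ ?_ ?_
  · intro i hi
    rw [Finset.mem_filter, mem_level] at hi
    rw [mem_level]
    have := deg_sub_single hi.2
    omega
  · intro i hi
    rw [mem_level] at hi
    simp [mem_level, deg_add_single, hi]
  · intro i hi
    exact sub_single_add_single (Finset.mem_filter.1 hi).2
  · intro i _
    exact add_tsub_cancel_right i _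
  · intro i hi
    rw [sub_single_add_single (Finset.mem_filter.1 hi).2]

theorem norm_sq_ofReal_sqrt_mul {x : ℝ} (hx : 0 ≤ x) (z : ℂ) :
    ‖((Real.sqrt x : ℝ) : ℂ) * z‖ ^ 2 = x * ‖z‖ ^ 2 := by
  rw [norm_mul, mul_pow, Complex.norm_real, Real.norm_of_nonneg (Real.sqrt_nonneg x),
    Real.sq_sqrt hx]

/-- After the shift by one particle, mode `p` carries the weight i_p, and these weights add up to
the degree N + 1. For raising operators the weight is i_p + 1, which adds the number of modes. -/
theorem sum_level_low (X : Fn ι) (N : ℕ) :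
    ∑ i ∈ level ι N, ∑ p, ‖low p X i‖ ^ 2 = (N + 1) * ∑ i ∈ level ι (N + 1), ‖X i‖ ^ 2 := by
  have h1 : ∀ p : ι, ∑ i ∈ level ι N, ‖low p X i‖ ^ 2 =
      ∑ i ∈ level ι (N + 1), (i p : ℝ) * ‖X i‖ ^ 2 := by
    intro p
    rw [sum_level_succ N p _ fun i hi => by simp [hi]]
    refine Finset.sum_congr rfl fun i _ => ?_
    rw [low_apply, norm_sq_ofReal_sqrt_mul (by positivity)]
    simp
  rw [Finset.sum_comm, Finset.sum_congr rfl fun p _ => h1 p, Finset.sum_comm, Finset.mul_sum]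
  refine Finset.sum_congr rfl fun i hi => ?_
  rw [← Finset.sum_mul]
  congr 1
  have := mem_level.1 hi
  rw [deg] at this
  exact_mod_cast this

theorem sum_level_rai (X : Fn ι) (N : ℕ) :
    ∑ i ∈ level ι (N + 1), ∑ p, ‖rai p X i‖ ^ 2 =
      (N + Fintype.card ι) * ∑ i ∈ level ι N, ‖X i‖ ^ 2 := by
  have h1 : ∀ p : ι, ∑ i ∈ level ι (N + 1), ‖rai p X i‖ ^ 2 =
      ∑ i ∈ level ι N, ((i p : ℝ) + 1) * ‖X i‖ ^ 2 := by
    intro p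
    rw [sum_level_succ N p _ fun i hi => by simp [rai_apply, hi]]
    refine Finset.sum_congr rfl fun i _ => ?_
    rw [rai_apply, norm_sq_ofReal_sqrt_mul (by positivity)]
    simp
  rw [Finset.sum_comm, Finset.sum_congr rfl fun p _ => h1 p, Finset.sum_comm, Finset.mul_sum]
  refine Finset.sum_congr rfl fun i hi => ?_
  rw [← Finset.sum_mul, Finset.sum_add_distrib]
  congr 1
  have := mem_level.1 hi
  rw [deg] at this
  rw [← this]
  simp

/-- Functions annihilated by lowering operators modified by a contraction of the raising operators
decay exponentially. -/
theorem exists_expDecay_of_low_le {a b : ℝ} (ha : 0 ≤ a) (ha1 : a < 1) (hb : 0 ≤ b) :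
    ∃ C r : ℝ, 0 ≤ C ∧ 0 < r ∧ r < 1 ∧ ∀ X : Fn ι, ‖X 0‖ ≤ 1 →
      (∀ i, ∑ p, ‖low p X i‖ ^ 2 ≤ a * ∑ p, ‖rai p X i‖ ^ 2 + b * ‖X i‖ ^ 2) →
      ∀ i, ‖X i‖ ≤ C * r ^ deg i := by
  obtain ⟨C, r, hC, hr0, hr1, h⟩ := exists_geometric_bound ha ha1 hb
    (Nat.cast_nonneg (α := ℝ) (Fintype.card ι))
  refine ⟨Real.sqrt C, Real.sqrt r, Real.sqrt_nonneg _, Real.sqrt_pos.2 hr0,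
    by rw [Real.sqrt_lt' one_pos]; simpa using hr1, fun X h0 hX i => ?_⟩
  have hlev : level ι 0 = {0} := by
    ext j
    rw [mem_level, Finset.mem_singleton]
    constructor
    · intro hj
      ext p
      have := le_deg j p
      simp only [Pi.zero_apply]
      omega
    · rintro rfl
      simp [deg]
  have hsum : ∀ N, (N + 1) * ∑ i ∈ level ι (N + 1), ‖X i‖ ^ 2 ≤
      a * ∑ i ∈ level ι N, ∑ p, ‖rai p X i‖ ^ 2 + b * ∑ i ∈ level ι N, ‖X i‖ ^ 2 := by
    intro N
    rw [← sum_level_low, Finset.mul_sum, Finset.mul_sum, ← Finset.sum_add_distrib]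
    exact Finset.sum_le_sum fun i _ => hX i
  -- The level sums of ‖X‖² obey the three-term inequality: lowering contributes (N+2)F(N+2),
  -- raising contributes (N + D)F(N) with `D` the number of modes.
  have hF := h (fun N => ∑ i ∈ level ι N, ‖X i‖ ^ 2) (fun N => by positivity) (by
      rw [hlev, Finset.sum_singleton]
      exact pow_le_one₀ (norm_nonneg _) h0) (by
      have h1 := hsum 0
      have h2 : ∑ i ∈ level ι 0, ∑ p, ‖rai p X i‖ ^ 2 = 0 := by
        rw [hlev, Finset.sum_singleton]
        exact Finset.sum_eq_zero fun p _ => by simp [rai_apply]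
      rw [h2, hlev, Finset.sum_singleton] at h1
      have h3 : ‖X 0‖ ^ 2 ≤ 1 := pow_le_one₀ (norm_nonneg _) h0
      simp only [Nat.cast_zero, zero_add, one_mul, mul_zero] at h1
      nlinarith) (fun N => by
      have h1 := hsum (N + 1)
      rw [sum_level_rai] at h1
      push_cast at h1
      rw [← mul_assoc] at h1
      convert h1 using 2
      ring) (deg i)
  rw [← abs_of_nonneg (norm_nonneg (X i)), ← abs_of_nonneg (by positivity :
    0 ≤ Real.sqrt C * Real.sqrt r ^ deg i), ← sq_le_sq, mul_pow, Real.sq_sqrt hC, ← pow_mul,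
    mul_comm (deg i), pow_mul, Real.sq_sqrt hr0.le]
  exact (Finset.single_le_sum (f := fun i => ‖X i‖ ^ 2) (fun _ _ => by positivity)
    (mem_level.2 rfl)).trans hF

end Level

/-! ## Truncated exponentials -/

/-- The exponential series truncated to the first `K` terms. -/
def pexp {A : Type*} [Ring A] [Algebra ℂ A] (K : ℕ) (G : A) : A :=
  ∑ k ∈ Finset.range K, ((k.factorial : ℂ)⁻¹) • G ^ k

theorem pexp_succ {A : Type*} [Ring A] [Algebra ℂ A] (K : ℕ) (G : A) :
    pexp (K + 1) G = pexp K G + ((K.factorial : ℂ)⁻¹) • G ^ K := Finset.sum_range_succ _ _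

theorem inv_factorial_succ_mul (k : ℕ) :
    ((k + 1).factorial : ℂ)⁻¹ * ((k : ℂ) + 1) = (k.factorial : ℂ)⁻¹ := by
  have h1 : (k.factorial : ℂ) ≠ 0 := by exact_mod_cast k.factorial_ne_zero
  have h2 : (k : ℂ) + 1 ≠ 0 := by exact_mod_cast k.succ_ne_zero
  rw [Nat.factorial_succ]
  push_cast
  field_simp

/-- Leibniz rule for the derivation [e, ·], whose value `L` on `G` commutes with `G`. -/
theorem mul_pow_of_commutator {A : Type*} [Ring A] [Algebra ℂ A] {e G L : A}
    (h : e * G = G * e + L) (hL : L * G = G * L) (k : ℕ) :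
    e * G ^ (k + 1) = G ^ (k + 1) * e + ((k : ℂ) + 1) • (L * G ^ k) := by
  induction k with
  | zero => simp [h]
  | succ k ih =>
    have hL' : L * G ^ (k + 1) = G ^ (k + 1) * L := (Commute.pow_right hL (k + 1)).eq
    rw [pow_succ, ← mul_assoc, ih, add_mul, mul_assoc, h, mul_add, smul_mul_assoc, mul_assoc L,
      ← pow_succ, ← hL', ← mul_assoc]
    push_cast
    module

/-- The commutator differentiates the series, so its term is truncated one order earlier. -/
theorem mul_pexp_of_commutator {A : Type*} [Ring A] [Algebra ℂ A] {e G L : A}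
    (h : e * G = G * e + L) (hL : L * G = G * L) (K : ℕ) :
    e * pexp (K + 1) G = pexp (K + 1) G * e + L * pexp K G := by
  rw [pexp, Finset.sum_range_succ', pexp, mul_add, add_mul, Finset.mul_sum, Finset.sum_mul,
    Finset.mul_sum]
  simp only [mul_smul_comm, smul_mul_assoc, pow_zero, mul_one, one_mul,
    mul_pow_of_commutator h hL, smul_add, Finset.sum_add_distrib, smul_smul,
    inv_factorial_succ_mul]
  abel

/-- The binomial theorem; truncating the sum at total order K restricts the double series to the
triangle a + b < K. -/
theorem pexp_add_eq_sum {A : Type*} [Ring A] [Algebra ℂ A] {G H : A} (h : Commute G H) (K : ℕ) :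
    pexp K (G + H) = ∑ a ∈ Finset.range K, ∑ b ∈ Finset.range (K - a),
      (((a.factorial : ℂ)⁻¹) • G ^ a) * (((b.factorial : ℂ)⁻¹) • H ^ b) := by
  rw [Finset.sum_sigma', pexp]
  have h1 : ∀ k, ((k.factorial : ℂ)⁻¹) • (G + H) ^ k = ∑ x ∈ Finset.HasAntidiagonal.antidiagonal k,
      (((x.1.factorial : ℂ)⁻¹) • G ^ x.1) * (((x.2.factorial : ℂ)⁻¹) • H ^ x.2) := by
    intro k
    rw [h.add_pow', Finset.smul_sum]
    refine Finset.sum_congr rfl fun x hx => ?_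
    have hk := Finset.HasAntidiagonal.mem_antidiagonal.1 hx
    rw [smul_mul_smul_comm, ← Nat.cast_smul_eq_nsmul ℂ, smul_smul]
    congr 1
    have h2 := Nat.add_choose_mul_factorial_mul_factorial x.1 x.2
    rw [Nat.choose_symm_add.symm, hk] at h2
    have h3 : ((k.choose x.1 : ℕ) : ℂ) * x.1.factorial * x.2.factorial = k.factorial := by
      exact_mod_cast h2
    have h4 : (k.factorial : ℂ) ≠ 0 := by exact_mod_cast k.factorial_ne_zero
    have h5 : (x.1.factorial : ℂ) ≠ 0 := by exact_mod_cast x.1.factorial_ne_zero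
    have h6 : (x.2.factorial : ℂ) ≠ 0 := by exact_mod_cast x.2.factorial_ne_zero
    field_simp
    linear_combination h3
  rw [Finset.sum_congr rfl fun k _ => h1 k, Finset.sum_sigma']
  refine Finset.sum_nbij' (fun x => ⟨x.2.1, x.2.2⟩) (fun x => ⟨x.1 + x.2, (x.1, x.2)⟩) ?_ ?_ ?_ ?_ ?_
  · rintro ⟨k, a, b⟩ hx
    simp only [Finset.mem_sigma, Finset.mem_range, Finset.HasAntidiagonal.mem_antidiagonal] at hx ⊢
    omega
  · rintro ⟨a, b⟩ hx
    simp only [Finset.mem_sigma, Finset.mem_range, Finset.HasAntidiagonal.mem_antidiagonal,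
      and_true] at hx ⊢
    omega
  · rintro ⟨k, a, b⟩ hx
    simp only [Finset.mem_sigma, Finset.mem_range, Finset.HasAntidiagonal.mem_antidiagonal] at hx
    obtain ⟨_, rfl⟩ := hx
    rfl
  · rintro ⟨a, b⟩ _
    rfl
  · rintro ⟨k, a, b⟩ _
    rfl

/-! ## Exponentials of raising operators applied to the vacuum -/

section Raising

variable {ι : Type*} [DecidableEq ι] [Fintype ι]

/-- The vacuum. -/
def vacFn (ι : Type*) : Fn ι := by
  classical
  exact fun i => if i = 0 then 1 else 0

theorem low_vacFn (p : ι) : low p (vacFn ι) = 0 := by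
  ext i
  have : i + Pi.single p 1 ≠ 0 := fun h => by simpa using congrFun h p
  simp [low_apply, vacFn, this]

/-- `G` raises the degree by at least one. -/
def IsRaising (G : Module.End ℂ (Fn ι)) : Prop :=
  ∀ (X : Fn ι) (N : ℕ), (∀ i, deg i < N → X i = 0) → ∀ i, deg i < N + 1 → G X i = 0

theorem IsRaising.rai (p : ι) : IsRaising (rai p) := by
  intro X N h i hi
  rw [rai_apply]
  rcases Nat.eq_zero_or_pos (i p) with h0 | h0
  · simp [h0]
  · rw [h _ (by have := deg_sub_single h0; omega), mul_zero]

theorem IsRaising.zero : IsRaising (0 : Module.End ℂ (Fn ι)) := fun _ _ _ _ _ => rfl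

theorem IsRaising.add {G H : Module.End ℂ (Fn ι)} (hG : IsRaising G) (hH : IsRaising H) :
    IsRaising (G + H) := fun X N h i hi => by
  rw [LinearMap.add_apply, Pi.add_apply, hG X N h i hi, hH X N h i hi, add_zero]

theorem IsRaising.smul {G : Module.End ℂ (Fn ι)} (a : ℂ) (hG : IsRaising G) :
    IsRaising (a • G) := fun X N h i hi => by
  rw [LinearMap.smul_apply, Pi.smul_apply, hG X N h i hi, smul_zero]

theorem IsRaising.sum {α : Type*} {s : Finset α} {G : α → Module.End ℂ (Fn ι)}
    (h : ∀ a ∈ s, IsRaising (G a)) : IsRaising (∑ a ∈ s, G a) :=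
  Finset.sum_induction _ IsRaising (fun _ _ => IsRaising.add) IsRaising.zero h

theorem IsRaising.mul {G H : Module.End ℂ (Fn ι)} (hG : IsRaising G) (hH : IsRaising H) :
    IsRaising (G * H) := fun X N h i hi =>
  hG (H X) N (fun j hj => hH X N h j (by omega)) i hi

theorem IsRaising.pow_apply {G : Module.End ℂ (Fn ι)} (hG : IsRaising G) (k : ℕ) (X : Fn ι) (N : ℕ)
    (hX : ∀ i, deg i < N → X i = 0) (i : ι → ℕ) (hi : deg i < N + k) : (G ^ k) X i = 0 := by
  induction k generalizing i with
  | zero => exact hX i hi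
  | succ k ih => rw [pow_succ']; exact hG _ (N + k) ih i hi

theorem IsRaising.pexp_apply {G : Module.End ℂ (Fn ι)} (hG : IsRaising G) {K L : ℕ} (hKL : K ≤ L)
    (X : Fn ι) {i : ι → ℕ} (hi : deg i < K) : pexp L G X i = pexp K G X i := by
  induction L, hKL using Nat.le_induction with
  | base => rfl
  | succ L hL ih =>
    rw [pexp_succ, LinearMap.add_apply, Pi.add_apply, ih, LinearMap.smul_apply, Pi.smul_apply,
      hG.pow_apply L X 0 (fun _ h => absurd h (Nat.not_lt_zero _)) i (by omega), smul_zero,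
      add_zero]

/-- The product of the truncated series has extra terms with a + b ≥ K, and these vanish in degrees
below K. -/
theorem IsRaising.pexp_add_apply {G H : Module.End ℂ (Fn ι)} (hG : IsRaising G) (hH : IsRaising H)
    (h : Commute G H) (K : ℕ) (X : Fn ι) {i : ι → ℕ} (hi : deg i < K) :
    pexp K (G + H) X i = pexp K G (pexp K H X) i := by
  have h1 : pexp K G * pexp K H = ∑ a ∈ Finset.range K, ∑ b ∈ Finset.range K,
      (((a.factorial : ℂ)⁻¹) • G ^ a) * (((b.factorial : ℂ)⁻¹) • H ^ b) := by
    rw [pexp, pexp, Finset.sum_mul_sum]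
  rw [← Module.End.mul_apply, h1, pexp_add_eq_sum h]
  simp only [LinearMap.sum_apply, Finset.sum_apply]
  refine Finset.sum_congr rfl fun a ha => ?_
  refine Finset.sum_subset (Finset.range_mono (Nat.sub_le _ _)) fun b hb hb' => ?_
  rw [Finset.mem_range] at ha hb hb'
  rw [smul_mul_smul_comm, LinearMap.smul_apply, Pi.smul_apply, Module.End.mul_apply,
    hG.pow_apply a _ b (fun j hj => hH.pow_apply b X 0
      (fun _ h => absurd h (Nat.not_lt_zero _)) j (by omega)) i (by omega), smul_zero]

/-- `e^G |0⟩`, each entry of which is a finite sum if `G` is raising. -/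
def expVac (G : Module.End ℂ (Fn ι)) : Fn ι := fun i => pexp (deg i + 1) G (vacFn ι) i

theorem expVac_apply {G : Module.End ℂ (Fn ι)} (hG : IsRaising G) {K : ℕ} {i : ι → ℕ}
    (hi : deg i < K) : expVac G i = pexp K G (vacFn ι) i :=
  (hG.pexp_apply hi _ (Nat.lt_succ_self _)).symm

theorem expVac_zero_apply (G : Module.End ℂ (Fn ι)) : expVac G 0 = 1 := by
  simp [expVac, deg, pexp, vacFn]

theorem expVac_zero : expVac (0 : Module.End ℂ (Fn ι)) = vacFn ι := by
  ext i
  rw [expVac, pexp, Finset.sum_range_succ']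
  simp

/-- Since `e` kills the vacuum, only the commutator [e, e^G] = L e^G survives. Locality of `e` and
`L` reduces this to truncated exponentials. -/
theorem apply_expVac {e G L : Module.End ℂ (Fn ι)} (hG : IsRaising G) (he : e ∈ ladderAlg ι)
    (hL : L ∈ ladderAlg ι) (h : e * G = G * e + L) (hLG : L * G = G * L)
    (he0 : e (vacFn ι) = 0) : e (expVac G) = L (expVac G) := by
  obtain ⟨k, hk⟩ := exists_growthLE he
  obtain ⟨l, hl⟩ := exists_growthLE hL
  ext i
  -- Large enough that the truncations of order `K` and `K + 1` are exact on all degrees that `e`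
  -- and `L` consult.
  set K := deg i + k + l + 1
  rw [hk.eq_of_eq (Y := pexp (K + 1) G (vacFn ι)) (N := deg i)
    (fun j hj => expVac_apply hG (by omega)) le_rfl,
    hl.eq_of_eq (Y := pexp K G (vacFn ι)) (N := deg i)
    (fun j hj => expVac_apply hG (by omega)) le_rfl, ← Module.End.mul_apply,
    mul_pexp_of_commutator h hLG, LinearMap.add_apply, Module.End.mul_apply, he0, map_zero,
    zero_add, Module.End.mul_apply]

/-- The hypothesis `hG` is the entrywise product rule for `G t` applied to a moving vector.
Commutation of `G'` with `G t` turns the derivative of the power k + 1 into (k+1) G' G^k. -/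
theorem hasDerivWithinAt_pexp {G : ℝ → Module.End ℂ (Fn ι)} {G' : Module.End ℂ (Fn ι)} {s : Set ℝ}
    {t : ℝ} (hG : ∀ (X : ℝ → Fn ι) (X' : Fn ι), (∀ i, HasDerivWithinAt (fun t => X t i) (X' i) s t) →
      ∀ i, HasDerivWithinAt (fun t => G t (X t) i) ((G' (X t) + G t X') i) s t)
    (hc : Commute G' (G t)) (Y : Fn ι) (K : ℕ) (i : ι → ℕ) :
    HasDerivWithinAt (fun t => pexp (K + 1) (G t) Y i) (G' (pexp K (G t) Y) i) s t := by
  have hpow : ∀ (k : ℕ) (i : ι → ℕ), HasDerivWithinAt (fun t => (G t ^ (k + 1)) Y i)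
      ((((k : ℂ) + 1) • (G' * G t ^ k)) Y i) s t := by
    intro k
    induction k with
    | zero =>
      intro i
      simpa using hG (fun _ => Y) 0 (fun i => hasDerivWithinAt_const t s (Y i)) i
    | succ k ih =>
      intro i
      have h1 := hG (fun t => (G t ^ (k + 1)) Y) _ ih i
      simp only [← Module.End.mul_apply, ← pow_succ'] at h1
      refine h1.congr_deriv ?_
      have h2 : (((k + 1 : ℕ) : ℂ) + 1) • (G' * G t ^ (k + 1)) =
          G' * G t ^ (k + 1) + G t * ((k : ℂ) + 1) • (G' * G t ^ k) := by
        rw [mul_smul_comm, ← mul_assoc, ← hc.eq, mul_assoc, ← pow_succ']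
        push_cast
        module
      rw [h2]
      rfl
  induction K with
  | zero => simpa [pexp] using hasDerivWithinAt_const t s (Y i)
  | succ K ih =>
    have h1 := ih.add ((hpow K i).const_smul (((K + 1).factorial : ℂ)⁻¹))
    have h2 : (fun t => pexp (K + 1 + 1) (G t) Y i) = (fun t => pexp (K + 1) (G t) Y i) +
        (((K + 1).factorial : ℂ)⁻¹) • fun t => (G t ^ (K + 1)) Y i := by
      funext t
      rw [pexp_succ]
      rfl
    rw [h2]
    refine h1.congr_deriv ?_
    rw [pexp_succ, LinearMap.add_apply, map_add, Pi.add_apply]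
    congr 1
    rw [LinearMap.smul_apply, LinearMap.smul_apply, Pi.smul_apply, map_smul, Pi.smul_apply,
      smul_smul, inv_factorial_succ_mul, Module.End.mul_apply]

theorem hasDerivWithinAt_expVac {G : ℝ → Module.End ℂ (Fn ι)} {G' : Module.End ℂ (Fn ι)} {s : Set ℝ}
    {t : ℝ} (hr : ∀ t, IsRaising (G t)) (hG' : G' ∈ ladderAlg ι)
    (hG : ∀ (X : ℝ → Fn ι) (X' : Fn ι), (∀ i, HasDerivWithinAt (fun t => X t i) (X' i) s t) →
      ∀ i, HasDerivWithinAt (fun t => G t (X t) i) ((G' (X t) + G t X') i) s t)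
    (hc : Commute G' (G t)) (i : ι → ℕ) :
    HasDerivWithinAt (fun t => expVac (G t) i) (G' (expVac (G t)) i) s t := by
  obtain ⟨k, hk⟩ := exists_growthLE hG'
  set K := deg i + k + 1
  rw [hk.eq_of_eq (Y := pexp K (G t) (vacFn ι)) (N := deg i)
    (fun j hj => expVac_apply (hr t) (by omega)) le_rfl]
  have h1 : (fun t => expVac (G t) i) = fun t => pexp (K + 1) (G t) (vacFn ι) i := by
    ext t
    exact expVac_apply (hr t) (by omega)
  rw [h1]
  exact hasDerivWithinAt_pexp hG hc _ K i

end Raising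

section Rotated

variable {ι : Type*} [DecidableEq ι] [Fintype ι]

/-! ## Rotated ladder operators -/

/-- Lowering operators rotated by the matrix `V`. -/
def eOp (V : Matrix ι ι ℂ) (p : ι) : Module.End ℂ (Fn ι) := ∑ q, V p q • low q

/-- Raising operators rotated by the complex conjugate of the matrix `V`. -/
def rOp (V : Matrix ι ι ℂ) (p : ι) : Module.End ℂ (Fn ι) := ∑ q, star (V p q) • rai q

variable {V : Matrix ι ι ℂ}

theorem eOp_mem (p : ι) : eOp V p ∈ ladderAlg ι :=
  Subalgebra.sum_mem _ fun q _ => Subalgebra.smul_mem _ (low_mem q) _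

theorem rOp_mem (p : ι) : rOp V p ∈ ladderAlg ι :=
  Subalgebra.sum_mem _ fun q _ => Subalgebra.smul_mem _ (rai_mem q) _

theorem GrowthLE.eOp (p : ι) : GrowthLE 1 (eOp V p) := .sum fun q _ => .smul _ (.low q)

theorem GrowthLE.rOp (p : ι) : GrowthLE 1 (rOp V p) := .sum fun q _ => .smul _ (.rai q)

theorem IsRaising.rOp (p : ι) : IsRaising (rOp V p) := .sum fun q _ => .smul _ (.rai q)

theorem eOp_vacFn (p : ι) : eOp V p (vacFn ι) = 0 := by
  simp [eOp, LinearMap.sum_apply, low_vacFn]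

theorem eOp_mul_eOp (p q : ι) : eOp V p * eOp V q = eOp V q * eOp V p := by
  rw [eOp, eOp, Finset.sum_mul_sum, Finset.sum_mul_sum, Finset.sum_comm]
  refine Finset.sum_congr rfl fun i _ => Finset.sum_congr rfl fun j _ => ?_
  rw [smul_mul_smul_comm, smul_mul_smul_comm, low_mul_low, mul_comm]

theorem rOp_mul_rOp (p q : ι) : rOp V p * rOp V q = rOp V q * rOp V p := by
  rw [rOp, rOp, Finset.sum_mul_sum, Finset.sum_mul_sum, Finset.sum_comm]
  refine Finset.sum_congr rfl fun i _ => Finset.sum_congr rfl fun j _ => ?_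
  rw [smul_mul_smul_comm, smul_mul_smul_comm, rai_mul_rai, mul_comm]

theorem eOp_mul_rOp (hV : V * Vᴴ = 1) (p q : ι) :
    eOp V p * rOp V q = rOp V q * eOp V p + (if p = q then (1 : ℂ) else 0) • 1 := by
  have h1 : (if p = q then (1 : ℂ) else 0) = ∑ i, V p i * star (V q i) := by
    rw [← Matrix.one_apply, ← hV, Matrix.mul_apply]
    rfl
  rw [eOp, rOp, Finset.sum_mul_sum, Finset.sum_mul_sum, Finset.sum_comm (γ := ι), h1,
    Finset.sum_smul, ← Finset.sum_add_distrib]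
  rw [Finset.sum_comm (γ := ι)]
  have h2 : ∀ i j, (V p i • low i) * (star (V q j) • rai j) =
      (star (V q j) • rai j) * (V p i • low i) +
        (if i = j then V p i * star (V q j) else 0) • (1 : Module.End ℂ (Fn ι)) := by
    intro i j
    rw [smul_mul_smul_comm, smul_mul_smul_comm, low_mul_rai, smul_add, smul_smul, mul_comm (V p i)]
    simp
  simp_rw [h2, Finset.sum_add_distrib, ite_smul, zero_smul]
  rw [Finset.sum_comm]
  simp

/-- At each fixed index the unitary `V` preserves the Euclidean norm of the vector of entries. -/
theorem sum_norm_sq_eOp (hV : V * Vᴴ = 1) (X : Fn ι) (i : ι → ℕ) :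
    ∑ p, ‖eOp V p X i‖ ^ 2 = ∑ p, ‖low p X i‖ ^ 2 := by
  have hV' : Vᴴ * V = 1 := mul_eq_one_comm.1 hV
  set x : ι → ℂ := fun q => low q X i with hx
  have h1 : ∀ p, eOp V p X i = (V *ᵥ x) p := by
    intro p
    simp [eOp, LinearMap.sum_apply, Matrix.mulVec, dotProduct, hx]
  have h2 : ∀ y : ι → ℂ, ((∑ p, ‖y p‖ ^ 2 : ℝ) : ℂ) = star y ⬝ᵥ y := by
    intro y
    simp [dotProduct, ← Complex.conj_mul']
  have h3 : ((∑ p, ‖(V *ᵥ x) p‖ ^ 2 : ℝ) : ℂ) = ((∑ p, ‖x p‖ ^ 2 : ℝ) : ℂ) := by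
    rw [h2, h2, Matrix.star_mulVec, ← Matrix.dotProduct_mulVec, Matrix.mulVec_mulVec, hV',
      Matrix.one_mulVec]
  simp_rw [h1]
  exact_mod_cast h3

theorem sum_norm_sq_rOp (hV : V * Vᴴ = 1) (X : Fn ι) (i : ι → ℕ) :
    ∑ p, ‖rOp V p X i‖ ^ 2 = ∑ p, ‖rai p X i‖ ^ 2 := by
  have hV' : Vᴴ * V = 1 := mul_eq_one_comm.1 hV
  set x : ι → ℂ := fun q => star (rai q X i) with hx
  have h1 : ∀ p, ‖rOp V p X i‖ = ‖(V *ᵥ x) p‖ := by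
    intro p
    rw [← norm_star]
    simp [rOp, LinearMap.sum_apply, Matrix.mulVec, dotProduct, hx]
  have h2 : ∀ y : ι → ℂ, ((∑ p, ‖y p‖ ^ 2 : ℝ) : ℂ) = star y ⬝ᵥ y := by
    intro y
    simp [dotProduct, ← Complex.conj_mul']
  have h3 : ((∑ p, ‖(V *ᵥ x) p‖ ^ 2 : ℝ) : ℂ) = ((∑ p, ‖x p‖ ^ 2 : ℝ) : ℂ) := by
    rw [h2, h2, Matrix.star_mulVec, ← Matrix.dotProduct_mulVec, Matrix.mulVec_mulVec, hV',
      Matrix.one_mulVec]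
  have h4 : ∀ p, ‖x p‖ = ‖rai p X i‖ := fun p => norm_star _
  simp_rw [h1, ← h4]
  exact_mod_cast h3

/-! ## Gaussian vectors -/

/-- Linear combinations, with real coefficients, of operators. -/
def mv {E : Type*} [AddCommGroup E] [Module ℂ E] (N : Matrix ι ι ℝ) (x : ι → E) (p : ι) : E :=
  ∑ q, (N p q : ℂ) • x q

theorem mv_mv {E : Type*} [AddCommGroup E] [Module ℂ E] (N N' : Matrix ι ι ℝ) (x : ι → E) :
    mv N (mv N' x) = mv (N * N') x := by
  ext p
  simp only [mv, Finset.smul_sum, smul_smul, Matrix.mul_apply]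
  rw [Finset.sum_comm]
  refine Finset.sum_congr rfl fun q _ => ?_
  rw [← Finset.sum_smul]
  push_cast
  rfl

theorem mv_one {E : Type*} [AddCommGroup E] [Module ℂ E] (x : ι → E) :
    mv (1 : Matrix ι ι ℝ) x = x := by
  ext p
  simp [mv, Matrix.one_apply]

theorem mv_sub {E : Type*} [AddCommGroup E] [Module ℂ E] (N N' : Matrix ι ι ℝ) (x : ι → E)
    (p : ι) : mv (N - N') x p = mv N x p - mv N' x p := by
  simp [mv, sub_smul, Finset.sum_sub_distrib]

/-- The quadratic raising operator `½ ∑ A_{pq} r_p r_q + ∑ k_p r_p`. -/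
def quadOp (V : Matrix ι ι ℂ) (A : Matrix ι ι ℝ) (k : ι → ℝ) : Module.End ℂ (Fn ι) :=
  (1 / 2 : ℂ) • ∑ p, ∑ q, (A p q : ℂ) • (rOp V p * rOp V q) + ∑ p, (k p : ℂ) • rOp V p

theorem quadOp_mem (A : Matrix ι ι ℝ) (k : ι → ℝ) : quadOp V A k ∈ ladderAlg ι := by
  refine Subalgebra.add_mem _ (Subalgebra.smul_mem _ (Subalgebra.sum_mem _ fun p _ =>
    Subalgebra.sum_mem _ fun q _ => Subalgebra.smul_mem _ ?_ _) _)
    (Subalgebra.sum_mem _ fun p _ => Subalgebra.smul_mem _ (rOp_mem p) _)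
  exact Subalgebra.mul_mem _ (rOp_mem p) (rOp_mem q)

theorem IsRaising.quadOp (A : Matrix ι ι ℝ) (k : ι → ℝ) : IsRaising (quadOp V A k) :=
  .add (.smul _ (.sum fun p _ => .sum fun q _ => .smul _ (.mul (.rOp p) (.rOp q))))
    (.sum fun p _ => .smul _ (.rOp p))

theorem commute_rOp_quadOp (A : Matrix ι ι ℝ) (k : ι → ℝ) (p : ι) :
    Commute (rOp V p) (quadOp V A k) := by
  have h : ∀ q, Commute (rOp V p) (rOp V q) := rOp_mul_rOp p
  refine Commute.add_right (Commute.smul_right (Commute.sum_right _ _ _ fun q _ =>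
    Commute.sum_right _ _ _ fun q' _ => Commute.smul_right ?_ _) _)
    (Commute.sum_right _ _ _ fun q _ => Commute.smul_right (h q) _)
  exact (h q).mul_right (h q')

theorem commute_quadOp_quadOp (A A' : Matrix ι ι ℝ) (k k' : ι → ℝ) :
    Commute (quadOp V A k) (quadOp V A' k') := by
  have h : ∀ q, Commute (rOp V q) (quadOp V A' k') := commute_rOp_quadOp A' k'
  refine Commute.add_left (Commute.smul_left (Commute.sum_left _ _ _ fun q _ =>
    Commute.sum_left _ _ _ fun q' _ => Commute.smul_left ?_ _) _)
    (Commute.sum_left _ _ _ fun q _ => Commute.smul_left (h q) _)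
  exact (h q).mul_left (h q')

/-- The commutator of `e_p` with `quadOp V A k`. -/
def linOp (V : Matrix ι ι ℂ) (A : Matrix ι ι ℝ) (k : ι → ℝ) (p : ι) : Module.End ℂ (Fn ι) :=
  mv A (rOp V) p + (k p : ℂ) • 1

theorem eOp_mul_quadOp (hV : V * Vᴴ = 1) {A : Matrix ι ι ℝ} (hA : A.IsSymm) (k : ι → ℝ) (p : ι) :
    eOp V p * quadOp V A k = quadOp V A k * eOp V p + linOp V A k p := by
  have h1 : ∀ q q', eOp V p * (rOp V q * rOp V q') = rOp V q * rOp V q' * eOp V p +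
      (if p = q then (1 : ℂ) else 0) • rOp V q' + (if p = q' then (1 : ℂ) else 0) • rOp V q := by
    intro q q'
    rw [← mul_assoc, eOp_mul_rOp hV, add_mul, mul_assoc, eOp_mul_rOp hV, mul_add, mul_assoc]
    simp only [smul_mul_assoc, one_mul, mul_smul_comm, mul_one]
    abel
  rw [quadOp, linOp, mul_add, add_mul, mul_smul_comm, smul_mul_assoc, Finset.mul_sum,
    Finset.mul_sum, Finset.sum_mul, Finset.sum_mul]
  simp only [Finset.mul_sum, Finset.sum_mul, mul_smul_comm, smul_mul_assoc, h1, eOp_mul_rOp hV,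
    smul_add, Finset.sum_add_distrib]
  have h2 : ∑ q, ∑ q', (A q q' : ℂ) • (if p = q then (1 : ℂ) else 0) • rOp V q' =
      mv A (rOp V) p := by
    simp [mv, ite_smul, -Complex.coe_smul]
  have h3 : ∑ q, ∑ q', (A q q' : ℂ) • (if p = q' then (1 : ℂ) else 0) • rOp V q =
      mv A (rOp V) p := by
    simp [mv, ite_smul, hA.apply p, -Complex.coe_smul]
  have h4 : ∑ q, (k q : ℂ) • (if p = q then (1 : ℂ) else 0) • (1 : Module.End ℂ (Fn ι)) =
      (k p : ℂ) • 1 := by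
    simp [ite_smul]
  rw [h2, h3, h4]
  module

/-- The Gaussian vector `exp(½ ∑ A_{pq} r_p r_q + ∑ k_p r_p) |0⟩`. -/
def gaussFn (V : Matrix ι ι ℂ) (A : Matrix ι ι ℝ) (k : ι → ℝ) : Fn ι := expVac (quadOp V A k)

/-- The commutator of `e_p` with the exponent is (Ar)_p + k_p, and `e_p` kills the vacuum. -/
theorem eOp_gaussFn (hV : V * Vᴴ = 1) {A : Matrix ι ι ℝ} (hA : A.IsSymm) (k : ι → ℝ) (p : ι) :
    eOp V p (gaussFn V A k) = mv A (fun q => rOp V q (gaussFn V A k)) p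
      + (k p : ℂ) • gaussFn V A k := by
  have h1 : linOp V A k p * quadOp V A k = quadOp V A k * linOp V A k p :=
    Commute.add_left (Commute.sum_left _ _ _ fun q _ => (commute_rOp_quadOp A k q).smul_left _)
      ((Commute.one_left _).smul_left _)
  rw [gaussFn, apply_expVac (.quadOp A k) (eOp_mem p) (Subalgebra.add_mem _ (Subalgebra.sum_mem _
    fun q _ => Subalgebra.smul_mem _ (rOp_mem q) _) (Subalgebra.smul_mem _ (one_mem _) _))
    (eOp_mul_quadOp hV hA k p) h1 (eOp_vacFn p)]
  simp [mv, LinearMap.sum_apply]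

/-- Real coefficients act separately on real and imaginary parts. -/
theorem norm_sq_mv_le {a : ℝ} {A : Matrix ι ι ℝ}
    (hA : ∀ x : ι → ℝ, ∑ p, (A *ᵥ x) p ^ 2 ≤ a * ∑ p, x p ^ 2) (x : ι → ℂ) :
    ∑ p, ‖mv A x p‖ ^ 2 ≤ a * ∑ p, ‖x p‖ ^ 2 := by
  have h1 : ∀ z : ℂ, ‖z‖ ^ 2 = z.re ^ 2 + z.im ^ 2 := by
    intro z
    rw [← Complex.normSq_eq_norm_sq, Complex.normSq_apply]
    ring
  have h2 : ∀ p, mv A x p = ⟨(A *ᵥ fun q => (x q).re) p, (A *ᵥ fun q => (x q).im) p⟩ := by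
    intro p
    apply Complex.ext <;> simp [mv, Matrix.mulVec, dotProduct]
  simp_rw [h1, h2, Finset.sum_add_distrib, mul_add]
  exact add_le_add (hA _) (hA _)

/-- The relation e g = A r g + k g bounds the lowered entries by the raised ones, with a constant
below 1 because `A` is a strict contraction. All constants depend on `a` and `b` alone, so the decay
is uniform in the parameter. -/
theorem expDecay_gaussFn (hV : V * Vᴴ = 1) {α : Type*} {A : α → Matrix ι ι ℝ} {k : α → ι → ℝ}
    (hs : ∀ t, (A t).IsSymm) {a b : ℝ} (ha : 0 ≤ a) (ha1 : a < 1) (hb : 0 ≤ b)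
    (hA : ∀ t (x : ι → ℝ), ∑ p, (A t *ᵥ x) p ^ 2 ≤ a * ∑ p, x p ^ 2)
    (hk : ∀ t, ∑ p, k t p ^ 2 ≤ b) : ExpDecay fun t => gaussFn V (A t) (k t) := by
  obtain ⟨c, hac, hc1⟩ := exists_between ha1
  have hc0 : 0 < c := ha.trans_lt hac
  have hca : 0 < c - a := by linarith
  set d : ℝ := c / (c - a) * b with hd
  have hd0 : 0 ≤ d := by positivity
  obtain ⟨C, r, hC, hr0, hr1, h⟩ := exists_expDecay_of_low_le (ι := ι) hc0.le hc1 hd0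
  refine ⟨C, r, hC, hr0, hr1, fun t => h _ ?_ fun i => ?_⟩
  · exact (congrArg norm (expVac_zero_apply _)).le.trans norm_one.le
  set g := gaussFn V (A t) (k t) with hg
  set x : ι → ℂ := fun q => rOp V q g i with hx
  have h1 : ∀ p, eOp V p g i = mv (A t) x p + (k t p : ℂ) * g i := by
    intro p
    rw [hg, eOp_gaussFn hV (hs t)]
    simp [mv, hx, hg]
  -- Young's inequality with weights chosen so that the factor on `u` lifts `a` exactly to `c`. It
  -- divides by `a`, so `a = 0` is set aside; then `A` vanishes and no mixing occurs.
  have h2 : ∀ u v : ℂ, ‖u + v‖ ^ 2 ≤ c / a * ‖u‖ ^ 2 + c / (c - a) * ‖v‖ ^ 2 ∨ a = 0 := by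
    intro u v
    rcases ha.eq_or_lt with h0 | h0
    · exact Or.inr h0.symm
    left
    have h3 : ‖u + v‖ ^ 2 ≤ (‖u‖ + ‖v‖) ^ 2 := by
      gcongr
      exact norm_add_le u v
    refine h3.trans ?_
    have h4 : c / a * ‖u‖ ^ 2 + c / (c - a) * ‖v‖ ^ 2 - (‖u‖ + ‖v‖) ^ 2 =
        ((c - a) * ‖u‖ - a * ‖v‖) ^ 2 / (a * (c - a)) := by
      field_simp
      ring
    have h5 : 0 ≤ ((c - a) * ‖u‖ - a * ‖v‖) ^ 2 / (a * (c - a)) := by positivity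
    linarith
  have hkg : ∑ p, ‖(k t p : ℂ) * g i‖ ^ 2 ≤ b * ‖g i‖ ^ 2 := by
    have : ∀ p, ‖(k t p : ℂ) * g i‖ ^ 2 = k t p ^ 2 * ‖g i‖ ^ 2 := by
      intro p
      rw [norm_mul, mul_pow, Complex.norm_real, Real.norm_eq_abs, sq_abs]
    simp_rw [this, ← Finset.sum_mul]
    gcongr
    exact hk t
  have hAx := norm_sq_mv_le (hA t) x
  change ∑ p, ‖low p g i‖ ^ 2 ≤ c * ∑ p, ‖rai p g i‖ ^ 2 + d * ‖g i‖ ^ 2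
  rw [← sum_norm_sq_eOp hV, ← sum_norm_sq_rOp hV]
  simp_rw [h1]
  change _ ≤ c * ∑ p, ‖x p‖ ^ 2 + d * ‖g i‖ ^ 2
  rcases ha.eq_or_lt with h0 | h0
  · rw [← h0, zero_mul] at hAx
    have h3 : ∀ p, mv (A t) x p = 0 := by
      intro p
      have := (Finset.sum_eq_zero_iff_of_nonneg fun p _ => by positivity).1
        (hAx.antisymm (by positivity)) p (Finset.mem_univ p)
      simpa using this
    simp_rw [h3, zero_add]
    have h4 : c / (c - a) = 1 := by rw [← h0, sub_zero, div_self hc0.ne']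
    have h5 : 0 ≤ c * ∑ p, ‖x p‖ ^ 2 := by positivity
    rw [hd, h4, one_mul]
    linarith
  calc ∑ p, ‖mv (A t) x p + (k t p : ℂ) * g i‖ ^ 2
      ≤ ∑ p, (c / a * ‖mv (A t) x p‖ ^ 2 + c / (c - a) * ‖(k t p : ℂ) * g i‖ ^ 2) :=
        Finset.sum_le_sum fun p _ => (h2 _ _).resolve_right h0.ne'
    _ = c / a * ∑ p, ‖mv (A t) x p‖ ^ 2 + c / (c - a) * ∑ p, ‖(k t p : ℂ) * g i‖ ^ 2 := by
        rw [Finset.sum_add_distrib, Finset.mul_sum, Finset.mul_sum]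
    _ ≤ c / a * (a * ∑ p, ‖x p‖ ^ 2) + c / (c - a) * (b * ‖g i‖ ^ 2) := by gcongr
    _ = _ := by rw [hd]; field_simp

theorem hasDerivWithinAt_gaussFn {A : ℝ → Matrix ι ι ℝ} {k : ℝ → ι → ℝ}
    {A' : Matrix ι ι ℝ} {k' : ι → ℝ} {s : Set ℝ} {t : ℝ}
    (hA : ∀ p q, HasDerivWithinAt (fun t => A t p q) (A' p q) s t)
    (hk : ∀ p, HasDerivWithinAt (fun t => k t p) (k' p) s t) (i : ι → ℕ) :
    HasDerivWithinAt (fun t => gaussFn V (A t) (k t) i)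
      (quadOp V A' k' (gaussFn V (A t) (k t)) i) s t := by
  refine hasDerivWithinAt_expVac (fun t => .quadOp _ _) (quadOp_mem _ _) (fun X X' hX i => ?_)
    (commute_quadOp_quadOp _ _ _ _) i
  have h1 : ∀ p q, HasDerivWithinAt (fun t => (A t p q : ℂ) * (rOp V p * rOp V q) (X t) i)
      ((A' p q : ℂ) * (rOp V p * rOp V q) (X t) i + (A t p q : ℂ) * (rOp V p * rOp V q) X' i) s t :=
    fun p q => (hA p q).ofReal_comp.mul
      (hasDerivWithinAt_ladder (Subalgebra.mul_mem _ (rOp_mem p) (rOp_mem q)) hX i)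
  have h2 : ∀ p, HasDerivWithinAt (fun t => (k t p : ℂ) * rOp V p (X t) i)
      ((k' p : ℂ) * rOp V p (X t) i + (k t p : ℂ) * rOp V p X' i) s t :=
    fun p => (hk p).ofReal_comp.mul (hasDerivWithinAt_ladder (rOp_mem p) hX i)
  have h3 := ((HasDerivWithinAt.fun_sum (u := Finset.univ) fun p _ =>
    HasDerivWithinAt.fun_sum (u := Finset.univ) fun q _ => h1 p q).const_mul (1 / 2 : ℂ)).add
    (HasDerivWithinAt.fun_sum (u := Finset.univ) fun p _ => h2 p)
  have h4 : ∀ (B : Matrix ι ι ℝ) (l : ι → ℝ) (Y : Fn ι), quadOp V B l Y i =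
      (1 / 2 : ℂ) * ∑ p, ∑ q, (B p q : ℂ) * (rOp V p * rOp V q) Y i
        + ∑ p, (l p : ℂ) * rOp V p Y i := by
    intro B l Y
    simp [quadOp, LinearMap.sum_apply]
  have h5 : (fun t => quadOp V (A t) (k t) (X t) i) = fun t =>
      (1 / 2 : ℂ) * ∑ p, ∑ q, (A t p q : ℂ) * (rOp V p * rOp V q) (X t) i
        + ∑ p, (k t p : ℂ) * rOp V p (X t) i := funext fun t => h4 _ _ _
  rw [h5]
  refine h3.congr_deriv ?_
  rw [Pi.add_apply, h4, h4]
  simp only [Finset.sum_add_distrib, mul_add]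
  ring

end Rotated

/-! ### The quadratures b, b' and the Gaussian attached to a covariance matrix. -/

section Quadrature

variable {ι : Type*} [DecidableEq ι] [Fintype ι]

/-- The scalar `1/√2`. -/
def isqrt2 : ℂ := ((Real.sqrt 2 : ℝ) : ℂ)⁻¹

theorem isqrt2_mul_self : isqrt2 * isqrt2 = 1 / 2 := by
  rw [isqrt2, ← mul_inv, ofReal_sqrt_mul_self (by norm_num)]
  norm_num

theorem sqrt2_eq : ((Real.sqrt 2 : ℝ) : ℂ) = 2 * isqrt2 := by
  have h1 : ((Real.sqrt 2 : ℝ) : ℂ) * isqrt2 = 1 := by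
    rw [isqrt2]
    exact mul_inv_cancel₀ (by simp)
  linear_combination (-2 * ((Real.sqrt 2 : ℝ) : ℂ)) * isqrt2_mul_self + 2 * isqrt2 * h1

/-- The operators `(e_p + r_p)/√2`. -/
def bOp (V : Matrix ι ι ℂ) (p : ι) : Module.End ℂ (Fn ι) := isqrt2 • (eOp V p + rOp V p)

/-- The operators `(r_p - e_p)/√2`. -/
def bpOp (V : Matrix ι ι ℂ) (p : ι) : Module.End ℂ (Fn ι) := isqrt2 • (rOp V p - eOp V p)

variable {V : Matrix ι ι ℂ}

theorem bOp_mem (p : ι) : bOp V p ∈ ladderAlg ι :=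
  Subalgebra.smul_mem _ (Subalgebra.add_mem _ (eOp_mem p) (rOp_mem p)) _

theorem bpOp_mem (p : ι) : bpOp V p ∈ ladderAlg ι :=
  Subalgebra.smul_mem _ (Subalgebra.sub_mem _ (rOp_mem p) (eOp_mem p)) _

theorem GrowthLE.bpOp (p : ι) : GrowthLE 1 (bpOp V p) := by
  refine .smul _ ?_
  have h := (GrowthLE.rOp (V := V) p).add ((GrowthLE.eOp (V := V) p).smul (-1))
  have h1 : QuasiFree.rOp V p - QuasiFree.eOp V p =
      QuasiFree.rOp V p + (-1 : ℂ) • QuasiFree.eOp V p := by module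
  rwa [h1]

theorem bpOp_mul_bpOp (hV : V * Vᴴ = 1) (p q : ι) : bpOp V p * bpOp V q = bpOp V q * bpOp V p := by
  rw [bpOp, bpOp, smul_mul_smul_comm, smul_mul_smul_comm]
  congr 1
  simp only [mul_sub, sub_mul, eOp_mul_rOp hV, rOp_mul_rOp p q, eOp_mul_eOp p q, eq_comm (a := p)]
  abel

theorem bOp_mul_bOp (hV : V * Vᴴ = 1) (p q : ι) : bOp V p * bOp V q = bOp V q * bOp V p := by
  rw [bOp, bOp, smul_mul_smul_comm, smul_mul_smul_comm]
  congr 1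
  simp only [mul_add, add_mul, eOp_mul_rOp hV, rOp_mul_rOp p q, eOp_mul_eOp p q, eq_comm (a := p)]
  abel

theorem bOp_mul_bpOp (hV : V * Vᴴ = 1) (p q : ι) :
    bOp V p * bpOp V q = bpOp V q * bOp V p + (if p = q then (1 : ℂ) else 0) • 1 := by
  rw [bOp, bpOp, smul_mul_smul_comm, smul_mul_smul_comm, isqrt2_mul_self]
  simp only [mul_add, add_mul, mul_sub, sub_mul, eOp_mul_rOp hV, rOp_mul_rOp p q, eOp_mul_eOp p q,
    eq_comm (a := q)]
  module

theorem bpOp_mul_mv (hV : V * Vᴴ = 1) (M : Matrix ι ι ℝ) (p q : ι) :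
    bpOp V p * mv M (rOp V) q = mv M (rOp V) q * bpOp V p - (isqrt2 * (M q p : ℂ)) • 1 := by
  have h1 : ∀ q', bpOp V p * rOp V q' =
      rOp V q' * bpOp V p - (isqrt2 * (if p = q' then (1 : ℂ) else 0)) • 1 := by
    intro q'
    simp only [bpOp, smul_mul_assoc, mul_smul_comm, sub_mul, mul_sub, eOp_mul_rOp hV,
      rOp_mul_rOp p q']
    module
  rw [mv, Finset.mul_sum, Finset.sum_mul]
  simp only [mul_smul_comm, smul_mul_assoc, h1, smul_sub, Finset.sum_sub_distrib, smul_smul]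
  congr 1
  simp [ite_smul, mul_comm, -Complex.coe_smul]

/-- The real-coefficient generator `∑ v_p b'_p + ∑ Δ_{pq} b'_p b'_q`. -/
def genOp (V : Matrix ι ι ℂ) (Δ : Matrix ι ι ℝ) (v : ι → ℝ) : Module.End ℂ (Fn ι) :=
  ∑ p, (v p : ℂ) • bpOp V p + ∑ p, ∑ q, (Δ p q : ℂ) • (bpOp V p * bpOp V q)

theorem genOp_mem (Δ : Matrix ι ι ℝ) (v : ι → ℝ) : genOp V Δ v ∈ ladderAlg ι := by
  refine Subalgebra.add_mem _ (Subalgebra.sum_mem _ fun p _ => Subalgebra.smul_mem _ (bpOp_mem p) _)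
    (Subalgebra.sum_mem _ fun p _ => Subalgebra.sum_mem _ fun q _ => Subalgebra.smul_mem _ ?_ _)
  exact Subalgebra.mul_mem _ (bpOp_mem p) (bpOp_mem q)

theorem GrowthLE.genOp (Δ : Matrix ι ι ℝ) (v : ι → ℝ) : GrowthLE 2 (genOp V Δ v) :=
  .add (.sum fun p _ => .smul _ (GrowthLE.bpOp p).succ)
    (.sum fun p _ => .sum fun q _ => .smul _ ((GrowthLE.bpOp p).mul (GrowthLE.bpOp q)))

/-- The Gaussian vector attached to a covariance matrix `Γ` and a mean `κ`. -/
def gaussCov (V : Matrix ι ι ℂ) (Γ : Matrix ι ι ℝ) (κ : ι → ℝ) : Fn ι :=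
  gaussFn V (1 - (Γ + (1 / 2 : ℝ) • 1)⁻¹) ((Γ + (1 / 2 : ℝ) • 1)⁻¹ *ᵥ κ)

theorem bpOp_gaussFn (hV : V * Vᴴ = 1) {M : Matrix ι ι ℝ} (hM : M.IsSymm) (c : ι → ℝ) (p : ι) :
    bpOp V p (gaussFn V (1 - M) c) =
      isqrt2 • (mv M (rOp V) p (gaussFn V (1 - M) c) - (c p : ℂ) • gaussFn V (1 - M) c) := by
  have hA : (1 - M).IsSymm := Matrix.isSymm_one.sub hM
  rw [bpOp, LinearMap.smul_apply, LinearMap.sub_apply, eOp_gaussFn hV hA, mv_sub, mv_one]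
  have h : mv M (rOp V) p (gaussFn V (1 - M) c) =
      mv M (fun q => rOp V q (gaussFn V (1 - M) c)) p := by
    simp [mv, LinearMap.sum_apply]
  rw [h]
  congr 1
  abel

/-- With A = 1 - M, b' acts on the Gaussian as (Mr - c)/√2 and b as ((2 - M)r + c)/√2. From (Γ +
1/2)M = 1 one gets 2ΓM = 2 - M, and the constants add up to (2Γ + 1)c = 2κ. This is the relation
from which all properties of Gaussian states follow. -/
theorem bOp_gaussCov (hV : V * Vᴴ = 1) {Γ : Matrix ι ι ℝ} (hΓ : Γ.IsSymm)
    (hdet : IsUnit (Γ + (1 / 2 : ℝ) • 1).det) (κ : ι → ℝ) (p : ι) :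
    bOp V p (gaussCov V Γ κ) = (2 : ℂ) • ∑ q, (Γ p q : ℂ) • bpOp V q (gaussCov V Γ κ)
      + ((Real.sqrt 2 * κ p : ℝ) : ℂ) • gaussCov V Γ κ := by
  set M := (Γ + (1 / 2 : ℝ) • 1)⁻¹ with hM
  have hMs : M.IsSymm := (hΓ.add (Matrix.isSymm_one.smul _)).inv
  have h1 : (Γ + (1 / 2 : ℝ) • 1) * M = 1 := Matrix.mul_nonsing_inv _ hdet
  have hΓM : Γ * M = 1 - (1 / 2 : ℝ) • M := by
    rw [add_mul, smul_mul_assoc, one_mul] at h1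
    exact eq_sub_of_add_eq h1
  have hg : gaussCov V Γ κ = gaussFn V (1 - M) (M *ᵥ κ) := rfl
  set g := gaussCov V Γ κ
  have hA : (1 - M).IsSymm := Matrix.isSymm_one.sub hMs
  set c := M *ᵥ κ with hc
  have hb : ∀ q, bpOp V q g = isqrt2 • (mv M (fun r => rOp V r g) q - (c q : ℂ) • g) := by
    intro q
    rw [hg, bpOp_gaussFn hV hMs]
    simp [mv, LinearMap.sum_apply]
  have he : eOp V p g = rOp V p g - mv M (fun r => rOp V r g) p + (c p : ℂ) • g := by
    rw [hg, eOp_gaussFn hV hA, mv_sub, mv_one]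
  have h2 : ∑ q, (Γ p q : ℂ) • mv M (fun r => rOp V r g) q =
      rOp V p g - (1 / 2 : ℂ) • mv M (fun r => rOp V r g) p := by
    change mv Γ (mv M _) p = _
    rw [mv_mv, hΓM, mv_sub, mv_one]
    congr 1
    simp only [mv, Finset.smul_sum, smul_smul, Matrix.smul_apply, smul_eq_mul]
    push_cast
    rfl
  have h3 : ∑ q, (Γ p q : ℂ) • (c q : ℂ) • g = ((κ p : ℂ) - (1 / 2 : ℂ) * c p) • g := by
    simp only [smul_smul, ← Finset.sum_smul]
    congr 1
    have : (Γ *ᵥ c) p = κ p - (1 / 2 : ℝ) * c p := by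
      rw [hc, Matrix.mulVec_mulVec, hΓM, Matrix.sub_mulVec, Matrix.one_mulVec, Matrix.smul_mulVec]
      rfl
    have h4 := congrArg (fun x : ℝ => (x : ℂ)) this
    simp only [Matrix.mulVec, dotProduct] at h4
    push_cast at h4
    exact h4
  rw [bOp, LinearMap.smul_apply, LinearMap.add_apply, he]
  simp_rw [hb, smul_comm _ isqrt2, ← Finset.smul_sum, smul_sub, Finset.sum_sub_distrib]
  rw [h2, h3, Complex.ofReal_mul, sqrt2_eq]
  module

theorem quadOp_conj {M : Matrix ι ι ℝ} (hM : M.IsSymm) (Δ : Matrix ι ι ℝ) (u : ι → ℝ) :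
    quadOp V (M * Δ * M) (M *ᵥ u) =
      (1 / 2 : ℂ) • ∑ a, ∑ b, (Δ a b : ℂ) • (mv M (rOp V) a * mv M (rOp V) b)
        + ∑ a, (u a : ℂ) • mv M (rOp V) a := by
  rw [quadOp]
  congr 1
  · congr 1
    simp only [mv, Finset.sum_mul_sum, smul_mul_smul_comm, Finset.smul_sum, smul_smul]
    have h1 : ∀ p q, (((M * Δ * M) p q : ℝ) : ℂ) • (rOp V p * rOp V q) =
        ∑ a, ∑ b, ((Δ a b : ℂ) * ((M a p : ℂ) * (M b q : ℂ))) • (rOp V p * rOp V q) := by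
      intro p q
      simp only [← Finset.sum_smul]
      congr 1
      rw [Finset.sum_comm, Matrix.mul_apply]
      push_cast
      refine Finset.sum_congr rfl fun b _ => ?_
      rw [Matrix.mul_apply]
      push_cast
      rw [Finset.sum_mul]
      refine Finset.sum_congr rfl fun a _ => ?_
      rw [hM.apply p a]
      ring
    simp_rw [h1]
    calc _ = ∑ p, ∑ a, ∑ q, ∑ b, ((Δ a b : ℂ) * ((M a p : ℂ) * (M b q : ℂ))) •
          (rOp V p * rOp V q) := Finset.sum_congr rfl fun p _ => Finset.sum_comm
      _ = ∑ a, ∑ p, ∑ b, ∑ q, ((Δ a b : ℂ) * ((M a p : ℂ) * (M b q : ℂ))) •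
          (rOp V p * rOp V q) := by
          rw [Finset.sum_comm]
          exact Finset.sum_congr rfl fun a _ => Finset.sum_congr rfl fun p _ => Finset.sum_comm
      _ = _ := Finset.sum_congr rfl fun a _ => Finset.sum_comm
  · simp only [mv, Finset.smul_sum, smul_smul]
    rw [Finset.sum_comm]
    refine Finset.sum_congr rfl fun p _ => ?_
    rw [← Finset.sum_smul]
    congr 1
    simp only [Matrix.mulVec, dotProduct]
    push_cast
    refine Finset.sum_congr rfl fun a _ => ?_
    rw [hM.apply p a]
    ring

/-- Applying b' twice gives ½(y - c)(y - c) with y = Mr, up to a scalar from reordering. The left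
side is the derivative of the exponent along the path, since (1 - M)' = MΔM and (Mκ)' = M(w - ΔMκ)
when κ' = w; hence the path solves the evolution equation up to normalization. -/
theorem genOp_gaussFn (hV : V * Vᴴ = 1) {M Δ : Matrix ι ι ℝ} (hM : M.IsSymm) (hΔ : Δ.IsSymm)
    (c w : ι → ℝ) : ∃ z : ℂ, quadOp V (M * Δ * M) (M *ᵥ (w - Δ *ᵥ c)) (gaussFn V (1 - M) c) =
      genOp V Δ (fun p => Real.sqrt 2 * w p) (gaussFn V (1 - M) c) + z • gaussFn V (1 - M) c := by
  set g := gaussFn V (1 - M) c with hg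
  set y := mv M (rOp V) with hy
  have hyy : ∀ p q, y p * y q = y q * y p := by
    intro p q
    exact Commute.sum_left _ _ _ fun i _ => Commute.sum_right _ _ _ fun j _ =>
      Commute.smul_left (Commute.smul_right (rOp_mul_rOp i j) _) _
  have hb : ∀ p, bpOp V p g = isqrt2 • (y p g - (c p : ℂ) • g) := bpOp_gaussFn hV hM c
  have hbb : ∀ p q, bpOp V p (bpOp V q g) = (1 / 2 : ℂ) • (y p (y q g) - (c p : ℂ) • y q g
      - (c q : ℂ) • y p g + ((c p : ℂ) * c q - M q p) • g) := by
    intro p q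
    have h1 : bpOp V p (y q g) = y q (bpOp V p g) - (isqrt2 * (M q p : ℂ)) • g := by
      have := LinearMap.congr_fun (bpOp_mul_mv hV M p q) g
      simpa using this
    have h2 : y q (y p g) = y p (y q g) := LinearMap.congr_fun (hyy q p) g
    rw [hb q, map_smul, map_sub, map_smul, h1, hb p, map_smul, map_sub, map_smul, h2,
      ← isqrt2_mul_self]
    module
  have hsw : ∑ p, ∑ q, (Δ p q : ℂ) • (c q : ℂ) • y p g = ∑ p, (((Δ *ᵥ c) p : ℝ) : ℂ) • y p g := by
    refine Finset.sum_congr rfl fun p _ => ?_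
    simp only [smul_smul, ← Finset.sum_smul, Matrix.mulVec, dotProduct]
    push_cast
    rfl
  have hsw' : ∑ p, ∑ q, (Δ p q : ℂ) • (c p : ℂ) • y q g =
      ∑ p, (((Δ *ᵥ c) p : ℝ) : ℂ) • y p g := by
    rw [← hsw, Finset.sum_comm]
    simp_rw [hΔ.apply]
  -- The scalar collects -w·c from the linear term and the constant part of b'b', including the
  -- commutator contribution -M.
  refine ⟨∑ p, (w p : ℂ) * c p - ∑ p, ∑ q, (Δ p q : ℂ) * ((1 / 2 : ℂ) * ((c p : ℂ) * c q - M q p)),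
    ?_⟩
  rw [quadOp_conj hM, genOp]
  simp only [LinearMap.add_apply, LinearMap.smul_apply, LinearMap.sum_apply, Module.End.mul_apply,
    hbb, Complex.ofReal_mul, sqrt2_eq, Pi.sub_apply, Complex.ofReal_sub]
  have e1 : ∀ p q, (Δ p q : ℂ) • (1 / 2 : ℂ) • (y p (y q g) - (c p : ℂ) • y q g
      - (c q : ℂ) • y p g + ((c p : ℂ) * c q - M q p) • g) =
      (1 / 2 : ℂ) • ((Δ p q : ℂ) • y p (y q g)) - (1 / 2 : ℂ) • ((Δ p q : ℂ) • (c p : ℂ) • y q g)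
      - (1 / 2 : ℂ) • ((Δ p q : ℂ) • (c q : ℂ) • y p g)
      + ((Δ p q : ℂ) * ((1 / 2 : ℂ) * ((c p : ℂ) * c q - M q p))) • g := by
    intro p q
    module
  have e2 : ∀ p, (2 * isqrt2 * (w p : ℂ)) • isqrt2 • (y p g - (c p : ℂ) • g) =
      (w p : ℂ) • y p g - ((w p : ℂ) * c p) • g := by
    intro p
    rw [smul_smul, show 2 * isqrt2 * (w p : ℂ) * isqrt2 = w p by
      linear_combination (2 * (w p : ℂ)) * isqrt2_mul_self]
    module
  simp only [hb, e1, e2]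
  simp only [Finset.sum_add_distrib, Finset.sum_sub_distrib, ← Finset.smul_sum,
    ← Finset.sum_smul, sub_smul, hsw, hsw']
  module

end Quadrature

variable {n : ℕ}

/-! ## Operator products with finitely supported rows or columns -/

/-- Every row of `A` has finite support. -/
def RowFin (A : Op n) : Prop := ∀ m, (Function.support (A m)).Finite

theorem transpose_opMul (A R : Op n) : (A ⋆ₒ R)ᵀ = Rᵀ ⋆ₒ Aᵀ := by
  ext m m'
  simp only [Matrix.transpose_apply, opMul, mul_comm]

theorem opMul_eq_transpose (A R : Op n) : A ⋆ₒ R = (Rᵀ ⋆ₒ Aᵀ)ᵀ := by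
  rw [transpose_opMul, Matrix.transpose_transpose, Matrix.transpose_transpose]

theorem RowFin.summable {A : Op n} (hA : RowFin A) (R : Op n) (m m' : Occ n) :
    Summable fun k => A m k * R k m' :=
  summable_of_hasFiniteSupport ((hA m).subset fun k hk h => hk (by
    change A m k = 0 at h
    simp [h]))

theorem RowFin.zero : RowFin (0 : Op n) := fun m => by
  have : Function.support ((0 : Op n) m) = ∅ := by ext; simp
  rw [this]
  exact Set.finite_empty

theorem RowFin.one : RowFin (1 : Op n) := fun m => (Set.finite_singleton m).subset fun k hk => by
  by_contra h
  exact hk (Matrix.one_apply_ne (fun h' => h h'.symm))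

theorem RowFin.add {A B : Op n} (hA : RowFin A) (hB : RowFin B) : RowFin (A + B) := fun m =>
  ((hA m).union (hB m)).subset (Function.support_add _ _)

theorem RowFin.smul {A : Op n} (c : ℂ) (hA : RowFin A) : RowFin (c • A) := fun m =>
  (hA m).subset (Function.support_const_smul_subset c (A m))

theorem RowFin.sum {α : Type*} {s : Finset α} {A : α → Op n} (h : ∀ a ∈ s, RowFin (A a)) :
    RowFin (∑ a ∈ s, A a) :=
  Finset.sum_induction _ RowFin (fun _ _ => RowFin.add) RowFin.zero h

theorem RowFin.opMul {A B : Op n} (hA : RowFin A) (hB : RowFin B) : RowFin (A ⋆ₒ B) := fun m => by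
  refine ((hA m).biUnion fun k _ => hB k).subset fun l hl => ?_
  by_contra h
  refine hl ?_
  simp only [Set.mem_iUnion, Function.mem_support, not_exists, not_not] at h
  change ∑' k, A m k * B k l = 0
  rw [← tsum_zero]
  congr 1
  ext k
  by_cases hk : A m k = 0
  · simp [hk]
  · rw [h k hk, mul_zero]

theorem zero_opMul (R : Op n) : (0 : Op n) ⋆ₒ R = 0 := by
  ext m m'
  simp [opMul]

theorem opMul_zero (R : Op n) : R ⋆ₒ (0 : Op n) = 0 := by
  ext m m'
  simp [opMul]

theorem smul_opMul (c : ℂ) (A R : Op n) : (c • A) ⋆ₒ R = c • (A ⋆ₒ R) := by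
  ext m m'
  simp only [opMul, Matrix.smul_apply, smul_eq_mul, mul_assoc, tsum_mul_left]

theorem opMul_smul (c : ℂ) (A R : Op n) : A ⋆ₒ (c • R) = c • (A ⋆ₒ R) := by
  ext m m'
  simp only [opMul, Matrix.smul_apply, smul_eq_mul, mul_left_comm _ c, tsum_mul_left]

theorem RowFin.add_opMul {A B : Op n} (hA : RowFin A) (hB : RowFin B) (R : Op n) :
    (A + B) ⋆ₒ R = A ⋆ₒ R + B ⋆ₒ R := by
  ext m m'
  simp only [QuasiFree.opMul, Matrix.add_apply, add_mul]
  exact (hA.summable R m m').tsum_add (hB.summable R m m')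

theorem RowFin.sum_opMul {α : Type*} {s : Finset α} {A : α → Op n} (h : ∀ a ∈ s, RowFin (A a))
    (R : Op n) : (∑ a ∈ s, A a) ⋆ₒ R = ∑ a ∈ s, A a ⋆ₒ R := by
  classical
  induction s using Finset.induction_on with
  | empty => simpa using zero_opMul R
  | insert a s ha ih =>
    have h' : ∀ b ∈ s, RowFin (A b) := fun b hb => h b (Finset.mem_insert_of_mem hb)
    rw [Finset.sum_insert ha, Finset.sum_insert ha,
      (h a (Finset.mem_insert_self a s)).add_opMul (.sum h'), ih h']

theorem opMul_sum_of_colFin {α : Type*} {s : Finset α} {A : α → Op n}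
    (h : ∀ a ∈ s, RowFin (A a)ᵀ) (R : Op n) :
    R ⋆ₒ (∑ a ∈ s, A a) = ∑ a ∈ s, R ⋆ₒ A a := by
  rw [opMul_eq_transpose, Matrix.transpose_sum, RowFin.sum_opMul h, Matrix.transpose_sum]
  exact Finset.sum_congr rfl fun a _ => (opMul_eq_transpose _ _).symm

/-- Associativity of unbounded products is an interchange of two sums, harmless when only finitely
many pairs contribute. -/
theorem opMul_assoc_of_finite {A B C : Op n}
    (h : ∀ m m', (Function.support fun x : Occ n × Occ n => A m x.1 * B x.1 x.2 * C x.2 m').Finite) :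
    (A ⋆ₒ B) ⋆ₒ C = A ⋆ₒ (B ⋆ₒ C) := by
  ext m m'
  have h1 : Summable fun x : Occ n × Occ n => A m x.1 * B x.1 x.2 * C x.2 m' :=
    summable_of_hasFiniteSupport (h m m')
  simp only [opMul, ← tsum_mul_right, ← tsum_mul_left, ← mul_assoc]
  exact h1.tsum_comm (f := fun k l => A m k * B k l * C l m')

theorem RowFin.opMul_assoc {A B : Op n} (hA : RowFin A) (hB : RowFin B) (C : Op n) :
    (A ⋆ₒ B) ⋆ₒ C = A ⋆ₒ (B ⋆ₒ C) := by
  refine opMul_assoc_of_finite fun m m' => ?_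
  refine ((hA m).biUnion fun k _ => ((Set.finite_singleton k).prod (hB k))).subset ?_
  rintro ⟨k, l⟩ hkl
  have h := left_ne_zero_of_mul hkl
  simp only [Set.mem_iUnion, Set.mem_prod, Set.mem_singleton_iff, Function.mem_support]
  exact ⟨k, left_ne_zero_of_mul h, rfl, right_ne_zero_of_mul h⟩

theorem opMul_assoc_of_colFin {A B : Op n} (hA : RowFin Aᵀ) (hB : RowFin Bᵀ) (C : Op n) :
    C ⋆ₒ (B ⋆ₒ A) = (C ⋆ₒ B) ⋆ₒ A := by
  rw [opMul_eq_transpose C (B ⋆ₒ A), transpose_opMul B A, hA.opMul_assoc hB,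
    opMul_eq_transpose (C ⋆ₒ B) A,
    transpose_opMul C B]

theorem RowFin.opMul_opMul {A B : Op n} (hA : RowFin A) (hB : RowFin Bᵀ) (R : Op n) :
    (A ⋆ₒ R) ⋆ₒ B = A ⋆ₒ (R ⋆ₒ B) := by
  refine opMul_assoc_of_finite fun m m' => ?_
  refine ((hA m).prod (hB m')).subset ?_
  rintro ⟨k, l⟩ hkl
  exact ⟨left_ne_zero_of_mul (left_ne_zero_of_mul hkl), right_ne_zero_of_mul hkl⟩

/-! ## Ladder operators acting on matrices -/

/-- Matrices as functions of the occupation numbers of `2n` modes. -/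
def toFn (n : ℕ) : Op n ≃ₗ[ℂ] Fn (Ix n) where
  toFun X i := X (fun j => i (Sum.inl j)) (fun j => i (Sum.inr j))
  invFun F m m' := F (Sum.elim m m')
  map_add' X Y := rfl
  map_smul' a X := rfl
  left_inv X := rfl
  right_inv F := by
    funext i
    refine congrArg F ?_
    funext j
    rcases j with j | j <;> rfl

theorem toFn_symm_apply (F : Fn (Ix n)) (m m' : Occ n) :
    (toFn n).symm F m m' = F (Sum.elim m m') := rfl

theorem toFn_elim (X : Op n) (m m' : Occ n) : toFn n X (Sum.elim m m') = X m m' := rfl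

theorem deg_elim (m m' : Occ n) : deg (Sum.elim m m' : Ix n → ℕ) = deg m + deg m' := by
  simp [deg, Fintype.sum_sum_type]

theorem elim_add_single_inl (m m' : Occ n) (j : Fin n) :
    (Sum.elim m m' + Pi.single (Sum.inl j) 1 : Ix n → ℕ) = Sum.elim (m + Pi.single j 1) m' := by
  ext (k | k) <;> simp [Pi.single_apply]

theorem elim_add_single_inr (m m' : Occ n) (j : Fin n) :
    (Sum.elim m m' + Pi.single (Sum.inr j) 1 : Ix n → ℕ) = Sum.elim m (m' + Pi.single j 1) := by
  ext (k | k) <;> simp [Pi.single_apply]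

theorem elim_sub_single_inl (m m' : Occ n) (j : Fin n) :
    (Sum.elim m m' - Pi.single (Sum.inl j) 1 : Ix n → ℕ) = Sum.elim (m - Pi.single j 1) m' := by
  ext (k | k) <;> simp [Pi.single_apply]

theorem elim_sub_single_inr (m m' : Occ n) (j : Fin n) :
    (Sum.elim m m' - Pi.single (Sum.inr j) 1 : Ix n → ℕ) = Sum.elim m (m' - Pi.single j 1) := by
  ext (k | k) <;> simp [Pi.single_apply]

theorem fn_ext {F G : Fn (Ix n)} (h : ∀ m m', F (Sum.elim m m') = G (Sum.elim m m')) : F = G :=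
  (toFn n).symm.injective (by ext m m'; exact h m m')

theorem cre_apply (j : Fin n) (m m' : Occ n) :
    cre j m m' = if m = m' + Pi.single j 1 then ((Real.sqrt (m j) : ℝ) : ℂ) else 0 := by
  rw [cre, Matrix.conjTranspose_apply, ann]
  split_ifs <;> simp

theorem toFn_ann_opMul (j : Fin n) (R : Op n) :
    toFn n (ann j ⋆ₒ R) = low (Sum.inl j) (toFn n R) := by
  refine fn_ext fun m m' => ?_
  rw [toFn_elim, low_apply, elim_add_single_inl, toFn_elim, opMul,
    tsum_eq_single (m + Pi.single j 1) fun k hk => by simp [ann, hk]]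
  simp [ann]

theorem toFn_cre_opMul (j : Fin n) (R : Op n) :
    toFn n (cre j ⋆ₒ R) = rai (Sum.inl j) (toFn n R) := by
  refine fn_ext fun m m' => ?_
  rw [toFn_elim, rai_apply, elim_sub_single_inl, toFn_elim, opMul,
    tsum_eq_single (m - Pi.single j 1) fun k hk => ?_, cre_apply]
  · rcases Nat.eq_zero_or_pos (m j) with h | h
    · simp [h]
    · simp [sub_single_add_single h]
  · rw [cre_apply, if_neg, zero_mul]
    rintro rfl
    exact hk (add_tsub_cancel_right _ _).symm

theorem toFn_opMul_cre (j : Fin n) (R : Op n) :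
    toFn n (R ⋆ₒ cre j) = low (Sum.inr j) (toFn n R) := by
  refine fn_ext fun m m' => ?_
  rw [toFn_elim, low_apply, elim_add_single_inr, toFn_elim, opMul,
    tsum_eq_single (m' + Pi.single j 1) fun k hk => by simp [cre_apply, hk]]
  simp [cre_apply, mul_comm]

theorem toFn_opMul_ann (j : Fin n) (R : Op n) :
    toFn n (R ⋆ₒ ann j) = rai (Sum.inr j) (toFn n R) := by
  refine fn_ext fun m m' => ?_
  rw [toFn_elim, rai_apply, elim_sub_single_inr, toFn_elim, opMul,
    tsum_eq_single (m' - Pi.single j 1) fun k hk => ?_, ann]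
  · rcases Nat.eq_zero_or_pos (m' j) with h | h
    · simp [h]
    · simp [sub_single_add_single h, mul_comm]
  · rw [ann, if_neg, mul_zero]
    rintro rfl
    exact hk (add_tsub_cancel_right _ _).symm

theorem rowFin_ann (j : Fin n) : RowFin (ann j : Op n) := fun m =>
  (Set.finite_singleton (m + Pi.single j 1)).subset fun k hk => by
    by_contra h
    exact hk (if_neg h)

theorem rowFin_cre (j : Fin n) : RowFin (cre j : Op n) := fun m =>
  (Set.finite_singleton (m - Pi.single j 1)).subset fun k hk => by
    by_contra h
    refine hk ?_
    rw [cre_apply, if_neg]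
    rintro rfl
    exact h (add_tsub_cancel_right _ _).symm

theorem ann_transpose (j : Fin n) : (ann j : Op n)ᵀ = cre j := by
  ext m m'
  rw [Matrix.transpose_apply, cre_apply, ann]

theorem cre_transpose (j : Fin n) : (cre j : Op n)ᵀ = ann j := by
  rw [← ann_transpose, Matrix.transpose_transpose]

theorem rowFin_maj (p : Ix n) : RowFin (maj p) := by
  rcases p with j | j
  · exact .smul _ ((rowFin_ann j).add (rowFin_cre j))
  · rw [maj, sub_eq_add_neg, ← neg_one_smul ℂ]
    exact .smul _ ((rowFin_ann j).add ((rowFin_cre j).smul _))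

theorem rowFin_maj_transpose (p : Ix n) : RowFin (maj p)ᵀ := by
  rcases p with j | j
  · rw [maj, Matrix.transpose_smul, Matrix.transpose_add, ann_transpose, cre_transpose]
    exact .smul _ ((rowFin_cre j).add (rowFin_ann j))
  · rw [maj, Matrix.transpose_smul, Matrix.transpose_sub, ann_transpose, cre_transpose,
      sub_eq_add_neg, ← neg_one_smul ℂ]
    exact .smul _ ((rowFin_cre j).add ((rowFin_ann j).smul _))

theorem maj_conjTranspose (p : Ix n) : (maj p : Op n)ᴴ = maj p := by
  have h1 : ∀ j : Fin n, (cre j : Op n)ᴴ = ann j := fun j => Matrix.conjTranspose_conjTranspose _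
  have h2 : ∀ j : Fin n, (ann j : Op n)ᴴ = cre j := fun j => rfl
  rcases p with j | j
  · rw [maj, Matrix.conjTranspose_smul, Matrix.conjTranspose_add, h1, h2, add_comm]
    congr 1
    simp
  · rw [maj, Matrix.conjTranspose_smul, Matrix.conjTranspose_sub, h1, h2, ← neg_sub, smul_neg,
      ← neg_smul]
    congr 1
    simp

/-- Left multiplication by `w_p`. -/
def lw : Ix n → Module.End ℂ (Fn (Ix n))
  | Sum.inl j => isqrt2 • (low (Sum.inl j) + rai (Sum.inl j))
  | Sum.inr j => (Complex.I * isqrt2) • (low (Sum.inl j) - rai (Sum.inl j))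

/-- Right multiplication by `w_p`. -/
def rw' : Ix n → Module.End ℂ (Fn (Ix n))
  | Sum.inl j => isqrt2 • (rai (Sum.inr j) + low (Sum.inr j))
  | Sum.inr j => (Complex.I * isqrt2) • (rai (Sum.inr j) - low (Sum.inr j))

theorem lw_mem (p : Ix n) : lw p ∈ ladderAlg (Ix n) := by
  rcases p with j | j
  · exact Subalgebra.smul_mem _ (Subalgebra.add_mem _ (low_mem _) (rai_mem _)) _
  · exact Subalgebra.smul_mem _ (Subalgebra.sub_mem _ (low_mem _) (rai_mem _)) _

theorem rw'_mem (p : Ix n) : rw' p ∈ ladderAlg (Ix n) := by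
  rcases p with j | j
  · exact Subalgebra.smul_mem _ (Subalgebra.add_mem _ (rai_mem _) (low_mem _)) _
  · exact Subalgebra.smul_mem _ (Subalgebra.sub_mem _ (rai_mem _) (low_mem _)) _

theorem sub_opMul_ann (j : Fin n) (R : Op n) : (ann j - cre j) ⋆ₒ R = ann j ⋆ₒ R - cre j ⋆ₒ R := by
  rw [sub_eq_add_neg, ← neg_one_smul ℂ (cre j), (rowFin_ann j).add_opMul ((rowFin_cre j).smul _),
    smul_opMul, neg_one_smul, sub_eq_add_neg]

theorem toFn_maj_opMul (p : Ix n) (R : Op n) : toFn n (maj p ⋆ₒ R) = lw p (toFn n R) := by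
  rcases p with j | j
  · rw [maj, smul_opMul, (rowFin_ann j).add_opMul (rowFin_cre j), map_smul, map_add,
      toFn_ann_opMul, toFn_cre_opMul]
    rfl
  · rw [maj, smul_opMul, sub_opMul_ann, map_smul, map_sub, toFn_ann_opMul, toFn_cre_opMul]
    rfl

theorem opMul_add_cre (j : Fin n) (R : Op n) (c : ℂ) :
    R ⋆ₒ (ann j + c • cre j) = R ⋆ₒ ann j + c • (R ⋆ₒ cre j) := by
  rw [opMul_eq_transpose, Matrix.transpose_add, Matrix.transpose_smul, ann_transpose,
    cre_transpose, (rowFin_cre j).add_opMul ((rowFin_ann j).smul c), smul_opMul,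
    Matrix.transpose_add, Matrix.transpose_smul, ← ann_transpose, ← opMul_eq_transpose,
    ann_transpose, ← cre_transpose, ← opMul_eq_transpose, cre_transpose]

theorem toFn_opMul_maj (p : Ix n) (R : Op n) : toFn n (R ⋆ₒ maj p) = rw' p (toFn n R) := by
  rcases p with j | j
  · have h := opMul_add_cre j R 1
    rw [one_smul, one_smul] at h
    rw [maj, opMul_smul, h, map_smul, map_add, toFn_opMul_ann, toFn_opMul_cre]
    rfl
  · have h := opMul_add_cre j R (-1)
    rw [neg_one_smul, neg_one_smul, ← sub_eq_add_neg, ← sub_eq_add_neg] at h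
    rw [maj, opMul_smul, h, map_smul, map_sub, toFn_opMul_ann, toFn_opMul_cre]
    rfl

theorem neg_smul_end (c : ℂ) (T : Module.End ℂ (Fn (Ix n))) : (-c) • T = -(c • T) := by module

/-- The unitary matrix `R/√2`. -/
def rotV (n : ℕ) : Matrix (Ix n) (Ix n) ℂ := isqrt2 • rotR n

theorem star_isqrt2 : star isqrt2 = isqrt2 := by simp [isqrt2]

theorem conj_isqrt2 : (starRingEnd ℂ) isqrt2 = isqrt2 := star_isqrt2

theorem rotV_mul_conjTranspose (n : ℕ) : rotV n * (rotV n)ᴴ = 1 := by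
  rw [rotV, Matrix.conjTranspose_smul, smul_mul_smul_comm, star_isqrt2, isqrt2_mul_self, rotR,
    Matrix.fromBlocks_conjTranspose, Matrix.fromBlocks_multiply]
  simp only [Matrix.conjTranspose_smul, Matrix.conjTranspose_neg, Matrix.conjTranspose_one, mul_one,
    one_mul, smul_mul_smul_comm, neg_mul, mul_neg, neg_neg]
  rw [← Matrix.fromBlocks_one, Matrix.fromBlocks_smul]
  congr 1 <;> simp <;> module

theorem eOp_rotV_inl (j : Fin n) :
    eOp (rotV n) (Sum.inl j) = isqrt2 • (low (Sum.inl j) + low (Sum.inr j)) := by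
  simp [eOp, Fintype.sum_sum_type, rotV, rotR, Matrix.one_apply, ite_smul]

theorem eOp_rotV_inr (j : Fin n) :
    eOp (rotV n) (Sum.inr j) = (Complex.I * isqrt2) • (low (Sum.inl j) - low (Sum.inr j)) := by
  simp [eOp, Fintype.sum_sum_type, rotV, rotR, Matrix.one_apply, ite_smul, neg_smul_end]
  module

theorem rOp_rotV_inl (j : Fin n) :
    rOp (rotV n) (Sum.inl j) = isqrt2 • (rai (Sum.inl j) + rai (Sum.inr j)) := by
  simp [rOp, Fintype.sum_sum_type, rotV, rotR, Matrix.one_apply, ite_smul, conj_isqrt2, apply_ite]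

theorem rOp_rotV_inr (j : Fin n) :
    rOp (rotV n) (Sum.inr j) = (-Complex.I * isqrt2) • (rai (Sum.inl j) - rai (Sum.inr j)) := by
  simp [rOp, Fintype.sum_sum_type, rotV, rotR, Matrix.one_apply, ite_smul, neg_smul_end, conj_isqrt2,
    apply_ite]
  module

/-- The commutator part `(w_p R - R w_p)/√2`. -/
def epsOp (p : Ix n) : Module.End ℂ (Fn (Ix n)) := ∑ a, tau n a p • bpOp (rotV n) a

theorem epsOp_inl (j : Fin n) :
    epsOp (Sum.inl j) = Complex.I • bpOp (rotV n) (Sum.inr j) := by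
  simp [epsOp, Fintype.sum_sum_type, tau, Matrix.one_apply, ite_smul]

theorem epsOp_inr (j : Fin n) :
    epsOp (Sum.inr j) = -Complex.I • bpOp (rotV n) (Sum.inl j) := by
  simp [epsOp, Fintype.sum_sum_type, tau, Matrix.one_apply, ite_smul, neg_smul_end]

/-- Left multiplication is half the anticommutator plus half the commutator; the commutator is a
combination of b' with coefficients from τ. Right multiplication differs only in the sign of the
commutator part. -/
theorem lw_eq (p : Ix n) : lw p = isqrt2 • (bOp (rotV n) p + epsOp p) := by
  have h1 := isqrt2_mul_self
  have h2 := Complex.I_mul_I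
  rcases p with j | j
  · rw [epsOp_inl, bOp, bpOp, eOp_rotV_inl, eOp_rotV_inr, rOp_rotV_inl, rOp_rotV_inr, lw]
    match_scalars <;> grind
  · rw [epsOp_inr, bOp, bpOp, eOp_rotV_inl, eOp_rotV_inr, rOp_rotV_inl, rOp_rotV_inr, lw]
    match_scalars <;> grind

theorem rw'_eq (p : Ix n) : rw' p = isqrt2 • (bOp (rotV n) p - epsOp p) := by
  have h1 := isqrt2_mul_self
  have h2 := Complex.I_mul_I
  rcases p with j | j
  · rw [epsOp_inl, bOp, bpOp, eOp_rotV_inl, eOp_rotV_inr, rOp_rotV_inl, rOp_rotV_inr, rw']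
    match_scalars <;> grind
  · rw [epsOp_inr, bOp, bpOp, eOp_rotV_inl, eOp_rotV_inr, rOp_rotV_inl, rOp_rotV_inr, rw']
    match_scalars <;> grind

theorem toFn_bSup (p : Ix n) (R : Op n) : toFn n (bSup p R) = bOp (rotV n) p (toFn n R) := by
  have h : bOp (rotV n) p = isqrt2 • (lw p + rw' p) := by
    rw [lw_eq, rw'_eq, ← smul_add, smul_smul, isqrt2_mul_self]
    module
  rw [bSup, map_smul, map_add, toFn_maj_opMul, toFn_opMul_maj, h]
  rfl

theorem toFn_bSup' (p : Ix n) (R : Op n) : toFn n (bSup' p R) = bpOp (rotV n) p (toFn n R) := by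
  have h : ∀ q : Ix n, lw q - rw' q = (2 * isqrt2) • epsOp q := by
    intro q
    rw [lw_eq, rw'_eq]
    module
  have h1 := isqrt2_mul_self
  have h2 := Complex.I_mul_I
  rcases p with j | j
  · have h3 : bpOp (rotV n) (Sum.inl j) =
        (Complex.I * isqrt2) • (lw (Sum.inr j) - rw' (Sum.inr j)) := by
      rw [h, epsOp_inr]
      match_scalars
      grind
    rw [bSup', map_smul, map_sub, toFn_maj_opMul, toFn_opMul_maj, h3]
    rfl
  · have h3 : bpOp (rotV n) (Sum.inr j) =
        (-Complex.I * isqrt2) • (lw (Sum.inl j) - rw' (Sum.inl j)) := by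
      rw [h, epsOp_inl]
      match_scalars
      grind
    rw [bSup', map_smul, map_sub, toFn_maj_opMul, toFn_opMul_maj, h3]
    rfl

theorem toFn_aSup (p : Ix n) (R : Op n) : toFn n (aSup p R) = low p (toFn n R) := by
  rcases p with j | j
  · exact toFn_ann_opMul j R
  · exact toFn_opMul_cre j R

/-! ## The Liouvillian -/

/-- The bilinear expression `∑ N_{pq} x_p y_q`. -/
def bilin {A : Type*} [Ring A] [Algebra ℂ A] (N : Matrix (Ix n) (Ix n) ℂ) (x y : Ix n → A) : A :=
  ∑ p, ∑ q, N p q • (x p * y q)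

section Bilin

variable {A : Type*} [Ring A] [Algebra ℂ A]

theorem bilin_add (N N' : Matrix (Ix n) (Ix n) ℂ) (x y : Ix n → A) :
    bilin (N + N') x y = bilin N x y + bilin N' x y := by
  simp [bilin, add_smul, Finset.sum_add_distrib]

theorem bilin_neg (N : Matrix (Ix n) (Ix n) ℂ) (x y : Ix n → A) :
    bilin (-N) x y = -bilin N x y := by
  simp only [bilin, Matrix.neg_apply, neg_smul, Finset.sum_neg_distrib]

theorem bilin_smul (c : ℂ) (N : Matrix (Ix n) (Ix n) ℂ) (x y : Ix n → A) :
    bilin (c • N) x y = c • bilin N x y := by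
  simp [bilin, Finset.smul_sum, smul_smul]

theorem bilin_transpose (N : Matrix (Ix n) (Ix n) ℂ) (x y : Ix n → A) :
    ∑ p, ∑ q, N p q • (x q * y p) = bilin Nᵀ x y := by
  rw [Finset.sum_comm]
  rfl

theorem bilin_mul_left (T N : Matrix (Ix n) (Ix n) ℂ) (x y : Ix n → A) :
    bilin (T * N) x y = bilin N (fun p => ∑ a, T a p • x a) y := by
  simp only [bilin, Matrix.mul_apply, Finset.sum_mul, Finset.sum_smul, Finset.smul_sum,
    smul_mul_assoc, smul_smul]
  calc _ = ∑ a, ∑ p, ∑ q, (T a p * N p q) • (x a * y q) :=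
        Finset.sum_congr rfl fun a _ => Finset.sum_comm
    _ = ∑ p, ∑ a, ∑ q, (T a p * N p q) • (x a * y q) := Finset.sum_comm
    _ = _ := Finset.sum_congr rfl fun p _ => by
      rw [Finset.sum_comm]
      simp only [mul_comm]

theorem bilin_mul_right (N T : Matrix (Ix n) (Ix n) ℂ) (x y : Ix n → A) :
    bilin (N * T) x y = bilin N x (fun q => ∑ c, T q c • y c) := by
  simp only [bilin, Matrix.mul_apply, Finset.mul_sum, Finset.sum_smul, Finset.smul_sum,
    mul_smul_comm, smul_smul]
  exact Finset.sum_congr rfl fun a _ => Finset.sum_comm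

end Bilin

theorem tau_transpose (n : ℕ) : (tau n)ᵀ = -tau n := by
  rw [tau, Matrix.fromBlocks_transpose, Matrix.fromBlocks_neg]
  simp

theorem tau_apply_swap (p q : Ix n) : tau n q p = -tau n p q :=
  congrFun (congrFun (tau_transpose n) p) q

/-! ### The Lindblad generator in quadrature variables. -/

section Quadrature

variable {A : Type*} [Ring A] [Algebra ℂ A] {b ε : Ix n → A}

theorem sum_mul_tau_transpose (N : Matrix (Ix n) (Ix n) ℂ) :
    ∑ p, ∑ q, Nᵀ p q * tau n p q = -∑ p, ∑ q, N p q * tau n p q := by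
  rw [Finset.sum_comm, ← Finset.sum_neg_distrib]
  refine Finset.sum_congr rfl fun p _ => ?_
  rw [← Finset.sum_neg_distrib]
  refine Finset.sum_congr rfl fun q _ => ?_
  rw [tau_apply_swap p q, Matrix.transpose_apply]
  ring

theorem bilin_transpose_of_comm (N : Matrix (Ix n) (Ix n) ℂ)
    {x : Ix n → A} (h : ∀ p q, x p * x q = x q * x p) :
    bilin Nᵀ x x = bilin N x x := by
  rw [← bilin_transpose]
  simp only [bilin, h]

/-- Only the products b ε need reordering; their commutator τ produces the scalar, and moving b to
the right transposes the coefficient matrix. -/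
theorem bilin_quadrature (hbe : ∀ p q, b p * ε q = ε q * b p + tau n p q • 1)
    (N : Matrix (Ix n) (Ix n) ℂ) :
    bilin N (fun p => isqrt2 • (b p + ε p)) (fun p => isqrt2 • (b p + ε p)) =
      (1 / 2 : ℂ) • (bilin N b b + bilin N ε ε
        + (bilin N ε b + bilin Nᵀ ε b) + (∑ p, ∑ q, N p q * tau n p q) • 1) ∧
    bilin N (fun p => isqrt2 • (b p - ε p)) (fun p => isqrt2 • (b p - ε p)) =
      (1 / 2 : ℂ) • (bilin N b b + bilin N ε ε
        - (bilin N ε b + bilin Nᵀ ε b) - (∑ p, ∑ q, N p q * tau n p q) • 1) ∧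
    bilin N (fun p => isqrt2 • (b p + ε p)) (fun p => isqrt2 • (b p - ε p)) =
      (1 / 2 : ℂ) • (bilin N b b - bilin N ε ε
        + (bilin N ε b - bilin Nᵀ ε b) - (∑ p, ∑ q, N p q * tau n p q) • 1) := by
  have h1 : ∑ p, ∑ q, N p q • (b p * ε q) = bilin Nᵀ ε b +
      (∑ p, ∑ q, N p q * tau n p q) • 1 := by
    simp only [hbe, smul_add, Finset.sum_add_distrib, bilin_transpose, Finset.sum_smul,
      smul_smul]
  have h2 : ∀ p q, (isqrt2 • (b p + ε p)) * (isqrt2 • (b q + ε q)) =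
      (1 / 2 : ℂ) • (b p * b q + ε p * ε q + b p * ε q + ε p * b q) := by
    intro p q
    rw [smul_mul_smul_comm, isqrt2_mul_self]
    congr 1
    noncomm_ring
  have h3 : ∀ p q, (isqrt2 • (b p - ε p)) * (isqrt2 • (b q - ε q)) =
      (1 / 2 : ℂ) • (b p * b q + ε p * ε q - b p * ε q - ε p * b q) := by
    intro p q
    rw [smul_mul_smul_comm, isqrt2_mul_self]
    congr 1
    noncomm_ring
  have h4 : ∀ p q, (isqrt2 • (b p + ε p)) * (isqrt2 • (b q - ε q)) =
      (1 / 2 : ℂ) • (b p * b q - ε p * ε q - b p * ε q + ε p * b q) := by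
    intro p q
    rw [smul_mul_smul_comm, isqrt2_mul_self]
    congr 1
    noncomm_ring
  refine ⟨?_, ?_, ?_⟩
  · have h5 := h2
    simp only [bilin] at h1 ⊢
    simp only [h5]
    simp only [smul_comm _ (1 / 2 : ℂ), ← Finset.smul_sum, smul_add, Finset.sum_add_distrib, h1]
    module
  · have h5 := h3
    simp only [bilin] at h1 ⊢
    simp only [h5]
    simp only [smul_comm _ (1 / 2 : ℂ), ← Finset.smul_sum, smul_add,
      smul_sub, Finset.sum_add_distrib, Finset.sum_sub_distrib, h1]
    module
  · have h5 := h4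
    simp only [bilin] at h1 ⊢
    simp only [h5]
    simp only [smul_comm _ (1 / 2 : ℂ), ← Finset.smul_sum,
      smul_add, smul_sub, Finset.sum_add_distrib, Finset.sum_sub_distrib, h1]
    module

/-- The b·b terms and all scalars cancel, so every remaining term starts with ε. The antisymmetric
part of `B` survives in ε·b and its symmetric part in ε·ε. -/
theorem bilin_lindblad (hbb : ∀ p q, b p * b q = b q * b p) (hee : ∀ p q, ε p * ε q = ε q * ε p)
    (hbe : ∀ p q, b p * ε q = ε q * b p + tau n p q • 1) {l r : Ix n → A}
    (hl : l = fun p => isqrt2 • (b p + ε p)) (hr : r = fun p => isqrt2 • (b p - ε p))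
    {H B Br Bi : Matrix (Ix n) (Ix n) ℂ} (hH : Hᵀ = H) (hB : B = Br + Complex.I • Bi)
    (hB' : Bᵀ = Br - Complex.I • Bi) :
    (-Complex.I) • (bilin H l l - bilin H r r)
      + (bilin B l r - (1 / 2 : ℂ) • (bilin Bᵀ l l + bilin B r r)) =
    (-(2 * Complex.I)) • bilin H ε b + Complex.I • bilin Bi ε b - bilin Br ε ε := by
  have hBb : bilin Bᵀ b b = bilin B b b := bilin_transpose_of_comm _ hbb
  have hBe : bilin Bᵀ ε ε = bilin B ε ε := bilin_transpose_of_comm _ hee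
  -- A symmetric matrix contracted with the antisymmetric τ.
  have hHτ : ∑ p, ∑ q, H p q * tau n p q = 0 := by
    have h := sum_mul_tau_transpose H
    rw [hH] at h
    linear_combination h / 2
  have hBr : (2 : ℂ) • bilin B ε ε = (2 : ℂ) • bilin Br ε ε := by
    rw [two_smul]
    nth_rewrite 1 [← hBe]
    rw [hB', hB, sub_eq_add_neg, bilin_add, bilin_add, bilin_neg]
    module
  have hBr' : bilin B ε ε = bilin Br ε ε := smul_right_injective A (two_ne_zero (α := ℂ)) hBr
  have hBi : bilin B ε b - bilin Bᵀ ε b = (2 * Complex.I) • bilin Bi ε b := by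
    rw [hB', hB, sub_eq_add_neg Br, bilin_add, bilin_add, bilin_neg, bilin_smul]
    module
  rw [hl, hr, (bilin_quadrature hbe H).1, (bilin_quadrature hbe H).2.1,
    (bilin_quadrature hbe Bᵀ).1, (bilin_quadrature hbe B).2.1, (bilin_quadrature hbe B).2.2,
    sum_mul_tau_transpose, hHτ, hBb, hBe, hH, Matrix.transpose_transpose, hBi, hBr']
  module

end Quadrature

theorem bOp_mul_epsOp (p q : Ix n) :
    bOp (rotV n) p * epsOp q = epsOp q * bOp (rotV n) p + tau n p q • 1 := by
  rw [epsOp, Finset.mul_sum, Finset.sum_mul]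
  simp only [mul_smul_comm, smul_mul_assoc, bOp_mul_bpOp (rotV_mul_conjTranspose n), smul_add,
    Finset.sum_add_distrib]
  simp [ite_smul]

theorem epsOp_mul_epsOp (p q : Ix n) : (epsOp p : Module.End ℂ (Fn (Ix n))) * epsOp q =
    epsOp q * epsOp p :=
  Commute.sum_left _ _ _ fun i _ => Commute.sum_right _ _ _ fun j _ =>
    Commute.smul_left (Commute.smul_right (bpOp_mul_bpOp (rotV_mul_conjTranspose n) i j) _) _

namespace System

variable (𝒮 : System n)

theorem toFn_ham_opMul (R : Op n) :
    toFn n (𝒮.ham ⋆ₒ R) = (∑ p, ∑ q, (𝒮.H p q : ℂ) • (lw p * lw q)) (toFn n R) := by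
  have h : ∀ p q : Ix n, RowFin ((𝒮.H p q : ℂ) • (maj p ⋆ₒ maj q)) :=
    fun p q => .smul _ ((rowFin_maj p).opMul (rowFin_maj q))
  rw [ham, RowFin.sum_opMul fun p _ => .sum fun q _ => h p q]
  simp only [RowFin.sum_opMul fun q _ => h _ q, smul_opMul,
    (rowFin_maj _).opMul_assoc (rowFin_maj _), map_sum, map_smul, toFn_maj_opMul,
    LinearMap.sum_apply, LinearMap.smul_apply, Module.End.mul_apply]

theorem toFn_opMul_ham (R : Op n) :
    toFn n (R ⋆ₒ 𝒮.ham) = (∑ p, ∑ q, (𝒮.H p q : ℂ) • (rw' q * rw' p)) (toFn n R) := by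
  have h : ∀ p q : Ix n, RowFin ((𝒮.H p q : ℂ) • (maj p ⋆ₒ maj q))ᵀ := fun p q => by
    rw [Matrix.transpose_smul, transpose_opMul]
    exact .smul _ ((rowFin_maj_transpose q).opMul (rowFin_maj_transpose p))
  rw [ham, opMul_sum_of_colFin fun p _ => by
    rw [Matrix.transpose_sum]
    exact .sum fun q _ => h p q]
  simp only [opMul_sum_of_colFin fun q _ => h _ q, opMul_smul,
    opMul_assoc_of_colFin (rowFin_maj_transpose _) (rowFin_maj_transpose _), map_sum, map_smul,
    toFn_opMul_maj, LinearMap.sum_apply, LinearMap.smul_apply, Module.End.mul_apply]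

theorem rowFin_lind (r : Fin 𝒮.numL) : RowFin (𝒮.lind r) :=
  .sum fun p _ => .smul _ (rowFin_maj p)

theorem lind_conjTranspose (r : Fin 𝒮.numL) :
    (𝒮.lind r)ᴴ = ∑ p, star (𝒮.L r p) • maj p := by
  simp [lind, Matrix.conjTranspose_sum, Matrix.conjTranspose_smul, maj_conjTranspose]

theorem rowFin_lind_transpose (r : Fin 𝒮.numL) : RowFin (𝒮.lind r)ᵀ := by
  rw [lind, Matrix.transpose_sum]
  refine .sum fun p _ => ?_
  rw [Matrix.transpose_smul]
  exact .smul _ (rowFin_maj_transpose p)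

theorem rowFin_lind_conjTranspose (r : Fin 𝒮.numL) : RowFin (𝒮.lind r)ᴴ := by
  rw [lind_conjTranspose]
  exact .sum fun p _ => .smul _ (rowFin_maj p)

theorem rowFin_lind_conjTranspose_transpose (r : Fin 𝒮.numL) : RowFin (𝒮.lind r)ᴴᵀ := by
  rw [lind_conjTranspose, Matrix.transpose_sum]
  refine .sum fun p _ => ?_
  rw [Matrix.transpose_smul]
  exact .smul _ (rowFin_maj_transpose p)

theorem toFn_sum_maj_opMul (x : Ix n → ℂ) (R : Op n) :
    toFn n ((∑ p, x p • maj p) ⋆ₒ R) = (∑ p, x p • lw p) (toFn n R) := by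
  rw [RowFin.sum_opMul fun p _ => .smul _ (rowFin_maj p)]
  simp only [smul_opMul, map_sum, map_smul, toFn_maj_opMul, LinearMap.sum_apply,
    LinearMap.smul_apply]

theorem toFn_opMul_sum_maj (x : Ix n → ℂ) (R : Op n) :
    toFn n (R ⋆ₒ (∑ p, x p • maj p)) = (∑ p, x p • rw' p) (toFn n R) := by
  have h : ∀ p : Ix n, RowFin (x p • maj p)ᵀ := fun p => by
    rw [Matrix.transpose_smul]
    exact .smul _ (rowFin_maj_transpose p)
  rw [opMul_sum_of_colFin fun p _ => h p]
  simp only [opMul_smul, map_sum, map_smul, toFn_opMul_maj, LinearMap.sum_apply,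
    LinearMap.smul_apply]

theorem toFn_liouvillian_eq (R : Op n) : toFn n (𝒮.liouvillian R) =
    ((-Complex.I) • (∑ p, ∑ q, (𝒮.H p q : ℂ) • (lw p * lw q)
        - ∑ p, ∑ q, (𝒮.H p q : ℂ) • (rw' q * rw' p))
      + ∑ r, ((∑ p, 𝒮.L r p • lw p) * (∑ p, star (𝒮.L r p) • rw' p)
        - (1 / 2 : ℂ) • ((∑ p, star (𝒮.L r p) • lw p) * (∑ p, 𝒮.L r p • lw p)
          + (∑ p, 𝒮.L r p • rw' p) * (∑ p, star (𝒮.L r p) • rw' p)))) (toFn n R) := by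
  rw [liouvillian, map_add, map_smul, map_sub, toFn_ham_opMul, toFn_opMul_ham, map_sum,
    LinearMap.add_apply, LinearMap.smul_apply, LinearMap.sub_apply]
  refine congrArg₂ _ rfl ((Finset.sum_congr rfl fun r _ => ?_).trans (LinearMap.sum_apply _ _ _).symm)
  rw [map_sub, map_smul, map_add, (𝒮.rowFin_lind r).opMul_opMul
    (𝒮.rowFin_lind_conjTranspose_transpose r), (𝒮.rowFin_lind_conjTranspose r).opMul_assoc
    (𝒮.rowFin_lind r), opMul_assoc_of_colFin (𝒮.rowFin_lind_transpose r)
    (𝒮.rowFin_lind_conjTranspose_transpose r), lind_conjTranspose, lind, toFn_sum_maj_opMul,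
    toFn_opMul_sum_maj, toFn_sum_maj_opMul, toFn_sum_maj_opMul, toFn_opMul_sum_maj,
    toFn_opMul_sum_maj]
  rfl

/-- Right multiplication reverses the order of products: L†LR gives the coefficients Bᵀ, whereas
RL†L gives B. -/
theorem toFn_liouvillian_eq_bilin (R : Op n) : toFn n (𝒮.liouvillian R) =
    ((-Complex.I) • (bilin (𝒮.H.map Complex.ofReal) lw lw - bilin (𝒮.H.map Complex.ofReal) rw' rw')
      + (bilin 𝒮.B lw rw' - (1 / 2 : ℂ) • (bilin 𝒮.Bᵀ lw lw + bilin 𝒮.B rw' rw'))) (toFn n R) := by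
  have h1 : ∑ p, ∑ q, (𝒮.H p q : ℂ) • (rw' q * rw' p) =
      bilin (𝒮.H.map Complex.ofReal) rw' rw' := by
    rw [Finset.sum_comm, bilin]
    refine Finset.sum_congr rfl fun p _ => Finset.sum_congr rfl fun q _ => ?_
    rw [Matrix.map_apply, 𝒮.H_symm.apply]
  have h2 : ∀ (x y : Fin 𝒮.numL → Ix n → ℂ) (l k : Ix n → Module.End ℂ (Fn (Ix n))),
      ∑ r, (∑ p, x r p • l p) * (∑ p, y r p • k p) =
        bilin (Matrix.of fun p q => ∑ r, x r p * y r q) l k := by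
    intro x y l k
    simp only [Finset.sum_mul_sum, smul_mul_smul_comm, bilin, Matrix.of_apply, Finset.sum_smul]
    rw [Finset.sum_comm]
    exact Finset.sum_congr rfl fun p _ => Finset.sum_comm
  have h3 : (Matrix.of fun p q => ∑ r, star (𝒮.L r p) * 𝒮.L r q) = 𝒮.Bᵀ := by
    ext p q
    simp only [Matrix.of_apply, Matrix.transpose_apply, B, mul_comm]
  rw [toFn_liouvillian_eq, h1, Finset.sum_sub_distrib, ← Finset.smul_sum, Finset.sum_add_distrib,
    h2, h2, h2, h3]
  rfl

theorem B_eq : 𝒮.B = 𝒮.Bre + Complex.I • 𝒮.Bim := by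
  ext p q
  simp only [Bre, Bim, Matrix.add_apply, Matrix.smul_apply, Matrix.map_apply, smul_eq_mul]
  rw [mul_comm, Complex.re_add_im]

theorem B_transpose_eq : 𝒮.Bᵀ = 𝒮.Bre - Complex.I • 𝒮.Bim := by
  have h : ∀ p q, 𝒮.B q p = star (𝒮.B p q) := by
    intro p q
    simp [B, mul_comm]
  ext p q
  simp only [Bre, Bim, Matrix.sub_apply, Matrix.smul_apply, Matrix.map_apply, smul_eq_mul,
    Matrix.transpose_apply, h p q]
  apply Complex.ext <;> simp

/-- The Liouvillian in terms of `b` and `b'`. -/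
theorem toFn_liouvillian (R : Op n) : toFn n (𝒮.liouvillian R) =
    (bilin 𝒮.X₀ (bpOp (rotV n)) (bOp (rotV n)) + bilin 𝒮.Y (bpOp (rotV n)) (bpOp (rotV n)))
      (toFn n R) := by
  have hH : (𝒮.H.map Complex.ofReal)ᵀ = 𝒮.H.map Complex.ofReal := by
    rw [← Matrix.transpose_map, 𝒮.H_symm.eq]
  have hX : bilin 𝒮.X₀ (bpOp (rotV n)) (bOp (rotV n)) =
      (-(2 * Complex.I)) • bilin (𝒮.H.map Complex.ofReal) epsOp (bOp (rotV n))
        + Complex.I • bilin 𝒮.Bim epsOp (bOp (rotV n)) := by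
    rw [X₀, bilin_add, bilin_smul, bilin_smul, bilin_mul_left, bilin_mul_left]
    rfl
  have hY : bilin 𝒮.Y (bpOp (rotV n)) (bpOp (rotV n)) = -bilin 𝒮.Bre epsOp epsOp := by
    have h : 𝒮.Y = -(tau n * (𝒮.Bre * (tau n)ᵀ)) := by
      rw [Y, tau_transpose, mul_neg, mul_neg, neg_neg, mul_assoc]
    rw [h, bilin_neg, bilin_mul_left, bilin_mul_right]
    rfl
  rw [toFn_liouvillian_eq_bilin, bilin_lindblad (bOp_mul_bOp (rotV_mul_conjTranspose n))
    epsOp_mul_epsOp bOp_mul_epsOp (funext lw_eq) (funext rw'_eq) hH 𝒮.B_eq 𝒮.B_transpose_eq, hX, hY]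
  congr 1

end System

/-! ## Relations between the ladder super-operators -/

/-- The creation super-operators `a'` on functions. -/
def apOp : Ix n → Module.End ℂ (Fn (Ix n))
  | Sum.inl j => rai (Sum.inl j) - low (Sum.inr j)
  | Sum.inr j => rai (Sum.inr j) - low (Sum.inl j)

theorem toFn_aSup' (p : Ix n) (R : Op n) : toFn n (aSup' p R) = apOp p (toFn n R) := by
  rcases p with j | j
  · rw [aSup', map_sub, toFn_cre_opMul, toFn_opMul_cre]
    rfl
  · rw [aSup', map_sub, toFn_ann_opMul, toFn_opMul_ann]
    rfl

theorem bpOp_eq_sum_apOp (p : Ix n) :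
    bpOp (rotV n) p = ∑ q, ((1 / 2 : ℂ) • rotRconj n) p q • apOp q := by
  have h1 := isqrt2_mul_self
  rcases p with j | j
  · rw [bpOp, eOp_rotV_inl, rOp_rotV_inl]
    simp [Fintype.sum_sum_type, rotRconj, rotR, Matrix.one_apply, ite_smul, apply_ite, apOp]
    match_scalars <;> grind
  · rw [bpOp, eOp_rotV_inr, rOp_rotV_inr]
    simp [Fintype.sum_sum_type, rotRconj, rotR, Matrix.one_apply, ite_smul, apply_ite, apOp]
    match_scalars <;> grind

theorem bOp_eq_sum (p : Ix n) :
    bOp (rotV n) p = ∑ q, rotR n p q • low q + ∑ q, ((1 / 2 : ℂ) • rotRconj n) p q • apOp q := by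
  have h1 := isqrt2_mul_self
  rcases p with j | j
  · rw [bOp, eOp_rotV_inl, rOp_rotV_inl]
    simp [Fintype.sum_sum_type, rotRconj, rotR, Matrix.one_apply, ite_smul, apply_ite, apOp]
    match_scalars <;> grind
  · rw [bOp, eOp_rotV_inr, rOp_rotV_inr]
    simp [Fintype.sum_sum_type, rotRconj, rotR, Matrix.one_apply, ite_smul, apply_ite, apOp]
    match_scalars <;> grind

/-- A complex matrix acting on a vector with entries in a module. -/
def cmv {m m' E : Type*} [Fintype m'] [AddCommGroup E] [Module ℂ E] (N : Matrix m m' ℂ)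
    (x : m' → E) (p : m) : E :=
  ∑ q, N p q • x q

theorem cmv_mul {m m' m'' E : Type*} [Fintype m'] [Fintype m''] [AddCommGroup E] [Module ℂ E]
    (N : Matrix m m' ℂ) (N' : Matrix m' m'' ℂ) (x : m'' → E) : cmv (N * N') x = cmv N (cmv N' x) := by
  funext p
  simp only [cmv, Matrix.mul_apply, Finset.sum_smul, Finset.smul_sum, smul_smul]
  exact Finset.sum_comm

theorem cmv_fromBlocks {l m E : Type*} [Fintype l] [Fintype m] [AddCommGroup E] [Module ℂ E]
    (A : Matrix l l ℂ) (B : Matrix l m ℂ) (C : Matrix m l ℂ) (D : Matrix m m ℂ)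
    (x : l → E) (y : m → E) : cmv (Matrix.fromBlocks A B C D) (Sum.elim x y) =
      Sum.elim (fun p => cmv A x p + cmv B y p) (fun p => cmv C x p + cmv D y p) := by
  funext p
  rcases p with p | p <;> simp [cmv, Fintype.sum_sum_type]

theorem bSup'_eq_sum (R : Op n) :
    (fun p => bSup' p R) = cmv ((1 / 2 : ℂ) • rotRconj n) (fun q => aSup' q R) := by
  funext p
  apply (toFn n).injective
  rw [toFn_bSup', bpOp_eq_sum_apOp, cmv, map_sum, LinearMap.sum_apply]
  exact Finset.sum_congr rfl fun q _ => by rw [map_smul, toFn_aSup']; rfl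

theorem bSup_eq_sum (R : Op n) : (fun p => bSup p R) =
    fun p => cmv (rotR n) (fun q => aSup q R) p
      + cmv ((1 / 2 : ℂ) • rotRconj n) (fun q => aSup' q R) p := by
  funext p
  apply (toFn n).injective
  rw [toFn_bSup, bOp_eq_sum, cmv, cmv, map_add, map_sum, map_sum, LinearMap.add_apply,
    LinearMap.sum_apply, LinearMap.sum_apply]
  congr 1
  · exact Finset.sum_congr rfl fun q _ => by rw [map_smul, toFn_aSup]; rfl
  · exact Finset.sum_congr rfl fun q _ => by rw [map_smul, toFn_aSup']; rfl

theorem toFn_vac (n : ℕ) : toFn n (vac n) = vacFn (Ix n) := by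
  refine fn_ext fun m m' => ?_
  rw [toFn_elim, vac, vacFn]
  have h : (Sum.elim m m' : Ix n → ℕ) = 0 ↔ m = 0 ∧ m' = 0 := by
    constructor
    · intro h
      exact ⟨funext fun j => congrFun h (Sum.inl j), funext fun j => congrFun h (Sum.inr j)⟩
    · rintro ⟨rfl, rfl⟩
      funext j
      rcases j with j | j <;> rfl
  simp only [h]

theorem aSup_vac (p : Ix n) : aSup p (vac n) = 0 := by
  apply (toFn n).injective
  rw [toFn_aSup, toFn_vac, low_vacFn, map_zero]

theorem rotR_mul_conjTranspose (n : ℕ) : rotR n * ((1 / 2 : ℂ) • (rotR n)ᴴ) = 1 := by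
  have h := rotV_mul_conjTranspose n
  rwa [rotV, Matrix.conjTranspose_smul, smul_mul_smul_comm, star_isqrt2, isqrt2_mul_self,
    ← mul_smul_comm] at h

namespace JordanForm

variable {X : Matrix (Ix n) (Ix n) ℂ} (J : JordanForm X) (Γ : Matrix (Ix n) (Ix n) ℝ)

theorem elim_eq_sum_W (R : Op n) (i : Ix n ⊕ Ix n) :
    Sum.elim (fun p => J.dVec Γ p R) (fun p => J.dVec' p R) i =
      ∑ j, J.W Γ i j • Sum.elim (fun p => aSup p R) (fun p => aSup' p R) j := by
  refine congrFun (?_ : _ = cmv (J.W Γ) (Sum.elim (fun p => aSup p R) (fun p => aSup' p R))) i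
  rw [W, cmv_mul, cmv_mul, cmv_fromBlocks]
  have h0 : ∀ x : Ix n → Op n, cmv (0 : Matrix (Ix n) (Ix n) ℂ) x = 0 := by
    intro x
    funext p
    simp [cmv]
  have h1 : ∀ x : Ix n → Op n, cmv (1 : Matrix (Ix n) (Ix n) ℂ) x = x := by
    intro x
    funext p
    simp [cmv, Matrix.one_apply]
  rw [← bSup_eq_sum, h0]
  simp only [Pi.zero_apply, zero_add]
  rw [← bSup'_eq_sum, cmv_fromBlocks, cmv_fromBlocks, h0, h0, h0, h1, h1]
  simp only [Pi.zero_apply, zero_add, add_zero]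
  congr 1
  funext p
  refine Finset.sum_congr rfl fun q _ => ?_
  congr 1
  rw [sub_eq_add_neg]
  congr 1
  simp only [cmv, Matrix.neg_apply, Matrix.smul_apply, neg_smul, Finset.sum_neg_distrib,
    smul_assoc, Finset.smul_sum, Matrix.map_apply]

theorem r_eq : J.r Γ = J.S⁻¹ * rotR n := by
  simp [r, W, Matrix.fromBlocks_multiply]

theorem s_eq : J.s Γ =
    J.S⁻¹ * ((1 - (2 : ℂ) • Γ.map Complex.ofReal) * ((1 / 2 : ℂ) • rotRconj n)) := by
  rw [s, W, Matrix.fromBlocks_multiply, Matrix.fromBlocks_multiply, Matrix.toBlocks_fromBlocks₁₂]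
  noncomm_ring
  rw [smul_add]

theorem isUnit_det_r : IsUnit (J.r Γ).det := by
  rw [r_eq, Matrix.det_mul]
  exact (Matrix.isUnit_nonsing_inv_det _ J.S_unit).mul
    ((Matrix.isUnit_iff_isUnit_det _).mp (IsUnit.of_mul_eq_one _ (rotR_mul_conjTranspose n)))

/-- The Jordan basis drops out: S cancels, and U⁻¹ is the transpose of U*/2. -/
theorem r_inv_mul_s : (J.r Γ)⁻¹ * J.s Γ = ((1 / 2 : ℂ) • rotRconj n)ᵀ *
    ((1 - (2 : ℂ) • Γ.map Complex.ofReal) * ((1 / 2 : ℂ) • rotRconj n)) := by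
  have h : (rotR n)⁻¹ = ((1 / 2 : ℂ) • rotRconj n)ᵀ :=
    Matrix.inv_eq_right_inv (rotR_mul_conjTranspose n)
  rw [r_eq, s_eq, Matrix.mul_inv_rev, h, Matrix.nonsing_inv_nonsing_inv _ J.S_unit, mul_assoc,
    ← mul_assoc J.S, Matrix.mul_nonsing_inv _ J.S_unit, one_mul]

/-- The outer factors U*/2 convert a' into b', leaving b'·(Γ - 1/2)b'. This generator raises the
vacuum covariance 1/2 to Γ. -/
theorem toFn_Q (R : Op n) :
    toFn n (J.Q Γ R) = genOp (rotV n) (Γ - (1 / 2 : ℝ) • 1) 0 (toFn n R) := by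
  have h1 : toFn n (J.Q Γ R) =
      ((-(1 / 2) : ℂ) • bilin ((J.r Γ)⁻¹ * J.s Γ) apOp apOp) (toFn n R) := by
    simp only [Q, bilin, map_smul, map_sum, toFn_aSup', LinearMap.smul_apply, LinearMap.sum_apply,
      Module.End.mul_apply]
  have h2 : (fun p => ∑ a, ((1 / 2 : ℂ) • rotRconj n)ᵀ a p • (apOp a : Module.End ℂ (Fn (Ix n)))) =
      bpOp (rotV n) := funext fun p => (bpOp_eq_sum_apOp p).symm
  have h3 : (fun p => ∑ a, ((1 / 2 : ℂ) • rotRconj n) p a • (apOp a : Module.End ℂ (Fn (Ix n)))) =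
      bpOp (rotV n) := funext fun p => (bpOp_eq_sum_apOp p).symm
  rw [h1, r_inv_mul_s, bilin_mul_left, bilin_mul_right, h2, h3, ← bilin_smul]
  congr 1
  have h4 : (-(1 / 2) : ℂ) • (1 - (2 : ℂ) • Γ.map Complex.ofReal) =
      (Γ - (1 / 2 : ℝ) • 1).map Complex.ofReal := by
    ext p q
    simp [Matrix.one_apply, apply_ite]
    split_ifs <;> ring
  rw [h4, genOp, bilin]
  simp only [Pi.zero_apply, Complex.ofReal_zero, zero_smul, Finset.sum_const_zero, zero_add,
    Matrix.map_apply]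

theorem toFn_dVec' (p : Ix n) (R : Op n) :
    toFn n (J.dVec' p R) = (∑ q, J.S q p • bpOp (rotV n) q) (toFn n R) := by
  simp only [dVec', map_sum, map_smul, toFn_bSup', LinearMap.sum_apply, LinearMap.smul_apply,
    Matrix.transpose_apply]

theorem toFn_dVec (p : Ix n) (R : Op n) : toFn n (J.dVec Γ p R) = (∑ q, J.S⁻¹ p q •
    (bOp (rotV n) q - (2 : ℂ) • ∑ s, (Γ q s : ℂ) • bpOp (rotV n) s)) (toFn n R) := by
  simp only [dVec, map_sum, map_smul, map_sub, toFn_bSup, toFn_bSup', LinearMap.sum_apply,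
    LinearMap.smul_apply, LinearMap.sub_apply]

/-- The creation operator `d'_{k,1}` of a zero mode on functions. -/
def zeroOp (k : J.ZeroIx) : Module.End ℂ (Fn (Ix n)) := ∑ q, J.col0 k q • bpOp (rotV n) q

theorem zeroOp_mem (k : J.ZeroIx) : J.zeroOp k ∈ ladderAlg (Ix n) :=
  Subalgebra.sum_mem _ fun q _ => Subalgebra.smul_mem _ (bpOp_mem q) _

theorem toFn_d0' (k : J.ZeroIx) (R : Op n) : toFn n (J.d0' k R) = J.zeroOp k (toFn n R) :=
  J.toFn_dVec' _ R

variable {Γ}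

/-- Although the zero-mode coefficients are complex, their combinations with the columns of S are
real for a shift, so the theory of real generators applies. -/
theorem toFn_zeroGen {c : J.ZeroIx → ℂ} {C : J.ZeroIx → J.ZeroIx → ℂ} {v : Ix n → ℝ}
    {Γ' : Matrix (Ix n) (Ix n) ℝ} (h : J.IsShift Γ c C v Γ') (R : Op n) :
    toFn n (J.zeroGen c C R) = genOp (rotV n) (Γ' - Γ) v (toFn n R) := by
  have h1 : genOp (rotV n) (Γ' - Γ) v =
      ∑ k, c k • J.zeroOp k + ∑ k, ∑ l, C k l • (J.zeroOp k * J.zeroOp l) := by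
    rw [genOp]
    congr 1
    · simp only [h.1, zeroOp, Finset.sum_smul, Finset.smul_sum, smul_smul]
      exact Finset.sum_comm
    · have h2 : ∀ p q, (((Γ' - Γ) p q : ℝ) : ℂ) = ∑ k, ∑ l, C k l * J.col0 k p * J.col0 l q := by
        intro p q
        rw [Matrix.sub_apply, Complex.ofReal_sub, h.2.1]
        ring
      simp only [h2, zeroOp, Finset.sum_mul_sum, smul_mul_smul_comm, Finset.sum_smul,
        Finset.smul_sum, smul_smul, ← mul_assoc]
      calc _ = ∑ p, ∑ k, ∑ q, ∑ l, (C k l * J.col0 k p * J.col0 l q) •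
              (bpOp (rotV n) p * bpOp (rotV n) q) :=
            Finset.sum_congr rfl fun p _ => Finset.sum_comm
        _ = ∑ k, ∑ p, ∑ q, ∑ l, (C k l * J.col0 k p * J.col0 l q) •
              (bpOp (rotV n) p * bpOp (rotV n) q) := Finset.sum_comm
        _ = ∑ k, ∑ p, ∑ l, ∑ q, (C k l * J.col0 k p * J.col0 l q) •
              (bpOp (rotV n) p * bpOp (rotV n) q) :=
            Finset.sum_congr rfl fun k _ => Finset.sum_congr rfl fun p _ => Finset.sum_comm
        _ = _ := Finset.sum_congr rfl fun k _ => Finset.sum_comm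
  rw [h1]
  simp only [zeroGen, map_add, map_sum, map_smul, toFn_d0', LinearMap.add_apply,
    LinearMap.sum_apply, LinearMap.smul_apply, Module.End.mul_apply]

end JordanForm

/-! ## Trace-class operators -/

section Hilbert

variable {E : Type*} [NormedAddCommGroup E] [InnerProductSpace ℂ E] [CompleteSpace E]

theorem norm_absOp_apply (T : E →L[ℂ] E) (x : E) : ‖absOp T x‖ = ‖T x‖ := by
  have h1 : (absOp T).IsPositive :=
    (ContinuousLinearMap.nonneg_iff_isPositive _).mp (CFC.abs_nonneg T)
  have h2 : absOp T * absOp T = star T * T := CFC.abs_mul_abs T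
  have h3 : ‖absOp T x‖ ^ 2 = ‖T x‖ ^ 2 := by
    rw [← inner_self_eq_norm_sq (𝕜 := ℂ), ← inner_self_eq_norm_sq (𝕜 := ℂ),
      ← ContinuousLinearMap.adjoint_inner_right, ← ContinuousLinearMap.adjoint_inner_right,
      h1.isSelfAdjoint.adjoint_eq]
    exact congrArg (fun A : E →L[ℂ] E => RCLike.re (inner ℂ x (A x))) h2
  exact (sq_eq_sq₀ (norm_nonneg _) (norm_nonneg _)).mp h3

theorem absOp_isPositive (T : E →L[ℂ] E) : (absOp T).IsPositive :=
  (ContinuousLinearMap.nonneg_iff_isPositive _).mp (CFC.abs_nonneg T)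

theorem isUnit_add_smul_one {P : E →L[ℂ] E} (hP : 0 ≤ P) {ε : ℝ} (hε : 0 < ε) :
    IsUnit (P + ε • (1 : E →L[ℂ] E)) := by
  have h : -ε ∉ spectrum ℝ P := fun h => by
    have := spectrum_nonneg_of_nonneg hP h
    linarith
  rw [spectrum.notMem_iff, Algebra.algebraMap_eq_smul_one] at h
  have h2 : P + ε • (1 : E →L[ℂ] E) = -((-ε) • (1 : E →L[ℂ] E) - P) := by module
  rw [h2]
  exact h.neg

/-- In the expansion of the squared norm the cross term is nonnegative. -/
theorem norm_apply_le_of_isPositive {P : E →L[ℂ] E} (hP : P.IsPositive) {ε : ℝ} (hε : 0 < ε)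
    (z : E) : ‖P z‖ ≤ ‖P z + ε • z‖ := by
  refine abs_le_of_sq_le_sq' ?_ (norm_nonneg _) |>.2
  have h1 : 0 ≤ RCLike.re (inner ℂ (P z) z) := (RCLike.nonneg_iff.mp (hP.inner_nonneg_left z)).1
  have h2 := norm_add_sq (𝕜 := ℂ) (P z) (ε • z)
  have h3 : RCLike.re (inner ℂ (P z) (ε • z)) = ε * RCLike.re (inner ℂ (P z) z) := by
    rw [← Complex.coe_smul, inner_smul_right]
    simp
  rw [h2, h3]
  nlinarith [mul_nonneg hε.le h1, sq_nonneg ‖ε • z‖]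

/-- Approximate polar decomposition `T ≈ K B` of a bounded operator, with `B = |T|^{1/2}`. -/
theorem exists_factorization (T : E →L[ℂ] E) : ∃ B : E →L[ℂ] E,
    (∀ x, ‖B x‖ ^ 2 = (inner ℂ x (absOp T x)).re) ∧ ∀ ε : ℝ, 0 < ε → ∃ K : E →L[ℂ] E,
      (∀ x, ‖K x‖ ≤ ‖B x‖) ∧ ∀ x, ‖T x - K (B x)‖ ≤ ε * ‖x‖ := by
  have hP0 : 0 ≤ absOp T := CFC.abs_nonneg T
  have hP : (absOp T).IsPositive := (ContinuousLinearMap.nonneg_iff_isPositive _).mp hP0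
  have hB0 : 0 ≤ CFC.sqrt (absOp T) := CFC.sqrt_nonneg _
  have hB : (CFC.sqrt (absOp T)).IsPositive := (ContinuousLinearMap.nonneg_iff_isPositive _).mp hB0
  have hBB : CFC.sqrt (absOp T) * CFC.sqrt (absOp T) = absOp T := CFC.sqrt_mul_sqrt_self _ hP0
  refine ⟨CFC.sqrt (absOp T), fun x => ?_, fun ε hε => ?_⟩
  · rw [← inner_self_eq_norm_sq (𝕜 := ℂ), ← ContinuousLinearMap.adjoint_inner_right,
      hB.isSelfAdjoint.adjoint_eq]
    exact congrArg (fun A : E →L[ℂ] E => RCLike.re (inner ℂ x (A x))) hBB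
  · obtain ⟨u, hu⟩ := isUnit_add_smul_one hP0 hε
    have hbound : ∀ y, ‖absOp T (((u⁻¹ : (E →L[ℂ] E)ˣ) : E →L[ℂ] E) y)‖ ≤ ‖y‖ := fun y => by
      refine (norm_apply_le_of_isPositive hP hε _).trans (le_of_eq ?_)
      have h : (absOp T + ε • (1 : E →L[ℂ] E)) * ((u⁻¹ : (E →L[ℂ] E)ˣ) : E →L[ℂ] E) = 1 := by
        rw [← hu, Units.mul_inv]
      exact congrArg norm (congrArg (fun A : E →L[ℂ] E => A y) h)
    -- A regularized polar decomposition: K = T(|T| + ε)⁻¹|T|^{1/2}. Its error T - K|T|^{1/2} equals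
    -- εT(|T| + ε)⁻¹, of norm at most ε because T and |T| have equal norms on vectors.
    refine ⟨T * ((u⁻¹ : (E →L[ℂ] E)ˣ) : E →L[ℂ] E) * CFC.sqrt (absOp T), fun x => ?_, fun x => ?_⟩
    · change ‖T (_)‖ ≤ _
      rw [← norm_absOp_apply]
      exact hbound _
    · have h1 : T - T * ((u⁻¹ : (E →L[ℂ] E)ˣ) : E →L[ℂ] E) * CFC.sqrt (absOp T) *
          CFC.sqrt (absOp T) = ε • (T * ((u⁻¹ : (E →L[ℂ] E)ˣ) : E →L[ℂ] E)) := by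
        have h2 : ((u⁻¹ : (E →L[ℂ] E)ˣ) : E →L[ℂ] E) * (absOp T + ε • (1 : E →L[ℂ] E)) = 1 := by
          rw [← hu, Units.inv_mul]
        rw [mul_assoc _ (CFC.sqrt _), hBB]
        calc _ = T * (((u⁻¹ : (E →L[ℂ] E)ˣ) : E →L[ℂ] E) * (absOp T + ε • (1 : E →L[ℂ] E)))
              - T * ((u⁻¹ : (E →L[ℂ] E)ˣ) : E →L[ℂ] E) * absOp T := by rw [h2, mul_one]
          _ = _ := by rw [mul_add, mul_add, mul_assoc, mul_smul_comm, mul_smul_comm, mul_one,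
                        add_sub_cancel_left]
      have h3 := congrArg (fun A : E →L[ℂ] E => A x) h1
      change T x - _ = ε • T _ at h3
      change ‖T x - _‖ ≤ _
      refine (congrArg norm h3).trans_le ?_
      rw [norm_smul, Real.norm_of_nonneg hε.le, ← norm_absOp_apply]
      exact mul_le_mul_of_nonneg_left (hbound x) hε.le

end Hilbert

theorem norm_ket (m : Occ n) : ‖ket m‖ = 1 := by
  rw [ket, lp.norm_single (by norm_num), norm_one]

theorem inner_ket_left (m : Occ n) (x : Fock n) : inner ℂ (ket m) x = x m := by
  rw [ket, lp.inner_single_left]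
  simp

theorem ket_apply (m k : Occ n) : (ket m : Occ n → ℂ) k = if k = m then 1 else 0 := by
  rw [ket, lp.single_apply, Pi.single_apply]

theorem hasSum_norm_sq (x : Fock n) : HasSum (fun m => ‖x m‖ ^ 2) (‖x‖ ^ 2) := by
  have h := lp.hasSum_norm (p := 2) (by norm_num) x
  simpa using h

/-- An operator and its adjoint have the same Hilbert-Schmidt norm. -/
theorem sum_norm_sq_adjoint_le (K : Fock n →L[ℂ] Fock n) {b : Occ n → ℝ} (hb : Summable b)
    (hK : ∀ m, ‖K (ket m)‖ ^ 2 ≤ b m) (s : Finset (Occ n)) :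
    ∑ m ∈ s, ‖K.adjoint (ket m)‖ ^ 2 ≤ ∑' m, b m := by
  have h1 : ∀ m k, ‖(K.adjoint (ket m) : Occ n → ℂ) k‖ = ‖(K (ket k) : Occ n → ℂ) m‖ := by
    intro m k
    rw [← inner_ket_left, ContinuousLinearMap.adjoint_inner_right, ← inner_conj_symm,
      inner_ket_left, RCLike.norm_conj]
  have h2 : HasSum (fun k => ∑ m ∈ s, ‖(K (ket k) : Occ n → ℂ) m‖ ^ 2)
      (∑ m ∈ s, ‖K.adjoint (ket m)‖ ^ 2) := by
    refine hasSum_sum fun m _ => ?_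
    simp only [← h1]
    exact hasSum_norm_sq _
  rw [← h2.tsum_eq]
  refine h2.summable.tsum_le_tsum (fun k => ?_) hb
  exact (((hasSum_norm_sq (K (ket k))).summable.sum_le_tsum s fun _ _ => sq_nonneg _).trans_eq
    (hasSum_norm_sq (K (ket k))).tsum_eq).trans (hK k)

/-- Generalized diagonals of a trace-class operator are absolutely summable. -/
theorem IsTraceClass.summable_norm {R : Op n} (hR : IsTraceClass R) {f g : Occ n → Occ n}
    (hf : f.Injective) (hg : g.Injective) : Summable fun m => ‖R (f m) (g m)‖ := by
  obtain ⟨T, hT, hs⟩ := hR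
  obtain ⟨B, hB, hK⟩ := exists_factorization T
  simp only [← hB] at hs
  set c := ∑' m, ‖B (ket m)‖ ^ 2
  refine summable_of_sum_le (c := c) (fun _ => norm_nonneg _) fun s => ?_
  refine le_of_forall_pos_le_add fun δ hδ => ?_
  -- The error is shared among the elements of `s`, so that in total it is at most `δ`; the added 1
  -- covers the empty set.
  obtain ⟨K, hKB, hKT⟩ := hK (δ / (s.card + 1)) (by positivity)
  have hterm : ∀ m, ‖R (f m) (g m)‖ ≤ δ / (s.card + 1) +
      ((1 / 2) * ‖K.adjoint (ket (f m))‖ ^ 2 + (1 / 2) * ‖B (ket (g m))‖ ^ 2) := by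
    intro m
    -- Up to the error the entry is ⟨K†f(m), B g(m)⟩, bounded by half the sum of two Hilbert-Schmidt
    -- contributions. Injectivity of `f` and `g` ensures that no basis vector is counted twice.
    have h1 : R (f m) (g m) = inner ℂ (ket (f m)) (T (ket (g m)) - K (B (ket (g m)))) +
        inner ℂ (K.adjoint (ket (f m))) (B (ket (g m))) := by
      rw [ContinuousLinearMap.adjoint_inner_left, ← inner_add_right, sub_add_cancel,
        inner_ket_left, hT]
    rw [h1]
    refine (norm_add_le _ _).trans (add_le_add ?_ ?_)
    · refine (norm_inner_le_norm _ _).trans ?_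
      rw [norm_ket, one_mul]
      exact (hKT _).trans_eq (by rw [norm_ket, mul_one])
    · refine (norm_inner_le_norm _ _).trans ?_
      nlinarith [sq_nonneg (‖K.adjoint (ket (f m))‖ - ‖B (ket (g m))‖)]
  refine (Finset.sum_le_sum fun m _ => hterm m).trans ?_
  rw [Finset.sum_add_distrib, Finset.sum_add_distrib, ← Finset.mul_sum, ← Finset.mul_sum]
  have h1 : ∑ m ∈ s, ‖K.adjoint (ket (f m))‖ ^ 2 ≤ c := by
    rw [← Finset.sum_image (f := fun m => ‖K.adjoint (ket m)‖ ^ 2) (g := f) (hf.injOn)]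
    exact sum_norm_sq_adjoint_le K hs
      (fun m => pow_le_pow_left₀ (norm_nonneg _) (hKB _) 2) _
  have h2 : ∑ m ∈ s, ‖B (ket (g m))‖ ^ 2 ≤ c := by
    rw [← Finset.sum_image (f := fun m => ‖B (ket m)‖ ^ 2) (g := g) (hg.injOn)]
    exact hs.sum_le_tsum _ fun _ _ => sq_nonneg _
  have h3 : ∑ m ∈ s, δ / (s.card + 1 : ℝ) ≤ δ := by
    rw [Finset.sum_const, nsmul_eq_mul, mul_div_assoc', div_le_iff₀ (by positivity)]
    nlinarith
  linarith

/-- The bounded operator with absolutely summable matrix elements `R`. -/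
theorem exists_represents {R : Op n} (hR : Summable fun x : Occ n × Occ n => ‖R x.1 x.2‖) :
    ∃ T, Represents T R := by
  let S : Occ n × Occ n → Fock n →L[ℂ] Fock n := fun x =>
    R x.1 x.2 • (innerSL ℂ (ket x.2)).smulRight (ket x.1)
  have hS : Summable S := by
    refine .of_norm_bounded hR fun x => ?_
    rw [norm_smul, ContinuousLinearMap.norm_smulRight_apply, innerSL_apply_norm, norm_ket,
      norm_ket, mul_one, mul_one]
  refine ⟨∑' x, S x, fun m m' => ?_⟩
  have h1 : HasSum (fun x => inner ℂ (ket m) (S x (ket m')))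
      (inner ℂ (ket m) ((∑' x, S x) (ket m'))) :=
    (hS.hasSum.mapL (ContinuousLinearMap.apply ℂ (Fock n) (ket m'))).mapL (innerSL ℂ (ket m))
  have h2 : ∀ x, inner ℂ (ket m) (S x (ket m')) =
      if x = (m, m') then R m m' else 0 := by
    rintro ⟨k, k'⟩
    change inner ℂ (ket m) (R k k' • ((inner ℂ (ket k') (ket m')) • ket k)) = _
    rw [inner_smul_right, inner_smul_right, inner_ket_left, inner_ket_left, ket_apply, ket_apply]
    by_cases h : k = m
    · by_cases h' : k' = m'
      · subst h h'
        simp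
      · simp [h']
    · simp [h, Ne.symm h]
  simp only [h2] at h1
  rw [← inner_ket_left, ← h1.tsum_eq, tsum_ite_eq]

/-- ⟨m||T||m⟩ is at most the norm of |T||m⟩, which equals that of T|m⟩, the ℓ² norm of a column; the
ℓ¹ norm dominates it. -/
theorem isTraceClass_of_summable {R : Op n}
    (hR : Summable fun x : Occ n × Occ n => ‖R x.1 x.2‖) : IsTraceClass R := by
  obtain ⟨T, hT⟩ := exists_represents hR
  have hcol : Summable fun m' => ∑' m, ‖R m m'‖ :=
    ((Equiv.prodComm _ _).summable_iff.mpr hR).prod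
  have hcol' : ∀ m', Summable fun m => ‖R m m'‖ := fun m' =>
    ((Equiv.prodComm _ _).summable_iff.mpr hR).prod_factor m'
  refine ⟨T, hT, .of_nonneg_of_le (fun m => ?_) (fun m => ?_) hcol⟩
  · exact (Complex.nonneg_iff.mp ((absOp_isPositive T).inner_nonneg_right _)).1
  · refine ((Complex.re_le_norm _).trans (norm_inner_le_norm _ _)).trans ?_
    rw [norm_ket, one_mul, norm_absOp_apply]
    have h0 : 0 ≤ ∑' k, ‖R k m‖ := tsum_nonneg fun _ => norm_nonneg _
    refine lp.norm_le_of_forall_sum_le (by norm_num) h0 fun s => ?_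
    have h2 : (2 : ENNReal).toReal = ((2 : ℕ) : ℝ) := by norm_num
    simp only [h2, Real.rpow_natCast, hT _ m]
    exact (Finset.sum_sq_le_sq_sum_of_nonneg fun _ _ => norm_nonneg _).trans
      (pow_le_pow_left₀ (Finset.sum_nonneg fun _ _ => norm_nonneg _)
        ((hcol' m).sum_le_tsum s fun _ _ => norm_nonneg _) 2)

theorem IsTraceClass.summable_diag {R : Op n} (hR : IsTraceClass R) : Summable fun m => R m m :=
  (hR.summable_norm Function.injective_id Function.injective_id).of_norm

/-! ## The trace annihilates commutators -/

/-- A nonzero limit would force g(N) ≥ c/(N+1) eventually, contradicting the divergence of the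
harmonic series. -/
theorem eq_zero_of_norm_le_mul_summable {u : ℕ → ℂ} {L : ℂ} (hu : Filter.Tendsto u Filter.atTop (nhds L))
    {g : ℕ → ℝ} (hg : Summable g) (h : ∀ N : ℕ, ‖u N‖ ≤ (N + 1) * g N) : L = 0 := by
  by_contra hL
  have hc : 0 < ‖L‖ / 2 := by positivity
  have hev : ∀ᶠ N in Filter.atTop, ‖L‖ / 2 < ‖u N‖ :=
    hu.norm.eventually (lt_mem_nhds (half_lt_self (norm_pos_iff.mpr hL)))
  have h1 : Summable fun N : ℕ => (‖L‖ / 2) * (1 / ((N : ℝ) + 1)) := by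
    refine summable_of_isBigO_nat hg (Asymptotics.IsBigO.of_bound 1 ?_)
    filter_upwards [hev] with N hN
    have hN1 : (0 : ℝ) < (N : ℝ) + 1 := by positivity
    have h2 : ‖L‖ / 2 * (1 / ((N : ℝ) + 1)) ≤ g N := by
      rw [mul_one_div, div_le_iff₀ hN1, mul_comm]
      exact hN.le.trans (h N)
    rw [Real.norm_of_nonneg (by positivity), one_mul]
    exact h2.trans (le_abs_self _)
  have h3 := (summable_mul_left_iff hc.ne').mp h1
  have h4 := (summable_nat_add_iff (f := fun N : ℕ => 1 / (N : ℝ)) 1).mp (by simpa using h3)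
  exact Real.not_summable_one_div_natCast h4

theorem tendsto_sum_level {f : Occ n → ℂ} (hf : Summable f) :
    Filter.Tendsto (fun N => ∑ k ∈ Finset.range (N + 1), ∑ m ∈ level (Fin n) k, f m) Filter.atTop
      (nhds (∑' m, f m)) := by
  have h1 : ∀ N, ∑ k ∈ Finset.range (N + 1), ∑ m ∈ level (Fin n) k, f m =
      ∑ m ∈ (Finset.range (N + 1)).biUnion (level (Fin n)), f m := by
    intro N
    rw [Finset.sum_biUnion]
    intro a _ b _ hab
    rw [Function.onFun, Finset.disjoint_left]
    intro i hi hi'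
    exact hab ((mem_level.mp hi).symm.trans (mem_level.mp hi'))
  simp only [h1]
  refine hf.hasSum.comp (Filter.tendsto_atTop_finset_of_monotone (fun a b hab => ?_) fun m => ?_)
  · exact Finset.biUnion_subset_biUnion_of_subset_left _
      (Finset.range_mono (Nat.succ_le_succ hab))
  · exact ⟨deg m, Finset.mem_biUnion.mpr ⟨deg m, Finset.self_mem_range_succ _, mem_level.mpr rfl⟩⟩

theorem summable_sum_level {f : Occ n → ℝ} (hf : Summable f) (h0 : ∀ m, 0 ≤ f m) :
    Summable fun N => ∑ m ∈ level (Fin n) N, f m := by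
  refine summable_of_sum_range_le (c := ∑' m, f m)
    (fun N => Finset.sum_nonneg fun _ _ => h0 _) fun N => ?_
  rw [← Finset.sum_biUnion]
  · exact hf.sum_le_tsum _ fun _ _ => h0 _
  · intro a _ b _ hab
    rw [Function.onFun, Finset.disjoint_left]
    intro i hi hi'
    exact hab ((mem_level.mp hi).symm.trans (mem_level.mp hi'))

/-- Shifting mode `j` by one particle identifies the gain at degree k + 1 with the loss at degree k;
only the loss at the last degree remains. -/
theorem sum_range_level_telescope (j : Fin n) (g : Occ n → ℂ) (N : ℕ) :
    ∑ k ∈ Finset.range (N + 1), ∑ m ∈ level (Fin n) k,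
      (((Real.sqrt (m j) : ℝ) : ℂ) * g (m - Pi.single j 1)
        - ((Real.sqrt (m j + 1) : ℝ) : ℂ) * g m) =
      -∑ m ∈ level (Fin n) N, ((Real.sqrt (m j + 1) : ℝ) : ℂ) * g m := by
  induction N with
  | zero =>
    rw [Finset.sum_range_one, Finset.sum_sub_distrib, sub_eq_neg_self]
    refine Finset.sum_eq_zero fun m hm => ?_
    have h : m j = 0 := Nat.le_zero.mp ((le_deg m j).trans (mem_level.mp hm).le)
    simp [h]
  | succ N ih =>
    rw [Finset.sum_range_succ, ih, Finset.sum_sub_distrib, sum_level_succ N j]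
    · simp only [Pi.add_apply, Pi.single_eq_same, add_tsub_cancel_right, Nat.cast_add, Nat.cast_one]
      ring
    · intro i hi
      simp [hi]

/-- The combination of off-diagonal elements that enters the diagonal of `∑ xₐ a'ₐ R`. -/
def offDiag (x : Ix n → ℂ) (R : Op n) (j : Fin n) (m : Occ n) : ℂ :=
  x (Sum.inl j) * R m (m + Pi.single j 1) + x (Sum.inr j) * R (m + Pi.single j 1) m

theorem diag_sum_apOp {R D : Op n} {x : Ix n → ℂ}
    (hD : toFn n D = (∑ a, x a • apOp a) (toFn n R)) (m : Occ n) :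
    D m m = ∑ j, (((Real.sqrt (m j) : ℝ) : ℂ) * offDiag x R j (m - Pi.single j 1)
      - ((Real.sqrt (m j + 1) : ℝ) : ℂ) * offDiag x R j m) := by
  rw [← toFn_elim D, hD, LinearMap.sum_apply, Finset.sum_apply, Fintype.sum_sum_type,
    ← Finset.sum_add_distrib]
  refine Finset.sum_congr rfl fun j _ => ?_
  have e1 : (apOp (Sum.inl j) : Module.End ℂ (Fn (Ix n))) =
      rai (Sum.inl j) - low (Sum.inr j) := rfl
  have e2 : (apOp (Sum.inr j) : Module.End ℂ (Fn (Ix n))) =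
      rai (Sum.inr j) - low (Sum.inl j) := rfl
  simp only [e1, e2, LinearMap.smul_apply, LinearMap.sub_apply, Pi.smul_apply, Pi.sub_apply,
    rai_apply, low_apply, elim_sub_single_inl, elim_sub_single_inr, elim_add_single_inl,
    elim_add_single_inr, toFn_elim, Sum.elim_inl, Sum.elim_inr, smul_eq_mul, offDiag]
  rcases Nat.eq_zero_or_pos (m j) with h | h
  · simp only [h, Nat.cast_zero, Real.sqrt_zero, Complex.ofReal_zero, zero_mul]
    ring
  · rw [sub_single_add_single h]
    ring

theorem sum_range_level_sum_apOp {R D : Op n} {x : Ix n → ℂ}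
    (hD : toFn n D = (∑ a, x a • apOp a) (toFn n R)) (N : ℕ) :
    ∑ k ∈ Finset.range (N + 1), ∑ m ∈ level (Fin n) k, D m m =
      -∑ m ∈ level (Fin n) N, ∑ j, ((Real.sqrt (m j + 1) : ℝ) : ℂ) * offDiag x R j m := by
  simp only [diag_sum_apOp hD]
  calc _ = ∑ k ∈ Finset.range (N + 1), ∑ j, ∑ m ∈ level (Fin n) k,
        (((Real.sqrt (m j) : ℝ) : ℂ) * offDiag x R j (m - Pi.single j 1)
          - ((Real.sqrt (m j + 1) : ℝ) : ℂ) * offDiag x R j m) :=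
        Finset.sum_congr rfl fun k _ => Finset.sum_comm
    _ = ∑ j, ∑ k ∈ Finset.range (N + 1), ∑ m ∈ level (Fin n) k,
        (((Real.sqrt (m j) : ℝ) : ℂ) * offDiag x R j (m - Pi.single j 1)
          - ((Real.sqrt (m j + 1) : ℝ) : ℂ) * offDiag x R j m) := Finset.sum_comm
    _ = ∑ j, -∑ m ∈ level (Fin n) N, ((Real.sqrt (m j + 1) : ℝ) : ℂ) * offDiag x R j m :=
        Finset.sum_congr rfl fun j _ => sum_range_level_telescope j (offDiag x R j) N
    _ = _ := by rw [Finset.sum_neg_distrib, Finset.sum_comm]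

/-- The trace annihilates linear combinations of the `a'`. -/
theorem hasTrace_zero_of_eq_sum_apOp {R D : Op n} {x : Ix n → ℂ}
    (hD : toFn n D = (∑ a, x a • apOp a) (toFn n R)) (hR : IsTraceClass R)
    (hDt : IsTraceClass D) : HasTrace D 0 := by
  refine ⟨hDt, ?_⟩
  -- The boundary terms are next-to-diagonal entries of `R`, summable because generalized diagonals
  -- of trace-class operators are. Their weight √(m_j + 1) is at most N + 1 on level N.
  set h : Occ n → ℝ := fun m => ∑ j, (‖x (Sum.inl j)‖ * ‖R m (m + Pi.single j 1)‖
    + ‖x (Sum.inr j)‖ * ‖R (m + Pi.single j 1) m‖) with hh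
  have hs : Summable h := by
    refine summable_sum fun j _ => ?_
    exact ((hR.summable_norm Function.injective_id (add_left_injective _)).mul_left _).add
      ((hR.summable_norm (add_left_injective _) Function.injective_id).mul_left _)
  have h0 : ∀ m, 0 ≤ h m := fun m => Finset.sum_nonneg fun j _ => by positivity
  have hL := eq_zero_of_norm_le_mul_summable (tendsto_sum_level hDt.summable_diag)
    (summable_sum_level hs h0) fun N => ?_
  · rw [← hL]
    exact hDt.summable_diag.hasSum
  · rw [sum_range_level_sum_apOp hD, norm_neg, Finset.mul_sum]
    refine norm_sum_le_of_le _ fun m hm => ?_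
    rw [hh, Finset.mul_sum]
    refine norm_sum_le_of_le _ fun j _ => ?_
    rw [norm_mul, Complex.norm_real, Real.norm_of_nonneg (Real.sqrt_nonneg _)]
    have h2 : (m j : ℝ) ≤ N := by
      exact_mod_cast (le_deg m j).trans (mem_level.mp hm).le
    have h1 : Real.sqrt (m j + 1) ≤ N + 1 := by
      rw [Real.sqrt_le_left (by positivity)]
      nlinarith [(Nat.cast_nonneg (m j) : (0 : ℝ) ≤ m j)]
    refine mul_le_mul h1 ?_ (norm_nonneg _) (by positivity)
    refine (norm_add_le _ _).trans_eq ?_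
    rw [norm_mul, norm_mul]

theorem sum_bpOp_eq_sum_apOp (x : Ix n → ℂ) : ∃ y : Ix n → ℂ,
    ∑ q, x q • bpOp (rotV n) q = ∑ a, y a • apOp a := by
  refine ⟨fun a => ∑ q, x q * ((1 / 2 : ℂ) • rotRconj n) q a, ?_⟩
  simp only [bpOp_eq_sum_apOp, Finset.smul_sum, smul_smul, Finset.sum_smul]
  exact Finset.sum_comm

theorem JordanForm.hasTrace_dVec' {X : Matrix (Ix n) (Ix n) ℂ} (J : JordanForm X) (p : Ix n)
    {R : Op n} (hR : IsTraceClass R) (hD : IsTraceClass (J.dVec' p R)) :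
    HasTrace (J.dVec' p R) 0 := by
  obtain ⟨y, hy⟩ := sum_bpOp_eq_sum_apOp fun q => J.S q p
  exact hasTrace_zero_of_eq_sum_apOp ((J.toFn_dVec' p R).trans (by rw [hy])) hR hD

/-! ## Functions of exponential decay -/

/-- Exponential decay of a single function. -/
def Decays (X : Fn (Ix n)) : Prop := ExpDecay fun _ : Unit => X

theorem Decays.apply {X : Fn (Ix n)} (hX : Decays X) {T : Module.End ℂ (Fn (Ix n))}
    (hT : T ∈ ladderAlg (Ix n)) : Decays (T X) := ExpDecay.apply hX hT

theorem Decays.add {X Y : Fn (Ix n)} (hX : Decays X) (hY : Decays Y) : Decays (X + Y) :=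
  ExpDecay.add hX hY

theorem Decays.smul {X : Fn (Ix n)} (hX : Decays X) (c : ℂ) : Decays (c • X) :=
  ExpDecay.smul hX (c := fun _ => c) (K := ‖c‖) fun _ => le_rfl

theorem Decays.summable {X : Fn (Ix n)} (hX : Decays X) :
    Summable fun x : Occ n × Occ n => ‖X (Sum.elim x.1 x.2)‖ := by
  obtain ⟨C, r, -, hr0, hr1, h⟩ := hX
  have h1 : Summable fun i : Ix n → ℕ => ‖X i‖ :=
    .of_nonneg_of_le (fun _ => norm_nonneg _) (h ()) ((summable_geometric_deg hr0.le hr1).mul_left C)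
  exact (Equiv.summable_iff (Equiv.sumArrowEquivProdArrow (Fin n) (Fin n) ℕ).symm).mpr h1

theorem isTraceClass_of_decays {R : Op n} (h : Decays (toFn n R)) : IsTraceClass R :=
  isTraceClass_of_summable h.summable

theorem Decays.isTraceClass {X : Fn (Ix n)} (h : Decays X) : IsTraceClass ((toFn n).symm X) :=
  isTraceClass_of_summable h.summable

theorem decays_foldr (l : List (Ix n)) {R : Op n} (h : Decays (toFn n R)) :
    Decays (toFn n (l.foldr (fun p A => maj p ⋆ₒ A) R)) := by
  induction l with
  | nil => exact h
  | cons p l ih =>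
    rw [List.foldr_cons, toFn_maj_opMul]
    exact ih.apply (lw_mem p)

theorem decays_foldl (l : List (Ix n)) {R : Op n} (h : Decays (toFn n R)) :
    Decays (toFn n (l.foldl (fun A q => A ⋆ₒ maj q) R)) := by
  induction l generalizing R with
  | nil => exact h
  | cons p l ih =>
    rw [List.foldl_cons]
    refine ih ?_
    rw [toFn_opMul_maj]
    exact h.apply (rw'_mem p)

theorem isRegularOp_of_decays {R : Op n} (h : Decays (toFn n R)) : IsRegularOp R := fun l l' =>
  isTraceClass_of_decays (decays_foldl l' (decays_foldr l h))

/-- The trace. -/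
def tr (X : Fn (Ix n)) : ℂ := ∑' m : Occ n, X (Sum.elim m m)

theorem Decays.hasSum {X : Fn (Ix n)} (hX : Decays X) :
    HasSum (fun m : Occ n => X (Sum.elim m m)) (tr X) :=
  hX.isTraceClass.summable_diag.hasSum

theorem hasTrace_of_decays {R : Op n} (h : Decays (toFn n R)) : HasTrace R (tr (toFn n R)) :=
  ⟨isTraceClass_of_decays h, h.hasSum⟩

theorem tr_add {X Y : Fn (Ix n)} (hX : Decays X) (hY : Decays Y) : tr (X + Y) = tr X + tr Y :=
  (hX.hasSum.add hY.hasSum).tsum_eq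

theorem tr_smul (c : ℂ) (X : Fn (Ix n)) : tr (c • X) = c * tr X := tsum_mul_left

theorem tr_sum_bpOp {X : Fn (Ix n)} (hX : Decays X) (x : Ix n → ℂ) :
    tr ((∑ q, x q • bpOp (rotV n) q) X) = 0 := by
  obtain ⟨y, hy⟩ := sum_bpOp_eq_sum_apOp x
  have h1 : Decays ((∑ q, x q • bpOp (rotV n) q) X) := hX.apply
    (Subalgebra.sum_mem _ fun q _ => Subalgebra.smul_mem _ (bpOp_mem q) _)
  refine HasSum.tsum_eq (hasTrace_zero_of_eq_sum_apOp (R := (toFn n).symm X)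
    (D := (toFn n).symm ((∑ q, x q • bpOp (rotV n) q) X)) (x := y) ?_
    hX.isTraceClass h1.isTraceClass).2
  rw [hy, LinearEquiv.apply_symm_apply, LinearEquiv.apply_symm_apply]

theorem tr_bpOp {X : Fn (Ix n)} (hX : Decays X) (p : Ix n) : tr (bpOp (rotV n) p X) = 0 := by
  have h := tr_sum_bpOp hX (Pi.single p 1)
  rwa [Finset.sum_eq_single p (fun q _ hq => by rw [Pi.single_eq_of_ne hq, zero_smul])
    (fun h => absurd (Finset.mem_univ p) h), Pi.single_eq_same, one_smul] at h

theorem epsOp_mem (p : Ix n) : epsOp p ∈ ladderAlg (Ix n) :=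
  Subalgebra.sum_mem _ fun q _ => Subalgebra.smul_mem _ (bpOp_mem q) _

theorem tr_epsOp {X : Fn (Ix n)} (hX : Decays X) (p : Ix n) : tr (epsOp p X) = 0 :=
  tr_sum_bpOp hX _

/-- The commutator part ε is a combination of the b' and has trace zero. -/
theorem tr_lw {X : Fn (Ix n)} (hX : Decays X) (p : Ix n) :
    tr (lw p X) = isqrt2 * tr (bOp (rotV n) p X) := by
  have h := hX.apply (epsOp_mem p)
  rw [lw_eq, LinearMap.smul_apply, LinearMap.add_apply, tr_smul,
    tr_add (hX.apply (bOp_mem p)) h, tr_epsOp hX, add_zero]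

/-! ## Quadratic bounds for real matrices -/

section Bounds

variable {ι : Type*} [DecidableEq ι] [Fintype ι]

theorem dotProduct_self_nonneg' (x : ι → ℝ) : 0 ≤ x ⬝ᵥ x :=
  Finset.sum_nonneg fun p _ => mul_self_nonneg (x p)

theorem dotProduct_self_eq_sum_sq (x : ι → ℝ) : x ⬝ᵥ x = ∑ p, x p ^ 2 := by
  simp only [dotProduct, sq]

theorem dotProduct_mulVec_comm {M : Matrix ι ι ℝ} (hM : M.IsSymm) (x y : ι → ℝ) :
    x ⬝ᵥ M *ᵥ y = y ⬝ᵥ M *ᵥ x := by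
  rw [dotProduct_comm, ← Matrix.vecMul_transpose, hM.eq, Matrix.dotProduct_mulVec]

theorem exists_mulVec_sq_le (N : Matrix ι ι ℝ) :
    ∃ C, 0 ≤ C ∧ ∀ x, (N *ᵥ x) ⬝ᵥ (N *ᵥ x) ≤ C * (x ⬝ᵥ x) := by
  refine ⟨∑ p, ∑ q, N p q ^ 2, Finset.sum_nonneg fun _ _ => Finset.sum_nonneg fun _ _ => sq_nonneg _,
    fun x => ?_⟩
  rw [dotProduct_self_eq_sum_sq, dotProduct_self_eq_sum_sq, Finset.sum_mul]
  exact Finset.sum_le_sum fun p _ => Finset.sum_mul_sq_le_sq_mul_sq _ _ _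

theorem exists_dotProduct_mulVec_le (N : Matrix ι ι ℝ) :
    ∃ C, 0 < C ∧ ∀ x, x ⬝ᵥ N *ᵥ x ≤ C * (x ⬝ᵥ x) := by
  obtain ⟨C, hC, h⟩ := exists_mulVec_sq_le N
  refine ⟨C + 1, by linarith, fun x => ?_⟩
  have h1 := dotProduct_self_nonneg' (N *ᵥ x - x)
  have h2 := h x
  rw [sub_dotProduct, dotProduct_sub, dotProduct_sub, dotProduct_comm (N *ᵥ x) x] at h1
  linarith [dotProduct_self_nonneg' x, mul_nonneg hC (dotProduct_self_nonneg' x)]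

theorem posDef_isSymm {M : Matrix ι ι ℝ} (hM : M.PosDef) : M.IsSymm := by
  have h := hM.isHermitian
  rwa [Matrix.IsHermitian, Matrix.conjTranspose_eq_transpose_of_trivial] at h

theorem posDef_isUnit_det {M : Matrix ι ι ℝ} (hM : M.PosDef) : IsUnit M.det :=
  (Matrix.isUnit_iff_isUnit_det M).mp hM.isUnit

theorem posDef_nonneg {M : Matrix ι ι ℝ} (hM : M.PosDef) (x : ι → ℝ) : 0 ≤ x ⬝ᵥ M *ᵥ x := by
  have := hM.posSemidef.dotProduct_mulVec_nonneg x
  rwa [star_trivial] at this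

theorem exists_le_dotProduct_mulVec {M : Matrix ι ι ℝ} (hM : M.PosDef) :
    ∃ γ, 0 < γ ∧ ∀ x, γ * (x ⬝ᵥ x) ≤ x ⬝ᵥ M *ᵥ x := by
  obtain ⟨C, hC, h⟩ := exists_dotProduct_mulVec_le M⁻¹
  refine ⟨C⁻¹, by positivity, fun x => ?_⟩
  -- Expanding the form at x - C⁻¹M⁻¹x and using M⁻¹ ≤ C gives the lower bound C⁻¹ without any
  -- spectral theory.
  have h1 := posDef_nonneg hM (x - C⁻¹ • M⁻¹ *ᵥ x)
  have hMM : M *ᵥ M⁻¹ *ᵥ x = x := by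
    rw [Matrix.mulVec_mulVec, Matrix.mul_nonsing_inv _ (posDef_isUnit_det hM), Matrix.one_mulVec]
  rw [Matrix.mulVec_sub, Matrix.mulVec_smul, hMM, sub_dotProduct, dotProduct_sub, dotProduct_sub,
    smul_dotProduct, smul_dotProduct, dotProduct_smul, dotProduct_smul,
    dotProduct_mulVec_comm (posDef_isSymm hM) (M⁻¹ *ᵥ x) x, hMM, dotProduct_comm (M⁻¹ *ᵥ x) x] at h1
  simp only [smul_eq_mul] at h1
  have h2 : C⁻¹ * (C⁻¹ * (x ⬝ᵥ M⁻¹ *ᵥ x)) ≤ C⁻¹ * (x ⬝ᵥ x) := by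
    refine mul_le_mul_of_nonneg_left ?_ (by positivity)
    rw [inv_mul_le_iff₀ hC]
    exact h x
  linarith

/-- Interpolation between two covariance matrices. -/
def covPath (Γ₀ Γ₁ : Matrix ι ι ℝ) (t : ℝ) : Matrix ι ι ℝ := Γ₀ + t • (Γ₁ - Γ₀)

theorem covPath_zero (Γ₀ Γ₁ : Matrix ι ι ℝ) : covPath Γ₀ Γ₁ 0 = Γ₀ := by simp [covPath]

theorem covPath_one (Γ₀ Γ₁ : Matrix ι ι ℝ) : covPath Γ₀ Γ₁ 1 = Γ₁ := by simp [covPath]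

theorem covPath_eq (Γ₀ Γ₁ : Matrix ι ι ℝ) (t : ℝ) :
    covPath Γ₀ Γ₁ t = (1 - t) • Γ₀ + t • Γ₁ := by
  rw [covPath]
  module

theorem dotProduct_covPath (Γ₀ Γ₁ : Matrix ι ι ℝ) (t : ℝ) (x : ι → ℝ) :
    x ⬝ᵥ covPath Γ₀ Γ₁ t *ᵥ x = (1 - t) * (x ⬝ᵥ Γ₀ *ᵥ x) + t * (x ⬝ᵥ Γ₁ *ᵥ x) := by
  rw [covPath_eq, Matrix.add_mulVec, Matrix.smul_mulVec, Matrix.smul_mulVec, dotProduct_add,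
    dotProduct_smul, dotProduct_smul, smul_eq_mul, smul_eq_mul]

variable {Γ₀ Γ₁ : Matrix ι ι ℝ}

theorem posDef_covPath (h₀ : Γ₀.PosDef) (h₁ : Γ₁.PosDef) {t : ℝ} (ht : t ∈ Set.Icc (0 : ℝ) 1) :
    (covPath Γ₀ Γ₁ t).PosDef := by
  rcases ht.1.eq_or_lt with h | h
  · rwa [← h, covPath_zero]
  · rw [covPath_eq]
    exact Matrix.PosDef.posSemidef_add (h₀.posSemidef.smul (sub_nonneg.mpr ht.2)) (h₁.smul h)

theorem posDef_add_half {Γ : Matrix ι ι ℝ} (h : Γ.PosDef) : (Γ + (1 / 2 : ℝ) • 1).PosDef :=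
  h.add_posSemidef (Matrix.PosSemidef.one.smul (by norm_num))

theorem add_half_mulVec (Γ : Matrix ι ι ℝ) (z : ι → ℝ) :
    (Γ + (1 / 2 : ℝ) • 1) *ᵥ z = Γ *ᵥ z + (1 / 2 : ℝ) • z := by
  rw [Matrix.add_mulVec, Matrix.smul_mulVec, Matrix.one_mulVec]

/-- Writing x = Γz + z/2, the terms ‖Γz‖² and z·Γz in ‖x‖² are nonnegative, leaving at least ‖z‖²/4.
-/
theorem inv_add_half_sq_le {Γ : Matrix ι ι ℝ} (h : Γ.PosDef) (x : ι → ℝ) :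
    ((Γ + (1 / 2 : ℝ) • 1)⁻¹ *ᵥ x) ⬝ᵥ ((Γ + (1 / 2 : ℝ) • 1)⁻¹ *ᵥ x) ≤ 4 * (x ⬝ᵥ x) := by
  set z := (Γ + (1 / 2 : ℝ) • 1)⁻¹ *ᵥ x with hz
  have hx : x = Γ *ᵥ z + (1 / 2 : ℝ) • z := by
    rw [← add_half_mulVec, hz, Matrix.mulVec_mulVec,
      Matrix.mul_nonsing_inv _ (posDef_isUnit_det (posDef_add_half h)), Matrix.one_mulVec]
  rw [hx, add_dotProduct, dotProduct_add, dotProduct_add, smul_dotProduct, smul_dotProduct,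
    dotProduct_smul, dotProduct_smul, dotProduct_comm (Γ *ᵥ z) z, smul_eq_mul, smul_eq_mul,
    smul_eq_mul]
  linarith [posDef_nonneg h z, dotProduct_self_nonneg' (Γ *ᵥ z)]

/-- With x = (Γ + 1/2)z, the squared norm of x - z is exactly ‖x‖² - 2 z·Γz ≤ ‖x‖² - 2γ‖z‖², and
‖z‖² is at least ‖x‖²/C. The quotient C/(C + 2γ) dominates 1 - 2γ/C and makes sense for C = 0. -/
theorem one_sub_inv_sq_le {Γ : Matrix ι ι ℝ} (h : Γ.PosDef) {γ C : ℝ} (hγ : 0 < γ) (hC : 0 ≤ C)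
    (h1 : ∀ z, γ * (z ⬝ᵥ z) ≤ z ⬝ᵥ Γ *ᵥ z)
    (h2 : ∀ z, ((Γ + (1 / 2 : ℝ) • 1) *ᵥ z) ⬝ᵥ ((Γ + (1 / 2 : ℝ) • 1) *ᵥ z) ≤ C * (z ⬝ᵥ z))
    (x : ι → ℝ) :
    ((1 - (Γ + (1 / 2 : ℝ) • 1)⁻¹) *ᵥ x) ⬝ᵥ ((1 - (Γ + (1 / 2 : ℝ) • 1)⁻¹) *ᵥ x) ≤
      (C / (C + 2 * γ)) * (x ⬝ᵥ x) := by
  set z := (Γ + (1 / 2 : ℝ) • 1)⁻¹ *ᵥ x with hz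
  have hxP : x = (Γ + (1 / 2 : ℝ) • 1) *ᵥ z := by
    rw [hz, Matrix.mulVec_mulVec,
      Matrix.mul_nonsing_inv _ (posDef_isUnit_det (posDef_add_half h)), Matrix.one_mulVec]
  have hx : x = Γ *ᵥ z + (1 / 2 : ℝ) • z := hxP.trans (add_half_mulVec Γ z)
  have hxx : x ⬝ᵥ x ≤ C * (z ⬝ᵥ z) := by
    rw [hxP]
    exact h2 z
  have hxz : x ⬝ᵥ z = z ⬝ᵥ Γ *ᵥ z + (1 / 2) * (z ⬝ᵥ z) := by
    rw [hx, add_dotProduct, smul_dotProduct, smul_eq_mul, dotProduct_comm]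
  rw [Matrix.sub_mulVec, Matrix.one_mulVec, ← hz, sub_dotProduct, dotProduct_sub, dotProduct_sub,
    dotProduct_comm z x, hxz, div_mul_eq_mul_div C, le_div_iff₀ (by positivity)]
  have h3 := h1 z
  have h4 := dotProduct_self_nonneg' z
  nlinarith [mul_le_mul_of_nonneg_left h3 (by positivity : (0 : ℝ) ≤ C + 2 * γ),
    mul_le_mul_of_nonneg_left hxx hγ.le, mul_nonneg hγ.le (mul_nonneg hγ.le h4)]

end Bounds

/-! ### Gaussians along a segment of covariance matrices. -/

section Path

variable {ι : Type*} [DecidableEq ι] [Fintype ι] {Γ₀ Γ₁ : Matrix ι ι ℝ}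

/-- The lower bound on the quadratic form is affine in `t`, and the upper bound on the squared norm
is convex in `t`; both hence hold on the segment with constants from the endpoints. -/
theorem exists_contraction (h₀ : Γ₀.PosDef) (h₁ : Γ₁.PosDef) : ∃ a : ℝ, 0 ≤ a ∧ a < 1 ∧
    ∀ t ∈ Set.Icc (0 : ℝ) 1, ∀ x : ι → ℝ,
      ∑ p, ((1 - (covPath Γ₀ Γ₁ t + (1 / 2 : ℝ) • 1)⁻¹) *ᵥ x) p ^ 2 ≤ a * ∑ p, x p ^ 2 := by
  obtain ⟨γ₀, hγ₀, h₀'⟩ := exists_le_dotProduct_mulVec h₀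
  obtain ⟨γ₁, hγ₁, h₁'⟩ := exists_le_dotProduct_mulVec h₁
  obtain ⟨C₀, hC₀, h₀''⟩ := exists_mulVec_sq_le (Γ₀ + (1 / 2 : ℝ) • 1)
  obtain ⟨C₁, hC₁, h₁''⟩ := exists_mulVec_sq_le (Γ₁ + (1 / 2 : ℝ) • 1)
  set γ := min γ₀ γ₁
  have hγ : 0 < γ := lt_min hγ₀ hγ₁
  refine ⟨(C₀ + C₁) / (C₀ + C₁ + 2 * γ), by positivity, (div_lt_one (by positivity)).mpr (by linarith),
    fun t ht x => ?_⟩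
  rw [← dotProduct_self_eq_sum_sq, ← dotProduct_self_eq_sum_sq]
  have ht' : 0 ≤ 1 - t := sub_nonneg.mpr ht.2
  refine one_sub_inv_sq_le (posDef_covPath h₀ h₁ ht) hγ (add_nonneg hC₀ hC₁) (fun z => ?_)
    (fun z => ?_) x
  · have hz := dotProduct_self_nonneg' z
    rw [dotProduct_covPath]
    have e0 : γ * (z ⬝ᵥ z) ≤ z ⬝ᵥ Γ₀ *ᵥ z :=
      (mul_le_mul_of_nonneg_right (min_le_left _ _) hz).trans (h₀' z)
    have e1 : γ * (z ⬝ᵥ z) ≤ z ⬝ᵥ Γ₁ *ᵥ z :=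
      (mul_le_mul_of_nonneg_right (min_le_right _ _) hz).trans (h₁' z)
    nlinarith [mul_le_mul_of_nonneg_left e0 ht', mul_le_mul_of_nonneg_left e1 ht.1]
  · have hz := dotProduct_self_nonneg' z
    have e : (covPath Γ₀ Γ₁ t + (1 / 2 : ℝ) • 1) *ᵥ z =
        (1 - t) • ((Γ₀ + (1 / 2 : ℝ) • 1) *ᵥ z) + t • ((Γ₁ + (1 / 2 : ℝ) • 1) *ᵥ z) := by
      rw [add_half_mulVec, add_half_mulVec, add_half_mulVec, covPath_eq, Matrix.add_mulVec,
        Matrix.smul_mulVec, Matrix.smul_mulVec]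
      module
    set u := (Γ₀ + (1 / 2 : ℝ) • 1) *ᵥ z
    set v := (Γ₁ + (1 / 2 : ℝ) • 1) *ᵥ z
    have e2 := dotProduct_self_nonneg' (u - v)
    rw [sub_dotProduct, dotProduct_sub, dotProduct_sub, dotProduct_comm v u] at e2
    rw [e, add_dotProduct, dotProduct_add, dotProduct_add, smul_dotProduct, smul_dotProduct,
      smul_dotProduct, smul_dotProduct, dotProduct_smul, dotProduct_smul, dotProduct_smul,
      dotProduct_smul, dotProduct_comm v u]
    simp only [smul_eq_mul]
    have e3 := h₀'' z
    have e4 := h₁'' z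
    have e5 := mul_nonneg hC₀ hz
    have e6 := mul_nonneg hC₁ hz
    have e7 : (1 - t) * (u ⬝ᵥ u) ≤ (1 - t) * (C₀ * (z ⬝ᵥ z)) := mul_le_mul_of_nonneg_left e3 ht'
    have e8 : t * (v ⬝ᵥ v) ≤ t * (C₁ * (z ⬝ᵥ z)) := mul_le_mul_of_nonneg_left e4 ht.1
    nlinarith [mul_nonneg (mul_nonneg ht' ht.1) e2, mul_nonneg ht.1 e5, mul_nonneg ht' e6]

theorem expDecay_gaussCov_path {V : Matrix ι ι ℂ} (hV : V * Vᴴ = 1) (h₀ : Γ₀.PosDef)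
    (h₁ : Γ₁.PosDef) (w : ι → ℝ) :
    ExpDecay fun t : Set.Icc (0 : ℝ) 1 => gaussCov V (covPath Γ₀ Γ₁ t) ((t : ℝ) • w) := by
  obtain ⟨a, ha, ha1, h⟩ := exists_contraction h₀ h₁
  refine expDecay_gaussFn hV (fun t => ?_) ha ha1 (b := 4 * (w ⬝ᵥ w))
    (by have := dotProduct_self_nonneg' w; positivity) (fun t => h t t.2) fun t => ?_
  · exact Matrix.isSymm_one.sub (posDef_isSymm (posDef_add_half (posDef_covPath h₀ h₁ t.2)).inv)
  · rw [← dotProduct_self_eq_sum_sq]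
    refine (inv_add_half_sq_le (posDef_covPath h₀ h₁ t.2) _).trans ?_
    rw [smul_dotProduct, dotProduct_smul, smul_eq_mul, smul_eq_mul]
    have h1 := dotProduct_self_nonneg' w
    have h2 : (t : ℝ) * t ≤ 1 := mul_le_one₀ t.2.2 t.2.1 t.2.2
    nlinarith [mul_le_mul_of_nonneg_right h2 h1]

theorem hasDerivAt_inv_apply {P : ℝ → Matrix ι ι ℝ} {P' : Matrix ι ι ℝ} {t : ℝ}
    (hP : ∀ p q, HasDerivAt (fun t => P t p q) (P' p q) t) (hu : IsUnit (P t)) (p q : ι) :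
    HasDerivAt (fun t => (P t)⁻¹ p q) ((-((P t)⁻¹ * P' * (P t)⁻¹)) p q) t := by
  -- A submultiplicative norm, chosen locally so that the derivative of inversion in a Banach
  -- algebra applies.
  let _ : NormedRing (Matrix ι ι ℝ) := Matrix.linftyOpNormedRing
  let _ : NormedAlgebra ℝ (Matrix ι ι ℝ) := Matrix.linftyOpNormedAlgebra
  obtain ⟨u, hu⟩ := hu
  have h1 : HasDerivAt P P' t := hasDerivAt_pi.mpr fun p => hasDerivAt_pi.mpr fun q => hP p q
  have h2 := hasFDerivAt_ringInverse (𝕜 := ℝ) u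
  rw [hu] at h2
  have h3 := h2.comp_hasDerivAt t h1
  have h4 : ((u⁻¹ : (Matrix ι ι ℝ)ˣ) : Matrix ι ι ℝ) = (P t)⁻¹ := by
    rw [← hu, Matrix.coe_units_inv]
  have h5 := hasDerivAt_pi.mp (hasDerivAt_pi.mp h3 p) q
  rw [h4] at h5
  have h6 : (Ring.inverse ∘ P) = fun t => (P t)⁻¹ := by
    funext s
    exact (Matrix.nonsing_inv_eq_ringInverse _).symm
  rw [h6] at h5
  exact h5

theorem hasDerivAt_covPath (t : ℝ) (p q : ι) :
    HasDerivAt (fun t => (covPath Γ₀ Γ₁ t + (1 / 2 : ℝ) • (1 : Matrix ι ι ℝ)) p q)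
      ((Γ₁ - Γ₀) p q) t := by
  simp only [covPath, Matrix.add_apply, Matrix.smul_apply, smul_eq_mul]
  have h := ((hasDerivAt_id t).mul_const ((Γ₁ - Γ₀) p q)).const_add (Γ₀ p q)
  rw [one_mul] at h
  exact h.add_const ((1 / 2 : ℝ) * (1 : Matrix ι ι ℝ) p q)

/-- Gaussians along a linear path satisfy the evolution equation up to normalization. -/
theorem hasDerivWithinAt_gaussCov_path {V : Matrix ι ι ℂ} (hV : V * Vᴴ = 1) (h₀ : Γ₀.PosDef)
    (h₁ : Γ₁.PosDef) (w : ι → ℝ) {t : ℝ} (ht : t ∈ Set.Icc (0 : ℝ) 1) (S : Set ℝ) :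
    ∃ s : ℂ, ∀ i, HasDerivWithinAt (fun t => gaussCov V (covPath Γ₀ Γ₁ t) (t • w) i)
      ((genOp V (Γ₁ - Γ₀) (fun p => Real.sqrt 2 * w p) (gaussCov V (covPath Γ₀ Γ₁ t) (t • w))
        + s • gaussCov V (covPath Γ₀ Γ₁ t) (t • w)) i) S t := by
  have hP := posDef_add_half (posDef_covPath h₀ h₁ ht)
  set M := fun t => (covPath Γ₀ Γ₁ t + (1 / 2 : ℝ) • (1 : Matrix ι ι ℝ))⁻¹ with hMdef
  have hM : ∀ p q, HasDerivAt (fun t => M t p q) ((-(M t * (Γ₁ - Γ₀) * M t)) p q) t :=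
    fun p q => hasDerivAt_inv_apply (hasDerivAt_covPath t) hP.isUnit p q
  have hMs : (M t).IsSymm := posDef_isSymm hP.inv
  have hΔ : (Γ₁ - Γ₀).IsSymm := (posDef_isSymm h₁).sub (posDef_isSymm h₀)
  -- The mean at time `t` is tw, so the linear coefficient of the exponent is c = M_t(tw).
  obtain ⟨z, hz⟩ := genOp_gaussFn hV hMs hΔ (M t *ᵥ (t • w)) w
  refine ⟨z, fun i => ?_⟩
  have hA : ∀ p q, HasDerivWithinAt (fun t => (1 - M t) p q) ((M t * (Γ₁ - Γ₀) * M t) p q) S t := by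
    intro p q
    have := (hM p q).const_sub ((1 : Matrix ι ι ℝ) p q)
    rw [Matrix.neg_apply, neg_neg] at this
    exact this.hasDerivWithinAt
  have hk : ∀ p, HasDerivWithinAt (fun t => (M t *ᵥ (t • w)) p)
      ((M t *ᵥ (w - (Γ₁ - Γ₀) *ᵥ (M t *ᵥ (t • w)))) p) S t := by
    intro p
    have h1 : HasDerivAt (fun t => ∑ q, M t p q * (t * w q))
        (∑ q, ((-(M t * (Γ₁ - Γ₀) * M t)) p q * (t * w q) + M t p q * (1 * w q))) t :=
      HasDerivAt.fun_sum fun q _ => (hM p q).mul ((hasDerivAt_id t).mul_const (w q))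
    refine (h1.congr_deriv ?_).hasDerivWithinAt
    rw [Finset.sum_add_distrib, Matrix.mulVec_sub, Matrix.mulVec_mulVec, Matrix.mulVec_mulVec,
      ← neg_add_eq_sub ((M t * (Γ₁ - Γ₀) * M t) *ᵥ (t • w)), ← Matrix.neg_mulVec]
    simp only [one_mul]
    rfl
  have h2 := hasDerivWithinAt_gaussFn (V := V) hA hk i
  refine h2.congr_deriv ?_
  exact congrFun hz i

end Path

/-! ## Physical covariance matrices -/

section Physical

open scoped ComplexOrder MatrixOrder

theorem exists_eq_conjTranspose_mul {Γ : Matrix (Ix n) (Ix n) ℝ} (h : Γ.PosDef) :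
    ∃ C : Matrix (Ix n) (Ix n) ℂ, Γ.map Complex.ofReal = Cᴴ * C ∧ IsUnit C.det := by
  obtain ⟨B, hB⟩ : ∃ B : Matrix (Ix n) (Ix n) ℝ, Γ = Bᴴ * B :=
    CStarAlgebra.nonneg_iff_eq_star_mul_self.mp (Matrix.nonneg_iff_posSemidef.mpr h.posSemidef)
  have h1 : Γ.map Complex.ofReal = (B.map Complex.ofReal)ᴴ * B.map Complex.ofReal := by
    rw [hB]
    ext p q
    simp [Matrix.mul_apply]
  refine ⟨B.map Complex.ofReal, h1, ?_⟩
  have h2 : IsUnit (Bᴴ * B).det := hB ▸ posDef_isUnit_det h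
  rw [Matrix.det_mul] at h2
  have h3 : (B.map Complex.ofReal).det = Complex.ofReal B.det := (RingHom.map_det Complex.ofRealHom B).symm
  rw [h3]
  exact (isUnit_of_mul_isUnit_right h2).map Complex.ofRealHom

theorem tau_mul_self (n : ℕ) : tau n * tau n = 1 := by
  rw [tau, Matrix.fromBlocks_multiply, ← Matrix.fromBlocks_one]
  congr 1 <;> simp [smul_smul]

theorem tau_conjTranspose (n : ℕ) : (tau n)ᴴ = tau n := by
  rw [tau, Matrix.fromBlocks_conjTranspose]
  simp

/-- The uncertainty relation `Γ ≥ τ/2`. -/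
def IsBona (Γ : Matrix (Ix n) (Ix n) ℝ) : Prop :=
  Γ.PosDef ∧ (Γ.map Complex.ofReal - (1 / 2 : ℂ) • tau n).PosSemidef

/-- After the congruence Γ = C†C, a negative eigenvalue λ of 1 - ½C⁻†τC⁻¹ gives a vector with τy =
2(1-λ)Γy. As τ² = 1, y is an eigenvector of τΓ with eigenvalue 1/(2(1-λ)), a symplectic eigenvalue
below 1/2. -/
theorem IsPhysical.isBona {Γ : Matrix (Ix n) (Ix n) ℝ} (h : IsPhysical Γ) : IsBona Γ := by
  refine ⟨h.1, ?_⟩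
  obtain ⟨C, hC, hCu⟩ := exists_eq_conjTranspose_mul h.1
  have hCi : C * C⁻¹ = 1 := Matrix.mul_nonsing_inv _ hCu
  have hCi' : C⁻¹ * C = 1 := Matrix.nonsing_inv_mul _ hCu
  have hCh : Cᴴ * C⁻¹ᴴ = 1 := by rw [← Matrix.conjTranspose_mul, hCi', Matrix.conjTranspose_one]
  set A : Matrix (Ix n) (Ix n) ℂ := 1 - (1 / 2 : ℂ) • (C⁻¹ᴴ * tau n * C⁻¹) with hAdef
  have h1 : Γ.map Complex.ofReal - (1 / 2 : ℂ) • tau n = Cᴴ * A * C := by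
    have h2 : Cᴴ * (C⁻¹ᴴ * tau n * C⁻¹) * C = tau n := by
      calc _ = (Cᴴ * C⁻¹ᴴ) * tau n * (C⁻¹ * C) := by simp only [mul_assoc]
        _ = _ := by rw [hCh, hCi', one_mul, mul_one]
    rw [hC, hAdef, mul_sub, sub_mul, mul_one, mul_smul_comm, smul_mul_assoc, h2]
  rw [h1]
  refine Matrix.PosSemidef.conjTranspose_mul_mul_same ?_ C
  have hAH : A.IsHermitian := by
    rw [Matrix.IsHermitian, hAdef, Matrix.conjTranspose_sub, Matrix.conjTranspose_one,
      Matrix.conjTranspose_smul, Matrix.conjTranspose_mul, Matrix.conjTranspose_mul,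
      Matrix.conjTranspose_conjTranspose, tau_conjTranspose, mul_assoc]
    simp
  rw [hAH.posSemidef_iff_eigenvalues_nonneg]
  intro i
  by_contra hneg
  simp only [Pi.zero_apply, not_le] at hneg
  set x : Ix n → ℂ := (hAH.eigenvectorBasis i).ofLp with hx
  set ev : ℝ := hAH.eigenvalues i with hev
  have hx0 : x ≠ 0 := by
    intro h0
    have := hAH.eigenvectorBasis.orthonormal.ne_zero i
    exact this ((WithLp.ofLp_eq_zero 2).mp h0)
  have hAx : A *ᵥ x = (ev : ℂ) • x := by
    have := hAH.mulVec_eigenvectorBasis i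
    rw [← hx, ← hev] at this
    rw [this]
    ext
    simp
  set y := C⁻¹ *ᵥ x with hy
  have hxy : x = C *ᵥ y := by rw [hy, Matrix.mulVec_mulVec, hCi, Matrix.one_mulVec]
  have hμ : (2 * (1 - ev) : ℝ) > 0 := by linarith
  have h3 : tau n *ᵥ y = ((2 * (1 - ev) : ℝ) : ℂ) • (Γ.map Complex.ofReal *ᵥ y) := by
    have h4 : (C⁻¹ᴴ * tau n * C⁻¹) *ᵥ x = ((2 * (1 - ev) : ℝ) : ℂ) • x := by
      have h5 := hAx
      rw [hAdef, Matrix.sub_mulVec, Matrix.one_mulVec, Matrix.smul_mulVec] at h5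
      have h6 : (C⁻¹ᴴ * tau n * C⁻¹) *ᵥ x =
          (2 : ℂ) • (x - (x - (1 / 2 : ℂ) • (C⁻¹ᴴ * tau n * C⁻¹) *ᵥ x)) := by module
      rw [h6, h5]
      push_cast
      module
    have h7 := congrArg (fun z => Cᴴ *ᵥ z) h4
    simp only [Matrix.mulVec_smul] at h7
    rw [Matrix.mulVec_mulVec, ← mul_assoc, ← mul_assoc, hCh, one_mul, ← Matrix.mulVec_mulVec, ← hy,
      hxy] at h7
    rw [h7, hC, Matrix.mulVec_mulVec]
  have h8 : (tau n * Γ.map Complex.ofReal) *ᵥ y = (((2 * (1 - ev))⁻¹ : ℝ) : ℂ) • y := by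
    have h9 := congrArg (fun z => tau n *ᵥ z) h3
    simp only [Matrix.mulVec_smul] at h9
    rw [Matrix.mulVec_mulVec, tau_mul_self, Matrix.one_mulVec, Matrix.mulVec_mulVec] at h9
    nth_rewrite 2 [h9]
    rw [smul_smul, ← Complex.ofReal_mul, inv_mul_cancel₀ hμ.ne', Complex.ofReal_one, one_smul]
  have h10 := h.2 _ ⟨inv_pos.mpr hμ, Module.End.hasEigenvalue_of_hasEigenvector
    (x := y) (Module.End.hasEigenvector_iff.mpr ⟨Module.End.mem_eigenspace_iff.mpr (by
      rw [Matrix.toLin'_apply]; exact h8), fun h0 => hx0 (by rw [hxy, h0, Matrix.mulVec_zero])⟩)⟩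
  rw [one_div, inv_le_inv₀ (by norm_num) hμ] at h10
  linarith

/-- On an eigenvector, Γz = ντz. Hence z†Γz = ν z†τz > 0, while Γ ≥ τ/2 gives (ν - 1/2) z†τz ≥ 0. -/
theorem IsBona.isPhysical {Γ : Matrix (Ix n) (Ix n) ℝ} (h : IsBona Γ) : IsPhysical Γ := by
  refine ⟨h.1, fun ν hν => ?_⟩
  obtain ⟨hν0, hev⟩ := hν
  obtain ⟨z, hz⟩ := hev.exists_hasEigenvector
  obtain ⟨hz1, hz0⟩ := Module.End.hasEigenvector_iff.mp hz
  rw [Module.End.mem_eigenspace_iff, Matrix.toLin'_apply] at hz1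
  obtain ⟨C, hC, hCu⟩ := exists_eq_conjTranspose_mul h.1
  have h1 : Γ.map Complex.ofReal *ᵥ z = (ν : ℂ) • (tau n *ᵥ z) := by
    have := congrArg (fun z => tau n *ᵥ z) hz1
    simp only [Matrix.mulVec_smul] at this
    rwa [← Matrix.mulVec_mulVec, Matrix.mulVec_mulVec, tau_mul_self, Matrix.one_mulVec] at this
  have h2 : 0 < star z ⬝ᵥ (Γ.map Complex.ofReal *ᵥ z) := by
    have hpd : (Γ.map Complex.ofReal).PosDef := by
      rw [hC]
      exact Matrix.PosDef.conjTranspose_mul_self _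
        (Matrix.mulVec_injective_of_isUnit ((Matrix.isUnit_iff_isUnit_det _).mpr hCu))
    exact hpd.dotProduct_mulVec_pos hz0
  have h3 := h.2.dotProduct_mulVec_nonneg z
  rw [Matrix.sub_mulVec, Matrix.smul_mulVec, dotProduct_sub, dotProduct_smul, smul_eq_mul] at h3
  have h4 : star z ⬝ᵥ (Γ.map Complex.ofReal *ᵥ z) = ν * (star z ⬝ᵥ (tau n *ᵥ z)) := by
    rw [h1, dotProduct_smul, smul_eq_mul]
  rw [h4] at h2 h3
  set q := star z ⬝ᵥ (tau n *ᵥ z)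
  have h5 : 0 < ν * q.re := by
    have := (Complex.pos_iff.mp h2).1
    simpa using this
  have h6 : 0 ≤ ν * q.re - 1 / 2 * q.re := by
    have := (Complex.nonneg_iff.mp h3).1
    simpa using this
  have h7 : 0 < q.re := pos_of_mul_pos_right h5 hν0.le
  by_contra hlt
  nlinarith

theorem isBona_half : IsBona ((1 / 2 : ℝ) • (1 : Matrix (Ix n) (Ix n) ℝ)) := by
  refine ⟨Matrix.PosDef.one.smul (by norm_num), ?_⟩
  -- (1 - τ)/2 is an orthogonal projector, hence equal to its own square.
  have h1 : ((1 / 2 : ℝ) • (1 : Matrix (Ix n) (Ix n) ℝ)).map Complex.ofReal - (1 / 2 : ℂ) • tau n =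
      ((1 / 2 : ℂ) • (1 - tau n))ᴴ * ((1 / 2 : ℂ) • (1 - tau n)) := by
    have h2 : ((1 / 2 : ℝ) • (1 : Matrix (Ix n) (Ix n) ℝ)).map Complex.ofReal = (1 / 2 : ℂ) • 1 := by
      ext p q
      simp [Matrix.one_apply, apply_ite]
    have h3 : (1 - tau n) * (1 - tau n) = (2 : ℂ) • (1 - tau n) := by
      rw [sub_mul, mul_sub, mul_sub, tau_mul_self, one_mul, mul_one, one_mul]
      module
    rw [h2, Matrix.conjTranspose_smul, Matrix.conjTranspose_sub, Matrix.conjTranspose_one,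
      tau_conjTranspose, smul_mul_smul_comm, h3, smul_smul]
    simp
    module
  rw [h1]
  exact Matrix.posSemidef_conjTranspose_mul_self _

theorem IsBona.covPath {Γ₀ Γ₁ : Matrix (Ix n) (Ix n) ℝ} (h₀ : IsBona Γ₀) (h₁ : IsBona Γ₁) {t : ℝ}
    (ht : t ∈ Set.Icc (0 : ℝ) 1) : IsBona (covPath Γ₀ Γ₁ t) := by
  refine ⟨posDef_covPath h₀.1 h₁.1 ht, ?_⟩
  have h : (QuasiFree.covPath Γ₀ Γ₁ t).map Complex.ofReal - (1 / 2 : ℂ) • tau n =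
      (1 - t) • (Γ₀.map Complex.ofReal - (1 / 2 : ℂ) • tau n)
        + t • (Γ₁.map Complex.ofReal - (1 / 2 : ℂ) • tau n) := by
    rw [covPath_eq]
    ext p q
    simp
    ring
  rw [h]
  exact (h₀.2.smul (sub_nonneg.mpr ht.2)).add (h₁.2.smul ht.1)

theorem IsBona.add_vecMulVec {Γ : Matrix (Ix n) (Ix n) ℝ} (h : IsBona Γ) (v : Ix n → ℝ) :
    IsBona (Γ + Matrix.vecMulVec v v) := by
  have h1 : (Matrix.vecMulVec v v).PosSemidef := by
    have := Matrix.posSemidef_vecMulVec_self_star v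
    rwa [star_trivial] at this
  refine ⟨h.1.add_posSemidef h1, ?_⟩
  have h2 := Matrix.posSemidef_vecMulVec_self_star (fun p => (v p : ℂ))
  have h3 : (Γ + Matrix.vecMulVec v v).map Complex.ofReal - (1 / 2 : ℂ) • tau n =
      (Γ.map Complex.ofReal - (1 / 2 : ℂ) • tau n)
        + Matrix.vecMulVec (fun p => (v p : ℂ)) (star fun p => (v p : ℂ)) := by
    ext p q
    simp [Matrix.vecMulVec_apply]
    ring
  rw [h3]
  exact h.2.add h2

/-- The matrix that couples left and right creation operators in a Gaussian. -/
def couplingMatrix (Γ : Matrix (Ix n) (Ix n) ℝ) : Matrix (Fin n) (Fin n) ℂ :=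
  ((rotV n).submatrix id Sum.inl)ᴴ
    * ((1 - (Γ + (1 / 2 : ℝ) • 1)⁻¹ : Matrix (Ix n) (Ix n) ℝ).map Complex.ofReal)
    * (rotV n).submatrix id Sum.inl

theorem tau_mul_rotV_inl : tau n * (rotV n).submatrix id Sum.inl = (rotV n).submatrix id Sum.inl := by
  have h : (rotV n).submatrix id Sum.inl = isqrt2 • Matrix.fromRows 1 (Complex.I • 1) := by
    ext (p | p) q <;> simp [rotV, rotR]
  rw [h, tau, Matrix.mul_smul, Matrix.fromBlocks_mul_fromRows]
  congr 1
  simp [smul_smul]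

/-- The columns v are fixed by the projector P = (1 + τ)/2, and the uncertainty relation reads N - P
≥ 0 for N = Γ + 1/2. Completing the square with M = N⁻¹ then shows v†(1 - M)v ≥ 0. -/
theorem IsBona.couplingMatrix {Γ : Matrix (Ix n) (Ix n) ℝ} (h : IsBona Γ) :
    (couplingMatrix Γ).PosSemidef := by
  set v := (rotV n).submatrix id (Sum.inl : Fin n → Ix n) with hv
  set N := (Γ + (1 / 2 : ℝ) • 1).map Complex.ofReal with hN
  set P : Matrix (Ix n) (Ix n) ℂ := (1 / 2 : ℂ) • (1 + tau n) with hP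
  have hdet := posDef_isUnit_det (posDef_add_half h.1)
  have hNM : N * ((Γ + (1 / 2 : ℝ) • 1)⁻¹).map Complex.ofReal = 1 := by
    have := congrArg (fun A : Matrix (Ix n) (Ix n) ℝ => A.map Complex.ofReal)
      (Matrix.mul_nonsing_inv _ hdet)
    beta_reduce at this
    rw [hN]
    refine (Matrix.map_mul (f := Complex.ofRealHom)).symm.trans (this.trans ?_)
    ext p q
    simp [Matrix.one_apply, apply_ite]
  set M := ((Γ + (1 / 2 : ℝ) • 1)⁻¹).map Complex.ofReal with hM
  have hMH : Mᴴ = M := by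
    ext p q
    have := (posDef_isSymm (posDef_add_half h.1).inv).apply p q
    rw [hM, Matrix.conjTranspose_apply, Matrix.map_apply, Matrix.map_apply, this]
    simp
  have hPH : Pᴴ = P := by
    rw [hP, Matrix.conjTranspose_smul, Matrix.conjTranspose_add, Matrix.conjTranspose_one,
      tau_conjTranspose]
    simp
  have hPP : P * P = P := by
    rw [hP, smul_mul_smul_comm, add_mul, mul_add, mul_add, tau_mul_self, one_mul, mul_one, one_mul]
    module
  have hPv : P * v = v := by
    rw [hP, Matrix.smul_mul, Matrix.add_mul, tau_mul_rotV_inl, Matrix.one_mul]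
    module
  have hvP : vᴴ * P = vᴴ := by
    rw [← hPH, ← Matrix.conjTranspose_mul, hPv]
  have hNP : (N - P).PosSemidef := by
    have h1 : N - P = Γ.map Complex.ofReal - (1 / 2 : ℂ) • tau n := by
      ext p q
      simp [hN, hP, Matrix.one_apply, apply_ite]
      split_ifs <;> ring
    rw [h1]
    exact h.2
  -- The terms v†MPMv cancel between the two summands; Pv = v and NM = 1 reduce the rest to v†v -
  -- v†Mv.
  have hsplit : QuasiFree.couplingMatrix Γ =
      (v - P * (M * v))ᴴ * (v - P * (M * v)) + (M * v)ᴴ * (N - P) * (M * v) := by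
    have h1 : (1 - (Γ + (1 / 2 : ℝ) • 1)⁻¹ : Matrix (Ix n) (Ix n) ℝ).map Complex.ofReal = 1 - M := by
      ext p q
      simp [hM, Matrix.one_apply, apply_ite]
    have e1 : vᴴ * M * P * P * M * v = vᴴ * M * P * M * v := by
      rw [Matrix.mul_assoc (vᴴ * M) P P, hPP]
    have e2 : vᴴ * P * M * v = vᴴ * M * v := by rw [hvP]
    have e3 : vᴴ * M * P * v = vᴴ * M * v := by rw [Matrix.mul_assoc _ P v, hPv]
    have e4 : vᴴ * M * N * M * v = vᴴ * M * v := by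
      rw [Matrix.mul_assoc (vᴴ * M) N M, hNM, Matrix.mul_one]
    rw [QuasiFree.couplingMatrix, h1, Matrix.conjTranspose_sub, Matrix.conjTranspose_mul,
      Matrix.conjTranspose_mul, hPH, hMH]
    simp only [Matrix.mul_sub, Matrix.sub_mul, ← Matrix.mul_assoc, Matrix.mul_one]
    rw [e1, e2, e3, e4]
    abel
  rw [hsplit]
  exact (Matrix.posSemidef_conjTranspose_mul_self _).add (hNP.conjTranspose_mul_mul_same _)

end Physical

/-! ## Positivity -/

section Positivity

open scoped ComplexOrder

/-- The quadratic form of `R` is nonnegative on finitely supported vectors. -/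
def IsPosForm (R : Op n) : Prop := ∀ (s : Finset (Occ n)) (x : Occ n → ℂ),
  0 ≤ ∑ m ∈ s, ∑ m' ∈ s, star (x m) * R m m' * x m'

theorem IsPosForm.zero : IsPosForm (0 : Op n) := fun s x => by simp

theorem IsPosForm.add {R R' : Op n} (h : IsPosForm R) (h' : IsPosForm R') : IsPosForm (R + R') := by
  intro s x
  have : ∀ m m', star (x m) * (R + R') m m' * x m' =
      star (x m) * R m m' * x m' + star (x m) * R' m m' * x m' := by
    intro m m'
    rw [Matrix.add_apply]
    ring
  simp only [this, Finset.sum_add_distrib]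
  exact add_nonneg (h s x) (h' s x)

theorem IsPosForm.sum {α : Type*} {s : Finset α} {R : α → Op n} (h : ∀ a ∈ s, IsPosForm (R a)) :
    IsPosForm (∑ a ∈ s, R a) :=
  Finset.sum_induction _ IsPosForm (fun _ _ => .add) .zero h

theorem IsPosForm.smul {R : Op n} {c : ℂ} (hc : 0 ≤ c) (h : IsPosForm R) : IsPosForm (c • R) := by
  intro s x
  have : ∀ m m', star (x m) * (c • R) m m' * x m' = c * (star (x m) * R m m' * x m') := by
    intro m m'
    rw [Matrix.smul_apply, smul_eq_mul]
    ring
  simp only [this, ← Finset.mul_sum]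
  exact mul_nonneg hc (h s x)

theorem isPosForm_vac : IsPosForm (vac n) := by
  intro s x
  have : ∀ m m', star (x m) * vac n m m' * x m' =
      star (if m = 0 then x m else 0) * (if m' = 0 then x m' else 0) := by
    intro m m'
    rw [vac]
    by_cases h : m = 0 <;> by_cases h' : m' = 0 <;> simp [h, h']
  simp only [this, ← Finset.mul_sum, ← Finset.sum_mul, ← star_sum]
  exact star_mul_self_nonneg _

theorem RowFin.conjTranspose_transpose {A : Op n} (hA : RowFin A) : RowFin Aᴴᵀ := fun m =>
  (hA m).subset fun k hk => by
    simpa [Matrix.conjTranspose_apply, Matrix.transpose_apply] using hk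

theorem opMul_apply_of_support {A : Op n} {m : Occ n} {u : Finset (Occ n)}
    (hu : Function.support (A m) ⊆ u) (R : Op n) (m' : Occ n) :
    (A ⋆ₒ R) m m' = ∑ k ∈ u, A m k * R k m' := by
  rw [opMul, tsum_eq_sum fun k hk => ?_]
  have : A m k = 0 := by
    by_contra h
    exact hk (hu h)
  rw [this, zero_mul]

theorem sum_comm₄ {α β γ δ : Type*} (u : Finset α) (u' : Finset β) (s : Finset γ) (s' : Finset δ)
    (F : α → β → γ → δ → ℂ) : ∑ k ∈ u, ∑ k' ∈ u', ∑ m ∈ s, ∑ m' ∈ s', F k k' m m' =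
      ∑ m ∈ s, ∑ m' ∈ s', ∑ k' ∈ u', ∑ k ∈ u, F k k' m m' := by
  rw [Finset.sum_comm, Finset.sum_congr rfl fun k' _ => Finset.sum_comm, Finset.sum_comm]
  refine Finset.sum_congr rfl fun m _ => ?_
  rw [Finset.sum_congr rfl fun k' _ => Finset.sum_comm, Finset.sum_comm]

/-- The form of ARA† at x is the form of R at A†x, which again has finite support because the rows
of A do. -/
theorem IsPosForm.conj {A R : Op n} (hA : RowFin A) (h : IsPosForm R) :
    IsPosForm (A ⋆ₒ R ⋆ₒ Aᴴ) := by
  intro s x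
  set u : Finset (Occ n) := s.biUnion fun m => (hA m).toFinset with hu
  have hsub : ∀ m ∈ s, Function.support (A m) ⊆ u := fun m hm k hk =>
    Finset.mem_biUnion.mpr ⟨m, hm, (hA m).mem_toFinset.mpr hk⟩
  have h1 : ∀ m ∈ s, ∀ m' ∈ s, (A ⋆ₒ R ⋆ₒ Aᴴ) m m' =
      ∑ k' ∈ u, ∑ k ∈ u, A m k * R k k' * star (A m' k') := by
    intro m hm m' hm'
    rw [opMul_eq_transpose, Matrix.transpose_apply, opMul_apply_of_support (u := u)]
    · refine Finset.sum_congr rfl fun k' _ => ?_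
      rw [Matrix.transpose_apply, Matrix.transpose_apply, opMul_apply_of_support (hsub m hm),
        Matrix.conjTranspose_apply, Finset.mul_sum]
      exact Finset.sum_congr rfl fun k _ => by ring
    · refine Set.Subset.trans (fun k hk => ?_) (hsub m' hm')
      simpa [Matrix.conjTranspose_apply, Matrix.transpose_apply] using hk
  have h2 := h u fun k => ∑ m ∈ s, star (A m k) * x m
  refine h2.trans_eq ?_
  calc _ = ∑ k ∈ u, ∑ k' ∈ u, ∑ m ∈ s, ∑ m' ∈ s,
        star (x m) * (A m k * R k k' * star (A m' k')) * x m' := by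
        refine Finset.sum_congr rfl fun k _ => Finset.sum_congr rfl fun k' _ => ?_
        rw [star_sum, Finset.sum_mul, Finset.sum_mul]
        refine Finset.sum_congr rfl fun m _ => ?_
        rw [Finset.mul_sum]
        refine Finset.sum_congr rfl fun m' _ => ?_
        rw [star_mul', star_star]
        ring
    _ = ∑ m ∈ s, ∑ m' ∈ s, ∑ k' ∈ u, ∑ k ∈ u,
        star (x m) * (A m k * R k k' * star (A m' k')) * x m' := sum_comm₄ u u s s _
    _ = _ := by
      refine Finset.sum_congr rfl fun m hm => Finset.sum_congr rfl fun m' hm' => ?_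
      rw [h1 m hm m' hm', Finset.mul_sum, Finset.sum_mul]
      refine Finset.sum_congr rfl fun k' _ => ?_
      rw [Finset.mul_sum, Finset.sum_mul]

/-- Finitely supported vectors are dense and the quadratic form is continuous. -/
theorem isPositive_of_isPosForm {R : Op n} (h : IsPosForm R) {T : Fock n →L[ℂ] Fock n}
    (hT : Represents T R) : T.IsPositive := by
  have key : ∀ x : Fock n, 0 ≤ inner ℂ x (T x) := by
    intro x
    have hx := lp.hasSum_single (p := 2) (by norm_num) x
    have h1 : Filter.Tendsto (fun s : Finset (Occ n) =>
        inner ℂ (∑ m ∈ s, lp.single 2 m (x m)) (T (∑ m ∈ s, lp.single 2 m (x m))))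
        Filter.atTop (nhds (inner ℂ x (T x))) :=
      hx.inner ((T.continuous.tendsto _).comp hx)
    refine ge_of_tendsto' h1 fun s => ?_
    have h2 : ∀ m, (lp.single 2 m (x m) : Fock n) = x m • ket m := by
      intro m
      rw [ket, ← lp.single_smul, smul_eq_mul, mul_one]
    simp only [h2, map_sum, map_smul, sum_inner, inner_sum, inner_smul_left, inner_smul_right,
      inner_ket_left, hT _ _]
    refine (h s x).trans_eq ?_
    rw [Finset.sum_comm]
    refine Finset.sum_congr rfl fun m _ => ?_
    rw [Finset.mul_sum]
    refine Finset.sum_congr rfl fun m' _ => ?_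
    rw [mul_comm]
    rfl
  rw [ContinuousLinearMap.isPositive_iff_complex]
  intro x
  have h1 := key x
  rw [← inner_conj_symm] at h1
  obtain ⟨h2, h3⟩ := Complex.nonneg_iff.mp h1
  rw [Complex.conj_re] at h2
  rw [Complex.conj_im] at h3
  exact ⟨Complex.ext rfl (by simpa [eq_comm] using h3), h2⟩

theorem IsPosForm.diag_nonneg {R : Op n} (h : IsPosForm R) (m : Occ n) : 0 ≤ R m m := by
  have := h {m} fun _ => 1
  simpa using this

/-- `T` and `T'` are left multiplication by some `A` and right multiplication by `A†`. -/
def IsConjPair (T T' : Module.End ℂ (Fn (Ix n))) : Prop :=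
  ∃ A : Op n, RowFin A ∧ (∀ R, toFn n (A ⋆ₒ R) = T (toFn n R)) ∧
    ∀ R, toFn n (R ⋆ₒ Aᴴ) = T' (toFn n R)

theorem IsConjPair.rai (j : Fin n) : IsConjPair (rai (Sum.inl j)) (rai (Sum.inr j)) := by
  refine ⟨cre j, rowFin_cre j, toFn_cre_opMul j, fun R => ?_⟩
  rw [cre, Matrix.conjTranspose_conjTranspose]
  exact toFn_opMul_ann j R

theorem one_opMul (R : Op n) : (1 : Op n) ⋆ₒ R = R := by
  ext m m'
  rw [opMul, tsum_eq_single m fun k hk => by rw [Matrix.one_apply_ne hk.symm, zero_mul],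
    Matrix.one_apply_eq, one_mul]

theorem opMul_one (R : Op n) : R ⋆ₒ (1 : Op n) = R := by
  rw [opMul_eq_transpose, Matrix.transpose_one, one_opMul, Matrix.transpose_transpose]

theorem IsConjPair.one : IsConjPair (1 : Module.End ℂ (Fn (Ix n))) 1 :=
  ⟨1, RowFin.one, fun R => by rw [one_opMul]; rfl,
    fun R => by rw [Matrix.conjTranspose_one, opMul_one]; rfl⟩

theorem IsConjPair.zero : IsConjPair (0 : Module.End ℂ (Fn (Ix n))) 0 :=
  ⟨0, RowFin.zero, fun R => by rw [zero_opMul]; exact map_zero _,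
    fun R => by rw [Matrix.conjTranspose_zero, opMul_zero]; exact map_zero _⟩

theorem IsConjPair.add {T T' S S' : Module.End ℂ (Fn (Ix n))} (h : IsConjPair T T')
    (h' : IsConjPair S S') : IsConjPair (T + S) (T' + S') := by
  obtain ⟨A, hA, h1, h2⟩ := h
  obtain ⟨B, hB, h3, h4⟩ := h'
  refine ⟨A + B, hA.add hB, fun R => ?_, fun R => ?_⟩
  · rw [hA.add_opMul hB, map_add, h1, h3]
    rfl
  · rw [opMul_eq_transpose, Matrix.conjTranspose_add, Matrix.transpose_add,
      hA.conjTranspose_transpose.add_opMul hB.conjTranspose_transpose, Matrix.transpose_add,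
      ← opMul_eq_transpose, ← opMul_eq_transpose, map_add, h2, h4]
    rfl

theorem IsConjPair.smul {T T' : Module.End ℂ (Fn (Ix n))} (c : ℂ) (h : IsConjPair T T') :
    IsConjPair (c • T) (star c • T') := by
  obtain ⟨A, hA, h1, h2⟩ := h
  refine ⟨c • A, hA.smul c, fun R => ?_, fun R => ?_⟩
  · rw [smul_opMul, map_smul, h1]
    rfl
  · rw [Matrix.conjTranspose_smul, opMul_smul, map_smul, h2]
    rfl

theorem IsConjPair.mul {T T' S S' : Module.End ℂ (Fn (Ix n))} (h : IsConjPair T T')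
    (h' : IsConjPair S S') : IsConjPair (T * S) (T' * S') := by
  obtain ⟨A, hA, h1, h2⟩ := h
  obtain ⟨B, hB, h3, h4⟩ := h'
  refine ⟨A ⋆ₒ B, hA.opMul hB, fun R => ?_, fun R => ?_⟩
  · rw [hA.opMul_assoc hB, h1, h3]
    rfl
  · have h5 : (A ⋆ₒ B)ᴴ = Bᴴ ⋆ₒ Aᴴ := by
      ext m m'
      rw [Matrix.conjTranspose_apply, opMul, opMul, tsum_star]
      simp only [Matrix.conjTranspose_apply, star_mul]
    rw [h5, opMul_assoc_of_colFin hA.conjTranspose_transpose hB.conjTranspose_transpose, h2, h4]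
    rfl

theorem IsConjPair.sum {α : Type*} {s : Finset α} {T T' : α → Module.End ℂ (Fn (Ix n))}
    (h : ∀ a ∈ s, IsConjPair (T a) (T' a)) : IsConjPair (∑ a ∈ s, T a) (∑ a ∈ s, T' a) := by
  classical
  induction s using Finset.induction_on with
  | empty => exact .zero
  | insert a s ha ih =>
    rw [Finset.sum_insert ha, Finset.sum_insert ha]
    exact (h a (Finset.mem_insert_self a s)).add
      (ih fun b hb => h b (Finset.mem_insert_of_mem hb))

theorem IsConjPair.pow {T T' : Module.End ℂ (Fn (Ix n))} (h : IsConjPair T T') (k : ℕ) :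
    IsConjPair (T ^ k) (T' ^ k) := by
  induction k with
  | zero => simpa using IsConjPair.one
  | succ k ih =>
    rw [pow_succ, pow_succ]
    exact ih.mul h

theorem IsConjPair.pexp {T T' : Module.End ℂ (Fn (Ix n))} (h : IsConjPair T T') (K : ℕ) :
    IsConjPair (pexp K T) (pexp K T') := by
  refine .sum fun k _ => ?_
  have := (h.pow k).smul ((k.factorial : ℂ)⁻¹)
  rwa [star_inv₀, star_natCast] at this

theorem IsPosForm.mul_apply {T T' : Module.End ℂ (Fn (Ix n))} (hT : IsConjPair T T') {X : Fn (Ix n)}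
    (h : IsPosForm ((toFn n).symm X)) : IsPosForm ((toFn n).symm ((T * T') X)) := by
  obtain ⟨A, hA, h1, h2⟩ := hT
  have h3 := IsPosForm.conj hA h
  rw [hA.opMul_opMul hA.conjTranspose_transpose] at h3
  have h4 : (T * T') X = toFn n (A ⋆ₒ ((toFn n).symm X ⋆ₒ Aᴴ)) := by
    rw [h1, h2, LinearEquiv.apply_symm_apply]
    rfl
  rwa [h4, LinearEquiv.symm_apply_apply]

/-- The exponential of a raising operator of the form `D ⊗ 1 + 1 ⊗ D* + ∑ Lₗ ⊗ Lₗ*` is positive. -/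
theorem isPosForm_expVac {α : Type*} [Fintype α] {D D' : Module.End ℂ (Fn (Ix n))}
    {L L' : α → Module.End ℂ (Fn (Ix n))} (hD : IsConjPair D D') (hL : ∀ a, IsConjPair (L a) (L' a))
    (hDr : IsRaising D) (hDr' : IsRaising D') (hLr : IsRaising (∑ a, L a * L' a))
    (hc : Commute D D') (hc1 : Commute D (∑ a, L a * L' a)) (hc2 : Commute D' (∑ a, L a * L' a)) :
    IsPosForm ((toFn n).symm (expVac (D + (D' + ∑ a, L a * L' a)))) := by
  set C := ∑ a, L a * L' a with hC
  -- Each power of the coupling is a sum of compositions of maps R ↦ LRL†, applied to the positive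
  -- vacuum projector.
  have hpow : ∀ k, IsPosForm ((toFn n).symm ((C ^ k) (vacFn (Ix n)))) := by
    intro k
    induction k with
    | zero =>
      have h : vacFn (Ix n) = toFn n (vac n) := (toFn_vac n).symm
      rw [pow_zero, Module.End.one_apply, h, LinearEquiv.symm_apply_apply]
      exact isPosForm_vac
    | succ k ih =>
      have h : (C ^ (k + 1)) (vacFn (Ix n)) = ∑ a, (L a * L' a) ((C ^ k) (vacFn (Ix n))) := by
        rw [pow_succ', Module.End.mul_apply]
        nth_rewrite 1 [hC]
        rw [LinearMap.sum_apply]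
      rw [h, map_sum]
      exact .sum fun a _ => IsPosForm.mul_apply (hL a) ih
  have hexp : ∀ K, IsPosForm ((toFn n).symm (pexp K C (vacFn (Ix n)))) := by
    intro K
    rw [pexp, LinearMap.sum_apply, map_sum]
    refine .sum fun k _ => ?_
    rw [LinearMap.smul_apply, map_smul]
    refine .smul ?_ (hpow k)
    have : ((k.factorial : ℂ)⁻¹) = (((k.factorial : ℝ)⁻¹ : ℝ) : ℂ) := by push_cast; rfl
    rw [this]
    exact Complex.zero_le_real.mpr (by positivity)
  -- On degrees below K the full exponential factors as R ↦ ARA†, with A the truncated exponential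
  -- of `D`, after the exponential of the coupling. Replacing the inner exponential by its
  -- truncation alters only degrees at least K, which raising operators never bring down.
  have happ : ∀ K i, deg i < K → expVac (D + (D' + C)) i =
      (pexp K D * pexp K D') (pexp K C (vacFn (Ix n))) i := by
    intro K i hi
    have hr : IsRaising (D' + C) := hDr'.add hLr
    rw [expVac_apply (hDr.add hr) hi, hDr.pexp_add_apply hr (hc.add_right hc1) K _ hi,
      Module.End.mul_apply, ← sub_eq_zero, ← Pi.sub_apply, ← map_sub, QuasiFree.pexp,
      LinearMap.sum_apply, Finset.sum_apply]
    refine Finset.sum_eq_zero fun k _ => ?_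
    rw [LinearMap.smul_apply, Pi.smul_apply, hDr.pow_apply k _ K (fun l hl => ?_) i (by omega),
      smul_zero]
    rw [Pi.sub_apply, sub_eq_zero, hDr'.pexp_add_apply hLr hc2 K _ hl]
  intro s x
  -- A quadratic form on finitely many indices sees finitely many entries, so one truncation order
  -- serves for all of them.
  obtain ⟨K, hK⟩ : ∃ K, ∀ m ∈ s, ∀ m' ∈ s, deg (Sum.elim m m' : Ix n → ℕ) < K := by
    refine ⟨2 * s.sup deg + 1, fun m hm m' hm' => ?_⟩
    rw [deg_elim]
    have h1 : deg m ≤ s.sup deg := Finset.le_sup hm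
    have h2 : deg m' ≤ s.sup deg := Finset.le_sup hm'
    omega
  refine ((IsPosForm.mul_apply ((hD.pexp K)) (hexp K)) s x).trans_eq ?_
  refine Finset.sum_congr rfl fun m hm => Finset.sum_congr rfl fun m' hm' => ?_
  rw [toFn_symm_apply, toFn_symm_apply, happ K _ (hK m hm m' hm')]

/-- The part of `rOp` that acts from the left. -/
def rOpLeft (p : Ix n) : Module.End ℂ (Fn (Ix n)) :=
  ∑ j, star (rotV n p (Sum.inl j)) • rai (Sum.inl j)

/-- The part of `rOp` that acts from the right. -/
def rOpRight (p : Ix n) : Module.End ℂ (Fn (Ix n)) := ∑ j, rotV n p (Sum.inl j) • rai (Sum.inr j)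

/-- Each column of U belonging to a right index is conjugate to its left partner. Hence r splits
into a left multiplication and the matching right multiplication by the adjoint. -/
theorem star_rotV_inr (p : Ix n) (j : Fin n) :
    star (rotV n p (Sum.inr j)) = rotV n p (Sum.inl j) := by
  rcases p with p | p <;> by_cases h : p = j <;> simp [rotV, rotR, h, conj_isqrt2]

theorem rOp_rotV_eq (p : Ix n) : rOp (rotV n) p = rOpLeft p + rOpRight p := by
  rw [rOp, Fintype.sum_sum_type]
  simp only [star_rotV_inr]
  rfl

theorem isConjPair_rOp (p : Ix n) : IsConjPair (rOpLeft p) (rOpRight p) := by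
  refine .sum fun j _ => ?_
  have := (IsConjPair.rai j).smul (star (rotV n p (Sum.inl j)))
  rwa [star_star] at this

theorem IsRaising.rOpLeft (p : Ix n) : IsRaising (rOpLeft p) := .sum fun _ _ => (IsRaising.rai _).smul _

theorem IsRaising.rOpRight (p : Ix n) : IsRaising (rOpRight p) := .sum fun _ _ => (IsRaising.rai _).smul _

theorem commute_sum_rai {α β : Type*} [Fintype α] [Fintype β] (x : α → ℂ) (y : β → ℂ) (f : α → Ix n)
    (g : β → Ix n) : Commute (∑ j, x j • rai (f j)) (∑ j, y j • rai (g j)) :=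
  Commute.sum_left _ _ _ fun j _ => Commute.sum_right _ _ _ fun k _ =>
    Commute.smul_right (Commute.smul_left (rai_mul_rai (f j) (g k)) _) _

theorem commute_quadratic {A : Type*} [Ring A] [Algebra ℂ A] {x : Ix n → A} {z : A}
    (h : ∀ p, Commute (x p) z) (c : Ix n → Ix n → ℂ) (k : Ix n → ℂ) :
    Commute ((1 / 2 : ℂ) • ∑ p, ∑ q, c p q • (x p * x q) + ∑ p, k p • x p) z :=
  ((Commute.sum_left _ _ _ fun p _ => Commute.sum_left _ _ _ fun q _ =>
    ((h p).mul_left (h q)).smul_left _).smul_left _).add_left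
    (Commute.sum_left _ _ _ fun p _ => (h p).smul_left _)

/-- The exponent separates into left, right and mixed terms. Symmetry of `A` merges the two mixed
terms and cancels the factor ½. -/
theorem quadOp_rotV {A : Matrix (Ix n) (Ix n) ℝ} (hA : A.IsSymm) (k : Ix n → ℝ) :
    quadOp (rotV n) A k =
      ((1 / 2 : ℂ) • ∑ p, ∑ q, (A p q : ℂ) • (rOpLeft p * rOpLeft q) + ∑ p, (k p : ℂ) • rOpLeft p)
      + (((1 / 2 : ℂ) • ∑ p, ∑ q, (A p q : ℂ) • (rOpRight p * rOpRight q)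
        + ∑ p, (k p : ℂ) • rOpRight p) + ∑ p, ∑ q, (A p q : ℂ) • (rOpLeft p * rOpRight q)) := by
  have h1 : ∑ p, ∑ q, (A p q : ℂ) • (rOpRight p * rOpLeft q : Module.End ℂ (Fn (Ix n))) =
      ∑ p, ∑ q, (A p q : ℂ) • (rOpLeft p * rOpRight q) := by
    rw [Finset.sum_comm]
    refine Finset.sum_congr rfl fun p _ => Finset.sum_congr rfl fun q _ => ?_
    have h2 : Commute (rOpRight q) (rOpLeft p) := commute_sum_rai _ _ _ _
    rw [hA.apply, h2.eq]
  rw [quadOp]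
  simp only [rOp_rotV_eq, add_mul, mul_add, smul_add, Finset.sum_add_distrib, h1]
  module

theorem sum_rOpLeft_mul_rOpRight (Γ : Matrix (Ix n) (Ix n) ℝ) {B : Matrix (Fin n) (Fin n) ℂ}
    (hB : couplingMatrix Γ = Bᴴ * B) :
    ∑ p, ∑ q, (((1 - (Γ + (1 / 2 : ℝ) • 1)⁻¹ : Matrix (Ix n) (Ix n) ℝ) p q : ℝ) : ℂ) •
      (rOpLeft p * rOpRight q : Module.End ℂ (Fn (Ix n))) =
    ∑ a, (∑ j, star (B a j) • rai (Sum.inl j)) * (∑ k, B a k • rai (Sum.inr k)) := by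
  have h1 : ∀ j k, ∑ a, star (B a j) * B a k = ∑ p, ∑ q, star (rotV n p (Sum.inl j)) *
      (((1 - (Γ + (1 / 2 : ℝ) • 1)⁻¹ : Matrix (Ix n) (Ix n) ℝ) p q : ℝ) : ℂ) *
        rotV n q (Sum.inl k) := by
    intro j k
    have h2 := congrFun (congrFun hB j) k
    simp only [couplingMatrix, Matrix.mul_apply, Matrix.conjTranspose_apply, Matrix.submatrix_apply,
      Matrix.map_apply, id, Finset.sum_mul] at h2
    rw [← h2, Finset.sum_comm]
  calc _ = ∑ j, ∑ k, (∑ p, ∑ q, star (rotV n p (Sum.inl j)) *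
      (((1 - (Γ + (1 / 2 : ℝ) • 1)⁻¹ : Matrix (Ix n) (Ix n) ℝ) p q : ℝ) : ℂ) *
        rotV n q (Sum.inl k)) • (rai (Sum.inl j) * rai (Sum.inr k)) := by
        simp only [rOpLeft, rOpRight, Finset.sum_mul_sum, smul_mul_smul_comm, Finset.smul_sum,
          smul_smul, Finset.sum_smul]
        rw [Finset.sum_congr rfl fun p _ => Finset.sum_comm, Finset.sum_comm]
        refine Finset.sum_congr rfl fun j _ => ?_
        rw [Finset.sum_congr rfl fun p _ => Finset.sum_comm, Finset.sum_comm]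
        refine Finset.sum_congr rfl fun k _ => Finset.sum_congr rfl fun p _ =>
          Finset.sum_congr rfl fun q _ => ?_
        congr 1
        ring
    _ = _ := by
      simp only [← h1, Finset.sum_mul_sum, smul_mul_smul_comm, Finset.sum_smul]
      rw [Finset.sum_congr rfl fun j _ => Finset.sum_comm, Finset.sum_comm]

theorem IsRaising.quadratic {x : Ix n → Module.End ℂ (Fn (Ix n))} (h : ∀ p, IsRaising (x p))
    (c : Ix n → Ix n → ℂ) (k : Ix n → ℂ) :
    IsRaising ((1 / 2 : ℂ) • ∑ p, ∑ q, c p q • (x p * x q) + ∑ p, k p • x p) :=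
  ((IsRaising.sum fun p _ => .sum fun q _ => ((h p).mul (h q)).smul _).smul _).add
    (.sum fun p _ => (h p).smul _)

/-- Gaussians with a physical covariance matrix are positive. -/
theorem isPosForm_gaussCov {Γ : Matrix (Ix n) (Ix n) ℝ} (h : IsBona Γ) (κ : Ix n → ℝ) :
    IsPosForm ((toFn n).symm (gaussCov (rotV n) Γ κ)) := by
  -- The factorization B†B of the coupling matrix supplies the operators L of the coupling term, one
  -- per row of B.
  obtain ⟨B, hB⟩ : ∃ B : Matrix (Fin n) (Fin n) ℂ, couplingMatrix Γ = Bᴴ * B := by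
    open scoped MatrixOrder in
    exact CStarAlgebra.nonneg_iff_eq_star_mul_self.mp (Matrix.nonneg_iff_posSemidef.mpr h.couplingMatrix)
  have hA : (1 - (Γ + (1 / 2 : ℝ) • 1)⁻¹ : Matrix (Ix n) (Ix n) ℝ).IsSymm :=
    Matrix.isSymm_one.sub (posDef_isSymm (posDef_add_half h.1).inv)
  rw [gaussCov, gaussFn, quadOp_rotV hA, sum_rOpLeft_mul_rOpRight Γ hB]
  have hlr : ∀ p q, Commute (rOpLeft p : Module.End ℂ (Fn (Ix n))) (rOpRight q) :=
    fun p q => commute_sum_rai _ _ _ _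
  refine isPosForm_expVac ?_ (fun a => ?_) (.quadratic .rOpLeft _ _) (.quadratic .rOpRight _ _)
    (.sum fun a _ => (IsRaising.sum fun j _ => (IsRaising.rai _).smul _).mul
      (.sum fun j _ => (IsRaising.rai _).smul _)) ?_ ?_ ?_
  · have hreal : ∀ x : ℝ, star (x : ℂ) = x := Complex.conj_ofReal
    have h1 := ((IsConjPair.sum (s := Finset.univ) fun p _ => IsConjPair.sum (s := Finset.univ)
      fun q _ => ((isConjPair_rOp (n := n) p).mul (isConjPair_rOp q)).smul
        (((1 - (Γ + (1 / 2 : ℝ) • 1)⁻¹ : Matrix (Ix n) (Ix n) ℝ) p q : ℝ) : ℂ)).smul (1 / 2 : ℂ)).add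
      (.sum (s := Finset.univ) fun p _ => (isConjPair_rOp (n := n) p).smul
        ((((Γ + (1 / 2 : ℝ) • 1)⁻¹ *ᵥ κ) p : ℝ) : ℂ))
    simp only [hreal] at h1
    have h2 : star (1 / 2 : ℂ) = 1 / 2 := by simp
    rwa [h2] at h1
  · refine .sum fun j _ => ?_
    have := (IsConjPair.rai j).smul (star (B a j))
    rwa [star_star] at this
  · refine Commute.add_right (Commute.smul_right (Commute.sum_right _ _ _ fun p _ =>
      Commute.sum_right _ _ _ fun q _ => Commute.smul_right (Commute.mul_right ?_ ?_) _) _)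
      (Commute.sum_right _ _ _ fun p _ => Commute.smul_right ?_ _)
    all_goals exact commute_quadratic (x := rOpLeft) (fun p => hlr p _) _ _
  · refine Commute.sum_right _ _ _ fun a _ => Commute.mul_right ?_ ?_
    · exact commute_quadratic (x := rOpLeft) (fun p => commute_sum_rai _ _ _ _) _ _
    · exact commute_quadratic (x := rOpLeft) (fun p => commute_sum_rai _ _ _ _) _ _
  · refine Commute.sum_right _ _ _ fun a _ => Commute.mul_right ?_ ?_
    · exact commute_quadratic (x := rOpRight) (fun p => commute_sum_rai _ _ _ _) _ _
    · exact commute_quadratic (x := rOpRight) (fun p => commute_sum_rai _ _ _ _) _ _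

end Positivity

/-! ## Termwise differentiation under domination -/

section Dominated

variable {β : Type*}

/-- Mean value inequality. It turns a bound on derivatives into the dominating function for
difference quotients. -/
theorem norm_slope_le {f f' : ℝ → ℂ} {c : ℝ} {S : Set ℝ} (hS : Convex ℝ S)
    (hf : ∀ t ∈ S, HasDerivWithinAt f (f' t) S t) (hc : ∀ t ∈ S, ‖f' t‖ ≤ c)
    {s t : ℝ} (hs : s ∈ S) (ht : t ∈ S) (hst : s ≠ t) : ‖slope f t s‖ ≤ c := by
  have h := hS.norm_image_sub_le_of_norm_hasDerivWithin_le hf hc ht hs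
  rw [slope_def_module, norm_smul, norm_inv, inv_mul_le_iff₀ (norm_pos_iff.mpr (sub_ne_zero.mpr hst)),
    mul_comm]
  exact h

theorem hasDerivWithinAt_tsum_of_le {f f' : ℝ → β → ℂ} {u : β → ℝ} {S : Set ℝ} (hS : Convex ℝ S)
    (hu : Summable u) (hf : ∀ t ∈ S, ∀ i, HasDerivWithinAt (fun t => f t i) (f' t i) S t)
    (hfu : ∀ t ∈ S, Summable (f t)) (hf'u : ∀ t ∈ S, ∀ i, ‖f' t i‖ ≤ u i) {t : ℝ} (ht : t ∈ S) :
    HasDerivWithinAt (fun t => ∑' i, f t i) (∑' i, f' t i) S t := by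
  rw [hasDerivWithinAt_iff_tendsto_slope]
  have hev : ∀ᶠ s in nhdsWithin t (S \ {t}), s ∈ S \ {t} := self_mem_nhdsWithin
  have h1 : Filter.Tendsto (fun s => ∑' i, slope (fun t => f t i) t s) (nhdsWithin t (S \ {t}))
      (nhds (∑' i, f' t i)) := by
    refine tendsto_tsum_of_dominated_convergence hu
      (fun i => hasDerivWithinAt_iff_tendsto_slope.mp (hf t ht i)) ?_
    filter_upwards [hev] with s hs i
    exact norm_slope_le hS (fun t ht => hf t ht i) (fun t ht => hf'u t ht i) hs.1 ht hs.2
  refine h1.congr' ?_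
  filter_upwards [hev] with s hs
  simp only [slope_def_module]
  rw [tsum_const_smul'', (hfu s hs.1).tsum_sub (hfu t ht)]

theorem lp_hasSum_norm_sq (x : lp (fun _ : β => ℂ) 2) : HasSum (fun i => ‖x i‖ ^ 2) (‖x‖ ^ 2) := by
  have h := lp.hasSum_norm (p := 2) (by norm_num) x
  simpa using h

/-- Dominated convergence for the squared entries of the difference quotient minus the derivative,
each at most (2b)². -/
theorem hasDerivWithinAt_lp {u : ℝ → lp (fun _ : β => ℂ) 2} {v : ℝ → lp (fun _ : β => ℂ) 2}
    {b : β → ℝ} {S : Set ℝ} (hS : Convex ℝ S) (hb : Summable fun i => b i ^ 2)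
    (hu : ∀ t ∈ S, ∀ i, HasDerivWithinAt (fun t => u t i) (v t i) S t)
    (hv : ∀ t ∈ S, ∀ i, ‖v t i‖ ≤ b i) {t : ℝ} (ht : t ∈ S) : HasDerivWithinAt u (v t) S t := by
  rw [hasDerivWithinAt_iff_tendsto_slope, tendsto_iff_norm_sub_tendsto_zero]
  have hev : ∀ᶠ s in nhdsWithin t (S \ {t}), s ∈ S \ {t} := self_mem_nhdsWithin
  have h1 : Filter.Tendsto (fun s => ∑' i, ‖slope (fun t => u t i) t s - v t i‖ ^ 2)
      (nhdsWithin t (S \ {t})) (nhds (∑' i : β, (0 : ℝ))) := by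
    refine tendsto_tsum_of_dominated_convergence (bound := fun i => 4 * b i ^ 2) (hb.mul_left 4)
      (fun i => ?_) ?_
    · have := (tendsto_iff_norm_sub_tendsto_zero.mp
        (hasDerivWithinAt_iff_tendsto_slope.mp (hu t ht i))).pow 2
      simpa using this
    · filter_upwards [hev] with s hs i
      rw [Real.norm_of_nonneg (sq_nonneg _)]
      have h2 : ‖slope (fun t => u t i) t s - v t i‖ ≤ 2 * b i := by
        refine (norm_sub_le _ _).trans ?_
        have := norm_slope_le hS (fun t ht => hu t ht i) (fun t ht => hv t ht i) hs.1 ht hs.2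
        linarith [hv t ht i]
      calc _ ≤ (2 * b i) ^ 2 := pow_le_pow_left₀ (norm_nonneg _) h2 2
        _ = _ := by ring
  rw [tsum_zero] at h1
  have h3 := h1.sqrt
  rw [Real.sqrt_zero] at h3
  refine h3.congr fun s => ?_
  have h4 : ∀ i, slope (fun t => u t i) t s - v t i = (slope u t s - v t) i := by
    intro i
    rw [lp.coeFn_sub, Pi.sub_apply, slope_def_module, slope_def_module, lp.coeFn_smul, Pi.smul_apply,
      lp.coeFn_sub, Pi.sub_apply]
  simp only [h4]
  rw [(lp_hasSum_norm_sq _).tsum_eq, Real.sqrt_sq (norm_nonneg _)]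

end Dominated

/-! ## Existence of solutions -/

theorem summable_pairs {f : (Ix n → ℕ) → ℝ} (h : Summable f) :
    Summable fun x : Occ n × Occ n => f (Sum.elim x.1 x.2) :=
  (Equiv.summable_iff (Equiv.sumArrowEquivProdArrow (Fin n) (Fin n) ℕ).symm).mpr h

theorem summable_geometric_pairs {r : ℝ} (h0 : 0 ≤ r) (h1 : r < 1) :
    Summable fun x : Occ n × Occ n => r ^ deg (Sum.elim x.1 x.2 : Ix n → ℕ) :=
  summable_pairs (f := fun i => r ^ deg i) (summable_geometric_deg h0 h1)

theorem summable_bound_sq {r : ℝ} (C : ℝ) (h0 : 0 ≤ r) (h1 : r < 1) :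
    Summable fun x : Occ n × Occ n => (C * r ^ deg (Sum.elim x.1 x.2 : Ix n → ℕ)) ^ 2 := by
  have h2 : r ^ 2 < 1 := by nlinarith
  refine ((summable_geometric_pairs (n := n) (sq_nonneg r) h2).mul_left (C ^ 2)).congr fun x => ?_
  rw [mul_pow, ← pow_mul, ← pow_mul, mul_comm 2]

theorem Decays.memℓp {X : Fn (Ix n)} (hX : Decays X) :
    Memℓp (fun x : Occ n × Occ n => X (Sum.elim x.1 x.2)) 2 := by
  obtain ⟨C, r, hC, hr0, hr1, h⟩ := hX
  refine memℓp_gen ?_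
  have h2 : (2 : ENNReal).toReal = ((2 : ℕ) : ℝ) := by norm_num
  simp only [h2, Real.rpow_natCast]
  exact .of_nonneg_of_le (fun _ => sq_nonneg _)
    (fun x => pow_le_pow_left₀ (norm_nonneg _) (h () _) 2) (summable_bound_sq C hr0.le hr1)

/-- A decaying function as Hilbert-Schmidt operator. -/
def Decays.toHS {X : Fn (Ix n)} (hX : Decays X) : HS n := ⟨_, hX.memℓp⟩

theorem Decays.toOp_toHS {X : Fn (Ix n)} (hX : Decays X) : hX.toHS.toOp = (toFn n).symm X := rfl

/-- Uniform exponential decay of the derivative is a square-summable majorant, which upgrades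
entrywise differentiability to Hilbert-Schmidt norm. -/
theorem evolves_of_expDecay {𝒬 : Op n → Op n} {T : Module.End ℂ (Fn (Ix n))}
    (hT : T ∈ ladderAlg (Ix n)) (h𝒬 : ∀ R, toFn n (𝒬 R) = T (toFn n R)) {X : ℝ → Fn (Ix n)}
    (hX : ExpDecay fun t : Set.Icc (0 : ℝ) 1 => X t)
    (hd : ∀ t ∈ Set.Icc (0 : ℝ) 1, ∀ i,
      HasDerivWithinAt (fun t => X t i) (T (X t) i) (Set.Icc 0 1) t) :
    Evolves 𝒬 ((toFn n).symm (X 0)) ((toFn n).symm (X 1)) := by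
  -- A solution is a curve on all of ℝ, whereas decay is known on [0,1]; freezing time outside the
  -- interval keeps it in the Hilbert-Schmidt class.
  let pr : ℝ → Set.Icc (0 : ℝ) 1 := Set.projIcc 0 1 zero_le_one
  have hpr : ∀ t ∈ Set.Icc (0 : ℝ) 1, (pr t : ℝ) = t := fun t ht => by
    rw [show pr t = ⟨t, ht⟩ from Set.projIcc_of_mem _ ht]
  have hdec : ∀ t, Decays (X (pr t)) := fun t => hX.comp fun _ => pr t
  have hdec' : ∀ t, Decays (T (X (pr t))) := fun t => (hdec t).apply hT
  obtain ⟨C, r, hC, hr0, hr1, hb⟩ := hX.apply hT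
  refine ⟨fun t => (hdec t).toHS, ?_, ?_, fun t ht => ⟨(hdec' t).toHS, ?_, ?_⟩⟩
  · rw [Decays.toOp_toHS, hpr 0 ⟨le_rfl, zero_le_one⟩]
  · rw [Decays.toOp_toHS, hpr 1 ⟨zero_le_one, le_rfl⟩]
  · apply (toFn n).injective
    rw [h𝒬, Decays.toOp_toHS, Decays.toOp_toHS, LinearEquiv.apply_symm_apply,
      LinearEquiv.apply_symm_apply]
  · refine hasDerivWithinAt_lp (v := fun t => (hdec' t).toHS)
      (b := fun x => C * r ^ deg (Sum.elim x.1 x.2 : Ix n → ℕ)) (convex_Icc 0 1)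
      (summable_bound_sq C hr0.le hr1) (fun s hs x => ?_) (fun s _ x => hb (pr s) _) ht
    have h1 := hd s hs (Sum.elim x.1 x.2)
    change HasDerivWithinAt (fun t => X (pr t) (Sum.elim x.1 x.2)) (T (X (pr s)) (Sum.elim x.1 x.2)) _ _
    rw [hpr s hs]
    exact h1.congr (fun y hy => by rw [hpr y hy]) (by rw [hpr s hs])

/-! ## Uniqueness of solutions -/

/-- Integrating the equation k times costs degree 2k but gains (t-a)^k/k!. The coefficients
2C(K+1)⋯(K+k) collected on the way combine with 1/k! into a binomial coefficient. -/
theorem norm_le_of_growth {T : Module.End ℂ (Fn (Ix n))} {C : ℝ} (hC : 0 ≤ C)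
    (hT : ∀ (X : Fn (Ix n)) (N : ℕ) (b : ℝ), 0 ≤ b → (∀ i, deg i ≤ N + 2 → ‖X i‖ ≤ b) →
      ∀ i, deg i ≤ N → ‖T X i‖ ≤ C * Real.sqrt ((N : ℝ) + 2) ^ 2 * b)
    {X : ℝ → Fn (Ix n)} {a b M : ℝ} (hM : 0 ≤ M) (h0 : X a = 0)
    (hX : ∀ t ∈ Set.Icc a b, ∀ i, HasDerivWithinAt (fun t => X t i) (T (X t) i) (Set.Icc a b) t)
    (hb : ∀ t ∈ Set.Icc a b, ∀ i, ‖X t i‖ ≤ M) (k : ℕ) :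
    ∀ (K : ℕ), ∀ t ∈ Set.Icc a b, ∀ i, deg i ≤ 2 * K →
      ‖X t i‖ ≤ M * (2 * C * (t - a)) ^ k * ((K + k).choose k : ℝ) := by
  induction k with
  | zero =>
    intro K t ht i _
    simpa using hb t ht i
  | succ k ih =>
    intro K t ht i hi
    refine image_norm_le_of_norm_deriv_right_le_deriv_boundary (a := a) (b := b)
      (f := fun t => X t i) (f' := fun t => T (X t) i)
      (B := fun t => M * (2 * C * (t - a)) ^ (k + 1) * ((K + (k + 1)).choose (k + 1) : ℝ))
      (B' := fun t => M * ((k + 1) * (2 * C * (t - a)) ^ k * (2 * C)) *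
        ((K + (k + 1)).choose (k + 1) : ℝ))
      (fun s hs => (hX s hs i).continuousWithinAt)
      (fun s hs => (hX s (Set.Ico_subset_Icc_self hs) i).mono_of_mem_nhdsWithin
        (Icc_mem_nhdsGE_of_mem hs)) ?_ (fun s => ?_) (fun s hs => ?_) ht
    · simp [h0]
    · have h1 : HasDerivAt (fun t => 2 * C * (t - a)) (2 * C) s := by
        simpa using ((hasDerivAt_id s).sub_const a).const_mul (2 * C)
      have h2 := ((h1.pow (k + 1)).const_mul M).mul_const ((K + (k + 1)).choose (k + 1) : ℝ)
      simpa using h2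
    · have hs' := Set.Ico_subset_Icc_self hs
      have hsa : 0 ≤ s - a := sub_nonneg.mpr hs.1
      have h1 := hT (X s) (2 * K) (M * (2 * C * (s - a)) ^ k * ((K + 1 + k).choose k : ℝ))
        (by positivity) (fun j hj => ih (K + 1) s hs' j (by omega)) i hi
      refine h1.trans_eq ?_
      rw [Real.sq_sqrt (by positivity)]
      have h2 : ((K + (k + 1)).choose (k + 1) : ℝ) * (k + 1) = ((K + 1 + k).choose k : ℝ) * (K + 1) := by
        have h3 := Nat.choose_succ_right_eq (K + (k + 1)) k
        have h4 : K + (k + 1) - k = K + 1 := by omega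
        have h5 : K + (k + 1) = K + 1 + k := by omega
        rw [h4] at h3
        nth_rewrite 2 [h5] at h3
        exact_mod_cast h3
      push_cast
      linear_combination (-(M * (2 * C * (s - a)) ^ k * (2 * C))) * h2

/-- On a short interval the iterated bound tends to 0 as k grows, since binomial coefficients are at
most powers of 2. The interval length depends only on `C`, so finitely many steps cover [0,1]. -/
theorem eq_zero_of_growth {T : Module.End ℂ (Fn (Ix n))} (hT : GrowthLE 2 T)
    {X : ℝ → Fn (Ix n)} {M : ℝ} (hM : 0 ≤ M) (h0 : X 0 = 0)
    (hX : ∀ t ∈ Set.Icc (0 : ℝ) 1, ∀ i,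
      HasDerivWithinAt (fun t => X t i) (T (X t) i) (Set.Icc 0 1) t)
    (hb : ∀ t ∈ Set.Icc (0 : ℝ) 1, ∀ i, ‖X t i‖ ≤ M) : X 1 = 0 := by
  obtain ⟨C, hC, hT⟩ := hT
  -- With 8C(b-a) ≤ 1 the k-th power is at most 4^{-k}, against a binomial coefficient of at most
  -- 2^{deg i + k}.
  have hstep : ∀ a b : ℝ, 0 ≤ a → a ≤ b → b ≤ 1 → 8 * C * (b - a) ≤ 1 → X a = 0 → X b = 0 := by
    intro a b ha hab hb1 hC1 hXa
    have hsub : Set.Icc a b ⊆ Set.Icc 0 1 := Set.Icc_subset_Icc ha hb1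
    funext i
    rw [Pi.zero_apply, ← norm_le_zero_iff]
    have h1 : ∀ k, ‖X b i‖ ≤ M * 2 ^ deg i * (1 / 2) ^ k := by
      intro k
      have h2 := norm_le_of_growth hC hT hM hXa (fun t ht j => (hX t (hsub ht) j).mono hsub)
        (fun t ht => hb t (hsub ht)) k (deg i) b ⟨hab, le_rfl⟩ i (by omega)
      refine h2.trans ?_
      have h3 : ((deg i + k).choose k : ℝ) ≤ 2 ^ (deg i + k) := by
        exact_mod_cast Nat.choose_le_two_pow (deg i + k) k
      have h4 : 0 ≤ 2 * C * (b - a) := by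
        have := sub_nonneg.mpr hab
        positivity
      have h5 : (2 * C * (b - a)) ^ k ≤ (1 / 4 : ℝ) ^ k := pow_le_pow_left₀ h4 (by linarith) k
      calc _ ≤ M * (1 / 4 : ℝ) ^ k * 2 ^ (deg i + k) := by gcongr
        _ = _ := by
          rw [pow_add, show (1 / 4 : ℝ) = 1 / 2 * (1 / 2) by norm_num, mul_pow, one_div, inv_pow]
          field_simp
    have h6 : Filter.Tendsto (fun k : ℕ => M * 2 ^ deg i * (1 / 2 : ℝ) ^ k) Filter.atTop
        (nhds (M * 2 ^ deg i * 0)) :=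
      (tendsto_pow_atTop_nhds_zero_of_lt_one (by norm_num) (by norm_num)).const_mul _
    rw [mul_zero] at h6
    exact ge_of_tendsto' h6 h1
  obtain ⟨m, hm⟩ := exists_nat_gt (8 * C)
  have hm0 : (0 : ℝ) < m := lt_of_le_of_lt (by positivity) hm
  have hind : ∀ j : ℕ, j ≤ m → X (j / m) = 0 := by
    intro j
    induction j with
    | zero => intro _; simpa using h0
    | succ j ih =>
      intro hj
      refine hstep (j / m) ((j + 1 : ℕ) / m) (by positivity) ?_ ?_ ?_ (ih (by omega))
      · gcongr
        omega
      · rw [div_le_one hm0]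
        exact_mod_cast hj
      · rw [← sub_div, mul_div_assoc', div_le_one hm0]
        push_cast
        linarith
  have := hind m le_rfl
  rwa [div_self hm0.ne'] at this

/-- The difference of two solutions is continuous on a compact interval, so its Hilbert-Schmidt norm
bounds all entries uniformly. -/
theorem Evolves.unique {𝒬 : Op n → Op n} {T : Module.End ℂ (Fn (Ix n))}
    (hT : GrowthLE 2 T) (h𝒬 : ∀ R, toFn n (𝒬 R) = T (toFn n R)) {R₀ R R' : Op n}
    (h : Evolves 𝒬 R₀ R) (h' : Evolves 𝒬 R₀ R') : R = R' := by
  obtain ⟨u, hu0, hu1, hu⟩ := h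
  obtain ⟨u', hu0', hu1', hu'⟩ := h'
  have hcont : ContinuousOn (fun t => u t - u' t) (Set.Icc 0 1) := fun t ht => by
    obtain ⟨v, -, hv⟩ := hu t ht
    obtain ⟨v', -, hv'⟩ := hu' t ht
    exact (hv.sub hv').continuousWithinAt
  obtain ⟨M, hM⟩ := isCompact_Icc.exists_bound_of_continuousOn hcont
  have hM0 : 0 ≤ M := (norm_nonneg _).trans (hM 0 ⟨le_rfl, zero_le_one⟩)
  have key := eq_zero_of_growth hT (X := fun t => toFn n (u t - u' t).toOp) hM0 ?_ ?_ ?_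
  · have h1 : (u 1).toOp = (u' 1).toOp := by
      ext m m'
      have := congrFun key (Sum.elim m m')
      change (u 1 - u' 1 : HS n) (m, m') = 0 at this
      rw [lp.coeFn_sub, Pi.sub_apply, sub_eq_zero] at this
      exact this
    rw [← hu1, ← hu1', h1]
  · funext i
    change (u 0 - u' 0 : HS n) _ = 0
    rw [lp.coeFn_sub, Pi.sub_apply, sub_eq_zero]
    exact congrFun (congrFun (hu0.trans hu0'.symm) _) _
  · intro t ht i
    obtain ⟨v, hv, hv'⟩ := hu t ht
    obtain ⟨w, hw, hw'⟩ := hu' t ht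
    set x : Occ n × Occ n := (fun j => i (Sum.inl j), fun j => i (Sum.inr j))
    have h1 : HasDerivWithinAt (fun t => (u t - u' t : HS n) x) ((v - w : HS n) x) (Set.Icc 0 1) t :=
      ((lp.evalCLM ℝ (fun _ : Occ n × Occ n => ℂ) 2 x).hasFDerivAt.comp_hasDerivWithinAt t
        (hv'.sub hw'))
    refine h1.congr_deriv ?_
    have h2 : toFn n (u t - u' t).toOp = toFn n (u t).toOp - toFn n (u' t).toOp := rfl
    rw [h2, map_sub, ← h𝒬, ← h𝒬, ← hv, ← hw]
    rfl
  · intro t ht i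
    exact (lp.norm_apply_le_norm (by norm_num) (u t - u' t) _).trans (hM t ht)

/-! ## Normalized Gaussian states -/

theorem decays_gaussCov {Γ : Matrix (Ix n) (Ix n) ℝ} (h : Γ.PosDef) (κ : Ix n → ℝ) :
    Decays (gaussCov (rotV n) Γ κ) := by
  have h1 := (expDecay_gaussCov_path (rotV_mul_conjTranspose n) h h κ).comp
    fun _ : Unit => ⟨1, zero_le_one, le_rfl⟩
  simp only [covPath_one, one_smul] at h1
  exact h1

/-- The trace of the unnormalized Gaussian. -/
def gaussTr (Γ : Matrix (Ix n) (Ix n) ℝ) (κ : Ix n → ℝ) : ℂ := tr (gaussCov (rotV n) Γ κ)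

/-- Positivity makes the diagonal entries nonnegative, and the vacuum entry of the unnormalized
Gaussian is 1. The lower bound makes normalization harmless uniformly in the parameters. -/
theorem gaussTr_eq {Γ : Matrix (Ix n) (Ix n) ℝ} (h : IsBona Γ) (κ : Ix n → ℝ) :
    ∃ x : ℝ, 1 ≤ x ∧ gaussTr Γ κ = x := by
  have hs := (decays_gaussCov h.1 κ).hasSum
  have h0 : ∀ m : Occ n, 0 ≤ (gaussCov (rotV n) Γ κ (Sum.elim m m)).re ∧
      0 = (gaussCov (rotV n) Γ κ (Sum.elim m m)).im := fun m =>
    Complex.nonneg_iff.mp ((isPosForm_gaussCov h κ).diag_nonneg m)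
  refine ⟨(gaussTr Γ κ).re, ?_, ?_⟩
  · have h1 := le_hasSum (Complex.hasSum_re hs) 0 fun m _ => (h0 m).1
    have h2 : (Sum.elim 0 0 : Ix n → ℕ) = 0 := by
      funext j
      rcases j with j | j <;> rfl
    rw [h2, gaussCov, gaussFn, expVac_zero_apply, Complex.one_re] at h1
    exact h1
  · have h1 := Complex.hasSum_im hs
    simp only [← (h0 _).2] at h1
    exact Complex.ext rfl (h1.unique hasSum_zero)

theorem gaussTr_ne_zero {Γ : Matrix (Ix n) (Ix n) ℝ} (h : IsBona Γ) (κ : Ix n → ℝ) :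
    gaussTr Γ κ ≠ 0 := by
  obtain ⟨x, hx, h1⟩ := gaussTr_eq h κ
  rw [h1, Complex.ofReal_ne_zero]
  linarith

theorem norm_gaussTr_inv_le {Γ : Matrix (Ix n) (Ix n) ℝ} (h : IsBona Γ) (κ : Ix n → ℝ) :
    ‖(gaussTr Γ κ)⁻¹‖ ≤ 1 := by
  obtain ⟨x, hx, h1⟩ := gaussTr_eq h κ
  rw [h1, norm_inv, Complex.norm_real, Real.norm_of_nonneg (by linarith)]
  exact inv_le_one_of_one_le₀ hx

/-- The normalized Gaussian with covariance matrix `Γ` and mean `κ`. -/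
def gaussState (Γ : Matrix (Ix n) (Ix n) ℝ) (κ : Ix n → ℝ) : Fn (Ix n) :=
  (gaussTr Γ κ)⁻¹ • gaussCov (rotV n) Γ κ

theorem decays_gaussState {Γ : Matrix (Ix n) (Ix n) ℝ} (h : Γ.PosDef) (κ : Ix n → ℝ) :
    Decays (gaussState Γ κ) := (decays_gaussCov h κ).smul _

theorem tr_gaussState {Γ : Matrix (Ix n) (Ix n) ℝ} (h : IsBona Γ) (κ : Ix n → ℝ) :
    tr (gaussState Γ κ) = 1 := by
  rw [gaussState, tr_smul]
  exact inv_mul_cancel₀ (gaussTr_ne_zero h κ)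

theorem gaussState_ne_zero {Γ : Matrix (Ix n) (Ix n) ℝ} (h : IsBona Γ) (κ : Ix n → ℝ) :
    gaussState Γ κ ≠ 0 := fun h0 => by
  have := tr_gaussState h κ
  rw [h0, tr] at this
  simp at this

theorem isDensity_gaussState {Γ : Matrix (Ix n) (Ix n) ℝ} (h : IsBona Γ) (κ : Ix n → ℝ) :
    IsDensity ((toFn n).symm (gaussState Γ κ)) := by
  have hd := decays_gaussState h.1 κ
  refine ⟨⟨hd.isTraceClass, ?_⟩, ?_⟩
  · have := hd.hasSum
    rwa [tr_gaussState h κ] at this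
  · obtain ⟨T, hT⟩ := exists_represents (R := (toFn n).symm (gaussState Γ κ)) hd.summable
    refine ⟨T, hT, isPositive_of_isPosForm ?_ hT⟩
    rw [gaussState, map_smul]
    refine .smul ?_ (isPosForm_gaussCov h κ)
    obtain ⟨x, hx, h1⟩ := gaussTr_eq h κ
    rw [h1, ← Complex.ofReal_inv]
    open scoped ComplexOrder in
    exact Complex.zero_le_real.mpr (inv_nonneg.mpr (by linarith))

theorem isRegularOp_gaussState {Γ : Matrix (Ix n) (Ix n) ℝ} (h : Γ.PosDef) (κ : Ix n → ℝ) :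
    IsRegularOp ((toFn n).symm (gaussState Γ κ)) :=
  isRegularOp_of_decays (by
    rw [LinearEquiv.apply_symm_apply]
    exact decays_gaussState h κ)

theorem tr_vacFn : tr (vacFn (Ix n)) = 1 := by
  rw [tr, tsum_eq_single 0 fun m hm => ?_]
  · have h2 : (Sum.elim 0 0 : Ix n → ℕ) = 0 := by
      funext j
      rcases j with j | j <;> rfl
    rw [h2, vacFn, if_pos rfl]
  · rw [vacFn, if_neg fun h => hm (funext fun j => congrFun h (Sum.inl j))]

/-- For Γ = 1/2 the matrix Γ + 1/2 is the identity, so the quadratic exponent vanishes. -/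
theorem gaussState_half :
    gaussState ((1 / 2 : ℝ) • (1 : Matrix (Ix n) (Ix n) ℝ)) 0 = vacFn (Ix n) := by
  have h1 : ((1 / 2 : ℝ) • (1 : Matrix (Ix n) (Ix n) ℝ) + (1 / 2 : ℝ) • 1) = 1 := by module
  have h2 : gaussCov (rotV n) ((1 / 2 : ℝ) • (1 : Matrix (Ix n) (Ix n) ℝ)) 0 = vacFn (Ix n) := by
    rw [gaussCov, h1, inv_one, sub_self, Matrix.mulVec_zero, gaussFn]
    have h3 : quadOp (rotV n) 0 0 = 0 := by simp [quadOp]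
    rw [h3, expVac_zero]
  rw [gaussState, gaussTr, h2, tr_vacFn, inv_one, one_smul]

theorem bOp_gaussState {Γ : Matrix (Ix n) (Ix n) ℝ} (h : Γ.PosDef) (κ : Ix n → ℝ) (p : Ix n) :
    bOp (rotV n) p (gaussState Γ κ) = (2 : ℂ) • ∑ q, (Γ p q : ℂ) • bpOp (rotV n) q (gaussState Γ κ)
      + ((Real.sqrt 2 * κ p : ℝ) : ℂ) • gaussState Γ κ := by
  simp only [gaussState, map_smul]
  rw [bOp_gaussCov (rotV_mul_conjTranspose n) (posDef_isSymm h) (posDef_isUnit_det (posDef_add_half h)),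
    smul_add, smul_comm _ (2 : ℂ), Finset.smul_sum, smul_comm _ (((Real.sqrt 2 * κ p : ℝ)) : ℂ)]
  congr 2
  exact Finset.sum_congr rfl fun q _ => smul_comm _ _ _

/-! ### Exponentials of quadratic generators on Gaussian states. -/

section Exponential

variable {Γ₀ Γ₁ : Matrix (Ix n) (Ix n) ℝ}

/-- Every term of the generator has some b' as its outermost factor, and the trace annihilates b'.
-/
theorem tr_genOp {X : Fn (Ix n)} (hX : Decays X) (Δ : Matrix (Ix n) (Ix n) ℝ) (v : Ix n → ℝ) :
    tr (genOp (rotV n) Δ v X) = 0 := by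
  have h1 : genOp (rotV n) Δ v X = (∑ p, (1 : ℂ) • bpOp (rotV n) p * ((v p : ℂ) • 1
      + ∑ q, (Δ p q : ℂ) • bpOp (rotV n) q)) X := by
    rw [genOp, ← Finset.sum_add_distrib]
    refine congrFun (congrArg DFunLike.coe (Finset.sum_congr rfl fun p _ => ?_)) X
    rw [one_smul, mul_add, mul_smul_comm, mul_one, Finset.mul_sum]
    simp only [mul_smul_comm]
  have h2 : ∀ p, Decays (((v p : ℂ) • (1 : Module.End ℂ (Fn (Ix n)))
      + ∑ q, (Δ p q : ℂ) • bpOp (rotV n) q) X) := fun p => hX.apply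
    (Subalgebra.add_mem _ (Subalgebra.smul_mem _ (Subalgebra.one_mem _) _)
      (Subalgebra.sum_mem _ fun q _ => Subalgebra.smul_mem _ (bpOp_mem q) _))
  have h3 : ∀ s : Finset (Ix n), Decays ((∑ p ∈ s, (1 : ℂ) • bpOp (rotV n) p * ((v p : ℂ) • 1
      + ∑ q, (Δ p q : ℂ) • bpOp (rotV n) q)) X) ∧ tr ((∑ p ∈ s, (1 : ℂ) • bpOp (rotV n) p *
      ((v p : ℂ) • 1 + ∑ q, (Δ p q : ℂ) • bpOp (rotV n) q)) X) = 0 := by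
    intro s
    induction s using Finset.induction_on with
    | empty =>
      rw [Finset.sum_empty, LinearMap.zero_apply]
      refine ⟨by simpa using hX.smul 0, by simp [tr]⟩
    | insert p s hp ih =>
      rw [Finset.sum_insert hp, LinearMap.add_apply, one_smul, Module.End.mul_apply]
      have h4 := (h2 p).apply (bpOp_mem (V := rotV n) p)
      exact ⟨h4.add ih.1, by rw [tr_add h4 ih.1, ih.2, tr_bpOp (h2 p), add_zero]⟩
  rw [h1]
  exact (h3 Finset.univ).2

/-- The generator contributes no trace, so only the scalar factor remains after differentiating
under the sum. -/
theorem hasDerivWithinAt_gaussTr_path (h₀ : IsBona Γ₀) (h₁ : IsBona Γ₁) (w : Ix n → ℝ) {t : ℝ}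
    (ht : t ∈ Set.Icc (0 : ℝ) 1) {s : ℝ → ℂ} (hs : ∀ t ∈ Set.Icc (0 : ℝ) 1, ∀ i, HasDerivWithinAt
      (fun t => gaussCov (rotV n) (covPath Γ₀ Γ₁ t) (t • w) i)
      ((genOp (rotV n) (Γ₁ - Γ₀) (fun p => Real.sqrt 2 * w p)
        (gaussCov (rotV n) (covPath Γ₀ Γ₁ t) (t • w))
        + s t • gaussCov (rotV n) (covPath Γ₀ Γ₁ t) (t • w)) i) (Set.Icc 0 1) t) :
    HasDerivWithinAt (fun t => gaussTr (covPath Γ₀ Γ₁ t) (t • w))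
      (s t * gaussTr (covPath Γ₀ Γ₁ t) (t • w)) (Set.Icc 0 1) t := by
  set g : ℝ → Fn (Ix n) := fun t => gaussCov (rotV n) (covPath Γ₀ Γ₁ t) (t • w) with hg
  set G := genOp (rotV n) (Γ₁ - Γ₀) (fun p => Real.sqrt 2 * w p) with hG
  have hX : ExpDecay fun t : Set.Icc (0 : ℝ) 1 => g t :=
    expDecay_gaussCov_path (rotV_mul_conjTranspose n) h₀.1 h₁.1 w
  have hGX : ExpDecay fun t : Set.Icc (0 : ℝ) 1 => G (g t) := hX.apply (genOp_mem _ _)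
  have hdec : ∀ t ∈ Set.Icc (0 : ℝ) 1, Decays (g t) := fun t ht => hX.comp fun _ => ⟨t, ht⟩
  -- The vacuum entry of the unnormalized Gaussian is constantly 1, and its vanishing derivative
  -- determines `s`. This bounds `s` uniformly, as the domination argument requires.
  have hs0 : ∀ t ∈ Set.Icc (0 : ℝ) 1, s t = -G (g t) 0 := by
    intro t ht
    have h1 := hs t ht 0
    have h2 : (fun t => gaussCov (rotV n) (covPath Γ₀ Γ₁ t) (t • w) 0) = fun _ => 1 := by
      funext t
      exact expVac_zero_apply _
    rw [h2] at h1
    have h3 := (uniqueDiffOn_Icc zero_lt_one t ht).eq_deriv _ h1 (hasDerivWithinAt_const t _ _)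
    rw [Pi.add_apply, Pi.smul_apply, smul_eq_mul, gaussCov, gaussFn, expVac_zero_apply, mul_one] at h3
    exact eq_neg_of_add_eq_zero_right h3
  obtain ⟨K, hK⟩ : ∃ K, ∀ t : Set.Icc (0 : ℝ) 1, ‖s t‖ ≤ K := by
    obtain ⟨C, r, -, -, -, h⟩ := hGX
    refine ⟨C * r ^ deg (0 : Ix n → ℕ), fun t => ?_⟩
    rw [hs0 t t.2, norm_neg]
    exact h t 0
  obtain ⟨C, r, hC, hr0, hr1, hb⟩ := hGX.add (hX.smul (c := fun t => s t) hK)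
  have hb0 : Summable fun m : Occ n => C * r ^ deg (Sum.elim m m : Ix n → ℕ) :=
    ((summable_geometric_pairs hr0.le hr1).mul_left C).comp_injective
      (i := fun m : Occ n => (m, m)) fun a b hab => congrArg Prod.fst hab
  have h1 := hasDerivWithinAt_tsum_of_le (convex_Icc 0 1) hb0
    (f := fun t (m : Occ n) => g t (Sum.elim m m))
    (f' := fun t m => (G (g t) + s t • g t) (Sum.elim m m))
    (fun t ht m => hs t ht _) (fun t ht => (hdec t ht).hasSum.summable)
    (fun t ht m => hb ⟨t, ht⟩ _) ht
  have h2 : ∑' m : Occ n, (G (g t) + s t • g t) (Sum.elim m m) = s t * tr (g t) := by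
    change tr (G (g t) + s t • g t) = _
    rw [tr_add ((hdec t ht).apply (genOp_mem _ _)) ((hdec t ht).smul _), tr_genOp (hdec t ht),
      tr_smul, zero_add]
  exact h1.congr_deriv h2

/-- The logarithmic derivative of the trace is `s`; the quotient rule removes exactly the unwanted
scalar term. -/
theorem hasDerivWithinAt_gaussState_path (h₀ : IsBona Γ₀) (h₁ : IsBona Γ₁) (w : Ix n → ℝ) {t : ℝ}
    (ht : t ∈ Set.Icc (0 : ℝ) 1) (i : Ix n → ℕ) :
    HasDerivWithinAt (fun t => gaussState (covPath Γ₀ Γ₁ t) (t • w) i)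
      (genOp (rotV n) (Γ₁ - Γ₀) (fun p => Real.sqrt 2 * w p)
        (gaussState (covPath Γ₀ Γ₁ t) (t • w)) i) (Set.Icc 0 1) t := by
  have hex : ∀ t : ℝ, ∃ s : ℂ, t ∈ Set.Icc (0 : ℝ) 1 → ∀ i, HasDerivWithinAt
      (fun t => gaussCov (rotV n) (covPath Γ₀ Γ₁ t) (t • w) i)
      ((genOp (rotV n) (Γ₁ - Γ₀) (fun p => Real.sqrt 2 * w p)
        (gaussCov (rotV n) (covPath Γ₀ Γ₁ t) (t • w))
        + s • gaussCov (rotV n) (covPath Γ₀ Γ₁ t) (t • w)) i) (Set.Icc 0 1) t := by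
    intro t
    by_cases ht : t ∈ Set.Icc (0 : ℝ) 1
    · obtain ⟨s, hs⟩ := hasDerivWithinAt_gaussCov_path (rotV_mul_conjTranspose n) h₀.1 h₁.1 w ht
        (Set.Icc 0 1)
      exact ⟨s, fun _ => hs⟩
    · exact ⟨0, fun h => absurd h ht⟩
  choose s hs using hex
  have h1 := hasDerivWithinAt_gaussTr_path h₀ h₁ w ht hs
  have hne := gaussTr_ne_zero (h₀.covPath h₁ ht) (t • w)
  have h2 := (h1.inv hne).mul (hs t ht i)
  refine h2.congr_deriv ?_
  simp only [gaussState, map_smul, Pi.smul_apply, Pi.add_apply, smul_eq_mul, Pi.inv_apply]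
  field_simp
  ring

theorem isExp_gaussState (h₀ : IsBona Γ₀) (h₁ : IsBona Γ₁) (w : Ix n → ℝ) {𝒬 : Op n → Op n}
    (h𝒬 : ∀ R, toFn n (𝒬 R) =
      genOp (rotV n) (Γ₁ - Γ₀) (fun p => Real.sqrt 2 * w p) (toFn n R)) :
    IsExp 𝒬 ((toFn n).symm (gaussState Γ₀ 0)) ((toFn n).symm (gaussState Γ₁ w)) := by
  have h1 : Evolves 𝒬 ((toFn n).symm (gaussState Γ₀ 0)) ((toFn n).symm (gaussState Γ₁ w)) := by
    have hX : ExpDecay fun t : Set.Icc (0 : ℝ) 1 =>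
        gaussState (covPath Γ₀ Γ₁ t) ((t : ℝ) • w) :=
      (expDecay_gaussCov_path (rotV_mul_conjTranspose n) h₀.1 h₁.1 w).smul (K := 1)
        fun t => norm_gaussTr_inv_le (h₀.covPath h₁ t.2) _
    have h2 := evolves_of_expDecay (genOp_mem _ _) h𝒬
      (X := fun t => gaussState (covPath Γ₀ Γ₁ t) (t • w)) hX
      fun t ht i => hasDerivWithinAt_gaussState_path h₀ h₁ w ht i
    simpa only [covPath_zero, covPath_one, zero_smul, one_smul] using h2
  exact ⟨h1, fun R hR => hR.unique (GrowthLE.genOp _ _) h𝒬 h1⟩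

end Exponential

/-! ## Elementary estimates -/

/-- One nonnegative term of the binomial expansion of (x + (1 - x))^{N+k} = 1. -/
theorem choose_mul_pow_le {x : ℝ} (h0 : 0 ≤ x) (h1 : x ≤ 1) (N k : ℕ) :
    ((N + k).choose k : ℝ) * x ^ k * (1 - x) ^ N ≤ 1 := by
  have h := add_pow x (1 - x) (N + k)
  rw [add_sub_cancel, one_pow] at h
  have h2 := Finset.single_le_sum (s := Finset.range (N + k + 1))
    (f := fun m => x ^ m * (1 - x) ^ (N + k - m) * ((N + k).choose m : ℝ))
    (fun m _ => mul_nonneg (mul_nonneg (pow_nonneg h0 _) (pow_nonneg (sub_nonneg.mpr h1) _))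
      (Nat.cast_nonneg _)) (Finset.mem_range.mpr (by omega : k < N + k + 1))
  rw [← h, Nat.add_sub_cancel] at h2
  linarith

theorem summable_pow_div_sqrt_factorial (y : ℝ) :
    Summable fun k : ℕ => y ^ k / Real.sqrt (k.factorial) := by
  -- Each term is the product of (2|y|)^k/√k! and 2^{-k}; the squares of both factors are summable.
  have h1 := (Real.summable_pow_div_factorial (4 * y ^ 2)).add
    (summable_geometric_of_lt_one (r := (1 / 4 : ℝ)) (by norm_num) (by norm_num))
  refine .of_norm_bounded h1 fun k => ?_
  have hf : (0 : ℝ) < Real.sqrt (k.factorial) := Real.sqrt_pos.mpr (by positivity)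
  have hf2 : Real.sqrt (k.factorial) ^ 2 = k.factorial := Real.sq_sqrt (by positivity)
  have h3 : (4 * y ^ 2) ^ k / (k.factorial : ℝ) = ((2 * |y|) ^ k / Real.sqrt (k.factorial)) ^ 2 := by
    have h : 4 * y ^ 2 = (2 * |y|) ^ 2 := by rw [mul_pow, sq_abs]; norm_num
    rw [div_pow, hf2, h, ← pow_mul, ← pow_mul, mul_comm 2 k]
  have h4 : (1 / 4 : ℝ) ^ k = ((1 / 2 : ℝ) ^ k) ^ 2 := by
    rw [← pow_mul, mul_comm, pow_mul]
    norm_num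
  have h5 : ‖y ^ k / Real.sqrt (k.factorial)‖ =
      (2 * |y|) ^ k / Real.sqrt (k.factorial) * (1 / 2) ^ k := by
    rw [norm_div, norm_pow, Real.norm_eq_abs, Real.norm_of_nonneg hf.le, div_mul_eq_mul_div, ← mul_pow]
    congr 2
    ring
  rw [h3, h4, h5]
  nlinarith [sq_nonneg ((2 * |y|) ^ k / Real.sqrt (k.factorial) - (1 / 2) ^ k)]

/-- The product `√(N+1) ⋯ √(N+k)`. -/
def sqrtProd (k N : ℕ) : ℝ := ∏ i ∈ Finset.range k, Real.sqrt (N + 1 + i)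

theorem sqrtProd_nonneg (k N : ℕ) : 0 ≤ sqrtProd k N :=
  Finset.prod_nonneg fun _ _ => Real.sqrt_nonneg _

theorem sqrtProd_succ (k N : ℕ) :
    sqrtProd (k + 1) N = Real.sqrt (N + 1) * sqrtProd k (N + 1) := by
  rw [sqrtProd, Finset.prod_range_succ', mul_comm, sqrtProd]
  congr 1
  · simp
  · refine Finset.prod_congr rfl fun i _ => ?_
    push_cast
    ring_nf

theorem sqrtProd_mono (k : ℕ) {N M : ℕ} (h : N ≤ M) : sqrtProd k N ≤ sqrtProd k M := by
  refine Finset.prod_le_prod (fun _ _ => Real.sqrt_nonneg _) fun i _ => Real.sqrt_le_sqrt ?_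
  have : (N : ℝ) ≤ M := by exact_mod_cast h
  linarith

theorem sqrtProd_eq (k N : ℕ) :
    sqrtProd k N = Real.sqrt (k.factorial) * Real.sqrt ((N + k).choose k) := by
  rw [← Real.sqrt_mul (by positivity), sqrtProd, ← Real.sqrt_prod _ fun i _ => by positivity]
  congr 1
  have h := Nat.ascFactorial_eq_factorial_mul_choose N k
  rw [Nat.ascFactorial_eq_prod_range] at h
  exact_mod_cast h

/-- The quotient by k! is √binom(N+k, k)/√k!, and the binomial estimate absorbs the binomial
coefficient. -/
theorem sqrtProd_div_le {x : ℝ} (h0 : 0 < x) (h1 : x < 1) (k N : ℕ) :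
    sqrtProd k N / k.factorial * Real.sqrt x ^ k * Real.sqrt (1 - x) ^ N ≤
      1 / Real.sqrt (k.factorial) := by
  have hf : (0 : ℝ) < Real.sqrt (k.factorial) := Real.sqrt_pos.mpr (by positivity)
  have h2 := Real.sqrt_le_sqrt (choose_mul_pow_le h0.le h1.le N k)
  rw [Real.sqrt_mul (by positivity), Real.sqrt_mul (by positivity), Real.sqrt_one] at h2
  have h3 : Real.sqrt (x ^ k) = Real.sqrt x ^ k := by
    rw [Real.sqrt_eq_iff_mul_self_eq (by positivity) (by positivity), ← mul_pow,
      Real.mul_self_sqrt h0.le]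
  have h4 : Real.sqrt ((1 - x) ^ N) = Real.sqrt (1 - x) ^ N := by
    rw [Real.sqrt_eq_iff_mul_self_eq (pow_nonneg (by linarith) _) (by positivity), ← mul_pow,
      Real.mul_self_sqrt (by linarith)]
  rw [h3, h4] at h2
  have h5 : sqrtProd k N / k.factorial = Real.sqrt ((N + k).choose k) / Real.sqrt (k.factorial) := by
    rw [sqrtProd_eq, ← Real.mul_self_sqrt (show (0 : ℝ) ≤ k.factorial by positivity)]
    field_simp
    rw [Real.sqrt_sq hf.le]
  rw [h5, div_mul_eq_mul_div, div_mul_eq_mul_div]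
  exact div_le_div_of_nonneg_right h2 hf.le

/-! ## Powers of quadratures -/

/-- The quadrature `x·w`. -/
def quadrature (x : Ix n → ℝ) : Op n := ∑ p, (x p : ℂ) • maj p

/-- Right multiplication by the quadrature `x·w`. -/
def rwSum (x : Ix n → ℝ) : Module.End ℂ (Fn (Ix n)) := ∑ p, (x p : ℂ) • rw' p

theorem rwSum_mem (x : Ix n → ℝ) : rwSum x ∈ ladderAlg (Ix n) :=
  Subalgebra.sum_mem _ fun p _ => Subalgebra.smul_mem _ (rw'_mem p) _

theorem rowFin_quadrature (x : Ix n → ℝ) : RowFin (quadrature x) :=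
  .sum fun p _ => .smul _ (rowFin_maj p)

theorem rowFin_quadrature_transpose (x : Ix n → ℝ) : RowFin (quadrature x)ᵀ := by
  rw [quadrature, Matrix.transpose_sum]
  refine .sum fun p _ => ?_
  rw [Matrix.transpose_smul]
  exact .smul _ (rowFin_maj_transpose p)

theorem toFn_opMul_quadrature (x : Ix n → ℝ) (R : Op n) :
    toFn n (R ⋆ₒ quadrature x) = rwSum x (toFn n R) :=
  System.toFn_opMul_sum_maj _ R

theorem opPow_succ' (x : Ix n → ℝ) (k : ℕ) :
    opPow (quadrature x) (k + 1) = opPow (quadrature x) k ⋆ₒ quadrature x := by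
  induction k with
  | zero =>
    change quadrature x ⋆ₒ 1 = 1 ⋆ₒ quadrature x
    rw [one_opMul, opMul_one]
  | succ k ih =>
    change quadrature x ⋆ₒ opPow (quadrature x) (k + 1) =
      (quadrature x ⋆ₒ opPow (quadrature x) k) ⋆ₒ quadrature x
    rw [ih, (rowFin_quadrature x).opMul_opMul (rowFin_quadrature_transpose x)]

theorem rowFin_opPow_transpose (x : Ix n → ℝ) (k : ℕ) : RowFin (opPow (quadrature x) k)ᵀ := by
  induction k with
  | zero =>
    rw [opPow, Matrix.transpose_one]
    exact RowFin.one
  | succ k ih =>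
    rw [opPow, transpose_opMul]
    exact ih.opMul (rowFin_quadrature_transpose x)

theorem toFn_opMul_opPow (x : Ix n → ℝ) (R : Op n) (k : ℕ) :
    toFn n (R ⋆ₒ opPow (quadrature x) k) = (rwSum x ^ k) (toFn n R) := by
  induction k with
  | zero =>
    rw [opPow, opMul_one]
    rfl
  | succ k ih =>
    rw [opPow_succ', opMul_assoc_of_colFin (rowFin_quadrature_transpose x) (rowFin_opPow_transpose x k),
      toFn_opMul_quadrature, ih, pow_succ', Module.End.mul_apply]

theorem norm_isqrt2_le : ‖isqrt2‖ ≤ 1 := by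
  have h : ‖isqrt2‖ * ‖isqrt2‖ = 1 / 2 := by
    rw [← norm_mul, isqrt2_mul_self]
    norm_num
  nlinarith [norm_nonneg isqrt2]

/-- The mode of a Majorana index. -/
def modeOf : Ix n → Fin n := Sum.elim id id

theorem norm_rw'_apply_le (p : Ix n) (X : Fn (Ix n)) (l m : Occ n) :
    ‖rw' p X (Sum.elim l m)‖ ≤
      Real.sqrt (m (modeOf p)) * ‖X (Sum.elim l (m - Pi.single (modeOf p) 1))‖
      + Real.sqrt (m (modeOf p) + 1) * ‖X (Sum.elim l (m + Pi.single (modeOf p) 1))‖ := by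
  have h1 : ∀ (c : ℂ) (a b : ℝ) (y z : ℂ), ‖c‖ ≤ 1 → 0 ≤ a → 0 ≤ b →
      ‖c * ((a : ℂ) * y + (b : ℂ) * z)‖ ≤ a * ‖y‖ + b * ‖z‖ := by
    intro c a b y z hc ha hb
    rw [norm_mul]
    refine (mul_le_of_le_one_left (norm_nonneg _) hc).trans ((norm_add_le _ _).trans_eq ?_)
    rw [norm_mul, norm_mul, Complex.norm_real, Complex.norm_real, Real.norm_of_nonneg ha,
      Real.norm_of_nonneg hb]
  rcases p with j | j
  · have e : (rw' (Sum.inl j) : Module.End ℂ (Fn (Ix n))) =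
        isqrt2 • (rai (Sum.inr j) + low (Sum.inr j)) := rfl
    rw [e]
    simp only [LinearMap.smul_apply, LinearMap.add_apply, Pi.smul_apply, Pi.add_apply, rai_apply,
      low_apply, smul_eq_mul, elim_sub_single_inr, elim_add_single_inr, Sum.elim_inr]
    exact h1 _ _ _ _ _ norm_isqrt2_le (Real.sqrt_nonneg _) (Real.sqrt_nonneg _)
  · have e : (rw' (Sum.inr j) : Module.End ℂ (Fn (Ix n))) =
        (Complex.I * isqrt2) • (rai (Sum.inr j) - low (Sum.inr j)) := rfl
    rw [e]
    simp only [LinearMap.smul_apply, LinearMap.sub_apply, Pi.smul_apply, Pi.sub_apply, rai_apply,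
      low_apply, smul_eq_mul, elim_sub_single_inr, elim_add_single_inr, Sum.elim_inr]
    have h2 := h1 (Complex.I * isqrt2) (Real.sqrt (m j)) (Real.sqrt (m j + 1))
      (X (Sum.elim l (m - Pi.single j 1))) (-X (Sum.elim l (m + Pi.single j 1)))
      (by rw [norm_mul, Complex.norm_I, one_mul]; exact norm_isqrt2_le)
      (Real.sqrt_nonneg _) (Real.sqrt_nonneg _)
    rw [mul_neg, ← sub_eq_add_neg, norm_neg] at h2
    exact h2

/-- Induction on the last factor: a quadrature moves the column degree by one. Each ladder term
costs at most √(deg m + 1), and a step down costs 1/r; the factor 2 counts the two ladder terms of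
each w_p. -/
theorem sum_norm_opPow_le (x : Ix n → ℝ) {r : ℝ} (hr0 : 0 < r) (hr1 : r < 1) (k : ℕ)
    (s : Finset (Occ n)) (m : Occ n) :
    ∑ l ∈ s, r ^ deg l * ‖opPow (quadrature x) k l m‖ ≤
      ((2 * ∑ p, |x p|) / r) ^ k * sqrtProd k (deg m) * r ^ deg m := by
  induction k generalizing m with
  | zero =>
    rw [pow_zero, one_mul, sqrtProd, Finset.prod_range_zero, one_mul, opPow]
    by_cases hm : m ∈ s
    · rw [Finset.sum_eq_single m (fun l _ hl => by rw [Matrix.one_apply_ne hl, norm_zero, mul_zero])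
        (fun h => absurd hm h), Matrix.one_apply_eq, norm_one, mul_one]
    · rw [Finset.sum_eq_zero fun l hl => by
        rw [Matrix.one_apply_ne (fun h : l = m => hm (h ▸ hl)), norm_zero, mul_zero]]
      positivity
  | succ k ih =>
    set c := 2 * ∑ p, |x p| with hc
    have hc0 : 0 ≤ c := by positivity
    set A := (c / r) ^ k * sqrtProd k (deg m + 1) * (r ^ deg m / r) with hA
    have hA0 : 0 ≤ A := by
      have := sqrtProd_nonneg k (deg m + 1)
      positivity
    have hbound : ∀ m' : Occ n, deg m' ≤ deg m + 1 → deg m ≤ deg m' + 1 →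
        ∑ l ∈ s, r ^ deg l * ‖opPow (quadrature x) k l m'‖ ≤ A := by
      intro m' h1 h2
      refine (ih m').trans ?_
      have h3 : r ^ deg m' ≤ r ^ deg m / r := by
        rw [le_div_iff₀ hr0, ← pow_succ]
        exact pow_le_pow_of_le_one hr0.le hr1.le h2
      have h4 := sqrtProd_mono k h1
      have h5 := sqrtProd_nonneg k (deg m + 1)
      rw [hA]
      exact mul_le_mul (mul_le_mul_of_nonneg_left h4 (by positivity)) h3 (by positivity)
        (by positivity)
    have hterm : ∀ l, ‖opPow (quadrature x) (k + 1) l m‖ ≤ ∑ p, |x p| *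
        (Real.sqrt (m (modeOf p)) * ‖opPow (quadrature x) k l (m - Pi.single (modeOf p) 1)‖
        + Real.sqrt (m (modeOf p) + 1) *
          ‖opPow (quadrature x) k l (m + Pi.single (modeOf p) 1)‖) := by
      intro l
      rw [opPow_succ', ← toFn_elim (opPow (quadrature x) k ⋆ₒ quadrature x) l m, toFn_opMul_quadrature, rwSum, LinearMap.sum_apply,
        Finset.sum_apply]
      refine norm_sum_le_of_le _ fun p _ => ?_
      rw [LinearMap.smul_apply, Pi.smul_apply, norm_smul, Complex.norm_real, Real.norm_eq_abs]
      exact mul_le_mul_of_nonneg_left (norm_rw'_apply_le p _ l m) (abs_nonneg _)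
    have hsq : ∀ j : Fin n, Real.sqrt (m j) ≤ Real.sqrt (deg m + 1) ∧
        Real.sqrt (m j + 1) ≤ Real.sqrt (deg m + 1) := by
      intro j
      have h : (m j : ℝ) ≤ deg m := by exact_mod_cast le_deg m j
      exact ⟨Real.sqrt_le_sqrt (by linarith), Real.sqrt_le_sqrt (by linarith)⟩
    calc _ ≤ ∑ l ∈ s, ∑ p, (|x p| * (Real.sqrt (m (modeOf p)) *
          (r ^ deg l * ‖opPow (quadrature x) k l (m - Pi.single (modeOf p) 1)‖)
        + Real.sqrt (m (modeOf p) + 1) *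
          (r ^ deg l * ‖opPow (quadrature x) k l (m + Pi.single (modeOf p) 1)‖))) := by
          refine Finset.sum_le_sum fun l _ => ?_
          refine (mul_le_mul_of_nonneg_left (hterm l) (by positivity)).trans_eq ?_
          rw [Finset.mul_sum]
          exact Finset.sum_congr rfl fun p _ => by ring
      _ = ∑ p, |x p| * (Real.sqrt (m (modeOf p)) *
          (∑ l ∈ s, r ^ deg l * ‖opPow (quadrature x) k l (m - Pi.single (modeOf p) 1)‖)
        + Real.sqrt (m (modeOf p) + 1) *
          (∑ l ∈ s, r ^ deg l * ‖opPow (quadrature x) k l (m + Pi.single (modeOf p) 1)‖)) := by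
          rw [Finset.sum_comm]
          simp only [Finset.mul_sum, ← Finset.sum_add_distrib]
      _ ≤ ∑ p, |x p| * (Real.sqrt (deg m + 1) * A + Real.sqrt (deg m + 1) * A) := by
          refine Finset.sum_le_sum fun p _ => mul_le_mul_of_nonneg_left (add_le_add ?_ ?_) (abs_nonneg _)
          · rcases Nat.eq_zero_or_pos (m (modeOf p)) with h | h
            · rw [h, Nat.cast_zero, Real.sqrt_zero, zero_mul]
              positivity
            · have h1 := deg_sub_single h
              exact mul_le_mul (hsq _).1 (hbound _ (by omega) (by omega))
                (Finset.sum_nonneg fun _ _ => by positivity) (Real.sqrt_nonneg _)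
          · have h1 := deg_add_single m (modeOf p)
            exact mul_le_mul (hsq _).2 (hbound _ (by omega) (by omega))
              (Finset.sum_nonneg fun _ _ => by positivity) (Real.sqrt_nonneg _)
      _ = _ := by
          rw [← Finset.sum_mul, sqrtProd_succ, hA, pow_succ]
          have h1 : ∑ p, |x p| = c / 2 := by rw [hc]; ring
          rw [h1]
          field_simp
          ring

/-! ## Products with Weyl operators -/

/-- Summable bounds on the terms of the exponential series of a Weyl operator. -/
def weylBound (x : Ix n → ℝ) (r : ℝ) (k : ℕ) : ℝ :=
  ((2 * ∑ p, |x p|) / r / Real.sqrt (1 - r)) ^ k / Real.sqrt (k.factorial)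

theorem weylBound_nonneg (x : Ix n → ℝ) {r : ℝ} (h0 : 0 < r) (k : ℕ) : 0 ≤ weylBound x r k := by
  rw [weylBound]
  positivity

theorem summable_weylBound (x : Ix n → ℝ) (r : ℝ) : Summable (weylBound x r) :=
  summable_pow_div_sqrt_factorial _

/-- Half of the decay r^N is spent on the growth of the quadrature powers, by the binomial estimate
at x = 1 - r. The other half remains as √r^N, beside a bound summable in k. -/
theorem sum_norm_opPow_div_le (x : Ix n → ℝ) {r : ℝ} (hr0 : 0 < r) (hr1 : r < 1) (k : ℕ)
    (s : Finset (Occ n)) (m : Occ n) :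
    (∑ l ∈ s, r ^ deg l * ‖opPow (quadrature x) k l m‖) / k.factorial ≤
      weylBound x r k * Real.sqrt r ^ deg m := by
  have hf : (0 : ℝ) < k.factorial := by positivity
  have h1 := sqrtProd_div_le (sub_pos.mpr hr1) (by linarith : 1 - r < 1) k (deg m)
  rw [sub_sub_cancel] at h1
  have hx : 0 < Real.sqrt (1 - r) := Real.sqrt_pos.mpr (sub_pos.mpr hr1)
  have h3 := sum_norm_opPow_le x hr0 hr1 k s m
  have hy0 : 0 ≤ (2 * ∑ p, |x p|) / r := by positivity
  rw [weylBound]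
  generalize (2 * ∑ p, |x p|) / r = y at h3 hy0 ⊢
  have h2 : r ^ deg m = Real.sqrt r ^ deg m * Real.sqrt r ^ deg m := by
    rw [← mul_pow, Real.mul_self_sqrt hr0.le]
  calc _ ≤ (y ^ k * sqrtProd k (deg m) * r ^ deg m) / k.factorial :=
        div_le_div_of_nonneg_right h3 hf.le
    _ = (y / Real.sqrt (1 - r)) ^ k * Real.sqrt r ^ deg m *
        (sqrtProd k (deg m) / k.factorial * Real.sqrt (1 - r) ^ k * Real.sqrt r ^ deg m) := by
        rw [h2, div_pow]
        field_simp
    _ ≤ (y / Real.sqrt (1 - r)) ^ k * Real.sqrt r ^ deg m * (1 / Real.sqrt (k.factorial)) :=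
        mul_le_mul_of_nonneg_left h1 (by positivity)
    _ = _ := by ring

section Product

variable {R : Op n} {C r : ℝ}

theorem sum_norm_mul_opPow_le (hC : 0 ≤ C) (hr0 : 0 < r) (hr1 : r < 1)
    (hR : ∀ m l, ‖R m l‖ ≤ C * r ^ (deg m + deg l)) (x : Ix n → ℝ) (k : ℕ)
    (s : Finset (Occ n)) (m m' : Occ n) :
    ∑ l ∈ s, ‖R m l * ((Complex.I ^ k / (k.factorial : ℂ)) * opPow (quadrature x) k l m')‖ ≤
      C * r ^ deg m * (weylBound x r k * Real.sqrt r ^ deg m') := by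
  refine le_trans ?_ (mul_le_mul_of_nonneg_left (sum_norm_opPow_div_le x hr0 hr1 k s m')
    (by positivity))
  rw [Finset.sum_div, Finset.mul_sum]
  refine Finset.sum_le_sum fun l _ => ?_
  rw [norm_mul, norm_mul, norm_div, norm_pow, Complex.norm_I, one_pow, Complex.norm_natCast]
  refine (mul_le_mul_of_nonneg_right (hR m l) (by positivity)).trans_eq ?_
  rw [pow_add]
  ring

theorem summable_mul_opPow (hC : 0 ≤ C) (hr0 : 0 < r) (hr1 : r < 1)
    (hR : ∀ m l, ‖R m l‖ ≤ C * r ^ (deg m + deg l)) (x : Ix n → ℝ) (m m' : Occ n) :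
    Summable fun a : Occ n × ℕ => R m a.1 *
      ((Complex.I ^ a.2 / (a.2.factorial : ℂ)) * opPow (quadrature x) a.2 a.1 m') := by
  have h1 := sum_norm_mul_opPow_le hC hr0 hr1 hR x
  have h2 : Summable fun a : ℕ × Occ n => ‖R m a.2 *
      ((Complex.I ^ a.1 / (a.1.factorial : ℂ)) * opPow (quadrature x) a.1 a.2 m')‖ := by
    rw [summable_prod_of_nonneg fun _ => norm_nonneg _]
    refine ⟨fun k => summable_of_sum_le (fun _ => norm_nonneg _) fun s => h1 k s m m', ?_⟩
    refine .of_nonneg_of_le (fun k => tsum_nonneg fun _ => norm_nonneg _)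
      (fun k => Real.tsum_le_of_sum_le (fun _ => norm_nonneg _) fun s => h1 k s m m') ?_
    exact ((summable_weylBound x r).mul_right _).mul_left _
  exact .of_norm ((Equiv.prodComm _ _).summable_iff.mpr h2)

theorem opMul_weyl_apply (hC : 0 ≤ C) (hr0 : 0 < r) (hr1 : r < 1)
    (hR : ∀ m l, ‖R m l‖ ≤ C * r ^ (deg m + deg l)) (x : Ix n → ℝ) (m m' : Occ n) :
    (R ⋆ₒ weyl x) m m' =
      ∑' k : ℕ, (Complex.I ^ k / (k.factorial : ℂ)) * (R ⋆ₒ opPow (quadrature x) k) m m' := by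
  calc _ = ∑' l, ∑' k : ℕ, R m l *
        ((Complex.I ^ k / (k.factorial : ℂ)) * opPow (quadrature x) k l m') :=
        tsum_congr fun l => tsum_mul_left.symm
    _ = ∑' k : ℕ, ∑' l, R m l *
        ((Complex.I ^ k / (k.factorial : ℂ)) * opPow (quadrature x) k l m') :=
        (Summable.tsum_comm (f := fun l (k : ℕ) => R m l *
          ((Complex.I ^ k / (k.factorial : ℂ)) * opPow (quadrature x) k l m'))
          (summable_mul_opPow hC hr0 hr1 hR x m m')).symm
    _ = _ := tsum_congr fun k => by
        rw [opMul, ← tsum_mul_left]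
        exact tsum_congr fun l => by ring

theorem norm_opMul_opPow_le (hC : 0 ≤ C) (hr0 : 0 < r) (hr1 : r < 1)
    (hR : ∀ m l, ‖R m l‖ ≤ C * r ^ (deg m + deg l)) (x : Ix n → ℝ) (k : ℕ) (m m' : Occ n) :
    ‖(Complex.I ^ k / (k.factorial : ℂ)) * (R ⋆ₒ opPow (quadrature x) k) m m'‖ ≤
      C * r ^ deg m * (weylBound x r k * Real.sqrt r ^ deg m') := by
  have h1 := sum_norm_mul_opPow_le hC hr0 hr1 hR x k
  rw [opMul, ← tsum_mul_left]
  have h2 : Summable fun l => ‖R m l *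
      ((Complex.I ^ k / (k.factorial : ℂ)) * opPow (quadrature x) k l m')‖ :=
    summable_of_sum_le (fun _ => norm_nonneg _) fun s => h1 s m m'
  refine le_trans ?_ (Real.tsum_le_of_sum_le (fun _ => norm_nonneg _) fun s => h1 s m m')
  refine le_trans (le_of_eq ?_) (norm_tsum_le_tsum_norm h2)
  exact congrArg _ (tsum_congr fun l => by ring)

end Product

/-- The terms are dominated by a product of summable sequences in k and in the occupation numbers,
so the exponential series may be exchanged with the trace. -/
theorem hasTrace_opMul_weyl {R : Op n} (h : Decays (toFn n R)) (x : Ix n → ℝ) {c : ℂ}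
    (hc : HasSum (fun k : ℕ => (Complex.I ^ k / (k.factorial : ℂ)) *
      tr ((rwSum x ^ k) (toFn n R))) c) : HasTrace (R ⋆ₒ weyl x) c := by
  obtain ⟨C, r, hC, hr0, hr1, hR'⟩ := h
  have hR : ∀ m l, ‖R m l‖ ≤ C * r ^ (deg m + deg l) := fun m l => by
    rw [← deg_elim, ← toFn_elim R m l]
    exact hR' () _
  have hq1 : Real.sqrt r < 1 := by
    rw [Real.sqrt_lt' one_pos]
    linarith
  have hq0 : 0 ≤ Real.sqrt r := Real.sqrt_nonneg r
  set g : ℕ → Occ n → Occ n → ℂ := fun k m m' =>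
    (Complex.I ^ k / (k.factorial : ℂ)) * (R ⋆ₒ opPow (quadrature x) k) m m' with hg
  have hgb : ∀ k m m', ‖g k m m'‖ ≤ C * r ^ deg m * (weylBound x r k * Real.sqrt r ^ deg m') :=
    norm_opMul_opPow_le hC hr0 hr1 hR x
  have hw : ∀ m m', (R ⋆ₒ weyl x) m m' = ∑' k, g k m m' := opMul_weyl_apply hC hr0 hr1 hR x
  have hsum := summable_weylBound x r
  have hgeo : Summable fun m : Occ n => r ^ deg m := summable_geometric_deg hr0.le hr1
  have hgeo' : Summable fun m : Occ n => Real.sqrt r ^ deg m := summable_geometric_deg hq0 hq1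
  have hp : ∀ m : Occ n, 0 ≤ r ^ deg m := fun m => pow_nonneg hr0.le _
  refine ⟨isTraceClass_of_summable ?_, ?_⟩
  · have h1 := hgeo.mul_of_nonneg hgeo' hp fun m : Occ n => pow_nonneg hq0 (deg m)
    refine .of_nonneg_of_le (fun _ => norm_nonneg _) (fun a => ?_)
      (h1.mul_left (C * ∑' k, weylBound x r k))
    rw [hw]
    refine (tsum_of_norm_bounded ((hsum.hasSum.mul_right (Real.sqrt r ^ deg a.2)).mul_left
      (C * r ^ deg a.1)) fun k => hgb k a.1 a.2).trans_eq ?_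
    ring
  · have h1 : Summable fun a : ℕ × Occ n => g a.1 a.2 a.2 := by
      have h2 := hsum.mul_of_nonneg hgeo (fun k => weylBound_nonneg x hr0 k) hp
      refine .of_norm_bounded (h2.mul_left C) fun a => (hgb a.1 a.2 a.2).trans ?_
      have h3 : Real.sqrt r ^ deg a.2 ≤ 1 := pow_le_one₀ hq0 hq1.le
      have h4 := weylBound_nonneg x hr0 a.1
      have h5 : 0 ≤ C * r ^ deg a.2 * weylBound x r a.1 := by positivity
      nlinarith
    have h2 : ∀ k, ∑' m, g k m m =
        (Complex.I ^ k / (k.factorial : ℂ)) * tr ((rwSum x ^ k) (toFn n R)) := fun k => by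
      rw [hg, tr, ← tsum_mul_left]
      refine tsum_congr fun m => ?_
      rw [← toFn_opMul_opPow, toFn_elim]
    have h3 : Summable fun m => ∑' k, g k m m := ((Equiv.prodComm _ _).summable_iff.mpr h1).prod
    have h4 : ∑' m, ∑' k, g k m m = c := by
      rw [(show Summable (Function.uncurry fun k m => g k m m) from h1).tsum_comm, ← hc.tsum_eq]
      exact tsum_congr h2
    have h5 := h3.hasSum
    rw [h4] at h5
    simpa only [hw] using h5

/-! ## The exponential generating function of Gaussian moments -/

/-- The coefficients of `exp(v X²)`. -/
def expSqCoeff (v : ℂ) (k : ℕ) : ℂ := if Even k then v ^ (k / 2) / ((k / 2).factorial : ℂ) else 0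

theorem expSqCoeff_two_mul (v : ℂ) (k : ℕ) : expSqCoeff v (2 * k) = v ^ k / (k.factorial : ℂ) := by
  rw [expSqCoeff, if_pos (even_two_mul k), Nat.mul_div_cancel_left k two_pos]

theorem expSqCoeff_eq_zero (v : ℂ) {k : ℕ} (h : k ∉ Set.range fun c : ℕ => 2 * c) :
    expSqCoeff v k = 0 := by
  rw [expSqCoeff, if_neg]
  rintro ⟨c, hc⟩
  exact h ⟨c, by simp only; omega⟩

theorem hasSum_pow_div_factorial (u : ℂ) :
    HasSum (fun k : ℕ => u ^ k / (k.factorial : ℂ)) (Complex.exp u) := by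
  rw [Complex.exp_eq_exp_ℂ]
  exact NormedSpace.expSeries_div_hasSum_exp u

theorem summable_norm_pow_div_factorial (u : ℂ) :
    Summable fun k : ℕ => ‖u ^ k / (k.factorial : ℂ)‖ :=
  NormedSpace.norm_expSeries_div_summable u

theorem two_mul_injective : Function.Injective fun c : ℕ => 2 * c := fun a b h => by
  simp only at h
  omega

theorem hasSum_expSqCoeff (v : ℂ) : HasSum (expSqCoeff v) (Complex.exp v) := by
  rw [← two_mul_injective.hasSum_iff fun k hk => expSqCoeff_eq_zero v hk]
  simpa only [Function.comp_def, expSqCoeff_two_mul] using hasSum_pow_div_factorial v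

theorem summable_norm_expSqCoeff (v : ℂ) : Summable fun k => ‖expSqCoeff v k‖ := by
  rw [← two_mul_injective.summable_iff fun k hk => by rw [expSqCoeff_eq_zero v hk, norm_zero]]
  simpa only [Function.comp_def, expSqCoeff_two_mul] using summable_norm_pow_div_factorial v

open PowerSeries in
theorem derivative_expSqCoeff (v : ℂ) :
    d⁄dX ℂ (PowerSeries.mk (expSqCoeff v)) =
      PowerSeries.C (2 * v) * (PowerSeries.X * PowerSeries.mk (expSqCoeff v)) := by
  ext k
  rw [coeff_derivative, coeff_C_mul, coeff_mk]
  rcases k with _ | k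
  · rw [coeff_zero_X_mul, mul_zero, zero_add, expSqCoeff, if_neg (by decide), zero_mul]
  · rw [coeff_succ_X_mul, coeff_mk]
    by_cases h : Even k
    · obtain ⟨c, hc⟩ := h.two_dvd
      subst hc
      rw [show 2 * c + 1 + 1 = 2 * (c + 1) by ring, expSqCoeff_two_mul, expSqCoeff_two_mul,
        Nat.factorial_succ]
      have h1 : (c.factorial : ℂ) ≠ 0 := by exact_mod_cast c.factorial_ne_zero
      have h2 : (c : ℂ) + 1 ≠ 0 := by exact_mod_cast c.succ_ne_zero
      push_cast
      field_simp
      ring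
    · rw [expSqCoeff, expSqCoeff, if_neg h, if_neg (by rwa [Nat.even_add_one, Nat.even_add_one, not_not]),
        zero_mul, mul_zero]

open PowerSeries in
theorem derivative_pow_div_factorial (u : ℂ) :
    d⁄dX ℂ (PowerSeries.mk fun k : ℕ => u ^ k / (k.factorial : ℂ)) =
      PowerSeries.C u * PowerSeries.mk fun k : ℕ => u ^ k / (k.factorial : ℂ) := by
  ext k
  rw [coeff_derivative, coeff_C_mul, coeff_mk, coeff_mk, Nat.factorial_succ]
  have h1 : (k.factorial : ℂ) ≠ 0 := by exact_mod_cast k.factorial_ne_zero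
  have h2 : (k : ℂ) + 1 ≠ 0 := by exact_mod_cast k.succ_ne_zero
  push_cast
  field_simp
  ring

open PowerSeries in
-- The recurrence is the differential equation F' = (u + 2vX)F in coefficients, solved by exp(uX +
-- vX²). The Cauchy product of the two exponential series converges absolutely at X = 1.
theorem hasSum_of_recurrence {u v : ℂ} {q : ℕ → ℂ} (h0 : q 0 = 1) (h1 : q 1 = u)
    (h2 : ∀ k : ℕ, ((k : ℂ) + 2) * q (k + 2) = u * q (k + 1) + 2 * v * q k) :
    HasSum q (Complex.exp (u + v)) := by
  set A : PowerSeries ℂ := PowerSeries.mk fun k : ℕ => u ^ k / (k.factorial : ℂ) with hA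
  set H : PowerSeries ℂ := PowerSeries.mk (expSqCoeff v) with hH
  have hd : d⁄dX ℂ (A * H) = C u * (A * H) + C (2 * v) * (X * (A * H)) := by
    rw [Derivation.leibniz, smul_eq_mul, smul_eq_mul, derivative_expSqCoeff,
      derivative_pow_div_factorial]
    ring
  have hc0 : coeff 0 (A * H) = 1 := by
    rw [coeff_zero_eq_constantCoeff_apply, map_mul, hA, hH]
    simp [expSqCoeff, ← coeff_zero_eq_constantCoeff_apply]
  have hq : ∀ k, q k = coeff k (A * H) ∧ q (k + 1) = coeff (k + 1) (A * H) := by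
    intro k
    induction k with
    | zero =>
      have h3 := congrArg (coeff 0) hd
      rw [coeff_derivative, map_add, coeff_C_mul, coeff_C_mul, coeff_zero_X_mul, hc0] at h3
      refine ⟨h0.trans hc0.symm, h1.trans ?_⟩
      simpa using h3.symm
    | succ k ih =>
      refine ⟨ih.2, ?_⟩
      have h3 := congrArg (coeff (k + 1)) hd
      rw [coeff_derivative, map_add, coeff_C_mul, coeff_C_mul, coeff_succ_X_mul, ← ih.1, ← ih.2,
        ← h2] at h3
      have h4 : (k : ℂ) + 2 ≠ 0 := by exact_mod_cast (by omega : k + 2 ≠ 0)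
      refine mul_left_cancel₀ h4 (h3.symm.trans ?_)
      push_cast
      ring
  have hq' : q = fun k => ∑ a ∈ Finset.HasAntidiagonal.antidiagonal k,
      (u ^ a.1 / (a.1.factorial : ℂ)) * expSqCoeff v a.2 := funext fun k => by
    rw [(hq k).1, coeff_mul]
    simp only [hA, hH, coeff_mk]
  have hs := summable_norm_sum_mul_antidiagonal_of_summable_norm
    (summable_norm_pow_div_factorial u) (summable_norm_expSqCoeff v)
  have ht := tsum_mul_tsum_eq_tsum_sum_antidiagonal_of_summable_norm
    (summable_norm_pow_div_factorial u) (summable_norm_expSqCoeff v)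
  rw [(hasSum_pow_div_factorial u).tsum_eq, (hasSum_expSqCoeff v).tsum_eq, ← Complex.exp_add] at ht
  rw [hq', ht]
  exact hs.of_norm.hasSum

/-! ## Moments of Gaussian states -/

theorem pow_succ_mul_of_commutator {A : Type*} [Ring A] [Algebra ℂ A] {T D : A} {δ : ℂ}
    (h : T * D = D * T + δ • (1 : A)) (k : ℕ) :
    T ^ (k + 1) * D = D * T ^ (k + 1) + (((k : ℂ) + 1) * δ) • T ^ k := by
  induction k with
  | zero => simpa using h
  | succ k ih =>
    rw [pow_succ' T (k + 1), mul_assoc, ih, mul_add, ← mul_assoc, h, add_mul, mul_assoc,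
      smul_mul_assoc, one_mul, mul_smul_comm, ← pow_succ', ← pow_succ', add_assoc, ← add_smul]
    push_cast
    congr 2
    ring

theorem rw'_mul_bpOp (p q : Ix n) : rw' p * bpOp (rotV n) q =
    bpOp (rotV n) q * rw' p + (if p = q then isqrt2 else 0) • 1 := by
  have h : epsOp p * bpOp (rotV n) q = bpOp (rotV n) q * epsOp p := by
    rw [epsOp, Finset.sum_mul, Finset.mul_sum]
    exact Finset.sum_congr rfl fun a _ => by
      rw [smul_mul_assoc, mul_smul_comm, bpOp_mul_bpOp (rotV_mul_conjTranspose n)]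
  rw [rw'_eq, smul_mul_assoc, sub_mul, h, bOp_mul_bpOp (rotV_mul_conjTranspose n) p q,
    mul_smul_comm,
    mul_sub, smul_sub, smul_sub, smul_add, smul_smul]
  split_ifs
  · rw [mul_one]
    abel
  · rw [mul_zero, zero_smul, add_zero]
    abel

theorem rwSum_mul_sum_bpOp (x : Ix n → ℝ) (y : Ix n → ℂ) :
    rwSum x * ∑ q, y q • bpOp (rotV n) q =
      (∑ q, y q • bpOp (rotV n) q) * rwSum x + (isqrt2 * ∑ p, (x p : ℂ) * y p) • 1 := by
  have h1 : ∀ q, rwSum x * bpOp (rotV n) q =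
      bpOp (rotV n) q * rwSum x + (isqrt2 * (x q : ℂ)) • 1 := by
    intro q
    rw [rwSum, Finset.sum_mul, Finset.mul_sum]
    simp only [smul_mul_assoc, rw'_mul_bpOp, smul_add, Finset.sum_add_distrib, mul_smul_comm]
    rw [Finset.sum_eq_single (f := fun p => (x p : ℂ) • ((if p = q then isqrt2 else 0) •
      (1 : Module.End ℂ (Fn (Ix n))))) q (fun p _ hp => by rw [if_neg hp, zero_smul, smul_zero])
      (fun h => absurd (Finset.mem_univ q) h), if_pos rfl, smul_smul, mul_comm isqrt2]
  rw [Finset.mul_sum, Finset.sum_mul, Finset.mul_sum, Finset.sum_smul, ← Finset.sum_add_distrib]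
  refine Finset.sum_congr rfl fun q _ => ?_
  rw [mul_smul_comm, h1, smul_add, smul_smul, smul_mul_assoc]
  congr 2
  ring

section Moments

variable {Γ : Matrix (Ix n) (Ix n) ℝ}

/-- The coefficients of `b'` in the right multiplication of a Gaussian by `x·w`. -/
def rwCoeff (Γ : Matrix (Ix n) (Ix n) ℝ) (x : Ix n → ℝ) (q : Ix n) : ℂ :=
  isqrt2 * ∑ p, (x p : ℂ) * (2 * (Γ p q : ℂ) - tau n q p)

/-- On a Gaussian the relation b = 2Γb' + √2κ leaves only b' and a scalar in the right
multiplication. -/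
theorem rwSum_gaussState (h : Γ.PosDef) (κ x : Ix n → ℝ) :
    rwSum x (gaussState Γ κ) = (∑ q, rwCoeff Γ x q • bpOp (rotV n) q) (gaussState Γ κ)
      + ((x ⬝ᵥ κ : ℝ) : ℂ) • gaussState Γ κ := by
  have h1 : ∀ p, rw' p (gaussState Γ κ) =
      ∑ q, (isqrt2 * (2 * (Γ p q : ℂ) - tau n q p)) • bpOp (rotV n) q (gaussState Γ κ)
        + (κ p : ℂ) • gaussState Γ κ := by
    intro p
    have h2 : isqrt2 * ((Real.sqrt 2 * κ p : ℝ) : ℂ) = κ p := by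
      rw [Complex.ofReal_mul, sqrt2_eq]
      linear_combination 2 * (κ p : ℂ) * isqrt2_mul_self
    rw [rw'_eq, LinearMap.smul_apply, LinearMap.sub_apply, bOp_gaussState h, epsOp, LinearMap.sum_apply,
      add_sub_right_comm, smul_add, smul_smul, h2, Finset.smul_sum, ← Finset.sum_sub_distrib,
      Finset.smul_sum]
    congr 1
    refine Finset.sum_congr rfl fun q _ => ?_
    rw [LinearMap.smul_apply, smul_smul, ← sub_smul, smul_smul]
  rw [rwSum, LinearMap.sum_apply, LinearMap.sum_apply]
  simp only [LinearMap.smul_apply, h1, smul_add, Finset.sum_add_distrib, Finset.smul_sum, smul_smul]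
  rw [Finset.sum_comm]
  congr 1
  · refine Finset.sum_congr rfl fun q _ => ?_
    rw [← Finset.sum_smul, rwCoeff, Finset.mul_sum]
    congr 1
    exact Finset.sum_congr rfl fun p _ => by ring
  · rw [← Finset.sum_smul, dotProduct]
    push_cast
    rfl

theorem sum_mul_tau (x : Ix n → ℝ) : ∑ q, (x q : ℂ) * ∑ p, (x p : ℂ) * tau n q p = 0 := by
  have h : ∑ q, (x q : ℂ) * ∑ p, (x p : ℂ) * tau n q p =
      -∑ q, (x q : ℂ) * ∑ p, (x p : ℂ) * tau n q p := by
    conv_lhs => simp only [Finset.mul_sum]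
    rw [Finset.sum_comm, ← Finset.sum_neg_distrib]
    refine Finset.sum_congr rfl fun q _ => ?_
    rw [Finset.mul_sum, ← Finset.sum_neg_distrib]
    refine Finset.sum_congr rfl fun p _ => ?_
    rw [tau_apply_swap]
    ring
  exact self_eq_neg.mp h

/-- The antisymmetric τ drops out of the quadratic form, leaving the covariance alone. -/
theorem isqrt2_mul_sum_rwCoeff (Γ : Matrix (Ix n) (Ix n) ℝ) (hs : Γ.IsSymm) (x : Ix n → ℝ) :
    isqrt2 * ∑ p, (x p : ℂ) * rwCoeff Γ x p = ((x ⬝ᵥ Γ *ᵥ x : ℝ) : ℂ) := by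
  have h1 : ((x ⬝ᵥ Γ *ᵥ x : ℝ) : ℂ) = ∑ q, (x q : ℂ) * ∑ p, (x p : ℂ) * (Γ p q : ℂ) := by
    simp only [dotProduct, mulVec]
    push_cast
    refine Finset.sum_congr rfl fun q _ => ?_
    congr 1
    refine Finset.sum_congr rfl fun p _ => ?_
    rw [← hs.apply q p, mul_comm]
  have h2 : ∑ p, (x p : ℂ) * rwCoeff Γ x p = isqrt2 * (2 * ∑ q, (x q : ℂ) * ∑ p, (x p : ℂ) * (Γ p q : ℂ)
      - ∑ q, (x q : ℂ) * ∑ p, (x p : ℂ) * tau n q p) := by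
    rw [Finset.mul_sum, ← Finset.sum_sub_distrib, Finset.mul_sum]
    refine Finset.sum_congr rfl fun q _ => ?_
    simp only [rwCoeff, mul_sub, Finset.sum_sub_distrib]
    have h3 : ∑ p, (x p : ℂ) * (2 * (Γ p q : ℂ)) = 2 * ∑ p, (x p : ℂ) * (Γ p q : ℂ) := by
      rw [Finset.mul_sum]
      exact Finset.sum_congr rfl fun p _ => by ring
    rw [h3]
    ring
  rw [h2, sum_mul_tau, h1]
  linear_combination 2 * (∑ q, (x q : ℂ) * ∑ p, (x p : ℂ) * (Γ p q : ℂ)) * isqrt2_mul_self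

/-- The innermost factor becomes b' plus a scalar. Commuting b' to the outside, where the trace
kills it, gives k + 1 equal commutators x·Γx: Wick's theorem as a recurrence. -/
theorem tr_rwSum_pow_succ_succ (h : Γ.PosDef) (κ x : Ix n → ℝ) (k : ℕ) :
    tr ((rwSum x ^ (k + 2)) (gaussState Γ κ)) =
      ((k : ℂ) + 1) * ((x ⬝ᵥ Γ *ᵥ x : ℝ) : ℂ) * tr ((rwSum x ^ k) (gaussState Γ κ))
      + ((x ⬝ᵥ κ : ℝ) : ℂ) * tr ((rwSum x ^ (k + 1)) (gaussState Γ κ)) := by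
  have hd := decays_gaussState h κ
  have hpow : ∀ k, Decays ((rwSum x ^ k) (gaussState Γ κ)) := fun k =>
    hd.apply (Subalgebra.pow_mem _ (rwSum_mem x) k)
  have h1 := rwSum_mul_sum_bpOp x (rwCoeff Γ x)
  rw [isqrt2_mul_sum_rwCoeff Γ (posDef_isSymm h)] at h1
  have h2 := congrFun (congrArg DFunLike.coe (pow_succ_mul_of_commutator h1 k)) (gaussState Γ κ)
  rw [Module.End.mul_apply, LinearMap.add_apply, Module.End.mul_apply, LinearMap.smul_apply] at h2
  rw [pow_succ, Module.End.mul_apply, rwSum_gaussState h, map_add, map_smul, h2]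
  have h3 : Decays ((∑ q, rwCoeff Γ x q • bpOp (rotV n) q)
      ((rwSum x ^ (k + 1)) (gaussState Γ κ))) := (hpow _).apply
    (Subalgebra.sum_mem _ fun q _ => Subalgebra.smul_mem _ (bpOp_mem q) _)
  rw [tr_add (h3.add ((hpow k).smul _)) ((hpow _).smul _), tr_add h3 ((hpow k).smul _),
    tr_sum_bpOp (hpow _), tr_smul, tr_smul, zero_add]

theorem isGaussian_gaussState (h : IsBona Γ) (κ : Ix n → ℝ) :
    IsGaussian κ Γ ((toFn n).symm (gaussState Γ κ)) := by
  intro x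
  have hd := decays_gaussState h.1 κ
  refine hasTrace_opMul_weyl (by rwa [LinearEquiv.apply_symm_apply]) x ?_
  rw [LinearEquiv.apply_symm_apply]
  rw [show ∀ a b : ℂ, a - 1 / 2 * b = a + (-(1 / 2) * b) by intro a b; ring]
  refine hasSum_of_recurrence ?_ ?_ fun k => ?_
  · rw [pow_zero, pow_zero, Nat.factorial_zero, Nat.cast_one, div_one, one_mul, Module.End.one_apply,
      tr_gaussState h]
  · rw [pow_one, pow_one, Nat.factorial_one, Nat.cast_one, div_one, rwSum_gaussState h.1,
      tr_add (hd.apply (Subalgebra.sum_mem _ fun q _ => Subalgebra.smul_mem _ (bpOp_mem q) _))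
        (hd.smul _), tr_sum_bpOp hd, tr_smul, tr_gaussState h, mul_one, zero_add]
  · rw [tr_rwSum_pow_succ_succ h.1, Nat.factorial_succ, Nat.factorial_succ]
    have h1 : (k.factorial : ℂ) ≠ 0 := by exact_mod_cast k.factorial_ne_zero
    have h2 : (k : ℂ) + 1 ≠ 0 := by exact_mod_cast k.succ_ne_zero
    have h3 : (k : ℂ) + 2 ≠ 0 := by exact_mod_cast (by omega : k + 2 ≠ 0)
    have h4 : (k : ℂ) + 1 + 1 ≠ 0 := by exact_mod_cast (by omega : k + 1 + 1 ≠ 0)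
    push_cast
    rw [pow_add Complex.I k 2, pow_succ Complex.I k, Complex.I_sq]
    field_simp
    rw [Complex.I_sq]
    ring

end Moments

/-! ## Linear independence of monomials in creation operators -/

section Weight

variable {M : Type*} [AddCommGroup M] [Module ℂ M]

/-- `A` raises the eigenvalues of `N` by `c`. -/
def HasWeight (N : Module.End ℂ M) (c : ℕ) (A : Module.End ℂ M) : Prop :=
  N * A = A * N + c • A

theorem HasWeight.one (N : Module.End ℂ M) : HasWeight N 0 1 := by
  rw [HasWeight, mul_one, one_mul, zero_nsmul, add_zero]

theorem HasWeight.mul {N A B : Module.End ℂ M} {c d : ℕ} (hA : HasWeight N c A)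
    (hB : HasWeight N d B) : HasWeight N (c + d) (A * B) := by
  rw [HasWeight] at *
  rw [← mul_assoc, hA, add_mul, mul_assoc, hB, mul_add, mul_assoc, add_nsmul, smul_mul_assoc,
    mul_smul_comm]
  abel

theorem HasWeight.pow {N A : Module.End ℂ M} {c : ℕ} (hA : HasWeight N c A) (a : ℕ) :
    HasWeight N (a * c) (A ^ a) := by
  induction a with
  | zero => simpa using HasWeight.one N
  | succ a ih =>
    rw [pow_succ, Nat.succ_mul]
    exact ih.mul hA

theorem HasWeight.list_prod {ι : Type*} {N : Module.End ℂ M} {c : ι → ℕ} {A : ι → Module.End ℂ M}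
    (h : ∀ k, HasWeight N (c k) (A k)) (l : List ι) :
    HasWeight N (l.map c).sum (l.map A).prod := by
  induction l with
  | nil => exact HasWeight.one N
  | cons k l ih =>
    rw [List.map_cons, List.map_cons, List.sum_cons, List.prod_cons]
    exact (h k).mul ih

theorem HasWeight.apply {N A : Module.End ℂ M} {c : ℕ} (hA : HasWeight N c A) {x : M} {w : ℕ}
    (hx : N x = w • x) : N (A x) = (c + w) • A x := by
  have h := congrFun (congrArg DFunLike.coe hA) x
  rw [Module.End.mul_apply, LinearMap.add_apply, Module.End.mul_apply, LinearMap.smul_apply, hx,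
    map_nsmul] at h
  rw [h, add_nsmul, add_comm]

/-- If Zx were zero, then 0 = EZx = (ZE + 1)x = (w + 1)x; eigenvalues of the number operator ZE are
natural numbers here. -/
theorem pow_apply_ne_zero {E Z : Module.End ℂ M} (h : E * Z = Z * E + 1) (a : ℕ) {x : M} {w : ℕ}
    (hx : (Z * E) x = w • x) (h0 : x ≠ 0) : (Z ^ a) x ≠ 0 := by
  induction a generalizing x w with
  | zero => exact h0
  | succ a ih =>
    have h1 : HasWeight (Z * E) 1 Z := by
      rw [HasWeight, mul_assoc, h, mul_add, mul_one, one_nsmul]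
    rw [pow_succ, Module.End.mul_apply]
    refine ih (h1.apply hx) fun h2 => h0 ?_
    have h3 := congrFun (congrArg DFunLike.coe h) x
    rw [Module.End.mul_apply, LinearMap.add_apply, h2, map_zero, hx, Module.End.one_apply] at h3
    have h4 : ((w : ℂ) + 1) • x = 0 := by
      rw [add_smul, one_smul, Nat.cast_smul_eq_nsmul, ← h3]
    exact (smul_eq_zero.mp h4).resolve_left (by exact_mod_cast w.succ_ne_zero)

theorem linearIndependent_of_joint_eigenvectors {ι : Type*} (N : ι → Module.End ℂ M)
    {m : (ι → ℕ) → M} (hN : ∀ k α, N k (m α) = α k • m α) (h0 : ∀ α, m α ≠ 0) :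
    LinearIndependent ℂ m := by
  rw [linearIndependent_iff']
  intro s
  classical
  induction s using Finset.induction_on with
  | empty => exact fun g _ i hi => absurd hi (Finset.notMem_empty i)
  | insert β s hβ ih =>
    intro g hg
    rw [Finset.sum_insert hβ] at hg
    have h1 : ∀ α ∈ s, g α = 0 := by
      intro α hα
      -- A coordinate that separates α from β: applying N_k - β_k removes the new vector and
      -- multiplies the coefficient of α by a nonzero number.
      obtain ⟨k, hk⟩ : ∃ k, α k ≠ β k := by
        by_contra! h
        exact hβ (funext h ▸ hα)
      have h2 := congrArg (N k) hg
      rw [map_add, map_smul, hN, map_sum, map_zero] at h2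
      have h3 : ∑ α ∈ s, (g α * ((α k : ℂ) - β k)) • m α = 0 := by
        calc _ = (g β • β k • m β + ∑ α ∈ s, N k (g α • m α))
              - (β k : ℂ) • (g β • m β + ∑ α ∈ s, g α • m α) := by
              rw [smul_add, Finset.smul_sum, smul_comm, Nat.cast_smul_eq_nsmul, add_sub_add_left_eq_sub,
                ← Finset.sum_sub_distrib]
              refine Finset.sum_congr rfl fun α _ => ?_
              rw [map_smul, hN, ← Nat.cast_smul_eq_nsmul ℂ]
              module
          _ = 0 := by rw [h2, hg, smul_zero, sub_zero]
      refine (mul_eq_zero.mp (ih _ h3 α hα)).resolve_right (sub_ne_zero.mpr ?_)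
      exact_mod_cast hk
    intro α hα
    rcases Finset.mem_insert.mp hα with rfl | hα
    · rw [Finset.sum_eq_zero fun β hβ => by rw [h1 β hβ, zero_smul], add_zero] at hg
      exact (smul_eq_zero.mp hg).resolve_right (h0 _)
    · exact h1 α hα

end Weight

/-! ## The annihilators of a Gaussian state -/

theorem bpOp_mul_sum_bpOp (y : Ix n → ℂ) (p : Ix n) :
    bpOp (rotV n) p * ∑ q, y q • bpOp (rotV n) q =
      (∑ q, y q • bpOp (rotV n) q) * bpOp (rotV n) p := by
  rw [Finset.mul_sum, Finset.sum_mul]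
  exact Finset.sum_congr rfl fun q _ => by
    rw [mul_smul_comm, smul_mul_assoc, bpOp_mul_bpOp (rotV_mul_conjTranspose n)]

theorem bOp_mul_sum_bpOp (y : Ix n → ℂ) (p : Ix n) :
    bOp (rotV n) p * ∑ q, y q • bpOp (rotV n) q =
      (∑ q, y q • bpOp (rotV n) q) * bOp (rotV n) p + y p • 1 := by
  rw [Finset.mul_sum, Finset.sum_mul]
  simp only [mul_smul_comm, smul_mul_assoc, bOp_mul_bpOp (rotV_mul_conjTranspose n), smul_add,
    Finset.sum_add_distrib]
  rw [Finset.sum_eq_single (f := fun q => y q • ((if p = q then (1 : ℂ) else 0) •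
    (1 : Module.End ℂ (Fn (Ix n))))) p (fun q _ hq => by rw [if_neg hq.symm, zero_smul, smul_zero])
    (fun h => absurd (Finset.mem_univ p) h), if_pos rfl, one_smul]

/-- The operator `(b - 2Γb')_p`. -/
def annOp (Γ : Matrix (Ix n) (Ix n) ℝ) (p : Ix n) : Module.End ℂ (Fn (Ix n)) :=
  bOp (rotV n) p - (2 : ℂ) • ∑ s, (Γ p s : ℂ) • bpOp (rotV n) s

section AnnOp

variable {Γ : Matrix (Ix n) (Ix n) ℝ}

theorem annOp_gaussState (h : Γ.PosDef) (κ : Ix n → ℝ) (p : Ix n) :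
    annOp Γ p (gaussState Γ κ) = ((Real.sqrt 2 * κ p : ℝ) : ℂ) • gaussState Γ κ := by
  rw [annOp, LinearMap.sub_apply, bOp_gaussState h]
  simp only [LinearMap.smul_apply, LinearMap.sum_apply]
  abel

theorem annOp_gaussState_zero (h : Γ.PosDef) (p : Ix n) : annOp Γ p (gaussState Γ 0) = 0 := by
  rw [annOp_gaussState h, Pi.zero_apply, mul_zero, Complex.ofReal_zero, zero_smul]

theorem annOp_mul_sum_bpOp (y : Ix n → ℂ) (p : Ix n) :
    annOp Γ p * ∑ q, y q • bpOp (rotV n) q =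
      (∑ q, y q • bpOp (rotV n) q) * annOp Γ p + y p • 1 := by
  have h : (∑ s, (Γ p s : ℂ) • bpOp (rotV n) s) * ∑ q, y q • bpOp (rotV n) q =
      (∑ q, y q • bpOp (rotV n) q) * ∑ s, (Γ p s : ℂ) • bpOp (rotV n) s := by
    rw [Finset.sum_mul, Finset.mul_sum]
    exact Finset.sum_congr rfl fun s _ => by
      rw [smul_mul_assoc, mul_smul_comm, bpOp_mul_sum_bpOp]
  rw [annOp, sub_mul, mul_sub, smul_mul_assoc, mul_smul_comm, bOp_mul_sum_bpOp, h]
  abel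

/-- Subtracting the annihilation relations of the two parameter sets leaves (Γ - Γ')b' acting on the
state as a scalar. Applying b - 2Γb' to this extracts the entries of Γ - Γ', and then κ. -/
theorem gaussState_injective (h : IsBona Γ) {Γ' : Matrix (Ix n) (Ix n) ℝ} (h' : Γ'.PosDef)
    {κ : Ix n → ℝ} (he : gaussState Γ' κ = gaussState Γ 0) : κ = 0 ∧ Γ' = Γ := by
  have hX := gaussState_ne_zero h 0
  have h1 : ∀ p, (∑ q, ((Γ p q : ℂ) - Γ' p q) • bpOp (rotV n) q) (gaussState Γ 0) =
      ((1 / 2 : ℂ) * ((Real.sqrt 2 * κ p : ℝ) : ℂ)) • gaussState Γ 0 := by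
    intro p
    have h2 := annOp_gaussState h' κ p
    have h3 := annOp_gaussState_zero h.1 p
    rw [he, annOp, LinearMap.sub_apply] at h2
    rw [annOp, LinearMap.sub_apply, sub_eq_zero] at h3
    rw [h3, LinearMap.smul_apply, LinearMap.smul_apply, ← smul_sub] at h2
    rw [mul_smul, ← h2, smul_smul]
    have h5 : ∑ q, ((Γ p q : ℂ) - Γ' p q) • bpOp (rotV n) q =
        (∑ q, (Γ p q : ℂ) • bpOp (rotV n) q) - ∑ q, (Γ' p q : ℂ) • bpOp (rotV n) q := by
      rw [← Finset.sum_sub_distrib]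
      exact Finset.sum_congr rfl fun q _ => by module
    rw [h5, LinearMap.sub_apply]
    norm_num
  have h4 : ∀ p q, (Γ p q : ℂ) - Γ' p q = 0 := by
    intro p q
    have h2 := congrArg (annOp Γ q) (h1 p)
    rw [map_smul, annOp_gaussState_zero h.1, smul_zero, ← Module.End.mul_apply, annOp_mul_sum_bpOp,
      LinearMap.add_apply, Module.End.mul_apply, annOp_gaussState_zero h.1, map_zero, zero_add,
      LinearMap.smul_apply, Module.End.one_apply] at h2
    exact (smul_eq_zero.mp h2).resolve_right hX
  constructor
  · funext p
    have h2 := h1 p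
    simp only [h4, zero_smul, Finset.sum_const_zero, LinearMap.zero_apply] at h2
    have h3 := (smul_eq_zero.mp h2.symm).resolve_right hX
    have h5 := (mul_eq_zero.mp h3).resolve_left (by norm_num)
    rw [Complex.ofReal_eq_zero] at h5
    exact (mul_eq_zero.mp h5).resolve_left (by positivity)
  · ext p q
    exact_mod_cast (sub_eq_zero.mp (h4 p q)).symm

end AnnOp

/-! ## Second moments -/

theorem tr_bOp_sum_bpOp {X : Fn (Ix n)} (hX : Decays X) (y : Ix n → ℂ) (p : Ix n) :
    tr (bOp (rotV n) p ((∑ q, y q • bpOp (rotV n) q) X)) = y p * tr X := by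
  have h1 : (∑ q, y q • bpOp (rotV n) q) ∈ ladderAlg (Ix n) :=
    Subalgebra.sum_mem _ fun q _ => Subalgebra.smul_mem _ (bpOp_mem q) _
  rw [← Module.End.mul_apply, bOp_mul_sum_bpOp, LinearMap.add_apply, Module.End.mul_apply,
    LinearMap.smul_apply, Module.End.one_apply, tr_add ((hX.apply (bOp_mem p)).apply h1) (hX.smul _),
    tr_sum_bpOp (hX.apply (bOp_mem p)), tr_smul, zero_add]

theorem tr_lw_lw_gaussState {Γ : Matrix (Ix n) (Ix n) ℝ} (h : IsBona Γ) (p q : Ix n) :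
    tr (lw p (lw q (gaussState Γ 0))) = (Γ q p : ℂ) + (1 / 2 : ℂ) * tau n p q := by
  have hd := decays_gaussState h.1 0
  have h1 : lw q (gaussState Γ 0) =
      (∑ s, (isqrt2 * (2 * (Γ q s : ℂ) + tau n s q)) • bpOp (rotV n) s) (gaussState Γ 0) := by
    rw [lw_eq, LinearMap.smul_apply, LinearMap.add_apply, bOp_gaussState h.1, epsOp]
    simp only [LinearMap.sum_apply, LinearMap.smul_apply, Pi.zero_apply, mul_zero,
      Complex.ofReal_zero, zero_smul, add_zero, Finset.smul_sum, smul_smul,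
      ← Finset.sum_add_distrib, ← add_smul]
  rw [tr_lw (hd.apply (lw_mem q)), h1, tr_bOp_sum_bpOp hd, tr_gaussState h]
  linear_combination (2 * (Γ q p : ℂ) + tau n p q) * isqrt2_mul_self

theorem hasCovariance_gaussState {Γ : Matrix (Ix n) (Ix n) ℝ} (h : IsBona Γ) :
    HasCovariance ((toFn n).symm (gaussState Γ 0)) Γ := by
  intro p q
  set X := gaussState Γ 0 with hX
  have hd : Decays X := decays_gaussState h.1 0
  have h1 : toFn n ((1 / 2 : ℂ) • ((maj p ⋆ₒ maj q + maj q ⋆ₒ maj p) ⋆ₒ (toFn n).symm X)) =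
      (1 / 2 : ℂ) • (lw p (lw q X) + lw q (lw p X)) := by
    rw [map_smul, RowFin.add_opMul ((rowFin_maj p).opMul (rowFin_maj q))
      ((rowFin_maj q).opMul (rowFin_maj p)), map_add, (rowFin_maj p).opMul_assoc (rowFin_maj q),
      (rowFin_maj q).opMul_assoc (rowFin_maj p), toFn_maj_opMul, toFn_maj_opMul, toFn_maj_opMul,
      toFn_maj_opMul, LinearEquiv.apply_symm_apply]
  have h2 : ∀ p q, Decays (lw p (lw q X)) := fun p q => (hd.apply (lw_mem q)).apply (lw_mem p)
  have h3 := hasTrace_of_decays (R := (1 / 2 : ℂ) • ((maj p ⋆ₒ maj q + maj q ⋆ₒ maj p) ⋆ₒ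
    (toFn n).symm X)) (by rw [h1]; exact ((h2 p q).add (h2 q p)).smul _)
  rw [h1, tr_smul, tr_add (h2 p q) (h2 q p), tr_lw_lw_gaussState h, tr_lw_lw_gaussState h,
    ← (posDef_isSymm h.1).apply q p, tau_apply_swap q p] at h3
  convert h3 using 1
  rw [(posDef_isSymm h.1).apply]
  ring

/-! ## The Liouvillian on Gaussian states -/

/-- The Liouvillian on functions. -/
def System.liouvOp (𝒮 : System n) : Module.End ℂ (Fn (Ix n)) :=
  bilin 𝒮.X₀ (bpOp (rotV n)) (bOp (rotV n)) + bilin 𝒮.Y (bpOp (rotV n)) (bpOp (rotV n))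

/-- Replacing b by 2Γb' + √2κ gives b'·(2X₀Γ + Y)b'. As the b' commute, only the symmetric part
counts, and this is the Lyapunov equation. -/
theorem System.liouvOp_gaussState (𝒮 : System n) {Γ : Matrix (Ix n) (Ix n) ℝ} (h : Γ.PosDef)
    (hL : 𝒮.Lyapunov Γ) {κ : Ix n → ℝ} (hκ : 𝒮.X₀ *ᵥ (fun q => (κ q : ℂ)) = 0) :
    𝒮.liouvOp (gaussState Γ κ) = 0 := by
  set P : Ix n → Module.End ℂ (Fn (Ix n)) := bpOp (rotV n) with hP
  have hcomm : ∀ p q, P p * P q = P q * P p := bpOp_mul_bpOp (rotV_mul_conjTranspose n)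
  set Γc : Matrix (Ix n) (Ix n) ℂ := Γ.map Complex.ofReal with hΓc
  have h1 : bilin 𝒮.X₀ P (bOp (rotV n)) (gaussState Γ κ) =
      ((2 : ℂ) • bilin (𝒮.X₀ * Γc) P P) (gaussState Γ κ) := by
    have h2 : ∀ p, ∑ q, 𝒮.X₀ p q • P p (((Real.sqrt 2 * κ q : ℝ) : ℂ) • gaussState Γ κ) = 0 := by
      intro p
      have h3 : ∑ q, 𝒮.X₀ p q * (κ q : ℂ) = 0 := congrFun hκ p
      simp only [map_smul, smul_smul, ← Finset.sum_smul]
      rw [show ∑ q, 𝒮.X₀ p q * ((Real.sqrt 2 * κ q : ℝ) : ℂ) =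
        ((Real.sqrt 2 : ℝ) : ℂ) * ∑ q, 𝒮.X₀ p q * (κ q : ℂ) from by
          rw [Finset.mul_sum]
          refine Finset.sum_congr rfl fun q _ => ?_
          push_cast
          ring, h3, mul_zero, zero_smul]
    rw [bilin_mul_right, LinearMap.smul_apply]
    simp only [bilin, LinearMap.sum_apply, LinearMap.smul_apply, Module.End.mul_apply,
      bOp_gaussState h, map_add, smul_add, Finset.sum_add_distrib]
    rw [Finset.sum_eq_zero fun p _ => h2 p, add_zero]
    simp only [Finset.smul_sum, map_smul, map_sum, hΓc, Matrix.map_apply, ← hP]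
    refine Finset.sum_congr rfl fun p _ => Finset.sum_congr rfl fun q _ =>
      Finset.sum_congr rfl fun s _ => ?_
    exact smul_comm _ _ _
  have hsym : Γcᵀ = Γc := by
    rw [hΓc, ← Matrix.transpose_map, posDef_isSymm h]
  have h2 : (2 : ℂ) • bilin (𝒮.X₀ * Γc) P P = -bilin 𝒮.Y P P := by
    rw [two_smul]
    nth_rw 2 [← bilin_transpose_of_comm _ hcomm]
    rw [← bilin_add, Matrix.transpose_mul, hsym, ← bilin_neg]
    exact congrArg (fun N => bilin N P P) hL
  rw [System.liouvOp, LinearMap.add_apply, h1, h2, LinearMap.neg_apply, neg_add_cancel]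

theorem System.isSteadyState_gaussState (𝒮 : System n) {Γ : Matrix (Ix n) (Ix n) ℝ} (h : IsBona Γ)
    (hL : 𝒮.Lyapunov Γ) {κ : Ix n → ℝ} (hκ : 𝒮.X₀ *ᵥ (fun q => (κ q : ℂ)) = 0) :
    𝒮.IsSteadyState ((toFn n).symm (gaussState Γ κ)) := by
  refine ⟨isDensity_gaussState h κ, isRegularOp_gaussState h.1 κ, (toFn n).injective ?_⟩
  rw [𝒮.toFn_liouvillian, LinearEquiv.apply_symm_apply, map_zero]
  exact 𝒮.liouvOp_gaussState h.1 hL hκ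

/-- The commutator with y·b' is b'·X₀y. -/
theorem System.liouvOp_mul_sum_bpOp (𝒮 : System n) {y : Ix n → ℂ} (hy : 𝒮.X₀ *ᵥ y = 0) :
    𝒮.liouvOp * ∑ q, y q • bpOp (rotV n) q = (∑ q, y q • bpOp (rotV n) q) * 𝒮.liouvOp := by
  set Z := ∑ q, y q • bpOp (rotV n) q with hZ
  have h1 : ∀ p q, bpOp (rotV n) p * bOp (rotV n) q * Z =
      Z * (bpOp (rotV n) p * bOp (rotV n) q) + y q • bpOp (rotV n) p := fun p q => by
    rw [mul_assoc, bOp_mul_sum_bpOp, mul_add, ← mul_assoc, bpOp_mul_sum_bpOp, mul_assoc,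
      mul_smul_comm, mul_one]
  have h2 : ∀ p q, bpOp (rotV n) p * bpOp (rotV n) q * Z =
      Z * (bpOp (rotV n) p * bpOp (rotV n) q) := fun p q => by
    rw [mul_assoc, bpOp_mul_sum_bpOp, ← mul_assoc, bpOp_mul_sum_bpOp, mul_assoc]
  have h3 : ∀ p, ∑ q, 𝒮.X₀ p q • y q • bpOp (rotV n) p = 0 := fun p => by
    have h4 : ∑ q, 𝒮.X₀ p q * y q = 0 := congrFun hy p
    simp only [smul_smul, ← Finset.sum_smul, h4, zero_smul]
  rw [System.liouvOp, add_mul, mul_add]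
  simp only [bilin, Finset.sum_mul, Finset.mul_sum, smul_mul_assoc, mul_smul_comm, h1, h2, smul_add,
    Finset.sum_add_distrib, h3, add_zero]

/-! ## The kernel of a matrix in Jordan normal form -/

theorem jordanMatrix_mulVec {N : ℕ} (D : Fin N → ℕ) (ξ : Fin N → ℂ) (z : (Σ k, Fin (D k)) → ℂ)
    (k : Fin N) (l : Fin (D k)) : (jordanMatrix D ξ *ᵥ z) ⟨k, l⟩ =
      ξ k * z ⟨k, l⟩ + if h : (l : ℕ) + 1 < D k then z ⟨k, ⟨l + 1, h⟩⟩ else 0 := by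
  classical
  rw [mulVec, dotProduct, ← Finset.add_sum_erase _ _ (Finset.mem_univ (⟨k, l⟩ : Σ k, Fin (D k))),
    jordanMatrix, if_pos rfl]
  congr 1
  split_ifs with h
  · have hne : (⟨k, l⟩ : Σ k, Fin (D k)) ≠ ⟨k, ⟨l + 1, h⟩⟩ := fun h1 => by
      have h2 := congrArg Fin.val (eq_of_heq (Sigma.mk.inj h1).2)
      simp at h2
    rw [Finset.sum_eq_single_of_mem (⟨k, ⟨l + 1, h⟩⟩ : Σ k, Fin (D k))
      (Finset.mem_erase.mpr ⟨hne.symm, Finset.mem_univ _⟩), jordanMatrix, if_neg hne,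
      if_pos ⟨rfl, rfl⟩, one_mul]
    rintro ⟨k', l'⟩ h1 h2
    rw [jordanMatrix, if_neg (Finset.ne_of_mem_erase h1).symm, if_neg, zero_mul]
    rintro ⟨h3, h4⟩
    simp only at h3
    subst h3
    exact h2 (congrArg (Sigma.mk k) (Fin.ext h4.symm))
  · refine Finset.sum_eq_zero ?_
    rintro ⟨k', l'⟩ h1
    rw [jordanMatrix, if_neg (Finset.ne_of_mem_erase h1).symm, if_neg, zero_mul]
    rintro ⟨h3, h4⟩
    simp only at h3 h4
    subst h3
    exact h (h4 ▸ l'.2)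

/-- Row ℓ reads ξz_ℓ + z_{ℓ+1} = 0. For ξ = 0 it kills every entry after the first; for ξ ≠ 0 it
kills all of them, starting from the last. -/
theorem eq_zero_of_jordanMatrix_mulVec {N : ℕ} {D : Fin N → ℕ} {ξ : Fin N → ℂ}
    {z : (Σ k, Fin (D k)) → ℂ} (hz : jordanMatrix D ξ *ᵥ z = 0) (k : Fin N) (l : Fin (D k))
    (h : ξ k ≠ 0 ∨ (l : ℕ) ≠ 0) : z ⟨k, l⟩ = 0 := by
  have h1 : ∀ l : Fin (D k), ξ k * z ⟨k, l⟩ +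
      (if h : (l : ℕ) + 1 < D k then z ⟨k, ⟨l + 1, h⟩⟩ else 0) = 0 := fun l => by
    rw [← jordanMatrix_mulVec, hz]
    rfl
  by_cases hξ : ξ k = 0
  · obtain ⟨l, hl⟩ := l
    have hl0 : l ≠ 0 := h.resolve_left (not_not.mpr hξ)
    obtain ⟨l, rfl⟩ := Nat.exists_eq_succ_of_ne_zero hl0
    have h2 := h1 ⟨l, (Nat.lt_succ_self l).trans hl⟩
    rwa [hξ, zero_mul, zero_add, dif_pos hl] at h2
  · have h2 : ∀ (j : ℕ) (l : Fin (D k)), D k ≤ l + j → z ⟨k, l⟩ = 0 := by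
      intro j
      induction j with
      | zero => exact fun l hl => absurd l.2 (not_lt.mpr hl)
      | succ j ih =>
        intro l hl
        have h3 := h1 l
        have h4 : (if h : (l : ℕ) + 1 < D k then z ⟨k, ⟨l + 1, h⟩⟩ else 0) = 0 := by
          split_ifs with h5
          · exact ih ⟨l + 1, h5⟩ (by simp only; omega)
          · rfl
        rw [h4, add_zero] at h3
        exact (mul_eq_zero.mp h3).resolve_left hξ
    exact h2 (D k) l (Nat.le_add_left _ _)

namespace JordanForm

variable {X : Matrix (Ix n) (Ix n) ℂ} (J : JordanForm X)

theorem mul_S : X * J.S = J.S * Matrix.reindex J.idx J.idx (jordanMatrix J.D J.ξ) := by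
  rw [← J.eq, ← mul_assoc, ← mul_assoc, Matrix.mul_nonsing_inv _ J.S_unit, one_mul]

theorem reindex_mulVec (z : Ix n → ℂ) (i : Σ k, Fin (J.D k)) :
    (Matrix.reindex J.idx J.idx (jordanMatrix J.D J.ξ) *ᵥ z) (J.idx i) =
      (jordanMatrix J.D J.ξ *ᵥ (z ∘ J.idx)) i := by
  simp only [mulVec, dotProduct, Matrix.reindex_apply, Matrix.submatrix_apply,
    Equiv.symm_apply_apply, Function.comp]
  exact (J.idx.sum_comp fun x => jordanMatrix J.D J.ξ i (J.idx.symm x) * z x).symm.trans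
    (Finset.sum_congr rfl fun j _ => by rw [Equiv.symm_apply_apply])

theorem mulVec_col0 (k : J.ZeroIx) : X *ᵥ J.col0 k = 0 := by
  have h1 : J.col0 k = J.S *ᵥ Pi.single (J.idx ⟨k.1, ⟨0, J.D_pos k.1⟩⟩) 1 := by
    rw [Matrix.mulVec_single_one]
    rfl
  rw [h1, Matrix.mulVec_mulVec, mul_S, ← Matrix.mulVec_mulVec]
  have h2 : Matrix.reindex J.idx J.idx (jordanMatrix J.D J.ξ) *ᵥ
      Pi.single (J.idx ⟨k.1, ⟨0, J.D_pos k.1⟩⟩) 1 = 0 := by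
    funext p
    obtain ⟨⟨k', l'⟩, rfl⟩ := J.idx.surjective p
    rw [reindex_mulVec, jordanMatrix_mulVec, Pi.zero_apply]
    have h3 : ∀ i, (Pi.single (J.idx ⟨k.1, ⟨0, J.D_pos k.1⟩⟩) (1 : ℂ) ∘ J.idx) i =
        if i = ⟨k.1, ⟨0, J.D_pos k.1⟩⟩ then 1 else 0 := fun i => by
      rw [Function.comp, Pi.single_apply]
      exact if_congr J.idx.apply_eq_iff_eq rfl rfl
    rw [h3]
    have h4 : ∀ h : (l' : ℕ) + 1 < J.D k', (Pi.single (J.idx ⟨k.1, ⟨0, J.D_pos k.1⟩⟩) (1 : ℂ) ∘ J.idx)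
        ⟨k', ⟨l' + 1, h⟩⟩ = 0 := fun h => by
      rw [h3, if_neg]
      intro h5
      obtain ⟨h6, h7⟩ := Sigma.mk.inj h5
      subst h6
      have h8 := congrArg Fin.val (eq_of_heq h7)
      simp at h8
    simp only [h4, dite_eq_ite, ite_self, add_zero]
    split_ifs with h5
    · have h6 : k' = k.1 := (Sigma.mk.inj h5).1
      rw [h6, k.2, zero_mul]
    · rw [mul_zero]
  rw [h2, Matrix.mulVec_zero]

/-- In Jordan coordinates a kernel vector is supported on the first rows of the zero blocks. -/
theorem exists_coeff_of_mulVec_eq_zero {x : Ix n → ℂ} (hx : X *ᵥ x = 0) :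
    ∃ c : J.ZeroIx → ℂ, ∀ p, x p = ∑ k, c k * J.col0 k p := by
  classical
  set y := J.S⁻¹ *ᵥ x with hy
  have hxy : x = J.S *ᵥ y := by
    rw [hy, Matrix.mulVec_mulVec, Matrix.mul_nonsing_inv _ J.S_unit, Matrix.one_mulVec]
  have h1 : jordanMatrix J.D J.ξ *ᵥ (y ∘ J.idx) = 0 := by
    funext i
    rw [← reindex_mulVec, ← J.eq, hy, Matrix.mulVec_mulVec, mul_assoc, mul_assoc,
      Matrix.mul_nonsing_inv _ J.S_unit, mul_one, ← Matrix.mulVec_mulVec, hx, Matrix.mulVec_zero]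
    rfl
  refine ⟨fun k => y (J.idx ⟨k.1, ⟨0, J.D_pos k.1⟩⟩), fun p => ?_⟩
  have h2 : ∀ k : Fin J.N, ∑ l : Fin (J.D k), J.S p (J.idx ⟨k, l⟩) * y (J.idx ⟨k, l⟩) =
      if J.ξ k = 0 then y (J.idx ⟨k, ⟨0, J.D_pos k⟩⟩) * J.S p (J.idx ⟨k, ⟨0, J.D_pos k⟩⟩) else 0 := by
    intro k
    split_ifs with h
    · rw [Finset.sum_eq_single ⟨0, J.D_pos k⟩, mul_comm]
      · intro l _ hl
        have h3 : y (J.idx ⟨k, l⟩) = 0 := eq_zero_of_jordanMatrix_mulVec h1 k l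
          (Or.inr fun h4 => hl (Fin.ext h4))
        rw [h3, mul_zero]
      · exact fun h3 => absurd (Finset.mem_univ _) h3
    · refine Finset.sum_eq_zero fun l _ => ?_
      have h3 : y (J.idx ⟨k, l⟩) = 0 := eq_zero_of_jordanMatrix_mulVec h1 k l (Or.inl h)
      rw [h3, mul_zero]
  rw [hxy, mulVec, dotProduct, ← J.idx.sum_comp, Fintype.sum_sigma]
  simp only [h2]
  rw [← Finset.sum_filter, ← Finset.sum_subtype_eq_sum_filter]
  refine (Finset.sum_congr (Finset.ext fun k => ?_) fun k _ => rfl)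
  simp

theorem col0_ne_zero (k : J.ZeroIx) : J.col0 k ≠ 0 := by
  intro h
  have h1 : (J.S⁻¹ * J.S) (J.idx ⟨k.1, ⟨0, J.D_pos k.1⟩⟩) (J.idx ⟨k.1, ⟨0, J.D_pos k.1⟩⟩) = 0 := by
    rw [Matrix.mul_apply]
    exact Finset.sum_eq_zero fun q _ => by
      rw [show J.S q (J.idx ⟨k.1, ⟨0, J.D_pos k.1⟩⟩) = 0 from congrFun h q, mul_zero]
  rw [Matrix.nonsing_inv_mul _ J.S_unit, Matrix.one_apply_eq] at h1
  exact one_ne_zero h1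

/-! ## Monomials in the zero modes -/

section Monomial

variable {Γ : Matrix (Ix n) (Ix n) ℝ}

/-- The annihilation operator `d_{k,1}` of a zero mode on functions. -/
def zeroAnn (Γ : Matrix (Ix n) (Ix n) ℝ) (k : J.ZeroIx) : Module.End ℂ (Fn (Ix n)) :=
  ∑ q, J.S⁻¹ (J.idx ⟨k.1, ⟨0, J.D_pos k.1⟩⟩) q • annOp Γ q

/-- The rows of S⁻¹ and the columns of S are biorthogonal, so the zero modes are independent bosonic
pairs. -/
theorem zeroAnn_mul_zeroOp (k l : J.ZeroIx) :
    J.zeroAnn Γ k * J.zeroOp l = J.zeroOp l * J.zeroAnn Γ k + (if k = l then (1 : ℂ) else 0) • 1 := by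
  have h1 : ∑ q, J.S⁻¹ (J.idx ⟨k.1, ⟨0, J.D_pos k.1⟩⟩) q * J.col0 l q = if k = l then 1 else 0 := by
    have h2 := congrFun (congrFun (Matrix.nonsing_inv_mul _ J.S_unit)
      (J.idx ⟨k.1, ⟨0, J.D_pos k.1⟩⟩)) (J.idx ⟨l.1, ⟨0, J.D_pos l.1⟩⟩)
    rw [Matrix.mul_apply, Matrix.one_apply] at h2
    refine h2.trans (if_congr ?_ rfl rfl)
    rw [J.idx.apply_eq_iff_eq]
    refine ⟨fun h => Subtype.ext (Sigma.mk.inj h).1, fun h => by rw [h]⟩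
  rw [zeroAnn, Finset.sum_mul, Finset.mul_sum, zeroOp]
  simp only [smul_mul_assoc, mul_smul_comm, annOp_mul_sum_bpOp, smul_add, Finset.sum_add_distrib,
    smul_smul, ← Finset.sum_smul, h1]

theorem hasWeight_zeroOp (k l : J.ZeroIx) :
    HasWeight (J.zeroOp k * J.zeroAnn Γ k) (if k = l then 1 else 0) (J.zeroOp l) := by
  have h : J.zeroOp k * J.zeroOp l = J.zeroOp l * J.zeroOp k := by
    rw [zeroOp, zeroOp, Finset.sum_mul, Finset.mul_sum]
    exact Finset.sum_congr rfl fun q _ => by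
      rw [smul_mul_assoc, mul_smul_comm, bpOp_mul_sum_bpOp]
  rw [HasWeight, mul_assoc, zeroAnn_mul_zeroOp, mul_add, ← mul_assoc, h, mul_assoc]
  split_ifs with hkl
  · rw [one_smul, mul_one, one_nsmul, hkl]
  · rw [zero_smul, mul_zero, zero_nsmul]

/-- The factor of block `k` in a zero-mode monomial. -/
def zeroFactor (α : J.ZeroIx → ℕ) (k : Fin J.N) : Module.End ℂ (Fn (Ix n)) :=
  if h : J.ξ k = 0 then J.zeroOp ⟨k, h⟩ ^ α ⟨k, h⟩ else 1

/-- The operator of a zero-mode monomial, restricted to a list of blocks. -/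
def zeroProd (α : J.ZeroIx → ℕ) (l : List (Fin J.N)) : Module.End ℂ (Fn (Ix n)) :=
  (l.map (J.zeroFactor α)).prod

theorem toFn_iterate_d0' (k : J.ZeroIx) (a : ℕ) (R : Op n) :
    toFn n ((J.d0' k)^[a] R) = (J.zeroOp k ^ a) (toFn n R) := by
  induction a with
  | zero => rfl
  | succ a ih => rw [Function.iterate_succ_apply', toFn_d0', ih, pow_succ', Module.End.mul_apply]

theorem toFn_zeroMonomial (α : J.ZeroIx → ℕ) (R : Op n) :
    toFn n (J.zeroMonomial α R) = J.zeroProd α (List.finRange J.N) (toFn n R) := by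
  rw [zeroMonomial, zeroProd]
  induction List.finRange J.N with
  | nil => rfl
  | cons k l ih =>
    rw [List.foldr_cons, List.map_cons, List.prod_cons, Module.End.mul_apply, ← ih, zeroFactor]
    split_ifs
    · exact J.toFn_iterate_d0' _ _ _
    · rfl

theorem zeroFactor_mem (α : J.ZeroIx → ℕ) (k : Fin J.N) : J.zeroFactor α k ∈ ladderAlg (Ix n) := by
  rw [zeroFactor]
  split_ifs
  · exact Subalgebra.pow_mem _ (J.zeroOp_mem _) _
  · exact Subalgebra.one_mem _

theorem zeroProd_mem (α : J.ZeroIx → ℕ) (l : List (Fin J.N)) :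
    J.zeroProd α l ∈ ladderAlg (Ix n) :=
  Subalgebra.list_prod_mem _ fun T hT => by
    obtain ⟨k, -, rfl⟩ := List.mem_map.mp hT
    exact J.zeroFactor_mem α k

theorem hasWeight_zeroFactor (α : J.ZeroIx → ℕ) (k : J.ZeroIx) (j : Fin J.N) :
    HasWeight (J.zeroOp k * J.zeroAnn Γ k) (if j = k.1 then α k else 0) (J.zeroFactor α j) := by
  rw [zeroFactor]
  by_cases h : J.ξ j = 0
  · rw [dif_pos h]
    by_cases h1 : j = k.1
    · subst h1
      simpa using (J.hasWeight_zeroOp (Γ := Γ) k k).pow (α k)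
    · have h2 : k ≠ ⟨j, h⟩ := fun h2 => h1 (congrArg Subtype.val h2).symm
      simpa [h1, h2] using (J.hasWeight_zeroOp (Γ := Γ) k ⟨j, h⟩).pow (α ⟨j, h⟩)
  · rw [dif_neg h, if_neg (show ¬j = k.1 from fun h1 => h (h1 ▸ k.2))]
    exact HasWeight.one _

theorem number_zeroProd (h : Γ.PosDef) (α : J.ZeroIx → ℕ) (l : List (Fin J.N)) (k : J.ZeroIx) :
    (J.zeroOp k * J.zeroAnn Γ k) (J.zeroProd α l (gaussState Γ 0)) =
      (l.map fun j => if j = k.1 then α k else 0).sum • J.zeroProd α l (gaussState Γ 0) := by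
  have h1 : (J.zeroOp k * J.zeroAnn Γ k) (gaussState Γ 0) = (0 : ℕ) • gaussState Γ 0 := by
    rw [zero_nsmul, Module.End.mul_apply, zeroAnn, LinearMap.sum_apply,
      Finset.sum_eq_zero fun q _ => by
        rw [LinearMap.smul_apply, annOp_gaussState_zero h, smul_zero], map_zero]
  exact (HasWeight.list_prod (J.hasWeight_zeroFactor α k) l).apply h1

theorem zeroProd_gaussState_ne_zero (h : IsBona Γ) (α : J.ZeroIx → ℕ) (l : List (Fin J.N)) :
    J.zeroProd α l (gaussState Γ 0) ≠ 0 := by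
  induction l with
  | nil => exact gaussState_ne_zero h 0
  | cons k l ih =>
    have h1 : J.zeroProd α (k :: l) = J.zeroFactor α k * J.zeroProd α l := by
      rw [zeroProd, List.map_cons, List.prod_cons]
      rfl
    rw [h1, Module.End.mul_apply, zeroFactor]
    split_ifs with h2
    · refine pow_apply_ne_zero (E := J.zeroAnn Γ ⟨k, h2⟩) ?_ _ (J.number_zeroProd h.1 α l ⟨k, h2⟩) ih
      rw [zeroAnn_mul_zeroOp, if_pos rfl, one_smul]
    · exact ih

/-- The exponents are joint eigenvalues of the number operators d'_{k,1}d_{k,1}, so distinct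
monomials lie in distinct eigenspaces. -/
theorem linearIndependent_zeroMonomial (h : IsBona Γ) :
    LinearIndependent ℂ fun α => J.zeroMonomial α ((toFn n).symm (gaussState Γ 0)) := by
  have h1 : LinearIndependent ℂ fun α => J.zeroProd α (List.finRange J.N) (gaussState Γ 0) := by
    refine linearIndependent_of_joint_eigenvectors (fun k => J.zeroOp k * J.zeroAnn Γ k)
      (fun k α => ?_) fun α => J.zeroProd_gaussState_ne_zero h α _
    rw [J.number_zeroProd h.1, ← Fin.sum_univ_def, Finset.sum_ite_eq' Finset.univ k.1,
      if_pos (Finset.mem_univ _)]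
  have h2 : (fun α => J.zeroMonomial α ((toFn n).symm (gaussState Γ 0))) = (toFn n).symm ∘
      fun α => J.zeroProd α (List.finRange J.N) (gaussState Γ 0) := funext fun α => by
    rw [Function.comp, LinearEquiv.eq_symm_apply, toFn_zeroMonomial, LinearEquiv.apply_symm_apply]
  rw [h2]
  exact h1.map' (toFn n).symm.toLinearMap (LinearEquiv.ker _)

end Monomial

end JordanForm

/-! ## Zero modes of the Liouvillian -/

section ZeroModes

variable {𝒮 : System n} (J : JordanForm 𝒮.X₀) {Γ : Matrix (Ix n) (Ix n) ℝ}

theorem commute_liouvOp_zeroFactor (α : J.ZeroIx → ℕ) (k : Fin J.N) :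
    Commute 𝒮.liouvOp (J.zeroFactor α k) := by
  rw [JordanForm.zeroFactor]
  split_ifs
  · exact Commute.pow_right (𝒮.liouvOp_mul_sum_bpOp (J.mulVec_col0 _)) _
  · exact Commute.one_right _

theorem commute_liouvOp_zeroProd (α : J.ZeroIx → ℕ) (l : List (Fin J.N)) :
    Commute 𝒮.liouvOp (J.zeroProd α l) :=
  Commute.list_prod_right _ _ fun T hT => by
    obtain ⟨k, -, rfl⟩ := List.mem_map.mp hT
    exact commute_liouvOp_zeroFactor J α k

theorem span_zeroMonomial_gaussState (h : IsBona Γ) (hL : 𝒮.Lyapunov Γ) {R : Op n}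
    (hR : R ∈ Submodule.span ℂ (Set.range fun α : J.ZeroIx → ℕ =>
      J.zeroMonomial α ((toFn n).symm (gaussState Γ 0)))) :
    IsRegularOp R ∧ 𝒮.liouvillian R = 0 := by
  have h1 : Decays (toFn n R) ∧ 𝒮.liouvOp (toFn n R) = 0 := by
    induction hR using Submodule.span_induction with
    | mem R hR =>
      obtain ⟨α, rfl⟩ := hR
      simp only [JordanForm.toFn_zeroMonomial, LinearEquiv.apply_symm_apply]
      refine ⟨(decays_gaussState h.1 0).apply (J.zeroProd_mem α _), ?_⟩
      have h2 := congrFun (congrArg DFunLike.coe (commute_liouvOp_zeroProd J α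
        (List.finRange J.N))) (gaussState Γ 0)
      rw [Module.End.mul_apply, Module.End.mul_apply, 𝒮.liouvOp_gaussState h.1 hL, map_zero] at h2
      · exact h2
      · exact (congrArg _ (funext fun q => Complex.ofReal_zero)).trans (Matrix.mulVec_zero _)
    | zero =>
      rw [map_zero, map_zero]
      refine ⟨?_, rfl⟩
      simpa using (decays_gaussState h.1 0).smul 0
    | add R R' _ _ h1 h2 =>
      rw [map_add, map_add, h1.2, h2.2, add_zero]
      exact ⟨h1.1.add h2.1, rfl⟩
    | smul c R _ h1 =>
      rw [map_smul, map_smul, h1.2, smul_zero]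
      exact ⟨h1.1.smul c, rfl⟩
  refine ⟨isRegularOp_of_decays h1.1, (toFn n).injective ?_⟩
  rw [𝒮.toFn_liouvillian, map_zero]
  exact h1.2

/-- τ is imaginary and multiplied by an imaginary factor, so X₀ is real. -/
theorem star_X₀_apply (𝒮 : System n) (p q : Ix n) : star (𝒮.X₀ p q) = 𝒮.X₀ p q := by
  have ht : ∀ p q, star (tau n p q) = -tau n p q := by
    rintro (p | p) (q | q) <;> by_cases h : p = q <;> simp [tau, h]
  have h1 : ∀ M : Matrix (Ix n) (Ix n) ℂ, (∀ p q, star (M p q) = M p q) →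
      star ((tau n * M) p q) = -(tau n * M) p q := by
    intro M hM
    rw [Matrix.mul_apply, star_sum, ← Finset.sum_neg_distrib]
    exact Finset.sum_congr rfl fun s _ => by rw [star_mul', ht, hM, neg_mul]
  rw [System.X₀, Matrix.add_apply, Matrix.smul_apply, Matrix.smul_apply, star_add, star_smul,
    star_smul, h1 _ fun p q => by simp, h1 _ fun p q => by simp [System.Bim]]
  simp

theorem mulVec_eq_zero_of_sum {v : Ix n → ℝ} {c : J.ZeroIx → ℂ}
    (h : ∀ p, (v p : ℂ) = ∑ k, c k * J.col0 k p) : 𝒮.X₀ *ᵥ (fun p => (v p : ℂ)) = 0 := by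
  have h1 : (fun p => (v p : ℂ)) = ∑ k, c k • J.col0 k := funext fun p => by
    rw [h, Finset.sum_apply]
    rfl
  rw [h1, Matrix.mulVec_sum]
  exact Finset.sum_eq_zero fun k _ => by rw [Matrix.mulVec_smul, J.mulVec_col0, smul_zero]

/-- X₀ annihilates the zero-mode columns, so X₀Γ' = X₀Γ; symmetry of both matrices takes care of the
transposed term. -/
theorem lyapunov_of_isShift (hL : 𝒮.Lyapunov Γ) (hs : Γ.IsSymm) {c : J.ZeroIx → ℂ}
    {C : J.ZeroIx → J.ZeroIx → ℂ} {v : Ix n → ℝ} {Γ' : Matrix (Ix n) (Ix n) ℝ}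
    (h : J.IsShift Γ c C v Γ') : 𝒮.Lyapunov Γ' := by
  have h1 : ∀ A : Matrix (Ix n) (Ix n) ℝ, A.IsSymm →
      A.map Complex.ofReal * 𝒮.X₀ᵀ = (𝒮.X₀ * A.map Complex.ofReal)ᵀ := fun A hA => by
    rw [Matrix.transpose_mul, ← Matrix.transpose_map, hA]
  have h2 : 𝒮.X₀ * Γ'.map Complex.ofReal = 𝒮.X₀ * Γ.map Complex.ofReal := by
    have h3 : Γ'.map Complex.ofReal = Γ.map Complex.ofReal +
        ∑ k, ∑ l, C k l • vecMulVec (J.col0 k) (J.col0 l) := by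
      ext p q
      rw [Matrix.map_apply, h.2.1, Matrix.add_apply, Matrix.map_apply, Matrix.sum_apply]
      congr 1
      refine Finset.sum_congr rfl fun k _ => ?_
      rw [Matrix.sum_apply]
      exact Finset.sum_congr rfl fun l _ => by
        rw [Matrix.smul_apply, vecMulVec_apply, smul_eq_mul, mul_assoc]
    rw [h3, mul_add, Finset.mul_sum]
    simp only [Finset.mul_sum, Matrix.mul_smul, Matrix.mul_vecMulVec, J.mulVec_col0,
      Matrix.zero_vecMulVec, smul_zero, Finset.sum_const_zero, add_zero]
  rw [System.Lyapunov, h1 _ (posDef_isSymm h.2.2.1), h2, ← h1 _ hs]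
  exact hL

/-- X₀ is real, so the real and imaginary parts of a zero-mode column both lie in its kernel, and
one of them is nonzero. -/
theorem exists_real_kernel_vector (hZ : ∃ k, J.ξ k = 0) :
    ∃ v : Ix n → ℝ, v ≠ 0 ∧ 𝒮.X₀ *ᵥ (fun p => (v p : ℂ)) = 0 := by
  obtain ⟨k, hk⟩ := hZ
  set z := J.col0 ⟨k, hk⟩ with hz
  have h1 : ∀ p, ∑ q, 𝒮.X₀ p q * z q = 0 := fun p => congrFun (J.mulVec_col0 ⟨k, hk⟩) p
  have h2 : ∀ p, ∑ q, 𝒮.X₀ p q * star (z q) = 0 := fun p => by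
    have h3 := congrArg star (h1 p)
    rw [star_sum, star_zero] at h3
    refine Eq.trans (Finset.sum_congr rfl fun q _ => ?_) h3
    rw [star_mul', star_X₀_apply]
  by_cases hre : (fun p => (z p).re) = 0
  · refine ⟨fun p => (z p).im, fun him => J.col0_ne_zero ⟨k, hk⟩ (funext fun p =>
      Complex.ext (congrFun hre p) (congrFun him p)), funext fun p => ?_⟩
    change ∑ q, 𝒮.X₀ p q * ((z q).im : ℂ) = 0
    calc _ = ∑ q, (-(Complex.I / 2)) * (𝒮.X₀ p q * z q - 𝒮.X₀ p q * star (z q)) := by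
          refine Finset.sum_congr rfl fun q _ => ?_
          rw [Complex.star_def, ← mul_sub, Complex.sub_conj]
          push_cast
          linear_combination (𝒮.X₀ p q * ((z q).im : ℂ)) * Complex.I_sq
      _ = 0 := by rw [← Finset.mul_sum, Finset.sum_sub_distrib, h1, h2, sub_zero, mul_zero]
  · refine ⟨_, hre, funext fun p => ?_⟩
    change ∑ q, 𝒮.X₀ p q * ((z q).re : ℂ) = 0
    calc _ = ∑ q, (1 / 2 : ℂ) * (𝒮.X₀ p q * z q + 𝒮.X₀ p q * star (z q)) := by
          refine Finset.sum_congr rfl fun q _ => ?_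
          rw [Complex.star_def, ← mul_add, Complex.add_conj]
          push_cast
          ring
      _ = 0 := by rw [← Finset.mul_sum, Finset.sum_add_distrib, h1, h2, add_zero, mul_zero]

/-- For a real kernel vector v with coefficients c, the choice C = c⊗c gives Γ' = Γ + vvᵀ, and
adding a positive rank-one matrix preserves the uncertainty relation. -/
theorem exists_isShift (h : IsBona Γ) (hZ : ∃ k, J.ξ k = 0) :
    ∃ c C v Γ', J.IsShift Γ c C v Γ' ∧ v ≠ 0 ∧ Γ' ≠ Γ := by
  obtain ⟨v, hv, hXv⟩ := exists_real_kernel_vector J hZ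
  obtain ⟨c, hc⟩ := J.exists_coeff_of_mulVec_eq_zero hXv
  refine ⟨c, fun k l => c k * c l, v, Γ + vecMulVec v v, ⟨hc, fun p q => ?_,
    (h.add_vecMulVec v).isPhysical⟩, hv, fun h1 => hv ?_⟩
  · rw [Matrix.add_apply, vecMulVec_apply, Complex.ofReal_add, Complex.ofReal_mul, hc p, hc q,
      Finset.sum_mul_sum]
    congr 1
    exact Finset.sum_congr rfl fun k _ => Finset.sum_congr rfl fun l _ => by ring
  · funext p
    have h2 := congrFun (congrFun (add_eq_left.mp h1) p) p
    rw [vecMulVec_apply] at h2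
    exact mul_self_eq_zero.mp h2

theorem shift_gaussState (h : IsBona Γ) (hL : 𝒮.Lyapunov Γ) {c : J.ZeroIx → ℂ}
    {C : J.ZeroIx → J.ZeroIx → ℂ} {v : Ix n → ℝ} {Γ' : Matrix (Ix n) (Ix n) ℝ}
    (hs : J.IsShift Γ c C v Γ') :
    ∃ ρ' : Op n, IsExp (J.zeroGen c C) ((toFn n).symm (gaussState Γ 0)) ρ' ∧ 𝒮.IsSteadyState ρ' ∧
      IsGaussian (fun p => v p / Real.sqrt 2) Γ' ρ' ∧
      (v ≠ 0 ∨ Γ' ≠ Γ → ρ' ≠ (toFn n).symm (gaussState Γ 0)) := by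
  have h' : IsBona Γ' := hs.2.2.isBona
  -- The generator with linear coefficient √2 w moves the mean to w; this is the source of the
  -- factor 1/√2.
  set w : Ix n → ℝ := fun p => v p / Real.sqrt 2 with hw
  have h2 : (Real.sqrt 2 : ℝ) ≠ 0 := by positivity
  have hwv : (fun p => Real.sqrt 2 * w p) = v := funext fun p => by
    rw [hw, mul_div_cancel₀ _ h2]
  refine ⟨(toFn n).symm (gaussState Γ' w), isExp_gaussState h h' w fun R => ?_,
    𝒮.isSteadyState_gaussState h' (lyapunov_of_isShift J hL (posDef_isSymm h.1) hs) ?_,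
    isGaussian_gaussState h' w, fun h3 h4 => ?_⟩
  · rw [hwv]
    exact J.toFn_zeroGen hs R
  · have h3 : (fun q => (w q : ℂ)) = ((Real.sqrt 2 : ℝ) : ℂ)⁻¹ • fun q => (v q : ℂ) :=
      funext fun q => by
        rw [hw, Pi.smul_apply, smul_eq_mul]
        push_cast
        rw [div_eq_inv_mul]
    rw [h3, Matrix.mulVec_smul, mulVec_eq_zero_of_sum J hs.1, smul_zero]
  · obtain ⟨h5, h6⟩ := gaussState_injective h h'.1 ((toFn n).symm.injective h4)
    rcases h3 with h3 | h3
    · refine h3 (hwv.symm.trans (funext fun p => ?_))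
      rw [h5, Pi.zero_apply, mul_zero]
    · exact h3 h6

/-- The vacuum is the Gaussian with covariance 1/2, and the generator is the increment Γ - 1/2
without a linear term. -/
theorem isExp_vac (h : IsBona Γ) :
    IsExp (J.Q Γ) (vac n) ((toFn n).symm (gaussState Γ 0)) := by
  have h1 := isExp_gaussState isBona_half h (0 : Ix n → ℝ) (𝒬 := J.Q Γ) fun R => by
    rw [J.toFn_Q]
    congr 2
    funext p
    rw [Pi.zero_apply, mul_zero]
  rwa [gaussState_half, ← toFn_vac, LinearEquiv.symm_apply_apply] at h1

theorem JordanForm.d_gaussState {X : Matrix (Ix n) (Ix n) ℂ} (J : JordanForm X) (h : Γ.PosDef)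
    (k : Fin J.N) (l : Fin (J.D k)) : J.d Γ k l ((toFn n).symm (gaussState Γ 0)) = 0 := by
  refine (toFn n).injective ?_
  rw [JordanForm.d, J.toFn_dVec, LinearEquiv.apply_symm_apply, map_zero, LinearMap.sum_apply]
  refine Finset.sum_eq_zero fun q _ => ?_
  rw [LinearMap.smul_apply]
  exact (congrArg _ (annOp_gaussState_zero h q)).trans (smul_zero _)

end ZeroModes

end QuasiFree

end

/-! ### Assembly of the steady state and its zero modes. -/

theorem mainTheorem10 {n : ℕ} (𝒮 : System n) (Γ : Matrix (Ix n) (Ix n) ℝ)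
    (hΓ : IsPhysical Γ) (hL : 𝒮.Lyapunov Γ) (J : JordanForm 𝒮.X₀) :
    -- the zero-particle state is the vacuum of the `a`, and `W` maps `(a, a')` to `(d, d')`
    (∀ p, aSup p (vac n) = 0) ∧
    (∀ (R : Op n) (i : Ix n ⊕ Ix n),
      Sum.elim (fun p => J.dVec Γ p R) (fun p => J.dVec' p R) i =
        ∑ j, J.W Γ i j • Sum.elim (fun p => aSup p R) (fun p => aSup' p R) j) ∧
    -- the block `r` is invertible, and `ρ = exp(-½ a'·r⁻¹s a') |0⟩⟨0|` exists
    IsUnit (J.r Γ).det ∧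
    ∃ ρ : Op n, IsExp (J.Q Γ) (vac n) ρ ∧
      -- it is a trace-class, normalized, Gaussian steady state with covariance matrix `Γ`
      𝒮.IsSteadyState ρ ∧ IsGaussian 0 Γ ρ ∧ HasCovariance ρ Γ ∧
      -- it is the vacuum of the `d`
      (∀ k l, J.d Γ k l ρ = 0) ∧
      -- the trace functional annihilates every `d'`
      (∀ k l (R : Op n), IsTraceClass R → IsTraceClass (J.d' k l R) → HasTrace (J.d' k l R) 0) ∧
      -- polynomials in the zero-mode creation super-operators yield further steady operators
      (∀ R ∈ Submodule.span ℂ (Set.range fun α : J.ZeroIx → ℕ => J.zeroMonomial α ρ),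
        IsRegularOp R ∧ 𝒮.liouvillian R = 0) ∧
      LinearIndependent ℂ (fun α : J.ZeroIx → ℕ => J.zeroMonomial α ρ) ∧
      -- their exponentials yield further Gaussian steady states
      (∀ c C v Γ', J.IsShift Γ c C v Γ' →
        ∃ ρ' : Op n, IsExp (J.zeroGen c C) ρ ρ' ∧ 𝒮.IsSteadyState ρ' ∧
          IsGaussian (fun p => v p / Real.sqrt 2) Γ' ρ' ∧ (v ≠ 0 ∨ Γ' ≠ Γ → ρ' ≠ ρ)) ∧
      ((∃ k, J.ξ k = 0) → ∃ c C v Γ', J.IsShift Γ c C v Γ' ∧ v ≠ 0 ∧ Γ' ≠ Γ) := by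
  have hB : IsBona Γ := hΓ.isBona
  refine ⟨aSup_vac, fun R i => J.elim_eq_sum_W Γ R i, J.isUnit_det_r Γ,
    (toFn n).symm (gaussState Γ 0), isExp_vac J hB, 𝒮.isSteadyState_gaussState hB hL ?_,
    isGaussian_gaussState hB 0, hasCovariance_gaussState hB, J.d_gaussState hB.1,
    fun k l R hR hD => J.hasTrace_dVec' _ hR hD,
    fun R hR => span_zeroMonomial_gaussState J hB hL hR, J.linearIndependent_zeroMonomial hB,
    fun c C v Γ' hs => shift_gaussState J hB hL hs, exists_isShift J hB⟩
  -- The remaining goal is the kernel condition X₀κ = 0 at mean κ = 0.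
  exact (congrArg _ (funext fun q => Complex.ofReal_zero)).trans (Matrix.mulVec_zero _)
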